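/- **Setting and conventions.** Let $M$ be a smooth manifold of dimension $2n$ (Hausdorff, second countable), let $\mathcal A=\bigoplus_k\mathcal A^k$ be its algebra of smooth real differential forms, and let $\omega$ be an almost symplectic form on $M$, i.e. a smooth nondegenerate $2$-form; $(M,\omega)$ is symplectic if $d\omega=0$. A *real polarization* is a splitting $TM=\mathcal L\oplus\mathcal L'$ into smooth rank $n$ subbundles with $\omega|_{\mathcal L}=\omega|_{\mathcal L'}=0$; $\mathcal L$ is *integrable* if its sections are closed under the Lie bracket of vector fields. The polarization gives a bigrading $\mathcal A^k=\bigoplus_{p+q=k}\mathcal A^{p,q}$, $\mathcal A^{p,q}=\Gamma(\wedge^p(\mathcal L')^*\otimes\wedge^q\mathcal L^*)$, and $\bar\partial$, $\partial$ are the components of $d$ of bidegree $(0,1)$ and $(1,0)$. For a covector $a$ let $a^\sharp$ be the vector with $\omega(a^\sharp,\cdot)=a$ and put $\omega^{-1}(a,b)=b(a^\sharp)$. Let $\langle\cdot,\cdot\rangle_\omega$ be the induced pairing on forms, $\langle a_1\wedge\dots\wedge a_k,b_1\wedge\dots\wedge b_k\rangle_\omega=\det(\omega^{-1}(a_i,b_j))$,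 with forms of different degrees orthogonal, and let $\star_\omega:\mathcal A^k\to\mathcal A^{2n-k}$ be given by $\alpha\wedge\star_\omega\beta=\langle\alpha,\beta\rangle_\omega\,\omega^n/n!$. An operator $\phi$ on $\mathcal A$ of algebraic order zero has a symplectic adjoint $\phi^\omega$, defined by $\langle\phi\alpha,\beta\rangle_\omega=\langle\alpha,\phi^\omega\beta\rangle_\omega$; moreover $d^\omega:=(-1)^k\star_\omega d\star_\omega$ on $\mathcal A^k$. Let $L\alpha=\omega\wedge\alpha$ and $\Lambda=L^\omega$. Brackets are graded commutators. The operators $\partial$, $[\partial,L]$, $[\Lambda,[\partial,L]]$ are the components of bidegrees $(1,0)$, $(2,1)$, $(1,0)$ of $d$, $[d,L]$, $[\Lambda,[d,L]]$; their adjoints $\partial^\omega$, $[\partial,L]^\omega$, $[\Lambda,[\partial,L]]^\omega$ denote the components of the opposite bidegrees $(-1,0)$, $(-2,-1)$, $(-1,0)$ of $d^\omega$, $[d,L]^\omega$, $[\Lambda,[d,L]]^\omega$ respectively. (So $\partial^\omega=(-1)^k\star_\omega\bar\partial\star_\omega$ on $\mathcal A^k$.) On a graded commutative unital algebra $A$,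 a degree $k$ operator has order $\le 0$ if it is left multiplication by an element of $A^k$, and order $\le r+1$ if its graded commutator with every left multiplication by a homogeneous element has order $\le r$. A *commutative $\mathrm{BV}_\infty$-algebra* $(A,\wedge,\Delta_0=d,\Delta_1,\Delta_2,\dots)$ is a commutative unital dg-algebra $(A,\wedge,d)$ with operators $\Delta_r$ of degree $1-2r$ and order $\le r+1$ such that $\sum_{i=0}^{r}\Delta_i\Delta_{r-i}=0$ for all $r\ge0$ (operators not listed are zero). A *differential graded $\mathrm{BV}$-algebra* $(A,\wedge,d,\Delta)$ is one with $\Delta_1=\Delta$ and $\Delta_r=0$ for $r\ge2$. **Theorem.** Let $(M,\omega)$ be almost symplectic with a real polarization $(\mathcal L,\mathcal L')$ such that $\mathcal L$ is integrable. 1. If $(M,\omega)$ is symplectic, then $(\mathcal A,\wedge,\bar\partial,\Delta:=\partial^\omega)$ is a differential graded $\mathrm{BV}$-algebra, and in $\mathrm{End}(\mathcal A)[[\xi]]$ $$\bar\partial+\partial^\omega\xi=e^{\Lambda\xi}\,\bar\partial\,e^{-\Lambda\xi}.$$ 2. In general, $\big(\mathcal A,\wedge,\bar\partial,\ \Delta_1:=\partial^\omega+[\Lambda,[\partial,L]]^\omega,\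 \Delta_2:=-[\partial,L]^\omega\big)$ is a commutative $\mathrm{BV}_\infty$-algebra. -/

import Mathlib

open scoped Manifold ContDiff

noncomputable section

namespace SymplecticPolarization

/-! ### Commutative `BV_∞`-algebras

`A` is an `ℝ`-algebra with a `ℤ`-grading `𝒜`; linear operators are elements of `Module.End ℝ A`. -/

section Algebraic

variable {A : Type*} [Ring A] [Algebra ℝ A]

/-- `f` is homogeneous of degree `k`. -/
def IsHomogeneousOp (𝒜 : ℤ → Submodule ℝ A) (k : ℤ) (f : Module.End ℝ A) : Prop :=
  ∀ i : ℤ, ∀ a ∈ 𝒜 i, f a ∈ 𝒜 (i + k)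

/-- The graded commutator `f g - (-1)^{k l} g f` of operators of degrees `k` and `l`. -/
def gradedCommutator (k l : ℤ) (f g : Module.End ℝ A) : Module.End ℝ A :=
  f * g - ((-1 : ℝ) ^ (k * l)) • (g * f)

/-- `HasOrderLE 𝒜 r k f`: the operator `f` has degree `k` and algebraic order `≤ r`. Order `0` means
left multiplication by an element of degree `k`; order `≤ r + 1` means that the graded commutator
with every left multiplication has order `≤ r`. -/
def HasOrderLE (𝒜 : ℤ → Submodule ℝ A) : ℕ → ℤ → Module.End ℝ A → Prop
  | 0, k, f => ∃ a ∈ 𝒜 k, f = LinearMap.mulLeft ℝ a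
  | r + 1, k, f => IsHomogeneousOp 𝒜 k f ∧ ∀ j : ℤ, ∀ a ∈ 𝒜 j,
      HasOrderLE 𝒜 r (j + k) (gradedCommutator j k (LinearMap.mulLeft ℝ a) f)

/-- `(A, ·, d = Δ 0, Δ 1, Δ 2, …)` is a commutative `BV_∞`-algebra: a graded-commutative unital
dg-algebra with a multicomplex structure such that `Δ r` has degree `1 - 2 r` and
algebraic order `≤ r + 1`. -/
structure IsCommBVInfty (𝒜 : ℤ → Submodule ℝ A) (Δ : ℕ → Module.End ℝ A) : Prop where
  isInternal : DirectSum.IsInternal 𝒜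
  one_mem : (1 : A) ∈ 𝒜 0
  mul_mem : ∀ i j : ℤ, ∀ a ∈ 𝒜 i, ∀ b ∈ 𝒜 j, a * b ∈ 𝒜 (i + j)
  graded_comm : ∀ i j : ℤ, ∀ a ∈ 𝒜 i, ∀ b ∈ 𝒜 j, a * b = ((-1 : ℝ) ^ (i * j)) • (b * a)
  leibniz : ∀ i : ℤ, ∀ a ∈ 𝒜 i, ∀ b : A,
    Δ 0 (a * b) = Δ 0 a * b + ((-1 : ℝ) ^ i) • (a * Δ 0 b)
  degree : ∀ r : ℕ, IsHomogeneousOp 𝒜 (1 - 2 * r) (Δ r)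
  multicomplex : ∀ r : ℕ, ∑ i ∈ Finset.range (r + 1), Δ i * Δ (r - i) = 0
  order : ∀ r : ℕ, HasOrderLE 𝒜 (r + 1) (1 - 2 * r) (Δ r)

/-- The sequence of operators `d, Δ₁, Δ₂, 0, 0, …`. -/
def opSeq (d Δ₁ Δ₂ : Module.End ℝ A) : ℕ → Module.End ℝ A
  | 0 => d
  | 1 => Δ₁
  | 2 => Δ₂
  | _ => 0

/-- A differential graded `BV`-algebra `(A, ·, d, Δ)`: a commutative `BV_∞`-algebra whose
operators `Δ r` vanish for `r ≥ 2`. -/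
def IsDGBV (𝒜 : ℤ → Submodule ℝ A) (d Δ : Module.End ℝ A) : Prop :=
  IsCommBVInfty 𝒜 (opSeq d Δ 0)

/-- The formal exponential `e^{f ξ} ∈ End(A)[[ξ]]`. -/
def expSeries (f : Module.End ℝ A) : PowerSeries (Module.End ℝ A) :=
  PowerSeries.mk fun r => ((r.factorial : ℝ)⁻¹) • f ^ r

end Algebraic

/-! ### Linear algebra of exterior forms on a vector space -/

section Linear

variable {V : Type*} [AddCommGroup V] [Module ℝ V]

/-- Exterior forms (of mixed degree) on `V`. -/
abbrev ExtForms (V : Type*) [AddCommGroup V] [Module ℝ V] : Type _ :=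
  ExteriorAlgebra ℝ (Module.Dual ℝ V)

/-- The component of degree `k`. -/
def degPart (k : ℕ) (α : ExtForms V) : ExtForms V :=
  GradedAlgebra.proj (fun i : ℕ => ⋀[ℝ]^i (Module.Dual ℝ V)) k α

/-- Interior product (contraction in the first slot) with a vector. -/
def interior (v : V) : ExtForms V →ₗ[ℝ] ExtForms V :=
  CliffordAlgebra.contractLeft (Module.Dual.eval ℝ V v)

/-- The bilinear form `(u, v) ↦ η(u, v)` of an exterior form `η` (of degree two). -/
def toBilin (η : ExtForms V) : LinearMap.BilinForm ℝ V :=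
  LinearMap.mk₂ ℝ (fun u v => ExteriorAlgebra.algebraMapInv (interior v (interior u η)))
    (by intros; simp [interior]) (by intros; simp [interior])
    (by intros; simp [interior]) (by intros; simp [interior])

/-- The pull-back of forms along a linear map. -/
def pullbackForm {W : Type*} [AddCommGroup W] [Module ℝ W] (f : V →ₗ[ℝ] W) :
    ExtForms W →ₐ[ℝ] ExtForms V :=
  ExteriorAlgebra.map f.dualMap

/-- `Λ^{p,q}`: for a decomposition `V = L ⊕ L'` this is `Λ^p (L')^* ⊗ Λ^q L^*`, where `(L')^*` is
the annihilator of `L` and `L^*` is the annihilator of `L'`. It is spanned by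
the products of `p` covectors of the first and `q` covectors of the second kind. -/
def bidegPart (L L' : Submodule ℝ V) (p q : ℕ) : Submodule ℝ (ExtForms V) :=
  (L.dualAnnihilator.map (ExteriorAlgebra.ι ℝ)) ^ p *
    (L'.dualAnnihilator.map (ExteriorAlgebra.ι ℝ)) ^ q

/-- The `Λ^{p,q}`-component of a form: the element of `Λ^{p,q}` from which the form differs by an
element of the sum of the other `Λ^{p',q'}`. -/
def bidegProj (L L' : Submodule ℝ V) (p q : ℕ) (α : ExtForms V) : ExtForms V :=
  Classical.epsilon fun γ => γ ∈ bidegPart L L' p q ∧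
    α - γ ∈ ⨆ (r : ℕ × ℕ) (_ : r ≠ (p, q)), bidegPart L L' r.1 r.2

variable [FiniteDimensional ℝ V]

/-- The musical isomorphism `V^* ≃ V` of a nondegenerate form `B`: `B (♯ a) v = a v`. -/
def sharp (B : LinearMap.BilinForm ℝ V) (hB : B.Nondegenerate) : Module.Dual ℝ V →ₗ[ℝ] V :=
  (B.toDual hB).symm.toLinearMap

/-- The pairing `⟨α, β⟩` on forms induced by `B`: forms of different degrees are orthogonal and
`⟨a₁ ∧ ⋯ ∧ a_k, b₁ ∧ ⋯ ∧ b_k⟩ = det (B⁻¹(a_i, b_j))`, with `B⁻¹(a, b) = b (♯ a)`. -/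
def formPairing (B : LinearMap.BilinForm ℝ V) (hB : B.Nondegenerate) (α β : ExtForms V) : ℝ :=
  ∑ k ∈ Finset.range (Module.finrank ℝ V + 1),
    exteriorPower.pairingDual ℝ V k
      (DirectSum.decompose (fun i : ℕ => ⋀[ℝ]^i (Module.Dual ℝ V)) β k)
      (exteriorPower.map k (sharp B hB)
        (DirectSum.decompose (fun i : ℕ => ⋀[ℝ]^i (Module.Dual ℝ V)) α k))

/-- The star operator of `B` and the volume form `vol`: `⋆β` is determined by
`α ∧ ⋆β = ⟨α, β⟩ vol` for `α`, `β` of the same degree, and `⋆` sends forms of degree `k` to forms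
of complementary degree. For `β` of mixed degree both are expressed by comparing
the top degree parts for all `α`. -/
def linearStar (B : LinearMap.BilinForm ℝ V) (hB : B.Nondegenerate) (vol β : ExtForms V) :
    ExtForms V :=
  Classical.epsilon fun γ => ∀ α : ExtForms V,
    degPart (Module.finrank ℝ V) (α * γ) = formPairing B hB α β • vol

end Linear

/-! ### Differential forms on a `2n`-dimensional manifold -/

section Manifold

/-- The model space `ℝ^{2n}`. -/
abbrev Model (n : ℕ) : Type := EuclideanSpace ℝ (Fin (2 * n))

/-- The standard basis `e_i` of `ℝ^{2n}`. -/
def stdBasis (n : ℕ) : Module.Basis (Fin (2 * n)) ℝ (Model n) :=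
  (EuclideanSpace.basisFun (Fin (2 * n)) ℝ).toBasis

/-- The coordinate covectors `dx^i`. -/
def dualStdBasis (n : ℕ) : Module.Basis (Fin (2 * n)) ℝ (Module.Dual ℝ (Model n)) :=
  (stdBasis n).dualBasis

/-- The basis `dx^S = dx^{i_1} ∧ ⋯ ∧ dx^{i_k}`, `S = {i_1 < ⋯ < i_k}`, of the exterior forms
on `ℝ^{2n}`. -/
def formBasis (n : ℕ) : Module.Basis (Finset (Fin (2 * n))) ℝ (ExtForms (Model n)) :=
  (dualStdBasis n).ExteriorAlgebra

/-- The exterior derivative of a form `∑_S f_S dx^S` on (an open subset of) `ℝ^{2n}`: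
`∑_S ∑_i ∂_i f_S dx^i ∧ dx^S`. -/
def coordExtDeriv {n : ℕ} (f : Model n → ExtForms (Model n)) (y : Model n) :
    ExtForms (Model n) :=
  ∑ S : Finset (Fin (2 * n)), ∑ i : Fin (2 * n),
    fderiv ℝ (fun z => (formBasis n).repr (f z) S) y (stdBasis n i) •
      (ExteriorAlgebra.ι ℝ (dualStdBasis n i) * formBasis n S)

variable {n : ℕ} {M : Type*} [TopologicalSpace M] [ChartedSpace (Model n) M]

instance (x : M) : FiniteDimensional ℝ (TangentSpace (𝓡 (2 * n)) x) :=
  inferInstanceAs (FiniteDimensional ℝ (Model n))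

variable (n M) in
/-- Not necessarily smooth differential forms (of mixed degree) on `M`. Sums and wedge products
are pointwise. -/
abbrev RawForm : Type _ := ∀ x : M, ExtForms (TangentSpace (𝓡 (2 * n)) x)

/-- The expression of a form in the preferred chart at `x₀`: its pull-back along
the inverse of the chart. -/
def chartForm (x₀ : M) (α : RawForm n M) (y : Model n) : ExtForms (Model n) :=
  pullbackForm (V := Model n)
    (mfderiv 𝓘(ℝ, Model n) (𝓡 (2 * n)) (extChartAt (𝓡 (2 * n)) x₀).symm y).toLinearMap
    (α ((extChartAt (𝓡 (2 * n)) x₀).symm y))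

/-- Smoothness: the coefficients in all preferred charts are smooth. -/
def IsSmoothForm (α : RawForm n M) : Prop :=
  ∀ (x₀ : M) (S : Finset (Fin (2 * n))),
    ContDiffOn ℝ ∞ (fun y => (formBasis n).repr (chartForm x₀ α y) S)
      (extChartAt (𝓡 (2 * n)) x₀).target

/-- The exterior derivative, at each point computed in the preferred chart at that point. -/
def extD (α : RawForm n M) : RawForm n M := fun x =>
  pullbackForm (W := Model n)
    (mfderiv (𝓡 (2 * n)) 𝓘(ℝ, Model n) (extChartAt (𝓡 (2 * n)) x) x).toLinearMap
    (coordExtDeriv (chartForm x α) (extChartAt (𝓡 (2 * n)) x x))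

/-- `chartForm x₀ · y` as a homomorphism of algebras. -/
def chartFormHom (x₀ : M) (y : Model n) : RawForm n M →ₐ[ℝ] ExtForms (Model n) :=
  (pullbackForm (V := Model n)
    (mfderiv 𝓘(ℝ, Model n) (𝓡 (2 * n)) (extChartAt (𝓡 (2 * n)) x₀).symm y).toLinearMap).comp
    (Pi.evalAlgHom ℝ (fun x : M => ExtForms (TangentSpace (𝓡 (2 * n)) x))
      ((extChartAt (𝓡 (2 * n)) x₀).symm y))

theorem chartForm_eq (x₀ : M) (α : RawForm n M) (y : Model n) :
    chartForm x₀ α y = chartFormHom x₀ y α := rfl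

theorem IsSmoothForm.mul {α β : RawForm n M} (hα : IsSmoothForm α) (hβ : IsSmoothForm β) :
    IsSmoothForm (α * β) := by
  intro x₀ S
  have h : (fun y => (formBasis n).repr (chartForm x₀ (α * β) y) S) = fun y =>
      ∑ T : Finset (Fin (2 * n)), ∑ U : Finset (Fin (2 * n)),
        (formBasis n).repr (chartForm x₀ α y) T * ((formBasis n).repr (chartForm x₀ β y) U *
          (formBasis n).repr (formBasis n T * formBasis n U) S) := by
    funext y
    rw [chartForm_eq, map_mul, ← chartForm_eq, ← chartForm_eq]
    conv_lhs =>
      rw [← (formBasis n).sum_repr (chartForm x₀ α y), ← (formBasis n).sum_repr (chartForm x₀ β y)]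
    simp only [Finset.sum_mul, Finset.mul_sum, map_sum, Finsupp.finsetSum_apply, smul_mul_assoc,
      mul_smul_comm, map_smul, Finsupp.smul_apply, smul_eq_mul]
    refine Finset.sum_comm.trans ?_
    refine Finset.sum_congr rfl fun T _ => Finset.sum_congr rfl fun U _ => ?_
    ring
  rw [h]
  exact ContDiffOn.sum fun T _ => ContDiffOn.sum fun U _ =>
    (hα x₀ T).mul ((hβ x₀ U).mul contDiffOn_const)

variable (n M) in
/-- The algebra `𝒜` of smooth differential forms on `M`. -/
def Form : Subalgebra ℝ (RawForm n M) where
  carrier := {α | IsSmoothForm α}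
  mul_mem' := fun hα hβ => IsSmoothForm.mul hα hβ
  add_mem' := by
    intro α β hα hβ x₀ S
    have h : (fun y => (formBasis n).repr (chartForm x₀ (α + β) y) S) = fun y =>
        (formBasis n).repr (chartForm x₀ α y) S + (formBasis n).repr (chartForm x₀ β y) S := by
      funext y
      rw [chartForm_eq, map_add, map_add, Finsupp.add_apply, ← chartForm_eq, ← chartForm_eq]
    rw [h]
    exact (hα x₀ S).add (hβ x₀ S)
  algebraMap_mem' := by
    intro c x₀ S
    have h : (fun y => (formBasis n).repr (chartForm x₀ (algebraMap ℝ (RawForm n M) c) y) S) =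
        fun _ => (formBasis n).repr (algebraMap ℝ _ c) S := by
      funext y
      rw [chartForm_eq, AlgHom.commutes]
    rw [h]
    exact contDiffOn_const

variable (n M) in
/-- The grading of `𝒜` by degree; there are no forms of negative degree. -/
def formDegree : ℤ → Submodule ℝ (Form n M)
  | Int.ofNat k =>
    { carrier := {α | ∀ x, α.1 x ∈ ⋀[ℝ]^k (Module.Dual ℝ (TangentSpace (𝓡 (2 * n)) x))}
      add_mem' := fun ha hb x => Submodule.add_mem _ (ha x) (hb x)
      zero_mem' := fun _ => Submodule.zero_mem _
      smul_mem' := fun c _ ha x => Submodule.smul_mem _ c (ha x) }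
  | Int.negSucc _ => ⊥

variable (n M) in
/-- An almost symplectic form: a smooth nondegenerate `2`-form. -/
structure AlmostSymplecticForm where
  toForm : RawForm n M
  smooth : IsSmoothForm toForm
  degree_two : ∀ x, toForm x ∈ ⋀[ℝ]^2 (Module.Dual ℝ (TangentSpace (𝓡 (2 * n)) x))
  nondegenerate : ∀ x, (toBilin (toForm x)).Nondegenerate

/-- The almost symplectic form `Ω` is symplectic: `dω = 0`. -/
def AlmostSymplecticForm.IsSymplectic (Ω : AlmostSymplecticForm n M) : Prop :=
  extD Ω.toForm = 0

/-! ### Real polarizations -/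

variable (n M) in
/-- A field of subspaces of the tangent spaces. -/
abbrev TangentSubspaces : Type _ := ∀ x : M, Submodule ℝ (TangentSpace (𝓡 (2 * n)) x)

section Polarization

variable [IsManifold (𝓡 (2 * n)) ∞ M]

/-- `L` is a smooth subbundle of rank `r`: it has smooth local frames with `r` elements. -/
def IsSmoothSubbundle (r : ℕ) (L : TangentSubspaces n M) : Prop :=
  ∀ x₀ : M, ∃ U : Set M, IsOpen U ∧ x₀ ∈ U ∧
    ∃ s : Fin r → ∀ x : M, TangentSpace (𝓡 (2 * n)) x,
      (∀ i, ContMDiffOn (𝓡 (2 * n)) (𝓡 (2 * n)).tangent ∞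
        (fun x => (⟨x, s i x⟩ : TangentBundle (𝓡 (2 * n)) M)) U) ∧
      ∀ x ∈ U, LinearIndependent ℝ (fun i => s i x) ∧
        Submodule.span ℝ (Set.range fun i => s i x) = L x

/-- `L` is a Lagrangian subbundle: a smooth subbundle of rank `n` on which `Ω` vanishes. -/
def IsLagrangian (Ω : AlmostSymplecticForm n M) (L : TangentSubspaces n M) : Prop :=
  IsSmoothSubbundle n L ∧ ∀ x, ∀ u ∈ L x, ∀ v ∈ L x, toBilin (Ω.toForm x) u v = 0

/-- A real polarization: a splitting `TM = L ⊕ L'` into Lagrangian subbundles. -/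
structure IsRealPolarization (Ω : AlmostSymplecticForm n M) (L L' : TangentSubspaces n M) :
    Prop where
  lagrangian_left : IsLagrangian Ω L
  lagrangian_right : IsLagrangian Ω L'
  isCompl : ∀ x, IsCompl (L x) (L' x)

/-- `L` is integrable: smooth vector fields with values in `L` are closed under the Lie bracket. -/
def IsIntegrable (L : TangentSubspaces n M) : Prop :=
  ∀ X Y : ∀ x : M, TangentSpace (𝓡 (2 * n)) x,
    ContMDiff (𝓡 (2 * n)) (𝓡 (2 * n)).tangent ∞
      (fun x => (⟨x, X x⟩ : TangentBundle (𝓡 (2 * n)) M)) →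
    ContMDiff (𝓡 (2 * n)) (𝓡 (2 * n)).tangent ∞
      (fun x => (⟨x, Y x⟩ : TangentBundle (𝓡 (2 * n)) M)) →
    (∀ x, X x ∈ L x) → (∀ x, Y x ∈ L x) →
    ∀ x, VectorField.mlieBracket (𝓡 (2 * n)) X Y x ∈ L x

end Polarization

/-! ### Operators on differential forms

The operators below are written down on all forms; the theorem asserts in particular that they
restrict to linear operators on the smooth ones. -/

/-- The linear operator `D` on smooth forms is given by the formula `T`. -/
def IsGivenBy (D : Module.End ℝ (Form n M)) (T : RawForm n M → RawForm n M) : Prop :=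
  ∀ α : Form n M, (D α : RawForm n M) = T α

/-- The graded commutator `T₁ T₂ - (-1)^{k l} T₂ T₁` of operators of degrees `k` and `l`. -/
def opBracket (k l : ℤ) (T₁ T₂ : RawForm n M → RawForm n M) : RawForm n M → RawForm n M :=
  fun α => T₁ (T₂ α) - ((-1 : ℝ) ^ (k * l)) • T₂ (T₁ α)

/-- The component of bidegree `(a, b)` of an operator `T`, with respect to `𝒜 = ⨁ 𝒜^{p,q}`:
`∑_{p,q} π^{p+a,q+b} ∘ T ∘ π^{p,q}`. -/
def bidegComponent (L L' : TangentSubspaces n M) (a b : ℤ) (T : RawForm n M → RawForm n M) :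
    RawForm n M → RawForm n M := fun α =>
  ∑ r ∈ Finset.range (n + 1) ×ˢ Finset.range (n + 1),
    ∑ s ∈ Finset.range (n + 1) ×ˢ Finset.range (n + 1),
      if (s.1 : ℤ) = r.1 + a ∧ (s.2 : ℤ) = r.2 + b then
        fun x => bidegProj (L x) (L' x) s.1 s.2
          (T (fun z => bidegProj (L z) (L' z) r.1 r.2 (α z)) x)
      else 0

/-- `∂̄`, the component of `d` of bidegree `(0, 1)`. -/
def delbar (L L' : TangentSubspaces n M) : RawForm n M → RawForm n M :=
  bidegComponent L L' 0 1 extD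

namespace AlmostSymplecticForm

variable (Ω : AlmostSymplecticForm n M)

/-- The pointwise pairing `⟨α, β⟩_ω`. -/
def pairing (α β : RawForm n M) (x : M) : ℝ :=
  formPairing (toBilin (Ω.toForm x)) (Ω.nondegenerate x) (α x) (β x)

/-- The symplectic star operator: `α ∧ ⋆β = ⟨α, β⟩_ω ω^n / n!`. -/
def star (β : RawForm n M) : RawForm n M := fun x =>
  linearStar (toBilin (Ω.toForm x)) (Ω.nondegenerate x)
    (((n.factorial : ℝ)⁻¹) • Ω.toForm x ^ n) (β x)

/-- The operator `L α = ω ∧ α`. -/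
def lefschetz (α : RawForm n M) : RawForm n M := Ω.toForm * α

/-- The symplectic adjoint `T^ω` of an operator `T` of algebraic order zero, determined by
`⟨T α, β⟩_ω = ⟨α, T^ω β⟩_ω` for all smooth forms `α`. -/
def adjoint (T : RawForm n M → RawForm n M) : RawForm n M → RawForm n M := fun β =>
  Classical.epsilon fun γ => ∀ α : RawForm n M, IsSmoothForm α →
    Ω.pairing (T α) β = Ω.pairing α γ

/-- `Λ = L^ω`. -/
def dualLefschetz : RawForm n M → RawForm n M := Ω.adjoint Ω.lefschetz

/-- `d^ω = (-1)^k ⋆ d ⋆` on forms of degree `k`. -/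
def dAdjoint (β : RawForm n M) : RawForm n M :=
  ∑ k ∈ Finset.range (2 * n + 1),
    ((-1 : ℝ) ^ k) • Ω.star (extD (Ω.star (fun x => degPart k (β x))))

/-- The operator `[d, L]`, of degree `3`. -/
def dL : RawForm n M → RawForm n M := opBracket 1 2 extD Ω.lefschetz

/-- The operator `[Λ, [d, L]]`, of degree `1`. -/
def lambdaDL : RawForm n M → RawForm n M := opBracket (-2) 3 Ω.dualLefschetz Ω.dL

/-! If `δ` is the component of bidegree `(a, b)` of `d`, of `[d, L]` or of `[Λ, [d, L]]`, then `δ^ω`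
is the component of bidegree `(-a, -b)` of `d^ω`, of `[d, L]^ω`, of `[Λ, [d, L]]^ω` respectively.
For `∂` this is `∂^ω = (-1)^k ⋆ ∂̄ ⋆` on forms of degree `k`. Here `∂`, `[∂, L]`, `[Λ, [∂, L]]` are
the components of bidegrees `(1, 0)`, `(2, 1)`, `(1, 0)`. -/

/-- `∂^ω`. -/
def delAdjoint (L L' : TangentSubspaces n M) : RawForm n M → RawForm n M :=
  bidegComponent L L' (-1) 0 Ω.dAdjoint

/-- `[∂, L]^ω`. -/
def delLAdjoint (L L' : TangentSubspaces n M) : RawForm n M → RawForm n M :=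
  bidegComponent L L' (-2) (-1) (Ω.adjoint Ω.dL)

/-- `[Λ, [∂, L]]^ω`. -/
def lambdaDelLAdjoint (L L' : TangentSubspaces n M) : RawForm n M → RawForm n M :=
  bidegComponent L L' (-1) 0 (Ω.adjoint Ω.lambdaDL)

end AlmostSymplecticForm

end Manifold

end SymplecticPolarization

end

set_option linter.unusedSimpArgs false
set_option linter.unusedSectionVars false

noncomputable section

namespace SymplecticPolarization

/-! ### Algebraic order of operators and graded commutators -/

section OperatorOrder

variable {A : Type*} [Ring A] [Algebra ℝ A] {𝒜 : ℤ → Submodule ℝ A}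

/-! Work in the Lie algebra of operators on `𝒜` under commutators. There `L`, `Λ` and `H = [L, Λ]`,
which is `k - n` on `k`-forms, act as an `sl₂`. The operator `d` has weight one, and `D = [d, L]` is
multiplication by `dω`, so it commutes with `L`. Since `[L, d] = -D` and `[L, [Λ, D]] = 3 D`, the
operator `e = d + (1/3) [Λ, D]` is a highest weight vector of weight one. It generates a module of
dimension at most two, hence `[Λ, [Λ, e]] = 0`, i.e. `[Λ, [Λ, d]] = -(1/3) ad(Λ)³ D`
(`SlTwoWeightOne.lower_lower`). For a three-form `η`, the operator `ad(Λ)³` turns `η ∧ ·` into six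
times its adjoint, so `[Λ, [Λ, d]] = -2 [d, L]^ω`. The adjoints of `ω ∧ ·` and `dω ∧ ·` commute, so
`ad(Λ)³ d = 0`.

The star operator is, up to the sign `(-1)^{k(k+1)/2}`, the Weyl element `e^L e^{-Λ} e^L`: both
interchange multiplication by a covector with contraction, up to sign, and they agree on `1`
(`IsSharp.star_unique`). Conjugating `d` by the Weyl element gives `d^ω = [Λ, d] + (1/2) [Λ, [Λ,
D]]` (`SlTwoWeightOne.weyl_mul`), while `[Λ, D]^ω = -(1/2) [Λ, [Λ, D]]`. Therefore `d^ω + [Λ, [d,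
L]]^ω = [Λ, d]` and `-[d, L]^ω = (1/2) [Λ, [Λ, d]]`.

The polarization enters through the operator `N` acting by `q` on `𝒜^{p,q}`. As both subbundles are
Lagrangian, `ω` has `N`-weight one, so `ad L` and `ad Λ` shift weights by `1` and `-1`.
Integrability of `L` says that `d` has only the weights `-1, 0, 1` (`weightOp_bracket_cube`), and
its weight-one part is `∂̄`. An identity between operators built linearly from `d` by such brackets
holds separately in each weight, so every relation above survives with `∂̄` in place of `d`: `Δ₁ =
[Λ, ∂̄]`, `Δ₂ = (1/2) [Λ, [Λ, ∂̄]]`, `ad(Λ)³ ∂̄ = 0`.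

Thus `∂̄ + Δ₁ ξ + Δ₂ ξ² = e^{Λξ} ∂̄ e^{-Λξ}`. Its square vanishes because `∂̄² = 0`, and the orders
are right because `Λ` has order two, `∂̄` has order one and a commutator of orders `r`, `s` has
order `r + s - 1`. If `dω = 0`, then `D = 0` and the series stops after the linear term. -/

theorem neg_one_zpow_mul_self (k : ℤ) : ((-1 : ℝ) ^ k) * (-1) ^ k = 1 := by
  rw [← mul_zpow]; norm_num

theorem neg_one_zpow_add (k l : ℤ) : (-1 : ℝ) ^ (k + l) = (-1) ^ k * (-1) ^ l :=
  zpow_add₀ (by norm_num) k l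

theorem IsHomogeneousOp.add {k : ℤ} {f g : Module.End ℝ A} (hf : IsHomogeneousOp 𝒜 k f)
    (hg : IsHomogeneousOp 𝒜 k g) : IsHomogeneousOp 𝒜 k (f + g) :=
  fun i a ha => add_mem (hf i a ha) (hg i a ha)

theorem IsHomogeneousOp.smul {k : ℤ} {f : Module.End ℝ A} (c : ℝ)
    (hf : IsHomogeneousOp 𝒜 k f) : IsHomogeneousOp 𝒜 k (c • f) :=
  fun i a ha => Submodule.smul_mem _ c (hf i a ha)

theorem IsHomogeneousOp.mul {k l : ℤ} {f g : Module.End ℝ A} (hf : IsHomogeneousOp 𝒜 k f)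
    (hg : IsHomogeneousOp 𝒜 l g) : IsHomogeneousOp 𝒜 (k + l) (f * g) := fun i a ha => by
  have := hf _ _ (hg i a ha)
  rwa [add_assoc, add_comm l k] at this

theorem isHomogeneousOp_mulLeft (hmul : ∀ i j : ℤ, ∀ a ∈ 𝒜 i, ∀ b ∈ 𝒜 j, a * b ∈ 𝒜 (i + j))
    {k : ℤ} {a : A} (ha : a ∈ 𝒜 k) : IsHomogeneousOp 𝒜 k (LinearMap.mulLeft ℝ a) :=
  fun i b hb => by rw [add_comm]; exact hmul k i a ha b hb

theorem IsHomogeneousOp.gradedCommutator {k l : ℤ} {f g : Module.End ℝ A}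
    (hf : IsHomogeneousOp 𝒜 k f) (hg : IsHomogeneousOp 𝒜 l g) :
    IsHomogeneousOp 𝒜 (k + l) (gradedCommutator k l f g) := by
  have h2 : IsHomogeneousOp 𝒜 (k + l) (g * f) := by rw [add_comm]; exact hg.mul hf
  have := (hf.mul hg).add (h2.smul (-((-1 : ℝ) ^ (k * l))))
  have e : f * g + (-((-1 : ℝ) ^ (k * l))) • (g * f) =
      SymplecticPolarization.gradedCommutator k l f g := by
    rw [SymplecticPolarization.gradedCommutator]; module
  exact e ▸ this

theorem gradedCommutator_swap (k l : ℤ) (f g : Module.End ℝ A) :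
    gradedCommutator k l f g = (-((-1 : ℝ) ^ (k * l))) • gradedCommutator l k g f := by
  simp only [gradedCommutator, smul_sub, smul_smul, mul_comm l k]
  rw [neg_mul, neg_one_zpow_mul_self]
  module

/-- Bracketing with `a` is a graded derivation of the bracket. This is the inductive step in the
count of orders. -/
theorem gradedCommutator_jacobi (j k l : ℤ) (a f g : Module.End ℝ A) :
    gradedCommutator j (k + l) a (gradedCommutator k l f g) =
      gradedCommutator (j + k) l (gradedCommutator j k a f) g +
        ((-1 : ℝ) ^ (j * k)) • gradedCommutator k (j + l) f (gradedCommutator j l a g) := by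
  simp only [gradedCommutator, mul_sub, sub_mul, mul_smul_comm, smul_mul_assoc, smul_sub,
    smul_smul, mul_add, add_mul, neg_one_zpow_add, mul_assoc, mul_comm k j]
  have h1 : ((-1 : ℝ) ^ (k * j)) ^ 2 = 1 := by rw [sq, neg_one_zpow_mul_self]
  have h2 : ((-1 : ℝ) ^ (j * k)) ^ 2 = 1 := by rw [sq, neg_one_zpow_mul_self]
  match_scalars <;> (try ring_nf) <;> (try simp only [h1, h2]) <;> (try ring_nf)

theorem HasOrderLE.isHomogeneousOp
    (hmul : ∀ i j : ℤ, ∀ a ∈ 𝒜 i, ∀ b ∈ 𝒜 j, a * b ∈ 𝒜 (i + j)) {r : ℕ} {k : ℤ}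
    {f : Module.End ℝ A} (hf : HasOrderLE 𝒜 r k f) : IsHomogeneousOp 𝒜 k f := by
  cases r with
  | zero => obtain ⟨a, ha, rfl⟩ := hf; exact isHomogeneousOp_mulLeft hmul ha
  | succ r => exact hf.1

theorem gradedCommutator_add_right (k l : ℤ) (f g h : Module.End ℝ A) :
    gradedCommutator k l f (g + h) = gradedCommutator k l f g + gradedCommutator k l f h := by
  simp only [gradedCommutator, mul_add, add_mul, smul_add]; abel

theorem gradedCommutator_smul_right (k l : ℤ) (c : ℝ) (f g : Module.End ℝ A) :
    gradedCommutator k l f (c • g) = c • gradedCommutator k l f g := by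
  simp only [gradedCommutator, mul_smul_comm, smul_mul_assoc, smul_sub, smul_comm c]

theorem HasOrderLE.add {r : ℕ} {k : ℤ} {f g : Module.End ℝ A} (hf : HasOrderLE 𝒜 r k f)
    (hg : HasOrderLE 𝒜 r k g) : HasOrderLE 𝒜 r k (f + g) := by
  induction r generalizing k f g with
  | zero =>
    obtain ⟨a, ha, rfl⟩ := hf
    obtain ⟨b, hb, rfl⟩ := hg
    exact ⟨a + b, add_mem ha hb, by ext; simp [add_mul]⟩
  | succ r ih =>
    refine ⟨hf.1.add hg.1, fun j a ha => ?_⟩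
    rw [gradedCommutator_add_right]
    exact ih (hf.2 j a ha) (hg.2 j a ha)

theorem HasOrderLE.smul {r : ℕ} {k : ℤ} {f : Module.End ℝ A} (c : ℝ)
    (hf : HasOrderLE 𝒜 r k f) : HasOrderLE 𝒜 r k (c • f) := by
  induction r generalizing k f with
  | zero =>
    obtain ⟨a, ha, rfl⟩ := hf
    exact ⟨c • a, Submodule.smul_mem _ c ha, by ext; simp⟩
  | succ r ih =>
    refine ⟨hf.1.smul c, fun j a ha => ?_⟩
    rw [gradedCommutator_smul_right]
    exact ih (hf.2 j a ha)

theorem HasOrderLE.zero (r : ℕ) (k : ℤ) : HasOrderLE 𝒜 r k (0 : Module.End ℝ A) := by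
  induction r generalizing k with
  | zero => exact ⟨0, zero_mem _, by ext; simp⟩
  | succ r ih =>
    refine ⟨fun i a _ => zero_mem _, fun j a _ => ?_⟩
    have : gradedCommutator j k (LinearMap.mulLeft ℝ a) 0 = 0 := by simp [gradedCommutator]
    rw [this]
    exact ih _

/-- The graded commutator of operators of orders `≤ r` and `≤ s` has order `≤ r + s - 1`. -/
theorem HasOrderLE.gradedCommutator
    (hmul : ∀ i j : ℤ, ∀ a ∈ 𝒜 i, ∀ b ∈ 𝒜 j, a * b ∈ 𝒜 (i + j)) {r s : ℕ} {k l : ℤ}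
    {f g : Module.End ℝ A} (hf : HasOrderLE 𝒜 r k f) (hg : HasOrderLE 𝒜 (s + 1) l g) :
    HasOrderLE 𝒜 (r + s) (k + l) (gradedCommutator k l f g) := by
  -- Induction on the total order: each of the two Jacobi terms lowers the order of exactly one
  -- factor.
  suffices H : ∀ m r s : ℕ, r + s = m → ∀ (k l : ℤ) (f g : Module.End ℝ A), HasOrderLE 𝒜 r k f →
      HasOrderLE 𝒜 (s + 1) l g → HasOrderLE 𝒜 m (k + l)
        (SymplecticPolarization.gradedCommutator k l f g) from H _ r s rfl k l f g hf hg
  clear hf hg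
  intro m
  induction m with
  | zero =>
    intro r s hrs k l f g hf hg
    obtain ⟨rfl, rfl⟩ : r = 0 ∧ s = 0 := by omega
    obtain ⟨a, ha, rfl⟩ := hf
    exact hg.2 k a ha
  | succ m ih =>
    intro r s hrs k l f g hf hg
    rcases r with _ | r
    · obtain rfl : s = m + 1 := by omega
      obtain ⟨a, ha, rfl⟩ := hf
      exact hg.2 k a ha
    · refine ⟨(hf.isHomogeneousOp hmul).gradedCommutator (hg.isHomogeneousOp hmul),
        fun j a ha => ?_⟩
      rw [gradedCommutator_jacobi]
      refine HasOrderLE.add ?_ (HasOrderLE.smul _ ?_)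
      · rw [← add_assoc]
        exact ih r s (by omega) _ _ _ _ (hf.2 j a ha) hg
      · rw [add_left_comm]
        -- If `g` has order one, then `[a, g]` is itself a multiplication, so after exchanging the
        -- entries the bound is the definition of the order of `f`.
        rcases s with _ | s
        · obtain ⟨b, hb, hb'⟩ := hg.2 j a ha
          rw [hb', gradedCommutator_swap, add_comm]
          obtain rfl : r = m := by omega
          exact HasOrderLE.smul _ (hf.2 _ b hb)
        · exact ih (r + 1) s (by omega) _ _ _ _ hf (hg.2 j a ha)

theorem gradedCommutator_mul_right (j k l : ℤ) (a f g : Module.End ℝ A) :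
    gradedCommutator j (k + l) a (f * g) = gradedCommutator j k a f * g +
      ((-1 : ℝ) ^ (j * k)) • (f * gradedCommutator j l a g) := by
  simp only [gradedCommutator, mul_sub, sub_mul, mul_smul_comm, smul_mul_assoc, smul_sub,
    smul_smul, neg_one_zpow_add, mul_add]
  module

/-- The product of operators of orders `≤ r` and `≤ s` has order `≤ r + s`. -/
theorem HasOrderLE.mul
    (hmul : ∀ i j : ℤ, ∀ a ∈ 𝒜 i, ∀ b ∈ 𝒜 j, a * b ∈ 𝒜 (i + j))
    (hcomm : ∀ i j : ℤ, ∀ a ∈ 𝒜 i, ∀ b ∈ 𝒜 j, a * b = ((-1 : ℝ) ^ (i * j)) • (b * a))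
    {r s : ℕ} {k l : ℤ} {f g : Module.End ℝ A} (hf : HasOrderLE 𝒜 r k f)
    (hg : HasOrderLE 𝒜 s l g) : HasOrderLE 𝒜 (r + s) (k + l) (f * g) := by
  -- Multiplications graded-commute, so a factor of order zero contributes nothing to the bracket
  -- with `a`.
  have hz : ∀ (i j : ℤ) (a b : A), a ∈ 𝒜 i → b ∈ 𝒜 j → SymplecticPolarization.gradedCommutator i j
      (LinearMap.mulLeft ℝ a) (LinearMap.mulLeft ℝ b) = 0 := by
    intro i j a b ha hb
    ext c
    have h1 : a * b - ((-1 : ℝ) ^ (i * j)) • (b * a) = 0 := by rw [hcomm i j a ha b hb, sub_self]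
    have : (a * b - ((-1 : ℝ) ^ (i * j)) • (b * a)) * c = 0 := by rw [h1, zero_mul]
    simpa [SymplecticPolarization.gradedCommutator, sub_mul, mul_assoc] using this
  suffices H : ∀ m r s : ℕ, r + s = m → ∀ (k l : ℤ) (f g : Module.End ℝ A), HasOrderLE 𝒜 r k f →
      HasOrderLE 𝒜 s l g → HasOrderLE 𝒜 m (k + l) (f * g) from H _ r s rfl k l f g hf hg
  clear hf hg
  intro m
  induction m with
  | zero =>
    intro r s hrs k l f g hf hg
    obtain ⟨rfl, rfl⟩ : r = 0 ∧ s = 0 := by omega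
    obtain ⟨a, ha, rfl⟩ := hf
    obtain ⟨b, hb, rfl⟩ := hg
    exact ⟨a * b, hmul _ _ a ha b hb, by ext; simp⟩
  | succ m ih =>
    intro r s hrs k l f g hf hg
    refine ⟨(hf.isHomogeneousOp hmul).mul (hg.isHomogeneousOp hmul), fun j a ha => ?_⟩
    rw [gradedCommutator_mul_right]
    refine HasOrderLE.add ?_ (HasOrderLE.smul _ ?_)
    · rw [← add_assoc]
      rcases r with _ | r
      · obtain ⟨b, hb, rfl⟩ := hf
        rw [hz j k a b ha hb, zero_mul]
        exact HasOrderLE.zero _ _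
      · exact ih r s (by omega) _ _ _ _ (hf.2 j a ha) hg
    · rw [add_left_comm]
      rcases s with _ | s
      · obtain ⟨b, hb, rfl⟩ := hg
        rw [hz j l a b ha hb, mul_zero]
        exact HasOrderLE.zero _ _
      · exact ih r s (by omega) _ _ _ _ hf (hg.2 j a ha)

/-- An antiderivation of degree `k` (odd) has order `≤ 1`. -/
theorem HasOrderLE.of_antiderivation {k : ℤ} (hk : Odd k) {f : Module.End ℝ A}
    (hf : IsHomogeneousOp 𝒜 k f)
    (hder : ∀ i : ℤ, ∀ a ∈ 𝒜 i, ∀ b : A, f (a * b) = f a * b + ((-1 : ℝ) ^ i) • (a * f b)) :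
    HasOrderLE 𝒜 1 k f := by
  -- By Leibniz, `a f(b) - (-1)^{jk} f(a b) = -(-1)^j f(a) b`, because `k` is odd.
  refine ⟨hf, fun j a ha => ⟨(-((-1 : ℝ) ^ j)) • f a, ?_, ?_⟩⟩
  · rw [add_comm] at *
    exact Submodule.smul_mem _ _ (by simpa [add_comm] using hf j a ha)
  · ext b
    have h1 : (-1 : ℝ) ^ (j * k) = (-1) ^ j := by
      rw [mul_comm, zpow_mul, hk.neg_one_zpow]
    simp only [SymplecticPolarization.gradedCommutator, h1, LinearMap.sub_apply,
      LinearMap.smul_apply, Module.End.mul_apply, LinearMap.mulLeft_apply, hder j a ha b, smul_add,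
      smul_smul, neg_one_zpow_mul_self, smul_mul_assoc]
    module

end OperatorOrder

/-! ### Truncated exponentials -/

section Exponential

variable {R : Type*} [Ring R] [Algebra ℝ R]

/-- The divided iterated commutator `(ad T)^k X / k!`. -/
def adDiv (T X : R) (k : ℕ) : R := ((k.factorial : ℝ)⁻¹) • (fun Y => T * Y - Y * T)^[k] X

theorem divPow_succ (T : R) (k : ℕ) : (((k + 1).factorial : ℝ)⁻¹) • T ^ (k + 1) =
    ((k + 1 : ℝ)⁻¹) • (T * (((k.factorial : ℝ)⁻¹) • T ^ k)) := by
  rw [mul_smul_comm, ← pow_succ', smul_smul, Nat.factorial_succ]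
  push_cast
  rw [mul_inv]

theorem adDiv_succ (T X : R) (k : ℕ) : ((k + 1 : ℕ) : ℝ) • adDiv T X (k + 1) =
    T * adDiv T X k - adDiv T X k * T := by
  unfold adDiv
  rw [Function.iterate_succ_apply', mul_smul_comm, smul_mul_assoc, ← smul_sub, smul_smul,
    Nat.factorial_succ]
  congr 1
  push_cast
  field_simp

/-- The degree `k` coefficient of `e^T X = (e^{ad T} X) e^T`. Working coefficientwise serves both
the formal and the nilpotent exponentials. -/
theorem divPow_mul (T X : R) (k : ℕ) : (((k.factorial : ℝ)⁻¹) • T ^ k) * X =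
    ∑ p ∈ Finset.HasAntidiagonal.antidiagonal k, adDiv T X p.1 * (((p.2.factorial : ℝ)⁻¹) • T ^ p.2) := by
  induction k with
  | zero => simp [adDiv]
  | succ k ih =>
    have hk : ((k + 1 : ℕ) : ℝ) ≠ 0 := by positivity
    -- Multiply by `k + 1 = p.1 + p.2` and split: the first part absorbs `p.1` into the iterated
    -- commutator, the second absorbs `p.2` into the power.
    have key : ((k + 1 : ℕ) : ℝ) •
        ∑ p ∈ Finset.HasAntidiagonal.antidiagonal (k + 1), adDiv T X p.1 * (((p.2.factorial : ℝ)⁻¹) • T ^ p.2) =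
        T * ∑ p ∈ Finset.HasAntidiagonal.antidiagonal k, adDiv T X p.1 * (((p.2.factorial : ℝ)⁻¹) • T ^ p.2) := by
      have h1 : ((k + 1 : ℕ) : ℝ) •
        ∑ p ∈ Finset.HasAntidiagonal.antidiagonal (k + 1), adDiv T X p.1 * (((p.2.factorial : ℝ)⁻¹) • T ^ p.2) =
        ∑ p ∈ Finset.HasAntidiagonal.antidiagonal (k + 1),
            ((p.1 : ℝ) • adDiv T X p.1) * (((p.2.factorial : ℝ)⁻¹) • T ^ p.2) +
        ∑ p ∈ Finset.HasAntidiagonal.antidiagonal (k + 1),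
            adDiv T X p.1 * ((p.2 : ℝ) • (((p.2.factorial : ℝ)⁻¹) • T ^ p.2)) := by
        rw [Finset.smul_sum, ← Finset.sum_add_distrib]
        refine Finset.sum_congr rfl fun p hp => ?_
        rw [← Finset.HasAntidiagonal.mem_antidiagonal.mp hp, smul_mul_assoc, mul_smul_comm (p.2 : ℝ)]
        push_cast
        rw [add_smul]
      rw [h1, Finset.Nat.sum_antidiagonal_succ, Finset.Nat.sum_antidiagonal_succ', Finset.mul_sum]
      simp only [Nat.cast_zero, zero_smul, zero_mul, mul_zero, zero_add]
      rw [← Finset.sum_add_distrib]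
      refine Finset.sum_congr rfl fun p _ => ?_
      rw [adDiv_succ, divPow_succ, smul_smul]
      push_cast
      rw [mul_inv_cancel₀ (by positivity), one_smul, sub_mul, mul_assoc, mul_assoc]
      abel
    rw [divPow_succ, smul_mul_assoc, mul_assoc, ih, ← key, smul_smul]
    push_cast at hk ⊢
    rw [inv_mul_cancel₀ hk, one_smul]

/-- The coefficients of `e^T e^{-T} = 1`, from the binomial theorem for `(T + (-T))^k`. -/
theorem sum_antidiagonal_divPow_neg (T : R) (k : ℕ) :
    ∑ p ∈ Finset.HasAntidiagonal.antidiagonal k, (((p.1.factorial : ℝ)⁻¹) • T ^ p.1) *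
      (((p.2.factorial : ℝ)⁻¹) • (-T) ^ p.2) = if k = 0 then 1 else 0 := by
  have h := (Commute.refl T).neg_right.add_pow' k
  rw [add_neg_cancel] at h
  have h2 : ∑ p ∈ Finset.HasAntidiagonal.antidiagonal k, (((p.1.factorial : ℝ)⁻¹) • T ^ p.1) *
      (((p.2.factorial : ℝ)⁻¹) • (-T) ^ p.2) = ((k.factorial : ℝ)⁻¹) • (0 : R) ^ k := by
    rw [h, Finset.smul_sum]
    refine Finset.sum_congr rfl fun p hp => ?_
    rw [← Nat.cast_smul_eq_nsmul ℝ, smul_smul, smul_mul_smul_comm]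
    congr 1
    rw [← Finset.HasAntidiagonal.mem_antidiagonal.mp hp, ← Nat.add_choose_mul_factorial_mul_factorial p.1 p.2]
    have := Nat.choose_pos (Nat.le_add_right p.1 p.2)
    push_cast
    field_simp
    rw [Nat.choose_symm_add, div_self (by rw [← Nat.choose_symm_add]; positivity)]
  rw [h2]
  split_ifs with hk
  · simp [hk]
  · simp [hk]

/-- The exponential of an element `T` with `T ^ N = 0`. -/
def nilExp (N : ℕ) (T : R) : R := ∑ k ∈ Finset.range N, ((k.factorial : ℝ)⁻¹) • T ^ k

/-- A Cauchy product of two finite series; the bound `K + L` is generous, as every surplus term has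
a vanishing factor. -/
theorem sum_mul_sum_of_antidiagonal {S : Type*} [Ring S] (a b c : ℕ → S) (K L : ℕ) (ha : ∀ k, K ≤ k → a k = 0)
    (hb : ∀ k, L ≤ k → b k = 0)
    (hc : ∀ k, c k = ∑ p ∈ Finset.HasAntidiagonal.antidiagonal k, a p.1 * b p.2) :
    (∑ k ∈ Finset.range K, a k) * (∑ k ∈ Finset.range L, b k) =
      ∑ k ∈ Finset.range (K + L), c k := by
  rw [Finset.sum_mul_sum, ← Finset.sum_product', ← Finset.sum_fiberwise_of_maps_to
    (t := Finset.range (K + L)) (g := fun p : ℕ × ℕ => p.1 + p.2)]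
  · refine Finset.sum_congr rfl fun k _ => ?_
    rw [hc k]
    refine Finset.sum_subset (fun p hp => ?_) fun p hp hp' => ?_
    · exact Finset.HasAntidiagonal.mem_antidiagonal.mpr (Finset.mem_filter.mp hp).2
    · have hp := Finset.HasAntidiagonal.mem_antidiagonal.mp hp
      have : K ≤ p.1 ∨ L ≤ p.2 := by
        by_contra! h
        exact hp' (by simp [h, hp])
      rcases this with h | h
      · rw [ha _ h, zero_mul]
      · rw [hb _ h, mul_zero]
  · intro p hp
    simp only [Finset.mem_product, Finset.mem_range] at hp ⊢
    omega

theorem divPow_eq_zero {N k : ℕ} {T : R} (hT : T ^ N = 0) (hk : N ≤ k) :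
    ((k.factorial : ℝ)⁻¹) • T ^ k = 0 := by
  rw [pow_eq_zero_of_le hk hT, smul_zero]

theorem nilExp_eq_sum {N K : ℕ} {T : R} (hT : T ^ N = 0) (hK : N ≤ K) :
    ∑ k ∈ Finset.range K, ((k.factorial : ℝ)⁻¹) • T ^ k = nilExp N T := by
  refine (Finset.sum_subset (Finset.range_mono hK) fun k _ hk => ?_).symm
  exact divPow_eq_zero hT (by simpa using hk)

theorem adDiv_eq_zero {T X : R} {m k : ℕ} (hX : (fun Y => T * Y - Y * T)^[m] X = 0)
    (hk : m ≤ k) : adDiv T X k = 0 := by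
  obtain ⟨l, rfl⟩ := Nat.exists_eq_add_of_le hk
  have h0 : (fun Y => T * Y - Y * T)^[l] (0 : R) = 0 := by
    induction l with
    | zero => rfl
    | succ l ih => rw [Function.iterate_succ_apply', ih (Nat.le_add_right _ _)]; simp
  rw [adDiv, add_comm, Function.iterate_add_apply, hX, h0, smul_zero]

/-- `Ad(e^T) = e^{ad T}`, with finite sums on both sides: `T` is nilpotent and a power of `ad T`
kills `X`. -/
theorem nilExp_mul {N : ℕ} {T : R} (hT : T ^ N = 0) (X : R) {m : ℕ}
    (hX : (fun Y => T * Y - Y * T)^[m] X = 0) :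
    nilExp N T * X = (∑ k ∈ Finset.range m, adDiv T X k) * nilExp N T := by
  rw [nilExp, sum_mul_sum_of_antidiagonal (adDiv T X) (fun k => ((k.factorial : ℝ)⁻¹) • T ^ k)
    (fun k => (((k.factorial : ℝ)⁻¹) • T ^ k) * X) m N (fun k => adDiv_eq_zero hX)
    (fun k => divPow_eq_zero hT) (divPow_mul T X), ← Finset.sum_mul,
    nilExp_eq_sum hT (Nat.le_add_left _ _), nilExp]

theorem nilExp_mul_nilExp_neg {N : ℕ} {T : R} (hT : T ^ N = 0) :
    nilExp N T * nilExp N (-T) = 1 := by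
  have hT' : (-T) ^ N = 0 := by rw [neg_pow, hT, mul_zero]
  -- With exponent zero the hypothesis reads `1 = 0`, so the ring is trivial.
  rcases N with _ | N
  · rw [pow_zero] at hT
    rw [← one_mul (1 : R), hT]; simp [nilExp]
  rw [nilExp, nilExp, sum_mul_sum_of_antidiagonal (fun k => ((k.factorial : ℝ)⁻¹) • T ^ k)
    (fun k => ((k.factorial : ℝ)⁻¹) • (-T) ^ k) (fun k => if k = 0 then 1 else 0) _ _
    (fun k => divPow_eq_zero hT) (fun k => divPow_eq_zero hT')
    (fun k => (sum_antidiagonal_divPow_neg T k).symm)]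
  simp

end Exponential

/-! ### Conjugation by a formal exponential -/

section ExpSeries

variable {A : Type*} [Ring A] [Algebra ℝ A]

theorem expSeries_mul_expSeries_neg (f : Module.End ℝ A) :
    expSeries f * expSeries (-f) = 1 := by
  ext1 k
  rw [PowerSeries.coeff_mul, PowerSeries.coeff_one]
  simpa only [expSeries, PowerSeries.coeff_mk] using sum_antidiagonal_divPow_neg f k

/-- `e^{fξ} g e^{-fξ} = g + [f, g] ξ` if `[f, [f, g]] = 0`. -/
theorem expSeries_conj {f g h : Module.End ℝ A} (hh : h = f * g - g * f) (h0 : f * h - h * f = 0) :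
    PowerSeries.C g + PowerSeries.C h * PowerSeries.X =
      expSeries f * PowerSeries.C g * expSeries (-f) := by
  -- Moving `e^{-fξ}` to the other side leaves a comparison of coefficients, in which only the
  -- iterated commutators of length zero and one survive.
  have h1 : expSeries f * PowerSeries.C g =
      (PowerSeries.C g + PowerSeries.C h * PowerSeries.X) * expSeries f := by
    ext1 k
    have h2 : (fun Y => f * Y - Y * f)^[2] g = 0 := by
      simpa only [Function.iterate_succ, Function.iterate_zero, Function.comp_apply, id_eq, ← hh]
        using h0
    have h3 : PowerSeries.C h * PowerSeries.X = PowerSeries.X * PowerSeries.C h :=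
      (PowerSeries.commute_X _).eq
    rw [add_mul, map_add, PowerSeries.coeff_mul_C, PowerSeries.coeff_C_mul, h3, mul_assoc]
    simp only [expSeries, PowerSeries.coeff_mk]
    rw [divPow_mul]
    rcases k with _ | k
    · simp [adDiv]
    · rw [PowerSeries.coeff_succ_X_mul, PowerSeries.coeff_C_mul, PowerSeries.coeff_mk,
        Finset.Nat.sum_antidiagonal_succ]
      congr 1
      · simp [adDiv]
      · rcases k with _ | k
        · simp [adDiv, hh]
        · rw [Finset.Nat.sum_antidiagonal_succ, Finset.sum_eq_zero, add_zero]
          · simp [adDiv, hh]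
          · intro p _
            rw [add_assoc, adDiv_eq_zero h2 (by omega), zero_mul]
  rw [h1, mul_assoc, expSeries_mul_expSeries_neg, mul_one]

end ExpSeries

/-! ### Consequences of the `sl₂`-relations -/

section SlTwo

attribute [local instance] LieRing.ofAssociativeRing

variable {R : Type*} [Ring R] [Algebra ℝ R]

/-- Along the chain `ad(Λ)^k u`, applying `ad L` goes back one step with a factor which is a sum of
negative numbers, hence never zero. A chain that ends must therefore already vanish at its start:
finite-dimensional `sl₂`-modules have no highest weight vectors of negative weight. -/
theorem eq_zero_of_negative_weight {L Λ H u : R} {c : ℝ} (hc : c < 0) (hLΛ : ⁅L, Λ⁆ = H)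
    (hHΛ : ⁅H, Λ⁆ = (-2 : ℝ) • Λ) (hu : ⁅L, u⁆ = 0) (hHu : ⁅H, u⁆ = c • u) {N : ℕ}
    (hN : (LieAlgebra.ad ℝ R Λ ^ N) u = 0) : u = 0 := by
  have hH : ∀ k : ℕ, ⁅H, (LieAlgebra.ad ℝ R Λ ^ k) u⁆ =
      (c - 2 * k) • (LieAlgebra.ad ℝ R Λ ^ k) u := by
    intro k
    induction k with
    | zero => simpa using hHu
    | succ k ih =>
      rw [pow_succ', Module.End.mul_apply, LieAlgebra.ad_apply, leibniz_lie, hHΛ, ih, lie_smul,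
        smul_lie]
      push_cast
      module
  -- The factor is `c + (c - 2) + ⋯ + (c - 2k)`; only its sign is needed.
  have hL : ∀ k : ℕ, ∃ a : ℝ, a < 0 ∧ ⁅L, (LieAlgebra.ad ℝ R Λ ^ (k + 1)) u⁆ =
      a • (LieAlgebra.ad ℝ R Λ ^ k) u := by
    intro k
    induction k with
    | zero => exact ⟨c, hc, by simp [leibniz_lie L, hLΛ, hHu, hu]⟩
    | succ k ih =>
      obtain ⟨a, ha, h⟩ := ih
      refine ⟨a + (c - 2 * (k + 1 : ℕ)), ?_, ?_⟩
      · have : (0 : ℝ) ≤ (k + 1 : ℕ) := by positivity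
        linarith
      · rw [pow_succ' _ (k + 1), Module.End.mul_apply, LieAlgebra.ad_apply, leibniz_lie, hLΛ, hH, h,
          lie_smul, pow_succ' _ k, Module.End.mul_apply, LieAlgebra.ad_apply]
        module
  induction N with
  | zero => simpa using hN
  | succ N ih =>
    obtain ⟨a, ha, h⟩ := hL N
    rw [hN, lie_zero] at h
    exact ih ((smul_eq_zero.mp h.symm).resolve_left ha.ne)

theorem ad_pow_eq_zero {Λ : R} {N : ℕ} (hΛ : Λ ^ N = 0) :
    ∃ m, ∀ u : R, (LieAlgebra.ad ℝ R Λ ^ m) u = 0 := by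
  obtain ⟨m, hm⟩ := LieAlgebra.ad_nilpotent_of_nilpotent (R := ℝ) (a := Λ) ⟨N, hΛ⟩
  exact ⟨m, fun u => by rw [hm]; rfl⟩

/-- An operator `d` of weight one in a representation of `sl₂` on which the lowering operator
is nilpotent and such that `[d, L]` commutes with `L`. -/
structure SlTwoWeightOne (L Λ H d : R) : Prop where
  lie_raise_lower : ⁅L, Λ⁆ = H
  lie_weight_lower : ⁅H, Λ⁆ = (-2 : ℝ) • Λ
  lie_weight_raise : ⁅H, L⁆ = (2 : ℝ) • L
  lie_weight : ⁅H, d⁆ = d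
  lie_raise_sq : ⁅L, ⁅d, L⁆⁆ = 0
  lower_pow_four : ⁅Λ, ⁅Λ, ⁅Λ, ⁅Λ, ⁅d, L⁆⁆⁆⁆⁆ = 0

namespace SlTwoWeightOne

variable {L Λ H d : R} (h : SlTwoWeightOne L Λ H d)

include h

theorem lie_weight_D : ⁅H, ⁅d, L⁆⁆ = (3 : ℝ) • ⁅d, L⁆ := by
  rw [leibniz_lie, h.lie_weight, h.lie_weight_raise, lie_smul]
  module

theorem lie_raise_lower_D : ⁅L, ⁅Λ, ⁅d, L⁆⁆⁆ = (3 : ℝ) • ⁅d, L⁆ := by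
  rw [leibniz_lie, h.lie_raise_lower, h.lie_weight_D, h.lie_raise_sq, lie_zero, add_zero]

theorem lie_raise_lower_d : ⁅L, ⁅Λ, d⁆⁆ = d - ⁅Λ, ⁅d, L⁆⁆ := by
  rw [leibniz_lie, h.lie_raise_lower, h.lie_weight, (lie_skew L d).symm, lie_neg]
  abel

theorem lie_weight_lower_D : ⁅H, ⁅Λ, ⁅d, L⁆⁆⁆ = ⁅Λ, ⁅d, L⁆⁆ := by
  rw [leibniz_lie, h.lie_weight_lower, h.lie_weight_D, lie_smul, smul_lie]
  module

theorem lie_raise_lower_lower_D : ⁅L, ⁅Λ, ⁅Λ, ⁅d, L⁆⁆⁆⁆ = (4 : ℝ) • ⁅Λ, ⁅d, L⁆⁆ := by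
  rw [leibniz_lie, h.lie_raise_lower, h.lie_weight_lower_D, h.lie_raise_lower_D, lie_smul]
  module

/-- A highest weight vector of weight one generates a module of dimension at most two, so `ad(Λ)²`
kills it. The correction of `d` to such a vector is what appears on the right. -/
theorem lower_lower {N : ℕ} (hN : Λ ^ N = 0) :
    ⁅Λ, ⁅Λ, d⁆⁆ = (-(1 / 3) : ℝ) • ⁅Λ, ⁅Λ, ⁅Λ, ⁅d, L⁆⁆⁆⁆ := by
  -- The coefficient makes `[L, d] = -D` cancel against `[L, [Λ, D]] = 3 D`, where `D = [d, L]`.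
  set e := d + (1 / 3 : ℝ) • ⁅Λ, ⁅d, L⁆⁆ with he
  have hLe : ⁅L, e⁆ = 0 := by
    rw [he, lie_add, lie_smul, h.lie_raise_lower_D, (lie_skew L d).symm]; module
  have hHe : ⁅H, e⁆ = e := by
    rw [he, lie_add, lie_smul, h.lie_weight, h.lie_weight_lower_D]
  have hLFe : ⁅L, ⁅Λ, e⁆⁆ = e := by
    rw [leibniz_lie, h.lie_raise_lower, hHe, hLe, lie_zero, add_zero]
  have hHFe : ⁅H, ⁅Λ, e⁆⁆ = -⁅Λ, e⁆ := by
    rw [leibniz_lie, h.lie_weight_lower, hHe, smul_lie]; module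
  -- The vector `[Λ, [Λ, e]]` is again killed by `ad L`, now with weight `-3`, so it vanishes.
  have hLFFe : ⁅L, ⁅Λ, ⁅Λ, e⁆⁆⁆ = 0 := by
    rw [leibniz_lie, h.lie_raise_lower, hHFe, hLFe]; abel
  have hHFFe : ⁅H, ⁅Λ, ⁅Λ, e⁆⁆⁆ = (-3 : ℝ) • ⁅Λ, ⁅Λ, e⁆⁆ := by
    rw [leibniz_lie, h.lie_weight_lower, hHFe, smul_lie, lie_neg]; module
  obtain ⟨m, hm⟩ := ad_pow_eq_zero hN
  have h0 := eq_zero_of_negative_weight (by norm_num) h.lie_raise_lower h.lie_weight_lower hLFFe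
    hHFFe (hm _)
  rw [he, lie_add, lie_add, lie_smul, lie_smul] at h0
  rw [eq_neg_of_add_eq_zero_left h0, neg_smul]

theorem lower_pow_three {N : ℕ} (hN : Λ ^ N = 0) : ⁅Λ, ⁅Λ, ⁅Λ, d⁆⁆⁆ = 0 := by
  rw [h.lower_lower hN, lie_smul, h.lower_pow_four, smul_zero]

/-- Conjugation by the Weyl element `e^L e^{-Λ} e^L`. -/
theorem weyl_mul {N : ℕ} (hL : L ^ N = 0) (hΛ : Λ ^ N = 0) :
    nilExp N L * nilExp N (-Λ) * nilExp N L * d =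
      (-(⁅Λ, d⁆ + (1 / 2 : ℝ) • ⁅Λ, ⁅Λ, ⁅d, L⁆⁆⁆)) *
        (nilExp N L * nilExp N (-Λ) * nilExp N L) := by
  have hΛ' : (-Λ) ^ N = 0 := by rw [neg_pow, hΛ, mul_zero]
  -- This is `e^{-ad Λ} (d - D)` with `D = [d, L]`. The term `(1/2) ad(Λ)² d = -(1/6) ad(Λ)³ D`
  -- cancels the cubic term `(1/6) ad(Λ)³ D`.
  set Y := d - ⁅Λ, d⁆ - ⁅d, L⁆ + ⁅Λ, ⁅d, L⁆⁆ - (1 / 2 : ℝ) • ⁅Λ, ⁅Λ, ⁅d, L⁆⁆⁆ with hY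
  -- `ad L` takes `d` to `-D` and kills `D`, so the exponential stops at the linear term.
  have h1 : nilExp N L * d = (d - ⁅d, L⁆) * nilExp N L := by
    rw [nilExp_mul hL d (m := 2)]
    · simp only [Finset.sum_range_succ, Finset.sum_range_zero, adDiv, Function.iterate_succ,
        Function.iterate_zero, Function.comp_apply, id_eq, ← Ring.lie_def, (lie_skew L d).symm,
        Nat.factorial, Nat.cast_one, inv_one, one_smul, zero_add, ← sub_eq_add_neg, mul_one]
    · simp only [Function.iterate_succ, Function.iterate_zero, Function.comp_apply, id_eq,
        ← Ring.lie_def, (lie_skew L d).symm, lie_neg, h.lie_raise_sq, neg_zero]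
  have h2 : nilExp N (-Λ) * (d - ⁅d, L⁆) = Y * nilExp N (-Λ) := by
    rw [nilExp_mul hΛ' _ (m := 4)]
    · simp only [Finset.sum_range_succ, Finset.sum_range_zero, adDiv, Function.iterate_succ,
        Function.iterate_zero, Function.comp_apply, id_eq, ← Ring.lie_def,
        Nat.factorial, neg_lie, lie_neg, lie_sub, h.lower_lower hΛ, hY, lie_smul, h.lower_pow_four]
      congr 1
      push_cast
      module
    · simp only [Function.iterate_succ, Function.iterate_zero, Function.comp_apply, id_eq,
        ← Ring.lie_def, neg_lie, lie_neg, lie_sub, h.lower_pow_three hΛ, h.lower_pow_four, lie_zero,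
        neg_zero, sub_zero]
  have h3 : nilExp N L * Y =
      (-(⁅Λ, d⁆ + (1 / 2 : ℝ) • ⁅Λ, ⁅Λ, ⁅d, L⁆⁆⁆)) * nilExp N L := by
    have e1 : ⁅L, Y⁆ = (2 : ℝ) • ⁅d, L⁆ - ⁅Λ, ⁅d, L⁆⁆ - d := by
      simp only [hY, lie_add, lie_sub, lie_smul, (lie_skew L d).symm, h.lie_raise_lower_d, h.lie_raise_sq,
        h.lie_raise_lower_D, h.lie_raise_lower_lower_D]
      module
    -- One more bracket with `L` gives zero, so `e^{ad L} Y` is quadratic; all terms without a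
    -- leading `Λ` cancel in it.
    have e2 : ⁅L, ⁅L, Y⁆⁆ = (-2 : ℝ) • ⁅d, L⁆ := by
      rw [e1, lie_sub, lie_sub, lie_smul, h.lie_raise_sq, h.lie_raise_lower_D, (lie_skew L d).symm]
      module
    rw [nilExp_mul hL _ (m := 3)]
    · simp only [Finset.sum_range_succ, Finset.sum_range_zero, adDiv, Function.iterate_succ,
        Function.iterate_zero, Function.comp_apply, id_eq, ← Ring.lie_def, e1, Nat.factorial,
        lie_sub, lie_smul, h.lie_raise_sq, h.lie_raise_lower_D, (lie_skew L d).symm]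
      congr 1
      rw [hY]
      push_cast
      module
    · simp only [Function.iterate_succ, Function.iterate_zero, Function.comp_apply, id_eq,
        ← Ring.lie_def, e2, lie_smul, h.lie_raise_sq, smul_zero]
  rw [mul_assoc _ _ d, h1, ← mul_assoc, mul_assoc _ _ (d - ⁅d, L⁆), h2, ← mul_assoc, h3]
  simp only [mul_assoc]

end SlTwoWeightOne

/-- The vectors `a` and `y` of a two-dimensional representation of `sl₂`. -/
theorem weyl_mul_pair {L Λ a y : R} {N : ℕ} (hL : L ^ N = 0) (hΛ : Λ ^ N = 0) (h1 : ⁅L, a⁆ = 0)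
    (h2 : ⁅Λ, a⁆ = -y) (h3 : ⁅L, y⁆ = -a) (h4 : ⁅Λ, y⁆ = 0) :
    nilExp N L * nilExp N (-Λ) * nilExp N L * a = y * (nilExp N L * nilExp N (-Λ) * nilExp N L) ∧
    nilExp N L * nilExp N (-Λ) * nilExp N L * y =
      -a * (nilExp N L * nilExp N (-Λ) * nilExp N L) := by
  have hΛ' : (-Λ) ^ N = 0 := by rw [neg_pow, hΛ, mul_zero]
  have e1 : nilExp N L * a = a * nilExp N L := by
    rw [nilExp_mul hL _ (m := 1)]
    · simp [adDiv]
    · simpa [← Ring.lie_def] using h1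
  have e2 : nilExp N L * y = (y - a) * nilExp N L := by
    rw [nilExp_mul hL _ (m := 2)]
    · simp only [Finset.sum_range_succ, Finset.sum_range_zero, adDiv, Function.iterate_succ,
        Function.iterate_zero, Function.comp_apply, id_eq, ← Ring.lie_def, h3]
      simp [sub_eq_add_neg]
    · simp [← Ring.lie_def, h3, h1]
  have e3 : nilExp N (-Λ) * a = (a + y) * nilExp N (-Λ) := by
    rw [nilExp_mul hΛ' _ (m := 2)]
    · simp only [Finset.sum_range_succ, Finset.sum_range_zero, adDiv, Function.iterate_succ,
        Function.iterate_zero, Function.comp_apply, id_eq, ← Ring.lie_def, neg_lie, h2]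
      simp
    · simp only [Function.iterate_succ, Function.iterate_zero, Function.comp_apply, id_eq,
        ← Ring.lie_def, neg_lie, h2]
      simp [h4]
  have e4 : nilExp N (-Λ) * y = y * nilExp N (-Λ) := by
    rw [nilExp_mul hΛ' _ (m := 1)]
    · simp [adDiv]
    · simp only [Function.iterate_succ, Function.iterate_zero, Function.comp_apply, id_eq,
        ← Ring.lie_def, neg_lie, h4, neg_zero]
  constructor
  · rw [mul_assoc, e1, ← mul_assoc, mul_assoc _ _ a, e3, ← mul_assoc, mul_add, e1, e2, ← add_mul,
      add_sub_cancel]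
    simp only [mul_assoc]
  · rw [mul_assoc, e2, ← mul_assoc, mul_assoc _ _ (y - a), mul_sub, e3, e4, ← sub_mul, ← mul_assoc,
      mul_sub, mul_add, e1, e2]
    noncomm_ring

end SlTwo

/-! ### Interior products and gradings -/

section Interior

open ExteriorAlgebra

variable {V : Type*} [AddCommGroup V] [Module ℝ V]

theorem interior_ι_mul (v : V) (a : Module.Dual ℝ V) (β : ExtForms V) :
    interior v (ι ℝ a * β) = a v • β - ι ℝ a * interior v β :=
  CliffordAlgebra.contractLeft_ι_mul (Q := (0 : QuadraticForm ℝ (Module.Dual ℝ V))) _ _ _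

theorem interior_ι (v : V) (a : Module.Dual ℝ V) :
    interior v (ι ℝ a) = algebraMap ℝ _ (a v) :=
  CliffordAlgebra.contractLeft_ι (Q := (0 : QuadraticForm ℝ (Module.Dual ℝ V))) _ _

theorem interior_algebraMap (v : V) (r : ℝ) :
    interior v (algebraMap ℝ (ExtForms V) r) = 0 :=
  CliffordAlgebra.contractLeft_algebraMap (Q := (0 : QuadraticForm ℝ (Module.Dual ℝ V))) _ _

theorem interior_one (v : V) : interior v (1 : ExtForms V) = 0 :=
  CliffordAlgebra.contractLeft_one (Q := (0 : QuadraticForm ℝ (Module.Dual ℝ V))) _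

theorem interior_interior (v : V) (β : ExtForms V) : interior v (interior v β) = 0 :=
  CliffordAlgebra.contractLeft_contractLeft _ _

theorem interior_comm (u v : V) (β : ExtForms V) :
    interior u (interior v β) = -interior v (interior u β) :=
  CliffordAlgebra.contractLeft_comm _ _ _

theorem interior_add (u v : V) : interior (u + v) = interior u + interior v := by
  ext1 β; simp [interior]

theorem interior_smul (c : ℝ) (v : V) : interior (c • v) = c • interior v := by
  ext1 β; simp [interior]

variable (V) in
/-- The interior product as a linear map in the vector. -/
def interiorₗ : V →ₗ[ℝ] Module.End ℝ (ExtForms V) where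
  toFun := interior
  map_add' := interior_add
  map_smul' := interior_smul

theorem extForms_induction {P : ExtForms V → Prop} (h0 : ∀ r : ℝ, P (algebraMap ℝ _ r))
    (hadd : ∀ α β, P α → P β → P (α + β))
    (hι : ∀ (a : Module.Dual ℝ V) β, P β → P (ι ℝ a * β)) (α : ExtForms V) : P α :=
  CliffordAlgebra.left_induction (Q := (0 : QuadraticForm ℝ (Module.Dual ℝ V))) h0 hadd
    (fun β a h => hι a β h) α

/-- Linear maps on exterior forms which agree on `1` and have the same commutation rule with left
multiplication by covectors are equal. -/
theorem linearMap_ext_ι_mul {W : Type*} [AddCommGroup W] [Module ℝ W]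
    {S T : ExtForms V →ₗ[ℝ] W} (h1 : S 1 = T 1)
    (h : ∀ (a : Module.Dual ℝ V) β, S β = T β → S (ι ℝ a * β) = T (ι ℝ a * β)) : S = T := by
  refine LinearMap.ext fun α => ?_
  induction α using extForms_induction with
  | h0 r => rw [Algebra.algebraMap_eq_smul_one, map_smul, map_smul, h1]
  | hadd α β hα hβ => rw [map_add, map_add, hα, hβ]
  | hι a β hβ => exact h a β hβ

theorem ι_mul_mem {k : ℕ} (a : Module.Dual ℝ V) {β : ExtForms V}
    (hβ : β ∈ ⋀[ℝ]^k (Module.Dual ℝ V)) : ι ℝ a * β ∈ ⋀[ℝ]^(k + 1) (Module.Dual ℝ V) := by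
  rw [exteriorPower, pow_succ']
  exact Submodule.mul_mem_mul ⟨a, rfl⟩ hβ

theorem exteriorPower_induction {k : ℕ} {P : ExtForms V → Prop}
    (hadd : ∀ α β, P α → P β → P (α + β))
    (hι : ∀ (a : Module.Dual ℝ V), ∀ β ∈ ⋀[ℝ]^k (Module.Dual ℝ V), P (ι ℝ a * β))
    {α : ExtForms V} (hα : α ∈ ⋀[ℝ]^(k + 1) (Module.Dual ℝ V)) : P α := by
  rw [exteriorPower, pow_succ'] at hα
  refine Submodule.mul_induction_on hα ?_ hadd
  rintro _ ⟨a, rfl⟩ β hβ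
  exact hι a β hβ

theorem mem_exteriorPower_zero {β : ExtForms V} :
    β ∈ ⋀[ℝ]^0 (Module.Dual ℝ V) ↔ ∃ r : ℝ, algebraMap ℝ _ r = β := by
  rw [exteriorPower, pow_zero, Submodule.mem_one]

theorem algebraMap_mem (r : ℝ) : algebraMap ℝ (ExtForms V) r ∈ ⋀[ℝ]^0 (Module.Dual ℝ V) :=
  mem_exteriorPower_zero.mpr ⟨r, rfl⟩

theorem one_mem_exteriorPower : (1 : ExtForms V) ∈ ⋀[ℝ]^0 (Module.Dual ℝ V) :=
  mem_exteriorPower_zero.mpr ⟨1, map_one _⟩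

theorem mul_mem_exteriorPower {k l : ℕ} {α β : ExtForms V} (hα : α ∈ ⋀[ℝ]^k (Module.Dual ℝ V))
    (hβ : β ∈ ⋀[ℝ]^l (Module.Dual ℝ V)) : α * β ∈ ⋀[ℝ]^(k + l) (Module.Dual ℝ V) := by
  rw [exteriorPower, pow_add]
  exact Submodule.mul_mem_mul hα hβ

theorem interior_eq_zero_of_mem_zero (v : V) {β : ExtForms V}
    (hβ : β ∈ ⋀[ℝ]^0 (Module.Dual ℝ V)) : interior v β = 0 := by
  obtain ⟨r, rfl⟩ := mem_exteriorPower_zero.mp hβ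
  exact interior_algebraMap v r

theorem interior_mem {k : ℕ} (v : V) {β : ExtForms V}
    (hβ : β ∈ ⋀[ℝ]^(k + 1) (Module.Dual ℝ V)) :
    interior v β ∈ ⋀[ℝ]^k (Module.Dual ℝ V) := by
  induction k generalizing β with
  | zero =>
    refine exteriorPower_induction (P := fun β => interior v β ∈ ⋀[ℝ]^0 (Module.Dual ℝ V))
      (fun α β hα hβ => by rw [map_add]; exact add_mem hα hβ) (fun a β hβ => ?_) hβ
    rw [interior_ι_mul, interior_eq_zero_of_mem_zero v hβ, mul_zero, sub_zero]
    exact Submodule.smul_mem _ _ hβ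
  | succ k ih =>
    refine exteriorPower_induction (P := fun β => interior v β ∈ ⋀[ℝ]^(k + 1) (Module.Dual ℝ V))
      (fun α β hα hβ => by rw [map_add]; exact add_mem hα hβ) (fun a β hβ => ?_) hβ
    rw [interior_ι_mul]
    exact sub_mem (Submodule.smul_mem _ _ hβ) (ι_mul_mem a (ih hβ))

theorem iSup_exteriorPower : ⨆ k : ℕ, ⋀[ℝ]^k (Module.Dual ℝ V) = ⊤ :=
  (DirectSum.Decomposition.isInternal
    (fun i : ℕ => ⋀[ℝ]^i (Module.Dual ℝ V))).submodule_iSup_eq_top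

theorem homogeneous_induction {P : ExtForms V → Prop} (hadd : ∀ α β, P α → P β → P (α + β))
    (h : ∀ (k : ℕ), ∀ β ∈ ⋀[ℝ]^k (Module.Dual ℝ V), P β) (α : ExtForms V) : P α := by
  have hα : α ∈ ⨆ k : ℕ, ⋀[ℝ]^k (Module.Dual ℝ V) := by rw [iSup_exteriorPower]; trivial
  exact Submodule.iSup_induction _ (motive := P) hα h (h 0 _ (zero_mem _)) hadd

theorem linearMap_ext_homogeneous {W : Type*} [AddCommGroup W] [Module ℝ W]
    {S T : ExtForms V →ₗ[ℝ] W}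
    (h : ∀ (k : ℕ), ∀ β ∈ ⋀[ℝ]^k (Module.Dual ℝ V), S β = T β) : S = T := by
  refine LinearMap.ext fun α => ?_
  exact homogeneous_induction (P := fun α => S α = T α)
    (fun α β hα hβ => by rw [map_add, map_add, hα, hβ]) h α

theorem exteriorPower_eq_bot [FiniteDimensional ℝ V] {k : ℕ} (hk : Module.finrank ℝ V < k) :
    ⋀[ℝ]^k (Module.Dual ℝ V) = ⊥ := by
  rw [← Submodule.finrank_eq_zero, exteriorPower.finrank_eq, Subspace.dual_finrank_eq,
    Nat.choose_eq_zero_of_lt hk]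

/-- The operator acting on forms of degree `k` by the scalar `c k`. -/
def gradedScale (c : ℕ → ℝ) : Module.End ℝ (ExtForms V) :=
  (DirectSum.toModule ℝ ℕ (ExtForms V) fun k => c k • (⋀[ℝ]^k (Module.Dual ℝ V)).subtype) ∘ₗ
    (DirectSum.decomposeLinearEquiv fun i : ℕ => ⋀[ℝ]^i (Module.Dual ℝ V)).toLinearMap

theorem gradedScale_of_mem (c : ℕ → ℝ) {k : ℕ} {β : ExtForms V}
    (hβ : β ∈ ⋀[ℝ]^k (Module.Dual ℝ V)) : gradedScale c β = c k • β := by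
  lift β to ⋀[ℝ]^k (Module.Dual ℝ V) using hβ
  simp [gradedScale]

theorem gradedScale_ι_mul (c : ℕ → ℝ) (a : Module.Dual ℝ V) (β : ExtForms V) :
    gradedScale c (ι ℝ a * β) = ι ℝ a * gradedScale (fun k => c (k + 1)) β := by
  refine homogeneous_induction (P := fun β => gradedScale c (ι ℝ a * β) =
    ι ℝ a * gradedScale (fun k => c (k + 1)) β) (fun α β hα hβ => ?_) (fun k β hβ => ?_) β
  · rw [mul_add, map_add, map_add, mul_add, hα, hβ]
  · rw [gradedScale_of_mem _ hβ, gradedScale_of_mem _ (ι_mul_mem a hβ), mul_smul_comm]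

theorem gradedScale_mul_gradedScale (b c : ℕ → ℝ) :
    gradedScale (V := V) b * gradedScale c = gradedScale (b * c) := by
  refine linearMap_ext_homogeneous fun k β hβ => ?_
  rw [Module.End.mul_apply, gradedScale_of_mem _ hβ, map_smul, gradedScale_of_mem _ hβ,
    gradedScale_of_mem _ hβ, smul_smul, mul_comm, Pi.mul_apply]

theorem gradedScale_add (b c : ℕ → ℝ) :
    gradedScale (V := V) (b + c) = gradedScale b + gradedScale c := by
  refine linearMap_ext_homogeneous fun k β hβ => ?_
  rw [LinearMap.add_apply, gradedScale_of_mem _ hβ, gradedScale_of_mem _ hβ,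
    gradedScale_of_mem _ hβ, Pi.add_apply, add_smul]

theorem gradedScale_one (β : ExtForms V) : gradedScale (fun _ => (1 : ℝ)) β = β :=
  homogeneous_induction (P := fun β => gradedScale (fun _ => (1 : ℝ)) β = β)
    (fun α γ hα hγ => by rw [map_add, hα, hγ])
    (fun k γ hγ => by rw [gradedScale_of_mem _ hγ, one_smul]) β

theorem gradedScale_interior (c : ℕ → ℝ) (v : V) (β : ExtForms V) :
    gradedScale (fun k => c (k + 1)) (interior v β) = interior v (gradedScale c β) := by
  refine homogeneous_induction (P := fun β => gradedScale (fun k => c (k + 1)) (interior v β) =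
    interior v (gradedScale c β)) (fun α β hα hβ => ?_) (fun k β hβ => ?_) β
  · simp only [map_add, hα, hβ]
  · rcases k with _ | k
    · rw [gradedScale_of_mem _ hβ, map_smul, interior_eq_zero_of_mem_zero v hβ]; simp
    · rw [gradedScale_of_mem _ hβ, gradedScale_of_mem _ (interior_mem v hβ), map_smul]

theorem degPart_eq_gradedScale (k : ℕ) (β : ExtForms V) :
    degPart k β = gradedScale (Pi.single k 1) β := by
  refine homogeneous_induction (P := fun β => degPart k β = gradedScale (Pi.single k 1) β)
    (fun α β hα hβ => ?_) (fun l β hβ => ?_) β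
  · rw [map_add, ← hα, ← hβ]; exact map_add _ α β
  · rw [gradedScale_of_mem _ hβ, degPart, GradedAlgebra.proj_apply]
    by_cases h : l = k
    · subst h; rw [DirectSum.decompose_of_mem_same (fun i : ℕ => ⋀[ℝ]^i (Module.Dual ℝ V)) hβ]; simp
    · rw [DirectSum.decompose_of_mem_ne (fun i : ℕ => ⋀[ℝ]^i (Module.Dual ℝ V)) hβ h]; simp [h]

theorem degPart_mem (k : ℕ) (β : ExtForms V) : degPart k β ∈ ⋀[ℝ]^k (Module.Dual ℝ V) := by
  rw [degPart, GradedAlgebra.proj_apply]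
  exact SetLike.coe_mem _

variable (V) in
/-- The grading involution `(-1)^k`. -/
def gradingInvolution : Module.End ℝ (ExtForms V) := gradedScale fun k => (-1) ^ k

theorem gradingInvolution_of_mem {k : ℕ} {β : ExtForms V}
    (hβ : β ∈ ⋀[ℝ]^k (Module.Dual ℝ V)) : gradingInvolution V β = (-1 : ℝ) ^ k • β :=
  gradedScale_of_mem _ hβ

theorem gradingInvolution_ι_mul (a : Module.Dual ℝ V) (β : ExtForms V) :
    gradingInvolution V (ι ℝ a * β) = -(ι ℝ a * gradingInvolution V β) := by
  rw [gradingInvolution, gradedScale_ι_mul, ← mul_neg, ← LinearMap.neg_apply]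
  congr 2
  refine linearMap_ext_homogeneous fun k β hβ => ?_
  rw [LinearMap.neg_apply, gradedScale_of_mem _ hβ, gradedScale_of_mem _ hβ, pow_succ]
  module

/-- Anticommuting a covector past a `k`-form costs `(-1)^k`; in this form it holds for mixed
degrees. -/
theorem mul_ι (β : ExtForms V) (a : Module.Dual ℝ V) :
    β * ι ℝ a = ι ℝ a * gradingInvolution V β := by
  induction β using extForms_induction with
  | h0 r =>
    rw [gradingInvolution_of_mem (algebraMap_mem r), pow_zero, one_smul, Algebra.commutes]
  | hadd α γ hα hγ => rw [add_mul, hα, hγ, map_add, mul_add]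
  | hι b β hβ =>
    rw [mul_assoc, hβ, gradingInvolution_ι_mul, ← mul_assoc, mul_neg, ← mul_assoc, ← neg_mul,
      eq_neg_of_add_eq_zero_left (ExteriorAlgebra.ι_add_mul_swap b a)]

/-- The interior product is an antiderivation. -/
theorem interior_mul (v : V) (α β : ExtForms V) :
    interior v (α * β) = interior v α * β + gradingInvolution V α * interior v β := by
  induction α using extForms_induction with
  | h0 r =>
    rw [gradingInvolution_of_mem (algebraMap_mem r), pow_zero, one_smul, interior_algebraMap,
      ← Algebra.smul_def, map_smul, ← Algebra.smul_def, zero_mul, zero_add]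
  | hadd α γ hα hγ => simp only [add_mul, map_add, hα, hγ]; abel
  | hι a α hα =>
    rw [mul_assoc, interior_ι_mul, hα, interior_ι_mul, gradingInvolution_ι_mul, sub_mul, mul_add,
      neg_mul, smul_mul_assoc, mul_assoc, mul_assoc]
    abel

theorem mul_comm_of_mem {k l : ℕ} {α β : ExtForms V} (hα : α ∈ ⋀[ℝ]^k (Module.Dual ℝ V))
    (hβ : β ∈ ⋀[ℝ]^l (Module.Dual ℝ V)) : α * β = ((-1 : ℝ) ^ (k * l)) • (β * α) := by
  induction k generalizing α with
  | zero =>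
    obtain ⟨r, rfl⟩ := mem_exteriorPower_zero.mp hα
    rw [zero_mul, pow_zero, one_smul, Algebra.commutes]
  | succ k ih =>
    refine exteriorPower_induction (P := fun α => α * β = ((-1 : ℝ) ^ ((k + 1) * l)) • (β * α))
      (fun α γ hα hγ => by rw [add_mul, mul_add, hα, hγ, smul_add]) (fun a α hα => ?_) hα
    have h : (-1 : ℝ) ^ ((k + 1) * l) * (-1) ^ l = (-1) ^ (k * l) := by
      rw [add_mul, one_mul, pow_add, mul_assoc, ← mul_pow]; simp
    rw [mul_assoc, ih hα, mul_smul_comm, ← mul_assoc, ← mul_assoc, mul_ι,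
      gradingInvolution_of_mem hβ, mul_smul_comm, smul_mul_assoc, smul_smul, h]

end Interior

/-! ### Two-forms as bilinear forms -/

section TwoForms

open ExteriorAlgebra

variable {V : Type*} [AddCommGroup V] [Module ℝ V]

theorem interior_eq_ι {η : ExtForms V} (hη : η ∈ ⋀[ℝ]^2 (Module.Dual ℝ V)) (u : V) :
    interior u η = ι ℝ (toBilin η u) := by
  have h1 := interior_mem u hη
  rw [exteriorPower, pow_one] at h1
  obtain ⟨c, hc⟩ := h1
  rw [← hc]
  congr 1
  ext v
  change c v = algebraMapInv (interior v (interior u η))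
  rw [← hc, interior_ι, algebraMap_leftInverse]

theorem toBilin_add (η ζ : ExtForms V) : toBilin (η + ζ) = toBilin η + toBilin ζ := by
  ext u v
  change algebraMapInv (interior v (interior u (η + ζ))) =
    algebraMapInv (interior v (interior u η)) + algebraMapInv (interior v (interior u ζ))
  simp only [map_add]

theorem toBilin_ι_mul_ι (a b : Module.Dual ℝ V) (u v : V) :
    toBilin (ι ℝ a * ι ℝ b) u v = a u * b v - b u * a v := by
  change algebraMapInv (interior v (interior u (ι ℝ a * ι ℝ b))) = _
  rw [interior_ι_mul, interior_ι, map_sub, map_smul, interior_ι, interior_ι_mul,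
    interior_algebraMap, mul_zero, sub_zero, map_sub, map_smul, map_smul]
  simp [algebraMapInv, mul_comm]

theorem two_form_induction {P : ExtForms V → Prop} (hadd : ∀ α β, P α → P β → P (α + β))
    (h : ∀ a b : Module.Dual ℝ V, P (ι ℝ a * ι ℝ b)) {η : ExtForms V}
    (hη : η ∈ ⋀[ℝ]^2 (Module.Dual ℝ V)) : P η := by
  refine exteriorPower_induction hadd (fun a β hβ => ?_) hη
  rw [exteriorPower, pow_one] at hβ
  obtain ⟨b, rfl⟩ := hβ
  exact h a b

theorem toBilin_swap (η : ExtForms V) (u v : V) : toBilin η u v = -toBilin η v u := by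
  change algebraMapInv (interior v (interior u η)) = -algebraMapInv (interior u (interior v η))
  rw [interior_comm, map_neg]

/-- The degree is detected by the eigenvalue of the degree operator: `degree - m` is invertible away
from degree `m`. -/
theorem mem_exteriorPower_of_gradedScale {m : ℕ} {β : ExtForms V}
    (h : gradedScale (fun k => (k : ℝ)) β = (m : ℝ) • β) :
    β ∈ ⋀[ℝ]^m (Module.Dual ℝ V) := by
  -- At `k = m` the convention `0⁻¹ = 0` makes `c · (degree - m)` equal to one minus the projection
  -- to degree `m`.
  set c : ℕ → ℝ := fun k => ((k : ℝ) - m)⁻¹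
  have h1 : gradedScale (V := V) c * gradedScale (fun k => (k : ℝ)) - (m : ℝ) • gradedScale c =
      1 - gradedScale (Pi.single m 1) := by
    refine linearMap_ext_homogeneous fun k γ hγ => ?_
    simp only [LinearMap.sub_apply, Module.End.mul_apply, LinearMap.smul_apply,
      gradedScale_of_mem _ hγ, map_smul, Module.End.one_apply, smul_smul]
    by_cases hk : k = m
    · subst hk; simp
    · have : (k : ℝ) - m ≠ 0 := by rw [sub_ne_zero]; exact_mod_cast hk
      rw [Pi.single_eq_of_ne hk, zero_smul, sub_zero, ← sub_smul, ← sub_mul, mul_inv_cancel₀ this,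
        one_smul]
  have h2 := LinearMap.congr_fun h1 β
  rw [LinearMap.sub_apply, Module.End.mul_apply, h, map_smul, LinearMap.smul_apply, sub_self,
    LinearMap.sub_apply, ← degPart_eq_gradedScale, Module.End.one_apply, eq_comm, sub_eq_zero] at h2
  rw [h2]
  exact degPart_mem m β

end TwoForms

/-! ### Derivations of the exterior algebra induced by endomorphisms -/

section Derivation

open ExteriorAlgebra

variable {V : Type*} [AddCommGroup V] [Module ℝ V] [FiniteDimensional ℝ V]

/-- The derivation of the algebra of exterior forms which extends `a ↦ a ∘ f` on covectors. -/
def dualDerivation (f : Module.End ℝ V) : Module.End ℝ (ExtForms V) :=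
  ∑ i, LinearMap.mulLeft ℝ (ι ℝ ((Module.finBasis ℝ V).coord i ∘ₗ f)) *
    interior (Module.finBasis ℝ V i)

theorem dualDerivation_apply (f : Module.End ℝ V) (β : ExtForms V) : dualDerivation f β =
    ∑ i, ι ℝ ((Module.finBasis ℝ V).coord i ∘ₗ f) * interior (Module.finBasis ℝ V i) β := by
  simp [dualDerivation, LinearMap.sum_apply]

theorem dualDerivation_one (f : Module.End ℝ V) : dualDerivation f 1 = 0 := by
  simp [dualDerivation_apply, interior_one]

theorem dualDerivation_ι_mul (f : Module.End ℝ V) (a : Module.Dual ℝ V) (β : ExtForms V) :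
    dualDerivation f (ι ℝ a * β) = ι ℝ (a ∘ₗ f) * β + ι ℝ a * dualDerivation f β := by
  have h : a ∘ₗ f = ∑ i, a (Module.finBasis ℝ V i) • ((Module.finBasis ℝ V).coord i ∘ₗ f) := by
    ext v
    conv_lhs => rw [LinearMap.comp_apply, ← (Module.finBasis ℝ V).sum_repr (f v), map_sum]
    simp [LinearMap.sum_apply, -Module.Basis.sum_repr, mul_comm]
  rw [dualDerivation_apply, dualDerivation_apply, h, map_sum, Finset.sum_mul, Finset.mul_sum,
    ← Finset.sum_add_distrib]
  refine Finset.sum_congr rfl fun i _ => ?_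
  rw [interior_ι_mul, mul_sub, map_smul, smul_mul_assoc, mul_smul_comm, ← mul_assoc, ← mul_assoc,
    eq_neg_of_add_eq_zero_left (ExteriorAlgebra.ι_add_mul_swap _ a), neg_mul, sub_neg_eq_add]

theorem dualDerivation_ι (f : Module.End ℝ V) (a : Module.Dual ℝ V) :
    dualDerivation f (ι ℝ a) = ι ℝ (a ∘ₗ f) := by
  simpa [dualDerivation_one] using dualDerivation_ι_mul f a 1

theorem dualDerivation_mul (f : Module.End ℝ V) (α β : ExtForms V) :
    dualDerivation f (α * β) = dualDerivation f α * β + α * dualDerivation f β := by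
  induction α using extForms_induction with
  | h0 r =>
    rw [Algebra.algebraMap_eq_smul_one]
    simp [dualDerivation_one]
  | hadd α γ hα hγ => simp only [add_mul, map_add, hα, hγ]; abel
  | hι a α hα =>
    simp only [mul_assoc, dualDerivation_ι_mul, hα, add_mul, mul_add]; abel

theorem dualDerivation_mem (f : Module.End ℝ V) {k : ℕ} {β : ExtForms V}
    (hβ : β ∈ ⋀[ℝ]^k (Module.Dual ℝ V)) :
    dualDerivation f β ∈ ⋀[ℝ]^k (Module.Dual ℝ V) := by
  rw [dualDerivation_apply]
  refine sum_mem fun i _ => ?_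
  rcases k with _ | k
  · rw [interior_eq_zero_of_mem_zero _ hβ, mul_zero]; exact zero_mem _
  · exact ι_mul_mem _ (interior_mem _ hβ)

/-- Euler's formula: `∑ eⁱ ∧ ι_{eᵢ}` counts the degree. -/
theorem dualDerivation_id : dualDerivation (LinearMap.id : Module.End ℝ V) =
    gradedScale fun k => (k : ℝ) := by
  refine linearMap_ext_ι_mul ?_ fun a β h => ?_
  · rw [dualDerivation_one, gradedScale_of_mem _ one_mem_exteriorPower]; simp
  · have e : (fun k : ℕ => ((k + 1 : ℕ) : ℝ)) = (fun k : ℕ => (k : ℝ)) + fun _ => 1 := by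
      ext k; simp
    rw [dualDerivation_ι_mul, h, gradedScale_ι_mul, e, gradedScale_add, LinearMap.add_apply, gradedScale_one,
      LinearMap.comp_id, mul_add, add_comm]

/-- By Euler's formula `(k + 1) β` is a sum of products with the contractions of `β`; positivity of
the degree is essential. -/
theorem eq_zero_of_interior_eq_zero {k : ℕ} {β : ExtForms V}
    (hβ : β ∈ ⋀[ℝ]^(k + 1) (Module.Dual ℝ V)) (h : ∀ v, interior v β = 0) : β = 0 := by
  have h1 : dualDerivation (LinearMap.id : Module.End ℝ V) β = 0 := by
    simp [dualDerivation_apply, h]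
  rw [dualDerivation_id, gradedScale_of_mem _ hβ] at h1
  exact (smul_eq_zero.mp h1).resolve_left (by positivity)

theorem eq_zero_of_toBilin_eq_zero {η : ExtForms V} (hη : η ∈ ⋀[ℝ]^2 (Module.Dual ℝ V))
    (h : ∀ u v, toBilin η u v = 0) : η = 0 := by
  refine eq_zero_of_interior_eq_zero hη fun u => ?_
  have : toBilin η u = 0 := LinearMap.ext (h u)
  rw [interior_eq_ι hη, this, map_zero]

/-- The derivation acts on vectors contragrediently to its action on covectors, whence the minus
sign. -/
theorem dualDerivation_mul_interior (f : Module.End ℝ V) (v : V) (β : ExtForms V) :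
    dualDerivation f (interior v β) - interior v (dualDerivation f β) = -interior (f v) β := by
  induction β using extForms_induction with
  | h0 r =>
    rw [interior_algebraMap, interior_algebraMap, Algebra.algebraMap_eq_smul_one, map_smul,
      dualDerivation_one]
    simp
  | hadd α β hα hβ => simp only [map_add, neg_add, ← hα, ← hβ]; abel
  | hι a β hβ =>
    simp only [interior_ι_mul, dualDerivation_ι_mul, map_add, map_sub, map_smul, LinearMap.comp_apply]
    rw [sub_eq_iff_eq_add.mp hβ, mul_add, mul_neg]
    abel

end Derivation

/-! ### Adjoints of multiplications and the pairing of forms -/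

section AdjMul

open ExteriorAlgebra

variable {V : Type*} [AddCommGroup V] [Module ℝ V]

/-- The algebra antihomomorphism which sends a covector `a` to the interior product with `s a`. -/
def contractionHom (s : Module.Dual ℝ V →ₗ[ℝ] V) :
    ExtForms V →ₐ[ℝ] (Module.End ℝ (ExtForms V))ᵐᵒᵖ :=
  ExteriorAlgebra.lift ℝ ⟨(MulOpposite.opLinearEquiv ℝ).toLinearMap ∘ₗ interiorₗ V ∘ₗ s, fun a =>
    MulOpposite.unop_injective (LinearMap.ext fun β => interior_interior (s a) β)⟩

/-- The adjoint of the left multiplication by an exterior form with respect to the pairing defined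
by `s : V^* → V`. -/
def adjMul (s : Module.Dual ℝ V →ₗ[ℝ] V) : ExtForms V →ₗ[ℝ] Module.End ℝ (ExtForms V) :=
  (MulOpposite.opLinearEquiv ℝ).symm.toLinearMap ∘ₗ (contractionHom s).toLinearMap

variable (s : Module.Dual ℝ V →ₗ[ℝ] V)

theorem adjMul_ι (a : Module.Dual ℝ V) : adjMul s (ι ℝ a) = interior (s a) := by
  simp only [adjMul, contractionHom, LinearMap.comp_apply, AlgHom.toLinearMap_apply]
  erw [ExteriorAlgebra.lift_ι_apply]
  rfl

theorem adjMul_mul (α β : ExtForms V) : adjMul s (α * β) = adjMul s β * adjMul s α := by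
  simp [adjMul]

theorem adjMul_one : adjMul s (1 : ExtForms V) = 1 := by
  simp [adjMul]

theorem adjMul_pow (α : ExtForms V) (k : ℕ) : adjMul s (α ^ k) = adjMul s α ^ k := by
  simp [adjMul]

theorem adjMul_algebraMap (r : ℝ) : adjMul s (algebraMap ℝ (ExtForms V) r) = r • 1 := by
  rw [Algebra.algebraMap_eq_smul_one, map_smul, adjMul_one]

theorem adjMul_ι_mul (a : Module.Dual ℝ V) (β : ExtForms V) :
    adjMul s (ι ℝ a * β) = adjMul s β * interior (s a) := by
  rw [adjMul_mul, adjMul_ι]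

theorem adjMul_mem {k l : ℕ} {α β : ExtForms V} (hα : α ∈ ⋀[ℝ]^k (Module.Dual ℝ V))
    (hβ : β ∈ ⋀[ℝ]^(k + l) (Module.Dual ℝ V)) : adjMul s α β ∈ ⋀[ℝ]^l (Module.Dual ℝ V) := by
  induction k generalizing α β with
  | zero =>
    obtain ⟨r, rfl⟩ := mem_exteriorPower_zero.mp hα
    rw [adjMul_algebraMap, zero_add] at *
    exact Submodule.smul_mem _ _ hβ
  | succ k ih =>
    refine exteriorPower_induction (P := fun α => adjMul s α β ∈ ⋀[ℝ]^l (Module.Dual ℝ V))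
      (fun α γ hα hγ => by rw [map_add]; exact add_mem hα hγ) (fun a α hα => ?_) hα
    rw [adjMul_ι_mul]
    exact ih hα (interior_mem _ (by rwa [add_right_comm] at hβ))

theorem adjMul_eq_zero {k l : ℕ} {α β : ExtForms V} (hα : α ∈ ⋀[ℝ]^k (Module.Dual ℝ V))
    (hβ : β ∈ ⋀[ℝ]^l (Module.Dual ℝ V)) (h : l < k) : adjMul s α β = 0 := by
  induction k generalizing α β l with
  | zero => omega
  | succ k ih =>
    refine exteriorPower_induction (P := fun α => adjMul s α β = 0)
      (fun α γ hα hγ => by rw [map_add, LinearMap.add_apply, hα, hγ, add_zero])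
      (fun a α hα => ?_) hα
    rw [adjMul_ι_mul, Module.End.mul_apply]
    rcases l with _ | l
    · rw [interior_eq_zero_of_mem_zero _ hβ, map_zero]
    · exact ih hα (interior_mem _ hβ) (by omega)

theorem algebraMapInv_eq_zero {k : ℕ} (hk : k ≠ 0) {β : ExtForms V}
    (hβ : β ∈ ⋀[ℝ]^k (Module.Dual ℝ V)) : algebraMapInv β = 0 := by
  obtain ⟨k, rfl⟩ := Nat.exists_eq_succ_of_ne_zero hk
  refine exteriorPower_induction (P := fun β => algebraMapInv β = 0)
    (fun α β hα hβ => by rw [map_add, hα, hβ, add_zero]) (fun a β _ => ?_) hβ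
  simp [algebraMapInv]

theorem algebraMapInv_algebraMap (r : ℝ) :
    algebraMapInv (algebraMap ℝ (ExtForms V) r) = r :=
  algebraMap_leftInverse _ r

theorem interior_ιMulti (k : ℕ) (v : V) (b : Fin (k + 1) → Module.Dual ℝ V) :
    interior v (ExteriorAlgebra.ιMulti ℝ (k + 1) b) = ∑ i : Fin (k + 1),
      ((-1 : ℝ) ^ (i : ℕ) * b i v) • ExteriorAlgebra.ιMulti ℝ k (fun j => b (i.succAbove j)) := by
  induction k with
  | zero =>
    rw [ExteriorAlgebra.ιMulti_succ_apply, interior_ι_mul]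
    simp [ExteriorAlgebra.ιMulti_zero_apply, interior_one]
  | succ k ih =>
    rw [ExteriorAlgebra.ιMulti_succ_apply, interior_ι_mul, ih]
    conv_rhs => rw [Fin.sum_univ_succ]
    rw [sub_eq_add_neg]
    congr 1
    · simp only [Fin.val_zero, pow_zero, one_mul]; rfl
    · rw [Finset.mul_sum, ← Finset.sum_neg_distrib]
      refine Finset.sum_congr rfl fun i _ => ?_
      rw [ExteriorAlgebra.ιMulti_succ_apply (v := fun j => b (i.succ.succAbove j)), mul_smul_comm,
        ← neg_smul, Fin.val_succ, pow_succ]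
      congr 1
      · simp [Matrix.vecTail]
      · rw [Fin.succ_succAbove_zero]
        congr 2
        ext1 j
        simp [Matrix.vecTail]

/-- The contraction with the first covector comes first and produces the Laplace expansion of the
determinant along its first row. -/
theorem algebraMapInv_adjMul_ιMulti (k : ℕ) (a b : Fin k → Module.Dual ℝ V) :
    algebraMapInv (adjMul s (ExteriorAlgebra.ιMulti ℝ k a) (ExteriorAlgebra.ιMulti ℝ k b)) =
      Matrix.det (n := Fin k) (.of fun i j => b j (s (a i))) := by
  induction k with
  | zero => simp [ExteriorAlgebra.ιMulti_zero_apply, adjMul_one]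
  | succ k ih =>
    rw [ExteriorAlgebra.ιMulti_succ_apply, adjMul_ι_mul, Module.End.mul_apply, interior_ιMulti,
      map_sum, map_sum, Matrix.det_succ_row_zero]
    refine Finset.sum_congr rfl fun i _ => ?_
    rw [map_smul, map_smul, ih, smul_eq_mul]
    rfl

theorem pairingDual_eq (k : ℕ) (β α : ⋀[ℝ]^k (Module.Dual ℝ V)) :
    exteriorPower.pairingDual ℝ V k β (exteriorPower.map k s α) =
      algebraMapInv (adjMul s (α : ExtForms V) (β : ExtForms V)) := by
  have hα : α ∈ Submodule.span ℝ (Set.range (exteriorPower.ιMulti ℝ k)) := by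
    rw [exteriorPower.ιMulti_span]; trivial
  have hβ : β ∈ Submodule.span ℝ (Set.range (exteriorPower.ιMulti ℝ k)) := by
    rw [exteriorPower.ιMulti_span]; trivial
  induction hα using Submodule.span_induction with
  | zero => simp
  | add x y _ _ hx hy => simp only [map_add, Submodule.coe_add, LinearMap.add_apply, hx, hy]
  | smul c x _ hx => simp only [map_smul, Submodule.coe_smul, LinearMap.smul_apply, hx]
  | mem x hx =>
    obtain ⟨a, rfl⟩ := hx
    induction hβ using Submodule.span_induction with
    | zero => simp
    | add x y _ _ hx hy => simp only [map_add, Submodule.coe_add, LinearMap.add_apply, hx, hy]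
    | smul c x _ hx => simp only [map_smul, Submodule.coe_smul, LinearMap.smul_apply, hx]
    | mem x hx =>
      obtain ⟨b, rfl⟩ := hx
      rw [exteriorPower.map_apply_ιMulti, exteriorPower.pairingDual_ιMulti_ιMulti,
        exteriorPower.ιMulti_apply_coe, exteriorPower.ιMulti_apply_coe,
        algebraMapInv_adjMul_ιMulti]
      rfl

variable [FiniteDimensional ℝ V]

/-- `⟨α, β⟩` is the scalar part of the contraction of `β` with `α`. -/
theorem formPairing_eq (B : LinearMap.BilinForm ℝ V) (hB : B.Nondegenerate) (α β : ExtForms V) :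
    formPairing B hB α β = algebraMapInv (adjMul (sharp B hB) α β) := by
  refine homogeneous_induction (P := fun α => formPairing B hB α β =
    algebraMapInv (adjMul (sharp B hB) α β)) (fun α γ hα hγ => ?_) (fun k α hα => ?_) α
  · rw [map_add, LinearMap.add_apply, map_add, ← hα, ← hγ, formPairing, formPairing, formPairing,
      ← Finset.sum_add_distrib]
    simp only [DirectSum.decompose_add, DirectSum.add_apply, map_add]
  refine homogeneous_induction (P := fun β => formPairing B hB α β =
    algebraMapInv (adjMul (sharp B hB) α β)) (fun β γ hβ hγ => ?_) (fun l β hβ => ?_) β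
  · rw [map_add, map_add, ← hβ, ← hγ, formPairing, formPairing, formPairing,
      ← Finset.sum_add_distrib]
    simp only [DirectSum.decompose_add, DirectSum.add_apply, map_add, LinearMap.add_apply]
  lift α to ⋀[ℝ]^k (Module.Dual ℝ V) using hα
  lift β to ⋀[ℝ]^l (Module.Dual ℝ V) using hβ
  rw [formPairing]
  simp only [DirectSum.decompose_coe]
  by_cases hkl : k = l
  · subst hkl
    rw [Finset.sum_eq_single k]
    · rw [DirectSum.of_eq_same, DirectSum.of_eq_same, pairingDual_eq]
    · intro j _ hj
      rw [DirectSum.of_eq_of_ne _ _ _ (by exact hj)]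
      simp
    -- Degrees above the dimension are missing from the sum, but there are no nonzero forms of such
    -- degrees.
    · intro hk
      have hk' : Module.finrank ℝ V < k := by simpa using hk
      have h0 : α = 0 := by
        exact Subtype.ext ((Submodule.mem_bot ℝ).mp ((exteriorPower_eq_bot hk').le α.2))
      rw [h0]
      simp
  · rw [Finset.sum_eq_zero]
    · rcases lt_or_gt_of_ne hkl with h | h
      · obtain ⟨m, rfl⟩ := Nat.exists_eq_add_of_lt h
        rw [algebraMapInv_eq_zero (k := m + 1) (by omega)]
        exact adjMul_mem _ α.2 β.2
      · rw [adjMul_eq_zero _ α.2 β.2 h, map_zero]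
    · intro j _
      by_cases hj : j = k
      · subst hj
        rw [DirectSum.of_eq_of_ne (β := fun i : ℕ => ⋀[ℝ]^i (Module.Dual ℝ V)) l j β (by exact hkl)]
        simp
      · rw [DirectSum.of_eq_of_ne (β := fun i : ℕ => ⋀[ℝ]^i (Module.Dual ℝ V)) k j α (by exact hj)]
        simp

/-- Nondegeneracy of the pairing. For a homogeneous form the hypothesis passes to all its
contractions, so it vanishes by induction on the degree; in degree zero one pairs with `1`. -/
theorem eq_zero_of_adjMul {s : Module.Dual ℝ V →ₗ[ℝ] V} (hs : Function.Surjective s)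
    {β : ExtForms V} (h : ∀ α, algebraMapInv (adjMul s α β) = 0) : β = 0 := by
  have hom : ∀ k : ℕ, ∀ β ∈ ⋀[ℝ]^k (Module.Dual ℝ V),
      (∀ α, algebraMapInv (adjMul s α β) = 0) → β = 0 := by
    intro k
    induction k with
    | zero =>
      intro β hβ h
      obtain ⟨r, rfl⟩ := mem_exteriorPower_zero.mp hβ
      have := h 1
      rw [adjMul_one, Module.End.one_apply, algebraMapInv_algebraMap] at this
      rw [this, map_zero]
    | succ k ih =>
      intro β hβ h
      refine eq_zero_of_interior_eq_zero hβ fun v => ?_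
      obtain ⟨a, rfl⟩ := hs v
      refine ih _ (interior_mem _ hβ) fun α => ?_
      rw [← Module.End.mul_apply, ← adjMul_ι_mul]
      exact h _
  have hzero : ∀ k, degPart k β = 0 := by
    intro k
    refine hom k _ (degPart_mem k β) fun α => ?_
    -- Degree projections are self-adjoint, since forms of different degrees pair to zero. This
    -- reduces mixed forms to homogeneous ones.
    have key : ∀ α γ : ExtForms V, algebraMapInv (adjMul s α (degPart k γ)) =
        algebraMapInv (adjMul s (degPart k α) γ) := by
      intro α γ
      simp only [degPart_eq_gradedScale]
      refine homogeneous_induction (P := fun γ => algebraMapInv (adjMul s α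
        (gradedScale (Pi.single k 1) γ)) = algebraMapInv (adjMul s (gradedScale (Pi.single k 1) α) γ))
        (fun γ δ hγ hδ => by simp only [map_add, hγ, hδ]) (fun l γ hγ => ?_) γ
      refine homogeneous_induction (P := fun α => algebraMapInv (adjMul s α
        (gradedScale (Pi.single k 1) γ)) = algebraMapInv (adjMul s (gradedScale (Pi.single k 1) α) γ))
        (fun α δ hα hδ => by simp only [map_add, LinearMap.add_apply, hα, hδ]) (fun j α hα => ?_) α
      rw [gradedScale_of_mem _ hγ, gradedScale_of_mem _ hα]
      by_cases hjl : j = l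
      · subst hjl; simp
      · have : algebraMapInv (adjMul s α γ) = 0 := by
          rcases lt_or_gt_of_ne hjl with h | h
          · obtain ⟨m, rfl⟩ := Nat.exists_eq_add_of_lt h
            exact algebraMapInv_eq_zero (k := m + 1) (by omega) (adjMul_mem _ hα hγ)
          · rw [adjMul_eq_zero _ hα hγ h, map_zero]
        simp [this]
    rw [key]
    exact h _
  have hβ : ∀ k, (DirectSum.decompose (fun i : ℕ => ⋀[ℝ]^i (Module.Dual ℝ V)) β k : ExtForms V)
      = 0 := fun k => by
    have := hzero k
    rwa [degPart, GradedAlgebra.proj_apply] at this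
  have h0 : DirectSum.decompose (fun i : ℕ => ⋀[ℝ]^i (Module.Dual ℝ V)) β = 0 := by
    ext k
    rw [hβ k]; rfl
  exact (DirectSum.decompose _).injective (h0.trans (DirectSum.decompose_zero _).symm)

end AdjMul

/-! ### The Lefschetz `sl₂`-triple on exterior forms -/

section Lefschetz

open ExteriorAlgebra

variable {V : Type*} [AddCommGroup V] [Module ℝ V]

/-- The triple bracket with an element which acts on `A, B, C` by `ad² = 0`. -/
theorem triple_bracket_mul {R : Type*} [Ring R] {T A B C A' B' C' : R}
    (hA : T * A - A * T = -A') (hB : T * B - B * T = -B') (hC : T * C - C * T = -C')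
    (hA' : T * A' = A' * T) (hB' : T * B' = B' * T) (hC' : T * C' = C' * T) :
    (fun Y => T * Y - Y * T)^[3] (A * B * C) = -(6 • (A' * B' * C')) := by
  obtain ⟨f, hf⟩ : ∃ f : R → R, ∀ Y, T * Y - Y * T = f Y := ⟨_, fun _ => rfl⟩
  have lm : ∀ X Y : R, f (X * Y) = f X * Y + X * f Y := by
    intro X Y; simp only [← hf]; noncomm_ring
  have la : ∀ X Y : R, f (X + Y) = f X + f Y := by
    intro X Y; simp only [← hf]; noncomm_ring
  have ln : ∀ X : R, f (-X) = -f X := by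
    intro X; simp only [← hf]; noncomm_ring
  have l0 : f 0 = 0 := by simp [← hf]
  have hA'' := sub_eq_zero.mpr hA'
  have hB'' := sub_eq_zero.mpr hB'
  have hC'' := sub_eq_zero.mpr hC'
  rw [hf] at hA hB hC hA'' hB'' hC''
  -- A second bracket with `T` kills each factor, so the third iterate hits every factor once: `3!`
  -- orders and the sign `(-1)³`.
  simp only [hf, Function.iterate_succ, Function.iterate_zero, Function.comp_apply, id_eq, lm, la,
    ln, l0, hA, hB, hC, hA'', hB'', hC'', neg_mul, mul_neg, neg_neg, add_mul, mul_add, zero_mul,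
    mul_zero, neg_zero, zero_add, add_zero]
  abel

/-- Data on a vector space: a nondegenerate two-form `σ` and the inverse `s` of
`v ↦ σ(v, ·)`. -/
structure IsSharp (σ : ExtForms V) (s : Module.Dual ℝ V →ₗ[ℝ] V) : Prop where
  mem : σ ∈ ⋀[ℝ]^2 (Module.Dual ℝ V)
  toBilin_sharp : ∀ a, toBilin σ (s a) = a
  sharp_toBilin : ∀ v, s (toBilin σ v) = v

namespace IsSharp

variable {σ : ExtForms V} {s : Module.Dual ℝ V →ₗ[ℝ] V} (h : IsSharp σ s)

include h

theorem surjective : Function.Surjective s := fun v => ⟨_, h.sharp_toBilin v⟩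

theorem interior_sharp (a : Module.Dual ℝ V) : interior (s a) σ = ι ℝ a := by
  rw [interior_eq_ι h.mem, h.toBilin_sharp]

theorem apply_sharp (a b : Module.Dual ℝ V) : a (s b) = -b (s a) := by
  conv_lhs => rw [← h.toBilin_sharp a]
  conv_rhs => rw [← h.toBilin_sharp b]
  exact toBilin_swap _ _ _

/-- For a decomposable two-form both contractions pass the covector as odd derivations; skewness of
the inverse form collects the scalar terms into `interior (s a) η`. -/
theorem adjMul_ι_mul_of_two {η : ExtForms V} (hη : η ∈ ⋀[ℝ]^2 (Module.Dual ℝ V))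
    (a : Module.Dual ℝ V) (β : ExtForms V) :
    adjMul s η (ι ℝ a * β) = ι ℝ a * adjMul s η β - adjMul s (interior (s a) η) β := by
  refine two_form_induction (P := fun η => adjMul s η (ι ℝ a * β) =
    ι ℝ a * adjMul s η β - adjMul s (interior (s a) η) β) (fun η ζ hη hζ => ?_) (fun b c => ?_) hη
  · simp only [map_add, LinearMap.add_apply, hη, hζ, mul_add]; abel
  · rw [adjMul_ι_mul, adjMul_ι, interior_ι_mul, interior_ι, map_sub, map_smul, adjMul_ι,
      ← Algebra.commutes, ← Algebra.smul_def, map_smul, adjMul_ι]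
    simp only [Module.End.mul_apply, interior_ι_mul, map_sub, map_smul, LinearMap.sub_apply,
      LinearMap.smul_apply]
    rw [h.apply_sharp a b, h.apply_sharp a c]
    module

/-- `[Λ, a ∧ ·] = -ι_{♯a}`. -/
theorem lambda_ι_mul (a : Module.Dual ℝ V) (β : ExtForms V) :
    adjMul s σ (ι ℝ a * β) = ι ℝ a * adjMul s σ β - interior (s a) β := by
  rw [h.adjMul_ι_mul_of_two h.mem, h.interior_sharp, adjMul_ι]

theorem ι_mul_omega (a : Module.Dual ℝ V) : σ * ι ℝ a = ι ℝ a * σ := by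
  rw [mul_ι, gradingInvolution_of_mem h.mem]; simp

theorem lambda_interior (v : V) (β : ExtForms V) :
    adjMul s σ (interior v β) = interior v (adjMul s σ β) := by
  obtain ⟨a, rfl⟩ := h.surjective v
  rw [← adjMul_ι, ← Module.End.mul_apply, ← Module.End.mul_apply, ← adjMul_mul, ← adjMul_mul,
    h.ι_mul_omega]

theorem interior_omega_mul (a : Module.Dual ℝ V) (β : ExtForms V) :
    interior (s a) (σ * β) = ι ℝ a * β + σ * interior (s a) β := by
  rw [interior_mul, h.interior_sharp, gradingInvolution_of_mem h.mem]; simp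

theorem mulLeft_ι_bracket (a : Module.Dual ℝ V) :
    adjMul s σ * LinearMap.mulLeft ℝ (ι ℝ a) - LinearMap.mulLeft ℝ (ι ℝ a) * adjMul s σ =
      -interior (s a) := by
  refine LinearMap.ext fun β => ?_
  simp [h.lambda_ι_mul]

/-- `ad(Λ)³ (η ∧ ·) / 6` is the adjoint of `η ∧ ·` for a three-form `η`. -/
theorem triple_bracket_mulLeft {η : ExtForms V} (hη : η ∈ ⋀[ℝ]^3 (Module.Dual ℝ V)) :
    (fun Y => adjMul s σ * Y - Y * adjMul s σ)^[3] (LinearMap.mulLeft ℝ η) =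
      (6 : ℝ) • adjMul s η := by
  obtain ⟨f, hf⟩ : ∃ f : Module.End ℝ (Module.End ℝ (ExtForms V)),
      (fun Y => adjMul s σ * Y - Y * adjMul s σ) = f :=
    ⟨LinearMap.mulLeft ℝ (adjMul s σ) - LinearMap.mulRight ℝ (adjMul s σ), by ext1 Y; simp⟩
  have hf' : ∀ X, f^[3] X = (f ^ 3) X := fun X => (Module.End.pow_apply f 3 X).symm
  have hadd : ∀ α β : ExtForms V, LinearMap.mulLeft ℝ (α + β) =
      LinearMap.mulLeft ℝ α + LinearMap.mulLeft ℝ β := fun α β => by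
    refine LinearMap.ext fun γ => ?_
    simp [add_mul]
  rw [hf, hf']
  refine exteriorPower_induction (P := fun η => (f ^ 3) (LinearMap.mulLeft ℝ η) =
    (6 : ℝ) • adjMul s η) (fun α β hα hβ => by rw [hadd, map_add, hα, hβ, map_add, smul_add])
    (fun a η hη => ?_) hη
  refine two_form_induction (P := fun η => (f ^ 3) (LinearMap.mulLeft ℝ (ι ℝ a * η)) =
    (6 : ℝ) • adjMul s (ι ℝ a * η)) (fun α β hα hβ => by
      rw [mul_add, hadd, map_add, hα, hβ, map_add, smul_add]) (fun b c => ?_) hη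
  have h1 : LinearMap.mulLeft ℝ (ι ℝ a * (ι ℝ b * ι ℝ c)) = LinearMap.mulLeft ℝ (ι ℝ a) *
      LinearMap.mulLeft ℝ (ι ℝ b) * LinearMap.mulLeft ℝ (ι ℝ c) := by
    refine LinearMap.ext fun γ => ?_
    simp [mul_assoc]
  have h2 : ∀ v : V, adjMul s σ * interior v = interior v * adjMul s σ := fun v =>
    LinearMap.ext fun γ => h.lambda_interior v γ
  rw [← hf', ← hf, h1, triple_bracket_mul (h.mulLeft_ι_bracket a) (h.mulLeft_ι_bracket b)
    (h.mulLeft_ι_bracket c) (h2 _) (h2 _) (h2 _)]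
  refine LinearMap.ext fun γ => ?_
  simp only [adjMul_mul, adjMul_ι, LinearMap.neg_apply, LinearMap.smul_apply, Module.End.mul_apply]
  -- The adjoint of `a ∧ b ∧ c` contracts in the reversed order. Reversing three odd operators costs
  -- the sign `-1`, which cancels the sign of the triple bracket.
  rw [interior_comm (s a) (s b), interior_comm (s a) (s c), map_neg, neg_neg,
    interior_comm (s b) (s c), smul_neg, neg_neg, ← Nat.cast_smul_eq_nsmul ℝ]
  norm_num

variable [FiniteDimensional ℝ V]

/-- Contracting `σ` with a two-form `η` gives half the trace of the endomorphism `♯ ∘ η`, and for `η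
= σ` this is the identity. -/
theorem lambda_omega : adjMul s σ σ = algebraMap ℝ _ ((Module.finrank ℝ V : ℝ) / 2) := by
  have key : ∀ η ∈ ⋀[ℝ]^2 (Module.Dual ℝ V), (2 : ℝ) • adjMul s η σ =
      algebraMap ℝ _ (LinearMap.trace ℝ V (s ∘ₗ toBilin η)) := by
    intro η hη
    refine two_form_induction (P := fun η => (2 : ℝ) • adjMul s η σ =
      algebraMap ℝ _ (LinearMap.trace ℝ V (s ∘ₗ toBilin η))) (fun η ζ hη hζ => ?_) (fun b c => ?_) hη
    · rw [map_add, LinearMap.add_apply, smul_add, hη, hζ, toBilin_add, LinearMap.comp_add, map_add,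
        map_add]
    · have h1 : s ∘ₗ toBilin (ι ℝ b * ι ℝ c) = b.smulRight (s c) - c.smulRight (s b) := by
        ext v
        have : toBilin (ι ℝ b * ι ℝ c) v = b v • c - c v • b := by
          ext u
          simp [toBilin_ι_mul_ι, mul_comm]
        simp [this]
      rw [h1, map_sub, LinearMap.trace_smulRight, LinearMap.trace_smulRight, adjMul_ι_mul,
        Module.End.mul_apply, adjMul_ι, h.interior_sharp, interior_ι, h.apply_sharp c b,
        Algebra.smul_def, ← map_mul]
      congr 1; ring
  have h1 : s ∘ₗ toBilin σ = LinearMap.id := LinearMap.ext h.sharp_toBilin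
  have h2 := key σ h.mem
  rw [h1, LinearMap.trace_id] at h2
  rw [← inv_smul_smul₀ (two_ne_zero (α := ℝ)) (adjMul s σ σ), h2, Algebra.smul_def, ← map_mul]
  congr 1; ring

theorem lambda_one : adjMul s σ 1 = 0 :=
  adjMul_eq_zero s h.mem one_mem_exteriorPower (by norm_num)

/-- `[L, Λ]` acts on forms of degree `k` by `k - n`, where `2n` is the dimension. -/
theorem bracket_omega_lambda {n : ℕ} (hn : Module.finrank ℝ V = 2 * n) :
    LinearMap.mulLeft ℝ σ * adjMul s σ - adjMul s σ * LinearMap.mulLeft ℝ σ =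
      gradedScale fun k => (k : ℝ) - n := by
  refine linearMap_ext_ι_mul ?_ fun a β hβ => ?_
  · simp only [LinearMap.sub_apply, Module.End.mul_apply, LinearMap.mulLeft_apply, h.lambda_one,
      mul_zero, mul_one, h.lambda_omega, gradedScale_of_mem _ one_mem_exteriorPower, hn]
    rw [Algebra.algebraMap_eq_smul_one]
    push_cast
    module
  · have e : (fun k : ℕ => ((k + 1 : ℕ) : ℝ) - n) = (fun k : ℕ => (k : ℝ) - n) + fun _ => 1 := by
      ext k; simp; ring
    rw [gradedScale_ι_mul, e, gradedScale_add, LinearMap.add_apply, gradedScale_one, ← hβ]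
    simp only [LinearMap.sub_apply, Module.End.mul_apply, LinearMap.mulLeft_apply, h.lambda_ι_mul]
    rw [← mul_assoc σ, h.ι_mul_omega, mul_assoc, h.lambda_ι_mul, h.interior_omega_mul, mul_sub,
      ← mul_assoc σ, h.ι_mul_omega]
    simp only [mul_sub, mul_add, mul_assoc]
    abel


/-! ### The star operator -/

theorem mulLeft_pow_eq_zero {n : ℕ} (hn : Module.finrank ℝ V = 2 * n) : σ ^ (n + 1) = 0 := by
  have h1 : σ ^ (n + 1) ∈ ⋀[ℝ]^(2 * (n + 1)) (Module.Dual ℝ V) := by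
    rw [exteriorPower, pow_mul]
    exact Submodule.pow_mem_pow _ h.mem _
  rw [exteriorPower_eq_bot (by omega)] at h1
  exact (Submodule.mem_bot ℝ).mp h1

theorem pow_mem (k : ℕ) : σ ^ k ∈ ⋀[ℝ]^(2 * k) (Module.Dual ℝ V) := by
  rw [exteriorPower, pow_mul]
  exact Submodule.pow_mem_pow _ h.mem _

theorem lambda_pow_mem (j : ℕ) : ∀ (k : ℕ), ∀ β ∈ ⋀[ℝ]^(2 * j + k) (Module.Dual ℝ V),
    (adjMul s σ ^ j) β ∈ ⋀[ℝ]^k (Module.Dual ℝ V) := by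
  intro k β hβ
  rw [← adjMul_pow]
  exact adjMul_mem s (h.pow_mem j) hβ

end IsSharp

/-- The operator `e^L e^{-Λ} e^L`, for `L` and `Λ` with vanishing powers of exponent `N`. -/
def weylOp {R : Type*} [Ring R] [Algebra ℝ R] (N : ℕ) (L Λ : R) : R :=
  nilExp N L * nilExp N (-Λ) * nilExp N L

theorem neg_pow_eq_zero {R : Type*} [Ring R] {T : R} {N : ℕ} (hT : T ^ N = 0) : (-T) ^ N = 0 := by
  rw [neg_pow, hT, mul_zero]

theorem nilExp_conj_neg {R : Type*} [Ring R] [Algebra ℝ R] {T θ : R} (N : ℕ)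
    (hθ : θ * T = -T * θ) : θ * nilExp N T = nilExp N (-T) * θ := by
  rw [nilExp, nilExp, Finset.mul_sum, Finset.sum_mul]
  refine Finset.sum_congr rfl fun k _ => ?_
  rw [mul_smul_comm, smul_mul_assoc]
  congr 1
  exact (SemiconjBy.pow_right (show SemiconjBy θ T (-T) from hθ) k).eq

namespace IsSharp

variable {σ : ExtForms V} {s : Module.Dual ℝ V →ₗ[ℝ] V} (h : IsSharp σ s)
  [FiniteDimensional ℝ V] {n : ℕ} (hn : Module.finrank ℝ V = 2 * n)

include h hn

theorem raise_pow : LinearMap.mulLeft ℝ σ ^ (n + 1) = 0 := by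
  rw [LinearMap.pow_mulLeft, h.mulLeft_pow_eq_zero hn]; simp

theorem lower_pow : adjMul s σ ^ (n + 1) = 0 := by
  rw [← adjMul_pow, h.mulLeft_pow_eq_zero hn, map_zero]

/-- Multiplication by `a` and contraction with `♯a` form a two-dimensional `sl₂`-module under
brackets, whose two lines the Weyl element exchanges. -/
theorem weyl_aux (a : Module.Dual ℝ V) :
    weylOp (n + 1) (LinearMap.mulLeft ℝ σ) (adjMul s σ) * LinearMap.mulLeft ℝ (ι ℝ a) =
      interior (s a) * weylOp (n + 1) (LinearMap.mulLeft ℝ σ) (adjMul s σ) ∧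
    weylOp (n + 1) (LinearMap.mulLeft ℝ σ) (adjMul s σ) * interior (s a) =
      -LinearMap.mulLeft ℝ (ι ℝ a) * weylOp (n + 1) (LinearMap.mulLeft ℝ σ) (adjMul s σ) := by
  refine weyl_mul_pair (h.raise_pow hn) (h.lower_pow hn) ?_ ?_ ?_ ?_
  · rw [Ring.lie_def]
    refine LinearMap.ext fun β => ?_
    simp [← mul_assoc, h.ι_mul_omega]
  · rw [Ring.lie_def]
    exact h.mulLeft_ι_bracket a
  · rw [Ring.lie_def]
    refine LinearMap.ext fun β => ?_
    simp [h.interior_omega_mul]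
  · rw [Ring.lie_def]
    refine LinearMap.ext fun β => ?_
    simp [h.lambda_interior]

theorem weyl_ι_mul (a : Module.Dual ℝ V) (β : ExtForms V) :
    weylOp (n + 1) (LinearMap.mulLeft ℝ σ) (adjMul s σ) (ι ℝ a * β) =
      interior (s a) (weylOp (n + 1) (LinearMap.mulLeft ℝ σ) (adjMul s σ) β) :=
  LinearMap.congr_fun (h.weyl_aux hn a).1 β

theorem weyl_interior (a : Module.Dual ℝ V) (β : ExtForms V) :
    weylOp (n + 1) (LinearMap.mulLeft ℝ σ) (adjMul s σ) (interior (s a) β) =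
      -(ι ℝ a * weylOp (n + 1) (LinearMap.mulLeft ℝ σ) (adjMul s σ) β) := by
  simpa using LinearMap.congr_fun (h.weyl_aux hn a).2 β

/-- Contractions kill `1`, so every covector multiplies the image of `1` to zero. Hence `eⁱ ∧
ι_{eᵢ}` acts on it as the identity for each `i`, and Euler's formula gives the top degree. -/
theorem weyl_one_mem : weylOp (n + 1) (LinearMap.mulLeft ℝ σ) (adjMul s σ) 1 ∈
    ⋀[ℝ]^(2 * n) (Module.Dual ℝ V) := by
  set γ := weylOp (n + 1) (LinearMap.mulLeft ℝ σ) (adjMul s σ) 1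
  have h1 : ∀ a, ι ℝ a * γ = 0 := fun a => by
    rw [← neg_eq_zero, ← h.weyl_interior hn a 1, interior_one, map_zero]
  refine mem_exteriorPower_of_gradedScale ?_
  rw [← dualDerivation_id, dualDerivation_apply, ← hn]
  have h2 : ∀ i, ι ℝ ((Module.finBasis ℝ V).coord i ∘ₗ LinearMap.id) *
      interior (Module.finBasis ℝ V i) γ = γ := fun i => by
    have h3 := interior_ι_mul (Module.finBasis ℝ V i) ((Module.finBasis ℝ V).coord i) γ
    rw [h1, map_zero] at h3
    rw [LinearMap.comp_id, ← sub_eq_zero, ← neg_eq_zero, h3]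
    simp
  rw [Finset.sum_congr rfl fun i _ => h2 i]
  simp [Nat.cast_smul_eq_nsmul]

/-- The Weyl image `γ` of `1` has top degree, so `e^{-L}` fixes it; cancelling the outer `e^L` in
the Weyl element leaves `e^{-Λ} e^L 1 = γ`. -/
theorem exp_raise_one : nilExp (n + 1) (LinearMap.mulLeft ℝ σ) 1 =
    nilExp (n + 1) (adjMul s σ) (weylOp (n + 1) (LinearMap.mulLeft ℝ σ) (adjMul s σ) 1) := by
  set γ := weylOp (n + 1) (LinearMap.mulLeft ℝ σ) (adjMul s σ) 1 with hγ
  have h0 : σ * γ = 0 := by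
    have h1 := mul_mem_exteriorPower h.mem (h.weyl_one_mem hn)
    rw [exteriorPower_eq_bot (by omega)] at h1
    exact (Submodule.mem_bot ℝ).mp h1
  have h1 : nilExp (n + 1) (-LinearMap.mulLeft ℝ σ) γ = γ := by
    rw [nilExp, LinearMap.sum_apply, Finset.sum_range_succ', Finset.sum_eq_zero]
    · simp
    · intro k _
      rw [pow_succ, LinearMap.smul_apply, Module.End.mul_apply, LinearMap.neg_apply,
        LinearMap.mulLeft_apply, h0, neg_zero, map_zero, smul_zero]
  have h2 := nilExp_mul_nilExp_neg (T := -LinearMap.mulLeft ℝ σ) (N := n + 1)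
    (neg_pow_eq_zero (h.raise_pow hn))
  have h3 := nilExp_mul_nilExp_neg (h.lower_pow hn)
  rw [neg_neg] at h2
  conv_rhs => rw [← h1]
  rw [hγ, weylOp, ← Module.End.mul_apply, ← Module.End.mul_apply, mul_assoc (nilExp _ _) _
    (nilExp _ _ * _ * _), mul_assoc (nilExp (n + 1) (LinearMap.mulLeft ℝ σ)), ← mul_assoc
    (nilExp (n + 1) (-LinearMap.mulLeft ℝ σ)), h2, one_mul, ← mul_assoc, h3, one_mul]

theorem nilExp_lambda_mem_top (γ : ExtForms V) (hγ : γ ∈ ⋀[ℝ]^(2 * n) (Module.Dual ℝ V)) :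
    degPart (2 * n) (nilExp (n + 1) (adjMul s σ) γ) = γ := by
  rw [nilExp, LinearMap.sum_apply, degPart_eq_gradedScale, map_sum, Finset.sum_range_succ',
    Finset.sum_eq_zero]
  · simp [gradedScale_of_mem _ hγ]
  · intro k hk
    have hk : k + 1 ≤ n := by simpa using hk
    obtain ⟨m, rfl⟩ := Nat.exists_eq_add_of_le hk
    have := h.lambda_pow_mem (k + 1) (2 * m) γ (by rwa [mul_add] at hγ)
    rw [LinearMap.smul_apply, map_smul, gradedScale_of_mem _ this,
      Pi.single_eq_of_ne (by omega), zero_smul, smul_zero]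

/-- The Weyl operator sends `1` to the volume form. -/
theorem weyl_one : weylOp (n + 1) (LinearMap.mulLeft ℝ σ) (adjMul s σ) 1 =
    ((n.factorial : ℝ)⁻¹) • σ ^ n := by
  -- Compare the top degree parts of `e^ω = e^Λ γ`: on the left `ωⁿ / n!`, on the right `γ`.
  rw [← h.nilExp_lambda_mem_top hn _ (h.weyl_one_mem hn), ← h.exp_raise_one hn, nilExp,
    LinearMap.sum_apply, degPart_eq_gradedScale, map_sum, Finset.sum_range_succ,
    Finset.sum_eq_zero, zero_add]
  · rw [LinearMap.smul_apply, map_smul, LinearMap.pow_mulLeft, LinearMap.mulLeft_apply, mul_one,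
      gradedScale_of_mem _ (h.pow_mem n)]
    simp
  · intro k hk
    have hk : k < n := by simpa using hk
    rw [LinearMap.smul_apply, map_smul, LinearMap.pow_mulLeft, LinearMap.mulLeft_apply, mul_one,
      gradedScale_of_mem _ (h.pow_mem k), Pi.single_eq_of_ne (by omega), zero_smul, smul_zero]

theorem weyl_mem {k l : ℕ} (hkl : k + l = 2 * n) {β : ExtForms V}
    (hβ : β ∈ ⋀[ℝ]^k (Module.Dual ℝ V)) :
    weylOp (n + 1) (LinearMap.mulLeft ℝ σ) (adjMul s σ) β ∈ ⋀[ℝ]^l (Module.Dual ℝ V) := by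
  induction k generalizing l β with
  | zero =>
    obtain ⟨r, rfl⟩ := mem_exteriorPower_zero.mp hβ
    obtain rfl : l = 2 * n := by omega
    rw [Algebra.algebraMap_eq_smul_one, map_smul]
    exact Submodule.smul_mem _ _ (h.weyl_one_mem hn)
  | succ k ih =>
    refine exteriorPower_induction (P := fun β => weylOp (n + 1) (LinearMap.mulLeft ℝ σ)
      (adjMul s σ) β ∈ ⋀[ℝ]^l (Module.Dual ℝ V))
      (fun α γ hα hγ => by rw [map_add]; exact add_mem hα hγ) (fun a α hα => ?_) hβ
    rw [h.weyl_ι_mul hn]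
    exact interior_mem _ (ih (by omega) hα)

/-- The sign `(-1)^{⌊k/2⌋}` anticommutes with `L` and `Λ`, so it turns `e^L 1 = e^Λ γ` into `e^{-L}
1 = (-1)^n e^{-Λ} γ`. Since `e^L γ = γ`, the Weyl element sends `γ` to `e^L e^{-Λ} γ = (-1)^n 1`. -/
theorem weyl_weyl_one : weylOp (n + 1) (LinearMap.mulLeft ℝ σ) (adjMul s σ)
    (weylOp (n + 1) (LinearMap.mulLeft ℝ σ) (adjMul s σ) 1) = ((-1 : ℝ) ^ n) • 1 := by
  set γ := weylOp (n + 1) (LinearMap.mulLeft ℝ σ) (adjMul s σ) 1 with hγ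
  have h0 : σ * γ = 0 := by
    have h1 := mul_mem_exteriorPower h.mem (h.weyl_one_mem hn)
    rw [exteriorPower_eq_bot (by omega)] at h1
    exact (Submodule.mem_bot ℝ).mp h1
  have h1 : nilExp (n + 1) (LinearMap.mulLeft ℝ σ) γ = γ := by
    rw [nilExp, LinearMap.sum_apply, Finset.sum_range_succ', Finset.sum_eq_zero]
    · simp
    · intro k _
      rw [pow_succ, LinearMap.smul_apply, Module.End.mul_apply,
        LinearMap.mulLeft_apply, h0, map_zero, smul_zero]
  set θ : Module.End ℝ (ExtForms V) := gradedScale fun k => (-1) ^ (k / 2) with hθ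
  have e1 : θ * LinearMap.mulLeft ℝ σ = -LinearMap.mulLeft ℝ σ * θ := by
    refine linearMap_ext_homogeneous fun k β hβ => ?_
    have h2 := mul_mem_exteriorPower h.mem hβ
    change θ (σ * β) = -(σ * θ β)
    rw [hθ, gradedScale_of_mem _ h2, gradedScale_of_mem _ hβ, mul_smul_comm, Nat.add_div_left k (by norm_num), pow_succ]
    module
  have e2 : θ * adjMul s σ = -adjMul s σ * θ := by
    refine linearMap_ext_homogeneous fun k β hβ => ?_
    change θ (adjMul s σ β) = -adjMul s σ (θ β)
    rcases lt_or_ge k 2 with hk | hk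
    · rw [hθ, gradedScale_of_mem _ hβ, map_smul, adjMul_eq_zero s h.mem hβ hk]; simp
    · obtain ⟨m, rfl⟩ := Nat.exists_eq_add_of_le hk
      rw [hθ, gradedScale_of_mem _ hβ, map_smul, gradedScale_of_mem _ (adjMul_mem s h.mem hβ),
        Nat.add_div_left m (by norm_num), pow_succ]
      module
  have h2 := congrArg θ (h.exp_raise_one hn)
  rw [← hγ, ← Module.End.mul_apply, ← Module.End.mul_apply, nilExp_conj_neg _ e1,
    nilExp_conj_neg _ e2, Module.End.mul_apply, Module.End.mul_apply, hθ,
    gradedScale_of_mem _ one_mem_exteriorPower, gradedScale_of_mem _ (h.weyl_one_mem hn),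
    Nat.mul_div_cancel_left n (by norm_num)] at h2
  have h3 : nilExp (n + 1) (-adjMul s σ) γ =
      ((-1 : ℝ) ^ n) • nilExp (n + 1) (-LinearMap.mulLeft ℝ σ) 1 := by
    have h4 : ((-1 : ℝ) ^ n) * (-1) ^ n = 1 := by rw [← mul_pow]; simp
    simp only [Nat.zero_div, pow_zero, one_smul, map_smul, ← hγ] at h2
    rw [h2, smul_smul, h4, one_smul]
  rw [weylOp, Module.End.mul_apply, Module.End.mul_apply, h1, h3, map_smul, ← Module.End.mul_apply,
    nilExp_mul_nilExp_neg (h.raise_pow hn), Module.End.one_apply]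

/-- The square of the Weyl operator acts on forms of degree `k` by `(-1)^{n+k}`. -/
theorem weyl_weyl : weylOp (n + 1) (LinearMap.mulLeft ℝ σ) (adjMul s σ) *
    weylOp (n + 1) (LinearMap.mulLeft ℝ σ) (adjMul s σ) =
      ((-1 : ℝ) ^ n) • gradingInvolution V := by
  refine linearMap_ext_ι_mul ?_ fun a β hβ => ?_
  · rw [Module.End.mul_apply, h.weyl_weyl_one hn, LinearMap.smul_apply,
      gradingInvolution_of_mem one_mem_exteriorPower, pow_zero, one_smul]
  · rw [Module.End.mul_apply, h.weyl_ι_mul hn, h.weyl_interior hn, ← Module.End.mul_apply, hβ,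
      LinearMap.smul_apply, LinearMap.smul_apply, gradingInvolution_ι_mul, mul_smul_comm, smul_neg]

end IsSharp

end Lefschetz

/-! ### The star operator as a Weyl element with signs -/

section Star

open ExteriorAlgebra

variable {V : Type*} [AddCommGroup V] [Module ℝ V]

namespace IsSharp

variable {σ : ExtForms V} {s : Module.Dual ℝ V →ₗ[ℝ] V} (h : IsSharp σ s)

include h

/-- Unlike for a symmetric form, the adjoint of the contraction with `♯a` is minus the
multiplication by `a`, because the inverse form is skew. -/
theorem scalar_adjMul_interior (a : Module.Dual ℝ V) (α β : ExtForms V) :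
    algebraMapInv (adjMul s (interior (s a) α) β) = -algebraMapInv (adjMul s α (ι ℝ a * β)) := by
  induction α using extForms_induction generalizing β with
  | h0 r =>
    rw [interior_algebraMap, adjMul_algebraMap]
    simp [algebraMapInv]
  | hadd α γ hα hγ => simp only [map_add, LinearMap.add_apply, hα, hγ]; ring
  | hι b α hα =>
    rw [interior_ι_mul, map_sub, map_smul, adjMul_ι_mul, adjMul_ι_mul, LinearMap.sub_apply,
      LinearMap.smul_apply, Module.End.mul_apply, Module.End.mul_apply, map_sub, hα, map_smul,
      interior_ι_mul, map_sub, map_smul, map_sub, map_smul, h.apply_sharp a b]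
    simp only [smul_eq_mul]
    ring

/-- `Λ` is the adjoint of `L` and vice versa. -/
theorem scalar_adjMul_lambda (α β : ExtForms V) :
    algebraMapInv (adjMul s (adjMul s σ α) β) = algebraMapInv (adjMul s α (σ * β)) := by
  refine two_form_induction (P := fun η => algebraMapInv (adjMul s (adjMul s η α) β) =
    algebraMapInv (adjMul s α (η * β))) (fun η ζ hη hζ => ?_) (fun b c => ?_) h.mem
  · simp only [map_add, LinearMap.add_apply, hη, hζ, add_mul]
  · rw [adjMul_ι_mul, adjMul_ι, Module.End.mul_apply, h.scalar_adjMul_interior,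
      h.scalar_adjMul_interior, neg_neg, mul_assoc]

end IsSharp

theorem algebraMapInv_gradingInvolution (β : ExtForms V) :
    algebraMapInv (gradingInvolution V β) = algebraMapInv β := by
  refine homogeneous_induction (P := fun β => algebraMapInv (gradingInvolution V β) =
    algebraMapInv β) (fun α γ hα hγ => by rw [map_add, map_add, map_add, hα, hγ])
    (fun k γ hγ => ?_) β
  rw [gradingInvolution_of_mem hγ, map_smul]
  by_cases hk : k = 0
  · simp [hk]
  · rw [algebraMapInv_eq_zero hk hγ, smul_zero]

theorem gradingInvolution_sq (β : ExtForms V) :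
    gradingInvolution V (gradingInvolution V β) = β := by
  rw [gradingInvolution, ← Module.End.mul_apply, gradedScale_mul_gradedScale]
  convert gradedScale_one β using 3
  ext k
  simp [← mul_pow]

theorem gradingInvolution_interior (v : V) (β : ExtForms V) :
    gradingInvolution V (interior v β) = -interior v (gradingInvolution V β) := by
  rw [gradingInvolution, ← gradedScale_interior, ← LinearMap.neg_apply]
  congr 1
  refine linearMap_ext_homogeneous fun k β hβ => ?_
  rw [LinearMap.neg_apply, gradedScale_of_mem _ hβ, gradedScale_of_mem _ hβ, pow_succ]
  module

theorem adjMul_gradingInvolution (s : Module.Dual ℝ V →ₗ[ℝ] V) (α β : ExtForms V) :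
    adjMul s (gradingInvolution V α) β =
      gradingInvolution V (adjMul s α (gradingInvolution V β)) := by
  induction α using extForms_induction generalizing β with
  | h0 r =>
    rw [gradingInvolution_of_mem (algebraMap_mem r), pow_zero, one_smul, adjMul_algebraMap]
    simp [gradingInvolution_sq]
  | hadd α γ hα hγ => simp only [map_add, LinearMap.add_apply, hα, hγ]
  | hι a α hα =>
    rw [gradingInvolution_ι_mul, map_neg, adjMul_ι_mul, LinearMap.neg_apply, Module.End.mul_apply,
      hα, adjMul_ι_mul, Module.End.mul_apply, gradingInvolution_interior, map_neg, map_neg, neg_neg]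

/-- The sign `(-1)^{k(k+1)/2}`. -/
def starSign (k : ℕ) : ℝ := (-1) ^ (k * (k + 1) / 2)

theorem starSign_succ (k : ℕ) : starSign (k + 1) = -(starSign k * (-1) ^ k) := by
  have : (k + 1) * (k + 1 + 1) / 2 = k * (k + 1) / 2 + (k + 1) := by
    rw [show (k + 1) * (k + 1 + 1) = k * (k + 1) + (k + 1) * 2 by ring,
      Nat.add_mul_div_right _ _ (by norm_num)]
  rw [starSign, this, pow_add, starSign, pow_succ]
  ring

theorem starSign_mul_self (k : ℕ) : starSign k * starSign k = 1 := by
  rw [starSign, ← mul_pow]; simp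

/-- The combined sign of the two stars in `⋆ d ⋆`: the inner one acts in degree `k`, the outer one
in degree `2n + 1 - k`. The product does not depend on `k`. -/
theorem starSign_mul (n k : ℕ) (hk : k ≤ 2 * n + 1) :
    starSign k * starSign (2 * n + 1 - k) = (-1) ^ (n + 1) := by
  induction k with
  | zero =>
    rw [starSign, starSign]
    have : (2 * n + 1) * (2 * n + 1 + 1) / 2 = (n + 1) + 2 * (n * (n + 1)) := by
      rw [show (2 * n + 1) * (2 * n + 1 + 1) = ((n + 1) + 2 * (n * (n + 1))) * 2 by ring,
        Nat.mul_div_cancel _ (by norm_num)]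
    rw [Nat.sub_zero, this, pow_add (-1 : ℝ) (n + 1), pow_mul]
    simp
  | succ k ih =>
    obtain ⟨m, hm⟩ := Nat.exists_eq_add_of_le hk
    rw [show 2 * n + 1 - (k + 1) = m by omega]
    rw [show 2 * n + 1 - k = m + 1 by omega, starSign_succ] at ih
    -- `m + k = 2n`, so both have the same parity.
    have e : (-1 : ℝ) ^ m = (-1) ^ k := by
      have e1 : (-1 : ℝ) ^ k * (-1) ^ k = 1 := by rw [← mul_pow]; simp
      have e2 : (-1 : ℝ) ^ m * (-1) ^ k = 1 := by
        rw [← pow_add, show m + k = 2 * n by omega, pow_mul]; simp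
      linear_combination (-1 : ℝ) ^ k * e2 - (-1) ^ m * e1
    rw [starSign_succ, ← ih (by omega), e]
    ring

namespace IsSharp

variable {σ : ExtForms V} {s : Module.Dual ℝ V →ₗ[ℝ] V} (h : IsSharp σ s)
  [FiniteDimensional ℝ V] {n : ℕ} (hn : Module.finrank ℝ V = 2 * n)

include h hn

/-- `T` is the adjoint of right multiplication by `α`. The property is multiplicative in `α`, so it
suffices to treat covectors, where the recursion of the sign absorbs the difference between left and
right multiplication. -/
theorem mul_weyl_starSign (α : ExtForms V) : ∃ T : Module.End ℝ (ExtForms V),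
    (∀ β, α * weylOp (n + 1) (LinearMap.mulLeft ℝ σ) (adjMul s σ) (gradedScale starSign β) =
      weylOp (n + 1) (LinearMap.mulLeft ℝ σ) (adjMul s σ) (gradedScale starSign (T β))) ∧
    ∀ α' β, algebraMapInv (adjMul s (α' * α) β) = algebraMapInv (adjMul s α' (T β)) := by
  set W := weylOp (n + 1) (LinearMap.mulLeft ℝ σ) (adjMul s σ) with hW
  induction α using ExteriorAlgebra.induction with
  | algebraMap r =>
    refine ⟨r • 1, fun β => ?_, fun α' β => ?_⟩
    · simp [← Algebra.smul_def]
    · rw [← Algebra.commutes, ← Algebra.smul_def]; simp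
  | add α γ hα hγ =>
    obtain ⟨S, hS1, hS2⟩ := hα
    obtain ⟨T, hT1, hT2⟩ := hγ
    refine ⟨S + T, fun β => ?_, fun α' β => ?_⟩
    · rw [add_mul, hS1, hT1, LinearMap.add_apply, map_add, map_add]
    · rw [mul_add, map_add, LinearMap.add_apply, map_add, hS2, hT2, LinearMap.add_apply, map_add,
        map_add]
  | mul α γ hα hγ =>
    obtain ⟨S, hS1, hS2⟩ := hα
    obtain ⟨T, hT1, hT2⟩ := hγ
    refine ⟨S * T, fun β => ?_, fun α' β => ?_⟩
    · rw [mul_assoc, hT1, hS1]; rfl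
    · rw [← mul_assoc, hT2, hS2]; rfl
  | ι a =>
    refine ⟨gradingInvolution V * interior (s a), fun β => ?_, fun α' β => ?_⟩
    · have key : ∀ x : ExtForms V, -gradedScale (fun k => starSign (k + 1)) x =
          gradedScale starSign (gradingInvolution V x) := fun x => by
        rw [← LinearMap.neg_apply, ← Module.End.mul_apply]
        congr 1
        refine linearMap_ext_homogeneous fun k β hβ => ?_
        rw [LinearMap.neg_apply, gradedScale_of_mem _ hβ, Module.End.mul_apply,
          gradingInvolution_of_mem hβ, map_smul, gradedScale_of_mem _ hβ, starSign_succ]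
        module
      rw [← neg_eq_iff_eq_neg.mpr (h.weyl_interior hn a _), ← hW, ← map_neg,
        ← gradedScale_interior, Module.End.mul_apply, key]
    · rw [mul_ι, adjMul_ι_mul, Module.End.mul_apply, adjMul_gradingInvolution,
        algebraMapInv_gradingInvolution, Module.End.mul_apply]

/-- Moving `α` to its adjoint reduces to `α = 1`; then only the scalar part reaches the top degree,
and the Weyl element sends `1` to the volume form. -/
theorem degPart_mul_weyl (α β : ExtForms V) :
    degPart (2 * n) (α * weylOp (n + 1) (LinearMap.mulLeft ℝ σ) (adjMul s σ)
      (gradedScale starSign β)) =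
    algebraMapInv (adjMul s α β) • (((n.factorial : ℝ)⁻¹) • σ ^ n) := by
  obtain ⟨T, hT1, hT2⟩ := h.mul_weyl_starSign hn α
  rw [hT1, ← one_mul α, hT2, adjMul_one, Module.End.one_apply]
  generalize T β = γ
  refine homogeneous_induction (P := fun γ => degPart (2 * n) (weylOp (n + 1)
    (LinearMap.mulLeft ℝ σ) (adjMul s σ) (gradedScale starSign γ)) =
    algebraMapInv γ • (((n.factorial : ℝ)⁻¹) • σ ^ n)) (fun γ δ hγ hδ => ?_) (fun k γ hγ => ?_) γ
  · rw [map_add algebraMapInv, add_smul, ← hγ, ← hδ]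
    simp only [degPart_eq_gradedScale, map_add]
  · rw [gradedScale_of_mem _ hγ, map_smul, degPart_eq_gradedScale, map_smul]
    rcases Nat.eq_zero_or_pos k with rfl | hk
    · obtain ⟨r, rfl⟩ := mem_exteriorPower_zero.mp hγ
      rw [algebraMapInv_algebraMap, Algebra.algebraMap_eq_smul_one, map_smul, map_smul,
        gradedScale_of_mem _ (h.weyl_one_mem hn), h.weyl_one hn]
      simp [starSign]
    · rw [algebraMapInv_eq_zero hk.ne' hγ, zero_smul]
      rcases le_or_gt k (2 * n) with hk' | hk'
      · obtain ⟨l, hl⟩ := Nat.exists_eq_add_of_le hk'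
        rw [gradedScale_of_mem _ (h.weyl_mem hn hl.symm hγ), Pi.single_eq_of_ne (by omega)]
        simp
      · rw [exteriorPower_eq_bot (by omega)] at hγ
        rw [(Submodule.mem_bot ℝ).mp hγ]
        simp

theorem weyl_injective {β : ExtForms V}
    (hβ : weylOp (n + 1) (LinearMap.mulLeft ℝ σ) (adjMul s σ) β = 0) : β = 0 := by
  have h1 := LinearMap.congr_fun (h.weyl_weyl hn) β
  rw [Module.End.mul_apply, hβ, map_zero, LinearMap.smul_apply, eq_comm] at h1
  rw [← gradingInvolution_sq β, (smul_eq_zero.mp h1).resolve_left (by positivity), map_zero]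

/-- The star operator is given, up to signs, by the Weyl operator. -/
theorem star_unique {β γ : ExtForms V} (hγ : ∀ α, degPart (2 * n) (α * γ) =
      algebraMapInv (adjMul s α β) • (((n.factorial : ℝ)⁻¹) • σ ^ n)) :
    γ = weylOp (n + 1) (LinearMap.mulLeft ℝ σ) (adjMul s σ) (gradedScale starSign β) := by
  set W := weylOp (n + 1) (LinearMap.mulLeft ℝ σ) (adjMul s σ) with hW
  have hε : ∀ x : ExtForms V, gradedScale starSign (gradedScale starSign x) = x := fun x => by
    rw [← Module.End.mul_apply, gradedScale_mul_gradedScale,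
      show (starSign * starSign) = fun _ => 1 from funext starSign_mul_self, gradedScale_one]
  -- Both the sign operator and, up to signs, the Weyl operator square to the identity, which yields
  -- the preimage.
  have hsurj : ∀ x, ∃ y, W (gradedScale starSign y) = x := fun x => by
    refine ⟨gradedScale starSign (((-1 : ℝ) ^ n) • W (gradingInvolution V x)), ?_⟩
    have h1 := LinearMap.congr_fun (h.weyl_weyl hn) (gradingInvolution V x)
    rw [Module.End.mul_apply, LinearMap.smul_apply, gradingInvolution_sq] at h1
    have h4 : ((-1 : ℝ) ^ n) * (-1) ^ n = 1 := by rw [← mul_pow]; simp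
    rw [hε, map_smul, h1, smul_smul, h4, one_smul]
  have hvol : ((n.factorial : ℝ)⁻¹) • σ ^ n ≠ 0 := fun h0 => by
    rw [← h.weyl_one hn] at h0
    exact one_ne_zero (h.weyl_injective hn h0)
  obtain ⟨β', rfl⟩ := hsurj γ
  -- Writing the candidate as the star of some `β'`, nondegeneracy of the pairing forces `β' = β`.
  have : β' - β = 0 := eq_zero_of_adjMul h.surjective fun α => by
    have h1 := hγ α
    rw [h.degPart_mul_weyl hn, ← sub_eq_zero, ← sub_smul] at h1
    rw [map_sub, map_sub]
    exact (smul_eq_zero.mp h1).resolve_right hvol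
  rw [sub_eq_zero.mp this]

end IsSharp

variable [FiniteDimensional ℝ V]

theorem isSharp_sharp {σ : ExtForms V} (hσ : σ ∈ ⋀[ℝ]^2 (Module.Dual ℝ V))
    (hB : (toBilin σ).Nondegenerate) : IsSharp σ (sharp (toBilin σ) hB) where
  mem := hσ
  toBilin_sharp a := by
    have := ((toBilin σ).toDual hB).apply_symm_apply a
    ext v
    conv_rhs => rw [← this, LinearMap.BilinForm.toDual_def]
    rfl
  sharp_toBilin v := by
    have : toBilin σ v = (toBilin σ).toDual hB v := by
      ext u; rw [LinearMap.BilinForm.toDual_def]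
    rw [sharp, this]
    exact ((toBilin σ).toDual hB).symm_apply_apply v

theorem linearStar_eq {n : ℕ} (hn : Module.finrank ℝ V = 2 * n) {σ : ExtForms V}
    (hσ : σ ∈ ⋀[ℝ]^2 (Module.Dual ℝ V)) (hB : (toBilin σ).Nondegenerate) (β : ExtForms V) :
    linearStar (toBilin σ) hB (((n.factorial : ℝ)⁻¹) • σ ^ n) β =
      weylOp (n + 1) (LinearMap.mulLeft ℝ σ) (adjMul (sharp (toBilin σ) hB) σ)
        (gradedScale starSign β) := by
  have h := isSharp_sharp hσ hB
  refine h.star_unique hn ?_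
  have := Classical.epsilon_spec (p := fun γ => ∀ α : ExtForms V,
    degPart (Module.finrank ℝ V) (α * γ) =
      formPairing (toBilin σ) hB α β • (((n.factorial : ℝ)⁻¹) • σ ^ n))
    ⟨_, fun α => by rw [hn, formPairing_eq]; exact h.degPart_mul_weyl hn α β⟩
  intro α
  rw [← hn, ← formPairing_eq]
  exact this α

end Star

/-! ### The bigrading as a simultaneous eigenspace decomposition -/

section Bigrading

open ExteriorAlgebra Polynomial

/-- `π (p, q)`, `p, q ≤ n`, are the projections onto the simultaneous eigenspaces of the
commuting operators `H` and `N` with eigenvalues `p + q` and `q`. -/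
structure IsBigrading {A : Type*} [AddCommGroup A] [Module ℝ A] (n : ℕ)
    (H N : Module.End ℝ A) (π : ℕ × ℕ → Module.End ℝ A) : Prop where
  degree_mul : ∀ r, H * π r = ((r.1 : ℝ) + r.2) • π r
  weight_mul : ∀ r, N * π r = (r.2 : ℝ) • π r
  commute_degree : ∀ r, Commute H (π r)
  commute_weight : ∀ r, Commute N (π r)
  sum_eq : ∑ r ∈ Finset.range (n + 1) ×ˢ Finset.range (n + 1), π r = 1

namespace IsBigrading

variable {A : Type*} [AddCommGroup A] [Module ℝ A] {n : ℕ} {H N : Module.End ℝ A}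
  {π : ℕ × ℕ → Module.End ℝ A} (h : IsBigrading n H N π)

include h

/-- The projection commutes with both operators, so its value would have two different eigenvalues.
-/
theorem apply_eq_zero {x : A} {d w : ℝ} (hd : H x = d • x) (hw : N x = w • x) {r : ℕ × ℕ}
    (hr : ¬ ((r.1 : ℝ) + r.2 = d ∧ (r.2 : ℝ) = w)) : π r x = 0 := by
  have h1 : ((r.1 : ℝ) + r.2) • π r x = d • π r x := by
    rw [show d • π r x = π r (H x) by rw [hd, map_smul]]
    exact (LinearMap.congr_fun (h.degree_mul r) x).symm.trans
      (LinearMap.congr_fun (h.commute_degree r) x)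
  have h2 : (r.2 : ℝ) • π r x = w • π r x := by
    rw [show w • π r x = π r (N x) by rw [hw, map_smul]]
    exact (LinearMap.congr_fun (h.weight_mul r) x).symm.trans
      (LinearMap.congr_fun (h.commute_weight r) x)
  by_contra h0
  exact hr ⟨smul_left_injective ℝ h0 h1, smul_left_injective ℝ h0 h2⟩

theorem sum_apply (x : A) :
    ∑ r ∈ Finset.range (n + 1) ×ˢ Finset.range (n + 1), π r x = x := by
  conv_rhs => rw [← Module.End.one_apply (R := ℝ) x, ← h.sum_eq, LinearMap.sum_apply]

theorem eigen_of_bracket {T : Module.End ℝ A} {k c : ℤ} (hk : H * T - T * H = (k : ℝ) • T)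
    (hc : N * T - T * N = (c : ℝ) • T) (r : ℕ × ℕ) (x : A) :
    H (T (π r x)) = ((r.1 : ℝ) + r.2 + k) • T (π r x) ∧
      N (T (π r x)) = ((r.2 : ℝ) + c) • T (π r x) := by
  constructor
  · have h1 := LinearMap.congr_fun hk (π r x)
    have h2 := LinearMap.congr_fun (h.degree_mul r) x
    simp only [LinearMap.sub_apply, Module.End.mul_apply, LinearMap.smul_apply] at h1 h2
    rw [h2, map_smul, sub_eq_iff_eq_add] at h1
    rw [h1]; module
  · have h1 := LinearMap.congr_fun hc (π r x)
    have h2 := LinearMap.congr_fun (h.weight_mul r) x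
    simp only [LinearMap.sub_apply, Module.End.mul_apply, LinearMap.smul_apply] at h1 h2
    rw [h2, map_smul, sub_eq_iff_eq_add] at h1
    rw [h1]; module

/-- The component of bidegree `(k - b, b)` of a sum of operators of degree `k`
and weights `c ∈ S`. -/
theorem component {S : Finset ℤ} {T : ℤ → Module.End ℝ A} {k : ℤ}
    (hk : ∀ c ∈ S, H * T c - T c * H = (k : ℝ) • T c)
    (hc : ∀ c ∈ S, N * T c - T c * N = (c : ℝ) • T c) {b : ℤ} (hb : b ∈ S) (x : A) :
    (∑ r ∈ Finset.range (n + 1) ×ˢ Finset.range (n + 1),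
      ∑ s ∈ Finset.range (n + 1) ×ˢ Finset.range (n + 1),
        if (s.1 : ℤ) = r.1 + (k - b) ∧ (s.2 : ℤ) = r.2 + b then
          π s (∑ c ∈ S, T c (π r x)) else 0) = T b x := by
  -- The condition on `(r, s)` is automatic: the projections annihilate every term whose degree or
  -- weight does not match. What remains is a sum over all projections, which is the identity.
  have key : ∀ r s : ℕ × ℕ, (if (s.1 : ℤ) = r.1 + (k - b) ∧ (s.2 : ℤ) = r.2 + b then
      π s (∑ c ∈ S, T c (π r x)) else 0) = π s (T b (π r x)) := by
    intro r s
    split_ifs with hs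
    · rw [map_sum, Finset.sum_eq_single_of_mem b hb fun c hcS hcb => ?_]
      obtain ⟨e1, e2⟩ := h.eigen_of_bracket (hk c hcS) (hc c hcS) r x
      refine h.apply_eq_zero e1 e2 fun hh => hcb ?_
      have h2 : ((s.2 : ℤ) : ℝ) = ((r.2 + c : ℤ) : ℝ) := by push_cast; exact hh.2
      have h3 := Int.cast_injective h2
      linarith [hs.2]
    · obtain ⟨e1, e2⟩ := h.eigen_of_bracket (hk b hb) (hc b hb) r x
      refine (h.apply_eq_zero e1 e2 fun hh => hs ?_).symm
      have h2 : ((s.2 : ℤ) : ℝ) = ((r.2 + b : ℤ) : ℝ) := by push_cast; exact hh.2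
      have h1 : ((s.1 + s.2 : ℤ) : ℝ) = ((r.1 + r.2 + k : ℤ) : ℝ) := by push_cast; exact hh.1
      have h3 := Int.cast_injective h2
      have h4 := Int.cast_injective h1
      exact ⟨by linarith, h3⟩
  simp only [key]
  simp only [h.sum_apply]
  rw [← map_sum, h.sum_apply]

end IsBigrading

theorem aeval_apply_of_eigen {A : Type*} [AddCommGroup A] [Module ℝ A] {N : Module.End ℝ A}
    {x : A} {c : ℝ} (hx : N x = c • x) (p : ℝ[X]) : aeval N p x = p.eval c • x := by
  induction p using Polynomial.induction_on' with
  | add p q hp hq => rw [map_add, LinearMap.add_apply, hp, hq, eval_add, add_smul]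
  | monomial k a =>
    rw [aeval_monomial, eval_monomial, ← Algebra.smul_def, LinearMap.smul_apply, mul_smul]
    congr 1
    induction k with
    | zero => simp
    | succ k ih => rw [pow_succ', Module.End.mul_apply, ih, map_smul, hx, smul_smul, pow_succ]

variable {V : Type*} [AddCommGroup V] [Module ℝ V]

theorem mul_eigen [FiniteDimensional ℝ V] {f : Module.End ℝ V} {S T : Submodule ℝ (ExtForms V)}
    {s t : ℝ} (hS : ∀ x ∈ S, dualDerivation f x = s • x) (hT : ∀ x ∈ T, dualDerivation f x = t • x) :
    ∀ x ∈ S * T, dualDerivation f x = (s + t) • x := by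
  intro x hx
  refine Submodule.mul_induction_on hx (fun x hx y hy => ?_) (fun x y hx hy => ?_)
  · rw [dualDerivation_mul, hS x hx, hT y hy, smul_mul_assoc, mul_smul_comm, add_smul]
  · rw [map_add, hx, hy, smul_add]

theorem pow_eigen [FiniteDimensional ℝ V] {f : Module.End ℝ V} {S : Submodule ℝ (ExtForms V)}
    {s : ℝ} (hS : ∀ x ∈ S, dualDerivation f x = s • x) (k : ℕ) :
    ∀ x ∈ S ^ k, dualDerivation f x = ((k : ℝ) * s) • x := by
  induction k with
  | zero =>
    intro x hx
    rw [pow_zero, Submodule.one_eq_range] at hx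
    obtain ⟨r, rfl⟩ := hx
    simp [Algebra.algebraMap_eq_smul_one, dualDerivation_one]
  | succ k ih =>
    intro x hx
    rw [pow_succ] at hx
    rw [mul_eigen ih hS x hx]
    push_cast; module

variable {L L' : Submodule ℝ V}

theorem bidegPart_le_exteriorPower (p q : ℕ) :
    bidegPart L L' p q ≤ ⋀[ℝ]^(p + q) (Module.Dual ℝ V) := by
  have h : ∀ K : Submodule ℝ (Module.Dual ℝ V), K.map (ι ℝ) ≤ LinearMap.range (ι ℝ) :=
    fun K => LinearMap.map_le_range
  rw [exteriorPower, pow_add]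
  exact mul_le_mul' (pow_le_pow_left' (h _) p)
    (pow_le_pow_left' (h _) q)

/-- Products of `p` elements of a subspace come from its own exterior power, which vanishes above
its dimension. -/
theorem range_ι_comp_pow_eq_bot {W U : Type*} [AddCommGroup W] [Module ℝ W] [AddCommGroup U]
    [Module ℝ U] [FiniteDimensional ℝ W] (g : W →ₗ[ℝ] U) {p : ℕ} (hp : Module.finrank ℝ W < p) :
    LinearMap.range (ι ℝ ∘ₗ g) ^ p = ⊥ := by
  have h1 : LinearMap.range (ι ℝ ∘ₗ g) = (LinearMap.range (ι ℝ (M := W))).map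
      (ExteriorAlgebra.map g).toLinearMap := by
    rw [← map_comp_ι, LinearMap.range_comp]
  have h2 : LinearMap.range (ι ℝ (M := W)) ^ p = ⊥ := by
    have : ⋀[ℝ]^p W = ⊥ := by
      rw [← Submodule.finrank_eq_zero, exteriorPower.finrank_eq, Nat.choose_eq_zero_of_lt hp]
    exact this
  rw [h1, ← Submodule.map_pow, h2, Submodule.map_bot]

theorem map_ι_pow_eq_bot [FiniteDimensional ℝ V] {K : Submodule ℝ (Module.Dual ℝ V)} {p : ℕ}
    (hp : Module.finrank ℝ K < p) : K.map (ι ℝ) ^ p = ⊥ := by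
  have h := range_ι_comp_pow_eq_bot (W := K) (U := Module.Dual ℝ V) K.subtype (p := p) hp
  rwa [LinearMap.range_comp, Submodule.range_subtype] at h

theorem bidegPart_eq_bot [FiniteDimensional ℝ V] {n : ℕ}
    (hL : Module.finrank ℝ L.dualAnnihilator = n) (hL' : Module.finrank ℝ L'.dualAnnihilator = n)
    {r : ℕ × ℕ} (hr : r ∉ Finset.range (n + 1) ×ˢ Finset.range (n + 1)) :
    bidegPart L L' r.1 r.2 = ⊥ := by
  rw [Finset.mem_product, Finset.mem_range, Finset.mem_range, not_and_or] at hr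
  rw [bidegPart]
  rcases hr with hr | hr
  · rw [map_ι_pow_eq_bot (by omega), Submodule.bot_mul]
  · rw [map_ι_pow_eq_bot (K := L'.dualAnnihilator) (by omega), Submodule.mul_bot]

theorem map_ι_mul_comm_le (A B : Submodule ℝ (Module.Dual ℝ V)) :
    A.map (ι ℝ) * B.map (ι ℝ) ≤ B.map (ι ℝ) * A.map (ι ℝ) := by
  rw [Submodule.mul_le]
  rintro _ ⟨a, ha, rfl⟩ _ ⟨b, hb, rfl⟩
  rw [eq_neg_of_add_eq_zero_left (ι_add_mul_swap a b)]
  exact neg_mem (Submodule.mul_mem_mul ⟨b, hb, rfl⟩ ⟨a, ha, rfl⟩)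

theorem map_ι_commute (A B : Submodule ℝ (Module.Dual ℝ V)) :
    Commute (A.map (ι ℝ)) (B.map (ι ℝ)) :=
  le_antisymm (map_ι_mul_comm_le A B) (map_ι_mul_comm_le B A)

variable [FiniteDimensional ℝ V] (h : IsCompl L L')

theorem comp_projection_mem (a : Module.Dual ℝ V) :
    a ∘ₗ L.projection L' h ∈ L'.dualAnnihilator := by
  rw [Submodule.mem_dualAnnihilator]
  intro v hv
  rw [LinearMap.comp_apply, (Submodule.projection_apply_eq_zero_iff h).mpr hv, map_zero]

theorem sub_comp_projection_mem (a : Module.Dual ℝ V) :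
    a - a ∘ₗ L.projection L' h ∈ L.dualAnnihilator := by
  rw [Submodule.mem_dualAnnihilator]
  intro v hv
  rw [LinearMap.sub_apply, LinearMap.comp_apply, (Submodule.projection_eq_self_iff h v).mpr hv,
    sub_self]

theorem comp_projection_of_left {a : Module.Dual ℝ V} (ha : a ∈ L.dualAnnihilator) :
    a ∘ₗ L.projection L' h = 0 := by
  ext v
  exact (Submodule.mem_dualAnnihilator a).mp ha _ (Submodule.projection_apply_mem h v)

theorem comp_projection_of_right {a : Module.Dual ℝ V} (ha : a ∈ L'.dualAnnihilator) :
    a ∘ₗ L.projection L' h = a := by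
  ext v
  have h1 := Submodule.projection_add_projection_eq_self h v
  conv_rhs => rw [← h1, map_add,
    (Submodule.mem_dualAnnihilator a).mp ha _ (Submodule.projection_apply_mem h.symm v), add_zero]
  rfl

/-- Composition with the projection onto `L` along `L'` kills the covectors vanishing on `L` and
fixes those vanishing on `L'`, so the derivation counts the factors of the second kind. -/
theorem dualDerivation_projection_of_mem {p q : ℕ} {x : ExtForms V}
    (hx : x ∈ bidegPart L L' p q) : dualDerivation (L.projection L' h) x = (q : ℝ) • x := by
  have h1 : ∀ x ∈ L.dualAnnihilator.map (ι ℝ),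
      dualDerivation (L.projection L' h) x = (0 : ℝ) • x := by
    rintro _ ⟨a, ha, rfl⟩
    rw [dualDerivation_ι, comp_projection_of_left h ha, map_zero, zero_smul]
  have h2 : ∀ x ∈ L'.dualAnnihilator.map (ι ℝ),
      dualDerivation (L.projection L' h) x = (1 : ℝ) • x := by
    rintro _ ⟨a, ha, rfl⟩
    rw [dualDerivation_ι, comp_projection_of_right h ha, one_smul]
  have := mul_eigen (pow_eigen h1 p) (pow_eigen h2 q) x hx
  simpa using this

theorem iSup_bidegPart (h : IsCompl L L') : ⨆ r : ℕ × ℕ, bidegPart L L' r.1 r.2 = ⊤ := by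
  refine eq_top_iff.mpr fun α _ => ?_
  induction α using extForms_induction with
  | h0 r =>
    refine Submodule.mem_iSup_of_mem (0, 0) ?_
    simp only [bidegPart, pow_zero, mul_one]
    exact Submodule.algebraMap_mem r
  | hadd α β hα hβ => exact add_mem (hα trivial) (hβ trivial)
  | hι a α hα =>
    have hα := hα trivial
    refine Submodule.iSup_induction _ (motive := fun α => ι ℝ a * α ∈ _) hα (fun r x hx => ?_)
      (by simp) (fun x y hx hy => by rw [mul_add]; exact add_mem hx hy)
    rw [show a = (a - a ∘ₗ L.projection L' h) + a ∘ₗ L.projection L' h by abel, map_add, add_mul]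
    refine add_mem (Submodule.mem_iSup_of_mem (r.1 + 1, r.2) ?_)
      (Submodule.mem_iSup_of_mem (r.1, r.2 + 1) ?_)
    · simp only [bidegPart]
      rw [pow_succ', mul_assoc]
      exact Submodule.mul_mem_mul ⟨_, sub_comp_projection_mem h a, rfl⟩ hx
    · simp only [bidegPart]
      rw [pow_succ', ← mul_assoc, ((map_ι_commute _ _).pow_left r.1).eq, mul_assoc]
      exact Submodule.mul_mem_mul ⟨_, comp_projection_mem h a, rfl⟩ hx

/-- The polynomial expression in the degree and in `N` projecting onto degree `p + q` and
weight `q`. -/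
def bidegOp (N : Module.End ℝ V) (r : ℕ × ℕ) : Module.End ℝ (ExtForms V) :=
  gradedScale (Pi.single (r.1 + r.2) 1) * aeval (dualDerivation N)
    (Lagrange.basis (Finset.range (r.1 + r.2 + 1)) (fun j : ℕ => (j : ℝ)) r.2)

theorem bidegOp_of_mem {r s : ℕ × ℕ} {x : ExtForms V} (hx : x ∈ bidegPart L L' s.1 s.2) :
    bidegOp (L.projection L' h) r x = if r = s then x else 0 := by
  rw [bidegOp, Module.End.mul_apply, aeval_apply_of_eigen (dualDerivation_projection_of_mem h hx),
    map_smul, gradedScale_of_mem _ (bidegPart_le_exteriorPower _ _ hx)]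
  split_ifs with hrs
  · subst hrs
    rw [Lagrange.eval_basis_self (v := fun j : ℕ => (j : ℝ)) (Nat.cast_injective.injOn)
      (Finset.mem_range.mpr (by omega))]
    simp
  -- In total degree `p + q` the possible weights are `0, …, p + q`, exactly the interpolation
  -- nodes, so a wrong weight is a root of the basis polynomial; a wrong total degree is removed by
  -- the degree projection.
  · by_cases hd : s.1 + s.2 = r.1 + r.2
    · rw [Lagrange.eval_basis_of_ne (v := fun j : ℕ => (j : ℝ)) (i := r.2) (j := s.2) (fun h2 =>
        hrs (Prod.ext (by omega) h2)) (Finset.mem_range.mpr (by omega)), zero_smul]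
    · rw [Pi.single_eq_of_ne hd, zero_smul, smul_zero]

theorem linearMap_ext_bideg (h : IsCompl L L') {W : Type*} [AddCommGroup W] [Module ℝ W]
    {S T : ExtForms V →ₗ[ℝ] W}
    (hST : ∀ r : ℕ × ℕ, ∀ x ∈ bidegPart L L' r.1 r.2, S x = T x) : S = T := by
  refine LinearMap.ext fun α => ?_
  have hα : α ∈ ⨆ r : ℕ × ℕ, bidegPart L L' r.1 r.2 := by rw [iSup_bidegPart h]; trivial
  exact Submodule.iSup_induction _ (motive := fun α => S α = T α) hα hST (by simp)
    fun x y hx hy => by rw [map_add, map_add, hx, hy]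

theorem bidegOp_mem (r : ℕ × ℕ) (α : ExtForms V) :
    bidegOp (L.projection L' h) r α ∈ bidegPart L L' r.1 r.2 := by
  have hα : α ∈ ⨆ r : ℕ × ℕ, bidegPart L L' r.1 r.2 := by rw [iSup_bidegPart h]; trivial
  refine Submodule.iSup_induction _ (motive := fun α => bidegOp (L.projection L' h) r α ∈ _) hα
    (fun s x hx => ?_) (by simp) fun x y hx hy => by rw [map_add]; exact add_mem hx hy
  rw [bidegOp_of_mem h hx]
  split_ifs with hrs
  · exact hrs ▸ hx
  · exact zero_mem _

/-- The chosen component is unique because the sum of the parts is direct. Its expression as a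
polynomial in two operators is what later gives linearity and smoothness. -/
theorem bidegProj_eq (r : ℕ × ℕ) (α : ExtForms V) :
    bidegProj L L' r.1 r.2 α = bidegOp (L.projection L' h) r α := by
  have hsup : ∀ x ∈ ⨆ (s : ℕ × ℕ) (_ : s ≠ (r.1, r.2)), bidegPart L L' s.1 s.2,
      bidegOp (L.projection L' h) r x = 0 := by
    intro x hx
    rw [← LinearMap.mem_ker]
    refine (iSup₂_le fun s hs y hy => ?_ : (⨆ (s : ℕ × ℕ) (_ : s ≠ (r.1, r.2)),
      bidegPart L L' s.1 s.2) ≤ LinearMap.ker (bidegOp (L.projection L' h) r)) hx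
    rw [LinearMap.mem_ker, bidegOp_of_mem h hy, if_neg (Ne.symm hs)]
  have hex : α - bidegOp (L.projection L' h) r α ∈
      ⨆ (s : ℕ × ℕ) (_ : s ≠ (r.1, r.2)), bidegPart L L' s.1 s.2 := by
    have hα : α ∈ ⨆ r : ℕ × ℕ, bidegPart L L' r.1 r.2 := by rw [iSup_bidegPart h]; trivial
    refine Submodule.iSup_induction _ (motive := fun α => α - bidegOp (L.projection L' h) r α ∈ _)
      hα (fun s x hx => ?_) (by simp) fun x y hx hy => ?_
    · rw [bidegOp_of_mem h hx]
      split_ifs with hrs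
      · rw [sub_self]; exact zero_mem _
      · rw [sub_zero]
        exact Submodule.mem_iSup_of_mem s (Submodule.mem_iSup_of_mem (Ne.symm hrs) hx)
    · rw [map_add, add_sub_add_comm]; exact add_mem hx hy
  obtain ⟨h1, h2⟩ := Classical.epsilon_spec (p := fun γ => γ ∈ bidegPart L L' r.1 r.2 ∧
    α - γ ∈ ⨆ (s : ℕ × ℕ) (_ : s ≠ (r.1, r.2)), bidegPart L L' s.1 s.2)
    ⟨_, bidegOp_mem h r α, hex⟩
  have h3 := hsup _ h2
  rw [map_sub, sub_eq_zero, bidegOp_of_mem h (s := r) h1, if_pos rfl] at h3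
  rw [h3]; rfl

theorem isBigrading_bidegOp {n : ℕ}
    (hL : Module.finrank ℝ L.dualAnnihilator = n) (hL' : Module.finrank ℝ L'.dualAnnihilator = n) :
    IsBigrading n (gradedScale fun k => (k : ℝ)) (dualDerivation (L.projection L' h))
      (bidegOp (L.projection L' h)) := by
  have hd : ∀ r : ℕ × ℕ, ∀ x ∈ bidegPart L L' r.1 r.2,
      gradedScale (fun k => (k : ℝ)) x = ((r.1 : ℝ) + r.2) • x := fun r x hx => by
    rw [gradedScale_of_mem _ (bidegPart_le_exteriorPower _ _ hx), Nat.cast_add]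
  have hw : ∀ r : ℕ × ℕ, ∀ x ∈ bidegPart L L' r.1 r.2,
      dualDerivation (L.projection L' h) x = (r.2 : ℝ) • x := fun r x hx =>
    dualDerivation_projection_of_mem h hx
  refine ⟨fun r => ?_, fun r => ?_, fun r => ?_, fun r => ?_, ?_⟩
  · refine LinearMap.ext fun x => hd r _ (bidegOp_mem h r x)
  · refine LinearMap.ext fun x => hw r _ (bidegOp_mem h r x)
  · refine linearMap_ext_bideg h fun s x hx => ?_
    rw [Module.End.mul_apply, Module.End.mul_apply, hd s x hx, map_smul, bidegOp_of_mem h hx]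
    split_ifs with hrs
    · rw [hd s x hx]
    · simp
  · refine linearMap_ext_bideg h fun s x hx => ?_
    rw [Module.End.mul_apply, Module.End.mul_apply, hw s x hx, map_smul, bidegOp_of_mem h hx]
    split_ifs with hrs
    · rw [hw s x hx]
    · simp
  · refine linearMap_ext_bideg h fun s x hx => ?_
    rw [LinearMap.sum_apply, Module.End.one_apply]
    simp only [bidegOp_of_mem h hx]
    rw [Finset.sum_ite_eq']
    split_ifs with hs
    · rfl
    · rw [bidegPart_eq_bot hL hL' hs] at hx
      exact ((Submodule.mem_bot ℝ).mp hx).symm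

theorem toBilin_sub (η ζ : ExtForms V) : toBilin (η - ζ) = toBilin η - toBilin ζ := by
  ext u v
  change algebraMapInv (interior v (interior u (η - ζ))) =
    algebraMapInv (interior v (interior u η)) - algebraMapInv (interior v (interior u ζ))
  rw [map_sub, map_sub, map_sub]

theorem toBilin_dualDerivation (f : Module.End ℝ V) {η : ExtForms V}
    (hη : η ∈ ⋀[ℝ]^2 (Module.Dual ℝ V)) (u v : V) :
    toBilin (dualDerivation f η) u v = toBilin η (f u) v + toBilin η u (f v) := by
  refine two_form_induction (P := fun η => toBilin (dualDerivation f η) u v =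
    toBilin η (f u) v + toBilin η u (f v)) (fun α β hα hβ => ?_) (fun a b => ?_) hη
  · simp only [map_add, toBilin_add, LinearMap.add_apply, hα, hβ]; ring
  · rw [dualDerivation_ι_mul, dualDerivation_ι, toBilin_add]
    simp only [LinearMap.add_apply, toBilin_ι_mul_ι, LinearMap.comp_apply]
    ring

/-- The part of weight two of a `2`-form is its restriction to `L`. -/
theorem toBilin_dualDerivation_sq {f : Module.End ℝ V} (hf : f * f = f) {η : ExtForms V}
    (hη : η ∈ ⋀[ℝ]^2 (Module.Dual ℝ V)) (u v : V) :
    toBilin (dualDerivation f (dualDerivation f η - η)) u v = 2 * toBilin η (f u) (f v) := by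
  have hf' : ∀ w, f (f w) = f w := fun w => LinearMap.congr_fun hf w
  have h1 := toBilin_dualDerivation f (dualDerivation_mem f hη) u v
  have h2 := toBilin_dualDerivation f hη u v
  rw [map_sub, toBilin_sub, LinearMap.sub_apply, LinearMap.sub_apply, h1, h2,
    toBilin_dualDerivation f hη, toBilin_dualDerivation f hη, hf', hf']
  ring

/-- Both subspaces are isotropic, so `σ` is purely of type `(1, 1)`. -/
theorem dualDerivation_symplectic {σ : ExtForms V} (hσ : σ ∈ ⋀[ℝ]^2 (Module.Dual ℝ V))
    (hL : ∀ u ∈ L, ∀ v ∈ L, toBilin σ u v = 0) (hL' : ∀ u ∈ L', ∀ v ∈ L', toBilin σ u v = 0) :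
    dualDerivation (L.projection L' h) σ = σ := by
  rw [← sub_eq_zero]
  refine eq_zero_of_toBilin_eq_zero (sub_mem (dualDerivation_mem _ hσ) hσ) fun u v => ?_
  rw [toBilin_sub, LinearMap.sub_apply, LinearMap.sub_apply, toBilin_dualDerivation _ hσ]
  have hu := Submodule.projection_add_projection_eq_self h u
  have hv := Submodule.projection_add_projection_eq_self h v
  set Pu := L.projection L' h u
  set Pv := L.projection L' h v
  have h1 : toBilin σ Pu Pv = 0 := hL _ (Submodule.projection_apply_mem h u) _
    (Submodule.projection_apply_mem h v)
  have h2 := hL' _ (Submodule.projection_apply_mem h.symm u) _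
    (Submodule.projection_apply_mem h.symm v)
  rw [← hu, ← hv]
  simp only [map_add, LinearMap.add_apply, h1, h2]
  ring

/-- On a contraction with `s a` the derivation acts through the vector, contragrediently; the
hypothesis transfers this to the covector `a`. -/
theorem dualDerivation_bracket_adjMul {f g : Module.End ℝ V} {s : Module.Dual ℝ V →ₗ[ℝ] V}
    (hfg : ∀ a, f (s a) = s (a ∘ₗ g)) (η : ExtForms V) :
    dualDerivation f * adjMul s η - adjMul s η * dualDerivation f =
      -adjMul s (dualDerivation g η) := by
  induction η using extForms_induction with
  | h0 r =>
    rw [Algebra.algebraMap_eq_smul_one, map_smul, map_smul, dualDerivation_one, smul_zero, map_zero,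
      adjMul_one]
    simp
  | hadd α β hα hβ => 
    rw [map_add, map_add, map_add, mul_add, add_mul, add_sub_add_comm, hα, hβ, neg_add]
  | hι a α hα =>
    have h1 : dualDerivation f * interior (s a) - interior (s a) * dualDerivation f =
        -interior (s (a ∘ₗ g)) := by
      refine LinearMap.ext fun β => ?_
      rw [← hfg]
      exact dualDerivation_mul_interior f (s a) β
    rw [dualDerivation_ι_mul, map_add, adjMul_ι_mul, adjMul_ι_mul, adjMul_ι_mul]
    have e1 : dualDerivation f * adjMul s α = adjMul s α * dualDerivation f -
        adjMul s (dualDerivation g α) := by rw [← sub_eq_zero, ← sub_eq_zero.mpr hα]; abel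
    have e2 : dualDerivation f * interior (s a) = interior (s a) * dualDerivation f -
        interior (s (a ∘ₗ g)) := by rw [← sub_eq_zero, ← sub_eq_zero.mpr h1]; abel
    rw [← mul_assoc, e1, sub_mul, mul_assoc, e2, mul_sub, mul_assoc]
    abel

/-- `[N, Λ] = -Λ`. -/
theorem IsSharp.weight_lambda {σ : ExtForms V} {s : Module.Dual ℝ V →ₗ[ℝ] V} (hs : IsSharp σ s)
    (hL : ∀ u ∈ L, ∀ v ∈ L, toBilin σ u v = 0) (hL' : ∀ u ∈ L', ∀ v ∈ L', toBilin σ u v = 0) :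
    dualDerivation (L.projection L' h) * adjMul s σ - adjMul s σ * dualDerivation (L.projection L' h) =
      -adjMul s σ := by
  rw [dualDerivation_bracket_adjMul (g := L'.projection L h.symm), dualDerivation_symplectic h.symm
    hs.mem hL' hL]
  intro a
  -- As both subspaces are isotropic, `σ` exchanges the two projections: `σ(P u, v) = σ(u, P' v)`.
  have key : toBilin σ (L.projection L' h (s a)) = a ∘ₗ L'.projection L h.symm := by
    ext v
    have hv := Submodule.projection_add_projection_eq_self h v
    have h1 := hL _ (Submodule.projection_apply_mem h (s a)) _ (Submodule.projection_apply_mem h v)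
    have h2 := hL' _ (Submodule.projection_apply_mem h.symm (s a)) _
      (Submodule.projection_apply_mem h.symm v)
    conv_lhs => rw [← hv]
    rw [map_add, h1, zero_add, LinearMap.comp_apply]
    conv_rhs => rw [← hs.toBilin_sharp a, ← Submodule.projection_add_projection_eq_self h (s a),
      map_add, LinearMap.add_apply, h2, add_zero]
  rw [← key, hs.sharp_toBilin]

end Bigrading

/-! ### Exterior calculus on the model space -/

section Coordinates

open ExteriorAlgebra Topology

variable {n : ℕ}

/-- The norm of the coefficient vector. It serves only to speak of derivatives, and in finite
dimension its choice is immaterial. -/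
instance : NormedAddCommGroup (ExtForms (Model n)) :=
  NormedAddCommGroup.induced _ _ (formBasis n).equivFun.toLinearMap (formBasis n).equivFun.injective

instance : NormedSpace ℝ (ExtForms (Model n)) :=
  NormedSpace.induced _ _ _ (formBasis n).equivFun.toLinearMap

instance : FiniteDimensional ℝ (ExtForms (Model n)) := (formBasis n).finiteDimensional_of_finite

section Smoothness

variable {X : Type*} [NormedAddCommGroup X] [NormedSpace ℝ X] {x : X}
  {F G K : Type*} [NormedAddCommGroup F] [NormedSpace ℝ F] [FiniteDimensional ℝ F]
  [NormedAddCommGroup G] [NormedSpace ℝ G] [NormedAddCommGroup K] [NormedSpace ℝ K]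
  {m : WithTop ℕ∞}

theorem contDiffAt_linear (l : F →ₗ[ℝ] G) {f : X → F} (hf : ContDiffAt ℝ m f x) :
    ContDiffAt ℝ m (fun z => l (f z)) x :=
  (LinearMap.toContinuousLinearMap l).contDiff.contDiffAt.comp x hf

theorem contDiffAt_bilinear [FiniteDimensional ℝ G] (b : F →ₗ[ℝ] G →ₗ[ℝ] K) {f : X → F}
    {g : X → G} (hf : ContDiffAt ℝ m f x) (hg : ContDiffAt ℝ m g x) :
    ContDiffAt ℝ m (fun z => b (f z) (g z)) x :=
  (b.toContinuousBilinearMap.isBoundedBilinearMap.contDiff.contDiffAt.comp x (hf.prodMk hg) :)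

theorem contDiffAt_forms_iff {f : X → ExtForms (Model n)} :
    ContDiffAt ℝ m f x ↔ ∀ S, ContDiffAt ℝ m (fun z => (formBasis n).repr (f z) S) x := by
  refine ⟨fun hf S => contDiffAt_linear ((formBasis n).coord S) hf, fun h => ?_⟩
  have e : f = fun z => ∑ S, (formBasis n).repr (f z) S • formBasis n S := by
    ext z; rw [(formBasis n).sum_repr]
  rw [e]
  exact ContDiffAt.sum fun S _ => (h S).smul contDiffAt_const

theorem contDiffAt_mul {f g : X → ExtForms (Model n)} (hf : ContDiffAt ℝ m f x)
    (hg : ContDiffAt ℝ m g x) : ContDiffAt ℝ m (fun z => f z * g z) x :=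
  contDiffAt_bilinear (LinearMap.mul ℝ (ExtForms (Model n))) hf hg

/-- A family of linear operators is smooth if it maps constant forms to smooth ones. -/
theorem contDiffAt_apply {T : X → Module.End ℝ (ExtForms (Model n))} {f : X → ExtForms (Model n)}
    (hT : ∀ β, ContDiffAt ℝ m (fun z => T z β) x) (hf : ContDiffAt ℝ m f x) :
    ContDiffAt ℝ m (fun z => T z (f z)) x := by
  have e : (fun z => T z (f z)) = fun z =>
      ∑ S, (formBasis n).repr (f z) S • T z (formBasis n S) := by
    ext z
    conv_lhs => rw [← (formBasis n).sum_repr (f z), map_sum]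
    simp only [map_smul]
  rw [e]
  exact ContDiffAt.sum fun S _ => (contDiffAt_forms_iff.mp hf S).smul (hT _)

theorem contDiffAt_pullbackForm {T : X → Model n →L[ℝ] Model n} {f : X → ExtForms (Model n)}
    (hT : ContDiffAt ℝ m T x) (hf : ContDiffAt ℝ m f x) :
    ContDiffAt ℝ m (fun z => pullbackForm (T z).toLinearMap (f z)) x := by
  refine contDiffAt_apply (T := fun z => (pullbackForm (T z).toLinearMap).toLinearMap)
    (fun β => ?_) hf
  induction β using extForms_induction with
  | h0 r =>
    simp only [AlgHom.toLinearMap_apply, AlgHom.commutes]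
    exact contDiffAt_const
  | hadd α β hα hβ => simp only [map_add]; exact hα.add hβ
  | hι a β hβ =>
    simp only [AlgHom.toLinearMap_apply, map_mul]
    refine contDiffAt_mul ?_ hβ
    let l : (Model n →L[ℝ] Model n) →ₗ[ℝ] ExtForms (Model n) :=
      { toFun := fun T => ι ℝ (a ∘ₗ T.toLinearMap)
        map_add' := fun S T => by
          rw [← map_add]; congr 1; ext v; simp
        map_smul' := fun c T => by
          rw [RingHom.id_apply, ← map_smul]; congr 1; ext v; simp }
    have e : (fun z => pullbackForm (T z).toLinearMap (ι ℝ a)) = fun z => l (T z) := by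
      ext z
      rw [pullbackForm, map_apply_ι]; rfl
    rw [e]
    exact contDiffAt_linear l hT

theorem fderiv_linear (l : F →ₗ[ℝ] G) {f : X → F} (hf : DifferentiableAt ℝ f x) (v : X) :
    fderiv ℝ (fun z => l (f z)) x v = l (fderiv ℝ f x v) := by
  have := ((LinearMap.toContinuousLinearMap l).hasFDerivAt.comp x hf.hasFDerivAt).fderiv
  exact DFunLike.congr_fun this v

end Smoothness

theorem fderiv_mul_forms {f g : Model n → ExtForms (Model n)} {y : Model n}
    (hf : DifferentiableAt ℝ f y) (hg : DifferentiableAt ℝ g y) (v : Model n) :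
    fderiv ℝ (fun z => f z * g z) y v = f y * fderiv ℝ g y v + fderiv ℝ f y v * g y := by
  have := ((LinearMap.mul ℝ (ExtForms (Model n))).toContinuousBilinearMap.hasFDerivAt_of_bilinear
    hf.hasFDerivAt hg.hasFDerivAt).fderiv
  exact DFunLike.congr_fun this v

theorem coordExtDeriv_eq {f : Model n → ExtForms (Model n)} {y : Model n}
    (hf : DifferentiableAt ℝ f y) :
    coordExtDeriv f y = ∑ i, ι ℝ (dualStdBasis n i) * fderiv ℝ f y (stdBasis n i) := by
  rw [coordExtDeriv, Finset.sum_comm]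
  refine Finset.sum_congr rfl fun i _ => ?_
  conv_rhs => rw [← (formBasis n).sum_repr (fderiv ℝ f y (stdBasis n i)), Finset.mul_sum]
  refine Finset.sum_congr rfl fun S _ => ?_
  rw [mul_smul_comm]
  congr 1
  exact fderiv_linear ((formBasis n).coord S) hf _

theorem coordExtDeriv_congr {f g : Model n → ExtForms (Model n)} {y : Model n}
    (h : f =ᶠ[𝓝 y] g) : coordExtDeriv f y = coordExtDeriv g y := by
  simp only [coordExtDeriv]
  refine Finset.sum_congr rfl fun S _ => Finset.sum_congr rfl fun i _ => ?_
  rw [Filter.EventuallyEq.fderiv_eq]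
  filter_upwards [h] with z hz
  rw [hz]

theorem coordExtDeriv_const (β : ExtForms (Model n)) (y : Model n) :
    coordExtDeriv (fun _ => β) y = 0 := by
  simp [coordExtDeriv]

theorem coordExtDeriv_add {f g : Model n → ExtForms (Model n)} {y : Model n}
    (hf : DifferentiableAt ℝ f y) (hg : DifferentiableAt ℝ g y) :
    coordExtDeriv (fun z => f z + g z) y = coordExtDeriv f y + coordExtDeriv g y := by
  rw [coordExtDeriv_eq hf, coordExtDeriv_eq hg, coordExtDeriv_eq (hf.fun_add hg),
    ← Finset.sum_add_distrib]
  refine Finset.sum_congr rfl fun i _ => ?_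
  rw [fderiv_fun_add hf hg, ← mul_add]; rfl

theorem coordExtDeriv_sum {κ : Type*} (s : Finset κ) {f : κ → Model n → ExtForms (Model n)}
    {y : Model n} (hf : ∀ k ∈ s, DifferentiableAt ℝ (f k) y) :
    coordExtDeriv (fun z => ∑ k ∈ s, f k z) y = ∑ k ∈ s, coordExtDeriv (f k) y := by
  classical
  induction s using Finset.induction_on with
  | empty => simp [coordExtDeriv_const]
  | insert k s hk ih =>
    simp only [Finset.sum_insert hk]
    rw [coordExtDeriv_add (hf k (Finset.mem_insert_self k s)), ih fun j hj => hf j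
      (Finset.mem_insert_of_mem hj)]
    exact DifferentiableAt.fun_sum fun j hj => hf j (Finset.mem_insert_of_mem hj)

theorem ι_mul_eq (a : Module.Dual ℝ (Model n)) (β : ExtForms (Model n)) :
    ι ℝ a * β = gradingInvolution (Model n) β * ι ℝ a := by
  rw [mul_ι, gradingInvolution_sq]

theorem coordExtDeriv_mul {f g : Model n → ExtForms (Model n)} {y : Model n}
    (hf : DifferentiableAt ℝ f y) (hg : DifferentiableAt ℝ g y) :
    coordExtDeriv (fun z => f z * g z) y =
      coordExtDeriv f y * g y + gradingInvolution (Model n) (f y) * coordExtDeriv g y := by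
  have hfg : DifferentiableAt ℝ (fun z => f z * g z) y :=
    ((LinearMap.mul ℝ (ExtForms (Model n))).toContinuousBilinearMap.hasFDerivAt_of_bilinear
      hf.hasFDerivAt hg.hasFDerivAt).differentiableAt
  rw [coordExtDeriv_eq hf, coordExtDeriv_eq hg, coordExtDeriv_eq hfg, Finset.sum_mul,
    Finset.mul_sum, ← Finset.sum_add_distrib]
  refine Finset.sum_congr rfl fun i _ => ?_
  rw [fderiv_mul_forms hf hg, mul_add, add_comm, ← mul_assoc, ← mul_assoc, ι_mul_eq _ (f y),
    mul_assoc (gradingInvolution _ _)]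

theorem sum_dual_smul (a : Module.Dual ℝ (Model n)) :
    ∑ i, a (stdBasis n i) • dualStdBasis n i = a := by
  refine (stdBasis n).ext fun j => ?_
  simp [dualStdBasis, LinearMap.sum_apply, Finsupp.single_apply]

theorem coordExtDeriv_function {φ : Model n → ℝ} {y : Model n} (hφ : DifferentiableAt ℝ φ y) :
    coordExtDeriv (fun z => algebraMap ℝ _ (φ z)) y = ι ℝ (fderiv ℝ φ y).toLinearMap := by
  have h : DifferentiableAt ℝ (fun z => algebraMap ℝ (ExtForms (Model n)) (φ z)) y := by
    simp only [Algebra.algebraMap_eq_smul_one]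
    exact hφ.smul_const _
  rw [coordExtDeriv_eq h, ← sum_dual_smul (fderiv ℝ φ y).toLinearMap, map_sum]
  refine Finset.sum_congr rfl fun i _ => ?_
  have e := fderiv_linear (Algebra.linearMap ℝ (ExtForms (Model n))) hφ (stdBasis n i)
  simp only [Algebra.linearMap_apply] at e
  rw [e, map_smul, ← Algebra.commutes, ← Algebra.smul_def]; rfl

/-- Exchanging the two indices changes the sign, so the sum equals its negative. Applied to
symmetric second derivatives. -/
theorem sum_ι_mul_symm {c : Fin (2 * n) → Fin (2 * n) → ExtForms (Model n)}
    (hc : ∀ i j, c i j = c j i) :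
    ∑ i, ι ℝ (dualStdBasis n i) * ∑ j, ι ℝ (dualStdBasis n j) * c i j = 0 := by
  have h : ∑ i, ι ℝ (dualStdBasis n i) * ∑ j, ι ℝ (dualStdBasis n j) * c i j =
      -∑ i, ι ℝ (dualStdBasis n i) * ∑ j, ι ℝ (dualStdBasis n j) * c i j := by
    simp only [Finset.mul_sum]
    conv_lhs => rw [Finset.sum_comm]
    rw [← Finset.sum_neg_distrib]
    refine Finset.sum_congr rfl fun i _ => ?_
    rw [← Finset.sum_neg_distrib]
    refine Finset.sum_congr rfl fun j _ => ?_
    rw [hc j i, ← mul_assoc, ← mul_assoc, ← neg_mul,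
      eq_neg_of_add_eq_zero_left (ι_add_mul_swap (dualStdBasis n j) (dualStdBasis n i))]
  have h2 : (2 : ℝ) • ∑ i, ι ℝ (dualStdBasis n i) * ∑ j, ι ℝ (dualStdBasis n j) * c i j = 0 := by
    rw [two_smul]; exact add_eq_zero_iff_eq_neg.mpr h
  exact (smul_eq_zero.mp h2).resolve_left two_ne_zero

theorem differentiableAt_of_contDiffAt_two {F : Type*} [NormedAddCommGroup F] [NormedSpace ℝ F]
    {f : Model n → F} {y : Model n} (hf : ContDiffAt ℝ 2 f y) :
    (∀ᶠ z in 𝓝 y, DifferentiableAt ℝ f z) ∧ DifferentiableAt ℝ (fderiv ℝ f) y := by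
  refine ⟨?_, (hf.fderiv_right (m := 1) (by norm_num)).differentiableAt (by norm_num)⟩
  filter_upwards [hf.eventually (by norm_num)] with z hz using hz.differentiableAt (by norm_num)

theorem coordExtDeriv_coordExtDeriv {f : Model n → ExtForms (Model n)} {y : Model n}
    (hf : ContDiffAt ℝ 2 f y) : coordExtDeriv (coordExtDeriv f) y = 0 := by
  obtain ⟨h1, h2⟩ := differentiableAt_of_contDiffAt_two hf
  have e : coordExtDeriv f =ᶠ[𝓝 y] fun z => ∑ i, LinearMap.mulLeft ℝ (ι ℝ (dualStdBasis n i))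
      (fderiv ℝ f z (stdBasis n i)) := by
    filter_upwards [h1] with z hz
    rw [coordExtDeriv_eq hz]; rfl
  have hd : ∀ i, DifferentiableAt ℝ (fun z => fderiv ℝ f z (stdBasis n i)) y := fun i =>
    h2.clm_apply (differentiableAt_const _)
  have hd' : ∀ i, DifferentiableAt ℝ (fun z => LinearMap.mulLeft ℝ (ι ℝ (dualStdBasis n i))
      (fderiv ℝ f z (stdBasis n i))) y := fun i =>
    (LinearMap.toContinuousLinearMap (LinearMap.mulLeft ℝ (ι ℝ
      (dualStdBasis n i)))).differentiableAt.comp y (hd i)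
  rw [coordExtDeriv_congr e, coordExtDeriv_eq (DifferentiableAt.fun_sum fun i _ => hd' i)]
  have e2 : ∀ j, fderiv ℝ (fun z => ∑ i, LinearMap.mulLeft ℝ (ι ℝ (dualStdBasis n i))
      (fderiv ℝ f z (stdBasis n i))) y (stdBasis n j) = ∑ i, ι ℝ (dualStdBasis n i) *
        fderiv ℝ (fderiv ℝ f) y (stdBasis n j) (stdBasis n i) := fun j => by
    rw [fderiv_fun_sum fun i _ => hd' i, sum_apply]
    refine Finset.sum_congr rfl fun i _ => ?_
    rw [fderiv_linear _ (hd i), LinearMap.mulLeft_apply, fderiv_clm_apply h2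
      (differentiableAt_const _)]
    simp
  simp only [e2]
  exact sum_ι_mul_symm fun i j => hf.isSymmSndFDerivAt (by simp) _ _

theorem pullbackForm_ι (T : Model n →ₗ[ℝ] Model n) (a : Module.Dual ℝ (Model n)) :
    pullbackForm T (ι ℝ a) = ι ℝ (a ∘ₗ T) := by
  rw [pullbackForm, map_apply_ι]; rfl

theorem differentiableAt_pullbackForm {T : Model n → Model n →L[ℝ] Model n} {y : Model n}
    {f : Model n → ExtForms (Model n)} (hT : ContDiffAt ℝ 1 T y) (hf : ContDiffAt ℝ 1 f y) :
    DifferentiableAt ℝ (fun z => pullbackForm (T z).toLinearMap (f z)) y :=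
  (contDiffAt_pullbackForm hT hf).differentiableAt (by norm_num)

/-- On covectors this is `d(dψʲ) = 0`, the symmetry of the second derivative; Leibniz extends it to
products. -/
theorem coordExtDeriv_pullback_const {ψ : Model n → Model n} {y : Model n}
    (hψ : ContDiffAt ℝ 2 ψ y) (β : ExtForms (Model n)) :
    coordExtDeriv (fun z => pullbackForm (fderiv ℝ ψ z).toLinearMap β) y = 0 := by
  have hT : ContDiffAt ℝ 1 (fderiv ℝ ψ) y := hψ.fderiv_right (by norm_num)
  have hdiff : ∀ β, DifferentiableAt ℝ (fun z => pullbackForm (fderiv ℝ ψ z).toLinearMap β) y :=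
    fun β => differentiableAt_pullbackForm hT contDiffAt_const
  induction β using extForms_induction with
  | h0 r => simp only [AlgHom.commutes]; exact coordExtDeriv_const _ _
  | hadd α β hα hβ =>
    simp only [map_add]
    rw [coordExtDeriv_add (hdiff α) (hdiff β), hα, hβ, add_zero]
  | hι a β hβ =>
    simp only [map_mul]
    rw [coordExtDeriv_mul (hdiff _) (hdiff _), hβ, mul_zero, add_zero]
    have h2 := (differentiableAt_of_contDiffAt_two hψ).2
    let l : (Model n →L[ℝ] Model n) →ₗ[ℝ] ExtForms (Model n) :=
      { toFun := fun T => ι ℝ (a ∘ₗ T.toLinearMap)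
        map_add' := fun S T => by
          rw [← map_add]; congr 1; ext v; simp
        map_smul' := fun c T => by
          rw [RingHom.id_apply, ← map_smul]; congr 1; ext v; simp }
    have e : (fun z => pullbackForm (fderiv ℝ ψ z).toLinearMap (ι ℝ a)) =
        fun z => l (fderiv ℝ ψ z) := by
      ext z
      rw [pullbackForm_ι]; rfl
    have e2 : ∀ i, fderiv ℝ (fun z => l (fderiv ℝ ψ z)) y (stdBasis n i) =
        ∑ j, ι ℝ (dualStdBasis n j) * algebraMap ℝ _
          (a (fderiv ℝ (fderiv ℝ ψ) y (stdBasis n i) (stdBasis n j))) := fun i => by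
      rw [fderiv_linear l h2]
      change ι ℝ _ = _
      rw [← sum_dual_smul (a ∘ₗ _), map_sum]
      refine Finset.sum_congr rfl fun j _ => ?_
      rw [map_smul, ← Algebra.commutes, ← Algebra.smul_def]; rfl
    rw [e, coordExtDeriv_eq (by rw [← e]; exact hdiff _)]
    simp only [e2]
    rw [sum_ι_mul_symm fun i j => by rw [hψ.isSymmSndFDerivAt (by simp)], zero_mul]

/-- The exterior derivative commutes with pull-backs. -/
theorem coordExtDeriv_pullback {ψ : Model n → Model n} {y : Model n} (hψ : ContDiffAt ℝ 2 ψ y)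
    {f : Model n → ExtForms (Model n)} (hf : ContDiffAt ℝ 1 f (ψ y)) :
    coordExtDeriv (fun z => pullbackForm (fderiv ℝ ψ z).toLinearMap (f (ψ z))) y =
      pullbackForm (fderiv ℝ ψ y).toLinearMap (coordExtDeriv f (ψ y)) := by
  have hT : ContDiffAt ℝ 1 (fderiv ℝ ψ) y := hψ.fderiv_right (by norm_num)
  have hψ' : DifferentiableAt ℝ ψ y := hψ.differentiableAt (by norm_num)
  have hS : ∀ S, DifferentiableAt ℝ (fun z => (formBasis n).repr (f z) S) (ψ y) := fun S =>
    (contDiffAt_forms_iff.mp hf S).differentiableAt (by norm_num)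
  have hc : ∀ S, DifferentiableAt ℝ (fun z => (formBasis n).repr (f (ψ z)) S) y := fun S =>
    (hS S).comp y hψ'
  have hdalg : ∀ {φ : Model n → ℝ} {x : Model n}, DifferentiableAt ℝ φ x →
      DifferentiableAt ℝ (fun z => algebraMap ℝ (ExtForms (Model n)) (φ z)) x := fun h => by
    simp only [Algebra.algebraMap_eq_smul_one]
    exact h.smul_const _
  have hdmul : ∀ {f g : Model n → ExtForms (Model n)} {x : Model n}, DifferentiableAt ℝ f x →
      DifferentiableAt ℝ g x → DifferentiableAt ℝ (fun z => f z * g z) x := fun h1 h2 =>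
    ((LinearMap.mul ℝ (ExtForms (Model n))).toContinuousBilinearMap.hasFDerivAt_of_bilinear
      h1.hasFDerivAt h2.hasFDerivAt).differentiableAt
  have hB : ∀ S, DifferentiableAt ℝ
      (fun z => pullbackForm (fderiv ℝ ψ z).toLinearMap (formBasis n S)) y := fun S =>
    differentiableAt_pullbackForm hT contDiffAt_const
  -- Expanding in constant basis forms reduces naturality to the chain rule for the coefficient
  -- functions.
  have e1 : f = fun z => ∑ S, algebraMap ℝ _ ((formBasis n).repr (f z) S) * formBasis n S := by
    ext z
    conv_lhs => rw [← (formBasis n).sum_repr (f z)]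
    simp only [Algebra.smul_def]
  have e2 : (fun z => pullbackForm (fderiv ℝ ψ z).toLinearMap (f (ψ z))) = fun z =>
      ∑ S, algebraMap ℝ _ ((formBasis n).repr (f (ψ z)) S) *
        pullbackForm (fderiv ℝ ψ z).toLinearMap (formBasis n S) := by
    ext z
    conv_lhs => rw [congr_fun e1 (ψ z)]
    simp only [map_sum, map_mul, AlgHom.commutes]
  have e3 : coordExtDeriv f (ψ y) = ∑ S, ι ℝ (fderiv ℝ (fun z => (formBasis n).repr (f z) S)
      (ψ y)).toLinearMap * formBasis n S := by
    conv_lhs => rw [e1]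
    rw [coordExtDeriv_sum _ fun S _ => hdmul (hdalg (hS S)) (differentiableAt_const _)]
    refine Finset.sum_congr rfl fun S _ => ?_
    rw [coordExtDeriv_mul (hdalg (hS S)) (differentiableAt_const _), coordExtDeriv_const,
      coordExtDeriv_function (hS S), mul_zero, add_zero]
  rw [e2, coordExtDeriv_sum _ fun S _ => hdmul (hdalg (hc S)) (hB S), e3, map_sum]
  refine Finset.sum_congr rfl fun S _ => ?_
  rw [coordExtDeriv_mul (hdalg (hc S)) (hB S), coordExtDeriv_pullback_const hψ, mul_zero, add_zero,
    coordExtDeriv_function (hc S), map_mul, pullbackForm_ι]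
  congr 2
  have := fderiv_comp y (hS S) hψ'
  ext v
  exact DFunLike.congr_fun this v

theorem contDiffAt_coordExtDeriv {f : Model n → ExtForms (Model n)} {y : Model n}
    (hf : ContDiffAt ℝ ∞ f y) : ContDiffAt ℝ ∞ (coordExtDeriv f) y := by
  unfold coordExtDeriv
  refine ContDiffAt.sum fun S _ => ContDiffAt.sum fun i _ => ContDiffAt.fun_smul ?_ contDiffAt_const
  exact ((contDiffAt_forms_iff.mp hf S).fderiv_right (m := ∞) (by simp)).clm_apply contDiffAt_const

end Coordinates

/-! ### Forms in charts and the exterior derivative on the manifold -/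

section Charts

open ExteriorAlgebra Topology

theorem pullbackForm_comp {U V W : Type*} [AddCommGroup U] [Module ℝ U] [AddCommGroup V]
    [Module ℝ V] [AddCommGroup W] [Module ℝ W] (f : V →ₗ[ℝ] W) (g : U →ₗ[ℝ] V) (α : ExtForms W) :
    pullbackForm (f ∘ₗ g) α = pullbackForm g (pullbackForm f α) := by
  induction α using extForms_induction with
  | h0 r => simp only [AlgHom.commutes]
  | hadd α β hα hβ => simp only [map_add, hα, hβ]
  | hι a α hα =>
    simp only [map_mul, hα]
    congr 1
    simp only [pullbackForm, map_apply_ι]; rfl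

theorem pullbackForm_id {V : Type*} [AddCommGroup V] [Module ℝ V] (α : ExtForms V) :
    pullbackForm (LinearMap.id : V →ₗ[ℝ] V) α = α := by
  induction α using extForms_induction with
  | h0 r => simp only [AlgHom.commutes]
  | hadd α β hα hβ => simp only [map_add, hα, hβ]
  | hι a α hα =>
    simp only [map_mul, hα]
    congr 1
    simp only [pullbackForm, map_apply_ι]; rfl

theorem pullbackForm_mem {V W : Type*} [AddCommGroup V] [Module ℝ V] [AddCommGroup W]
    [Module ℝ W] (f : V →ₗ[ℝ] W) {k : ℕ} {α : ExtForms W}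
    (hα : α ∈ ⋀[ℝ]^k (Module.Dual ℝ W)) : pullbackForm f α ∈ ⋀[ℝ]^k (Module.Dual ℝ V) := by
  induction k generalizing α with
  | zero =>
    obtain ⟨r, rfl⟩ := mem_exteriorPower_zero.mp hα
    rw [AlgHom.commutes]; exact algebraMap_mem r
  | succ k ih =>
    refine exteriorPower_induction (P := fun α => pullbackForm f α ∈ _)
      (fun α β hα hβ => by rw [map_add]; exact add_mem hα hβ) (fun a β hβ => ?_) hα
    rw [map_mul, pullbackForm, map_apply_ι]
    exact ι_mul_mem _ (ih hβ)

theorem pullbackForm_gradedScale {V W : Type*} [AddCommGroup V] [Module ℝ V] [AddCommGroup W]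
    [Module ℝ W] (f : V →ₗ[ℝ] W) (c : ℕ → ℝ) (α : ExtForms W) :
    pullbackForm f (gradedScale c α) = gradedScale c (pullbackForm f α) := by
  refine homogeneous_induction (P := fun α => pullbackForm f (gradedScale c α) =
    gradedScale c (pullbackForm f α)) (fun α β hα hβ => by simp only [map_add, hα, hβ])
    (fun k α hα => ?_) α
  rw [gradedScale_of_mem _ hα, map_smul, gradedScale_of_mem _ (pullbackForm_mem f hα)]

variable {n : ℕ} {M : Type*} [TopologicalSpace M] [ChartedSpace (Model n) M]

local notation "𝓔" => extChartAt (𝓡 (2 * n))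

/-- Base points such as `(𝓔 x).symm (𝓔 x x)` and `x` are only propositionally equal; this transports
the tangent spaces, all of which are modelled on the same space. -/
theorem pullbackForm_point_congr {p q : M} (h : p = q)
    (T : Model n →L[ℝ] TangentSpace (𝓡 (2 * n)) p) (α : RawForm n M) :
    pullbackForm (V := Model n) (W := TangentSpace (𝓡 (2 * n)) p) T.toLinearMap (α p) =
      pullbackForm (V := Model n) (W := TangentSpace (𝓡 (2 * n)) q)
        (T : Model n →L[ℝ] Model n).toLinearMap (α q) := by
  subst h; rfl

theorem target_mem_nhds {x : M} {y : Model n} (hy : y ∈ (𝓔 x).target) : (𝓔 x).target ∈ 𝓝 y :=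
  (isOpen_extChartAt_target x).mem_nhds hy

theorem source_mem_nhds {x p : M} (hp : p ∈ (𝓔 x).source) : (𝓔 x).source ∈ 𝓝 p :=
  (isOpen_extChartAt_source x).mem_nhds hp

theorem eventually_symm_mem_source {x x' : M} {y : Model n} (hy : y ∈ (𝓔 x).target)
    (hy' : (𝓔 x).symm y ∈ (𝓔 x').source) : ∀ᶠ z in 𝓝 y, (𝓔 x).symm z ∈ (𝓔 x').source :=
  (continuousAt_extChartAt_symm'' hy).eventually (source_mem_nhds hy')

variable [IsManifold (𝓡 (2 * n)) ∞ M]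

theorem contDiffAt_coord_change {x x' : M} {y : Model n} (hy : y ∈ (𝓔 x).target)
    (hy' : (𝓔 x).symm y ∈ (𝓔 x').source) :
    ContDiffAt ℝ ∞ (fun z => 𝓔 x' ((𝓔 x).symm z)) y := by
  have h := contDiffWithinAt_ext_coord_change (I := 𝓡 (2 * n)) (n := ∞) x' x (y := y) (by
    rw [ext_coord_change_source]
    simpa [extChartAt] using And.intro hy hy')
  rw [ModelWithCorners.Boundaryless.range_eq_univ] at h
  exact contDiffWithinAt_univ.mp h

theorem isManifold_one : IsManifold (𝓡 (2 * n)) 1 M :=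
  IsManifold.of_le (n := ∞) (by simp)

theorem mdifferentiableAt_chart {x p : M} (hp : p ∈ (𝓔 x).source) :
    MDifferentiableAt (𝓡 (2 * n)) 𝓘(ℝ, Model n) (𝓔 x) p := by
  have := isManifold_one (n := n) (M := M)
  exact mdifferentiableAt_extChartAt (by rwa [extChartAt_source] at hp)

theorem mdifferentiableAt_chart_symm {x : M} {y : Model n} (hy : y ∈ (𝓔 x).target) :
    MDifferentiableAt 𝓘(ℝ, Model n) (𝓡 (2 * n)) (𝓔 x).symm y := by
  have := isManifold_one (n := n) (M := M)
  have h := mdifferentiableWithinAt_extChartAt_symm (I := 𝓡 (2 * n)) hy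
  rw [ModelWithCorners.Boundaryless.range_eq_univ] at h
  exact mdifferentiableWithinAt_univ.mp h

theorem mfderiv_coord_change {x x' : M} {y : Model n} (hy : y ∈ (𝓔 x).target)
    (hy' : (𝓔 x).symm y ∈ (𝓔 x').source) :
    fderiv ℝ (fun z => 𝓔 x' ((𝓔 x).symm z)) y =
      (mfderiv (𝓡 (2 * n)) 𝓘(ℝ, Model n) (𝓔 x') ((𝓔 x).symm y)).comp
        (mfderiv 𝓘(ℝ, Model n) (𝓡 (2 * n)) (𝓔 x).symm y) := by
  rw [← mfderiv_eq_fderiv]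
  exact mfderiv_comp y (mdifferentiableAt_chart hy') (mdifferentiableAt_chart_symm hy)

theorem mfderiv_symm_comp {x x' : M} {y : Model n} (hy : y ∈ (𝓔 x).target)
    (hy' : (𝓔 x).symm y ∈ (𝓔 x').source) :
    (mfderiv 𝓘(ℝ, Model n) (𝓡 (2 * n)) (𝓔 x).symm y : Model n →L[ℝ] Model n) =
      (mfderiv 𝓘(ℝ, Model n) (𝓡 (2 * n)) (𝓔 x').symm (𝓔 x' ((𝓔 x).symm y)) :
        Model n →L[ℝ] Model n).comp (fderiv ℝ (fun z => 𝓔 x' ((𝓔 x).symm z)) y) := by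
  have e : (𝓔 x).symm =ᶠ[𝓝 y] (𝓔 x').symm ∘ fun z => 𝓔 x' ((𝓔 x).symm z) := by
    filter_upwards [eventually_symm_mem_source hy hy'] with z hz
    exact ((𝓔 x').left_inv hz).symm
  have h1 : MDifferentiableAt 𝓘(ℝ, Model n) 𝓘(ℝ, Model n) (fun z => 𝓔 x' ((𝓔 x).symm z)) y :=
    ((contDiffAt_coord_change hy hy').differentiableAt (by simp)).mdifferentiableAt
  refine (e.mfderiv_eq).trans
    ((mfderiv_comp y (mdifferentiableAt_chart_symm ((𝓔 x').map_source hy')) h1).trans ?_)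
  exact congrArg (fun T : Model n →L[ℝ] Model n => (mfderiv 𝓘(ℝ, Model n) (𝓡 (2 * n)) (𝓔 x').symm
    (𝓔 x' ((𝓔 x).symm y)) : Model n →L[ℝ] Model n).comp T) mfderiv_eq_fderiv

theorem pullbackForm_of_eq_comp {A B C : Model n →L[ℝ] Model n} (h : A = B.comp C)
    (α : ExtForms (Model n)) : pullbackForm A.toLinearMap α =
      pullbackForm C.toLinearMap (pullbackForm B.toLinearMap α) := by
  subst h
  exact pullbackForm_comp B.toLinearMap C.toLinearMap α

/-- Change of charts. -/
theorem chartForm_coord_change (α : RawForm n M) {x x' : M} {y : Model n}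
    (hy : y ∈ (𝓔 x).target) (hy' : (𝓔 x).symm y ∈ (𝓔 x').source) :
    chartForm x α y = pullbackForm (fderiv ℝ (fun z => 𝓔 x' ((𝓔 x).symm z)) y).toLinearMap
      (chartForm x' α (𝓔 x' ((𝓔 x).symm y))) := by
  have h1 : chartForm x' α (𝓔 x' ((𝓔 x).symm y)) = pullbackForm (V := Model n) (W := Model n)
      (mfderiv 𝓘(ℝ, Model n) (𝓡 (2 * n)) (𝓔 x').symm (𝓔 x' ((𝓔 x).symm y)) :
        Model n →L[ℝ] Model n).toLinearMap (α ((𝓔 x).symm y)) :=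
    pullbackForm_point_congr ((𝓔 x').left_inv hy') _ α
  rw [h1]
  exact pullbackForm_of_eq_comp (mfderiv_symm_comp hy hy') _

theorem contDiffAt_chartForm_change {m : ℕ∞} {α : RawForm n M} {x x' : M} {y : Model n}
    (hy : y ∈ (𝓔 x).target) (hy' : (𝓔 x).symm y ∈ (𝓔 x').source)
    (hα : ContDiffAt ℝ m (chartForm x' α) (𝓔 x' ((𝓔 x).symm y))) :
    ContDiffAt ℝ m (chartForm x α) y := by
  have e : chartForm x α =ᶠ[𝓝 y] fun z =>
      pullbackForm (fderiv ℝ (fun z => 𝓔 x' ((𝓔 x).symm z)) z).toLinearMap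
        (chartForm x' α (𝓔 x' ((𝓔 x).symm z))) := by
    filter_upwards [target_mem_nhds hy, eventually_symm_mem_source hy hy'] with z h1 h2
    exact chartForm_coord_change α h1 h2
  refine ContDiffAt.congr_of_eventuallyEq ?_ e
  have h1 := contDiffAt_coord_change hy hy'
  have h2 : ContDiffAt ℝ m (fun z => 𝓔 x' ((𝓔 x).symm z)) y := h1.of_le (by exact_mod_cast le_top)
  exact contDiffAt_pullbackForm ((h1.fderiv_right (m := ∞) (by simp)).of_le
    (by exact_mod_cast le_top)) (ContDiffAt.comp (f := fun z => 𝓔 x' ((𝓔 x).symm z)) y hα h2)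

/-- Smoothness of a form at a point. -/
def IsSmoothFormAt (α : RawForm n M) (x : M) : Prop :=
  ContDiffAt ℝ ∞ (chartForm x α) (𝓔 x x)

/-- Smoothness at `p` can be tested in any chart around `p`, because chart changes are smooth. -/
theorem contDiffAt_chartForm_iff {α : RawForm n M} {x p : M} (hp : p ∈ (𝓔 x).source) :
    ContDiffAt ℝ ∞ (chartForm x α) (𝓔 x p) ↔ IsSmoothFormAt α p := by
  have h1 := (𝓔 x).left_inv hp
  have h2 := (𝓔 p).left_inv (mem_extChartAt_source p)
  constructor
  · intro h
    refine contDiffAt_chartForm_change (x' := x) (mem_extChartAt_target p) (by rwa [h2]) ?_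
    rwa [h2]
  · intro h
    refine contDiffAt_chartForm_change (x' := p) ((𝓔 x).map_source hp)
      (by rw [h1]; exact mem_extChartAt_source p) ?_
    rwa [h1]

theorem contDiffAt_chartForm_iff' {α : RawForm n M} {x : M} {y : Model n}
    (hy : y ∈ (𝓔 x).target) :
    ContDiffAt ℝ ∞ (chartForm x α) y ↔ IsSmoothFormAt α ((𝓔 x).symm y) := by
  rw [← contDiffAt_chartForm_iff ((𝓔 x).map_target hy), (𝓔 x).right_inv hy]

theorem isSmoothForm_iff {α : RawForm n M} : IsSmoothForm α ↔ ∀ x, IsSmoothFormAt α x := by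
  have key : ∀ x, (∀ S, ContDiffOn ℝ ∞ (fun y => (formBasis n).repr (chartForm x α y) S)
      (𝓔 x).target) ↔ ∀ y ∈ (𝓔 x).target, ContDiffAt ℝ ∞ (chartForm x α) y := by
    intro x
    simp only [contDiffAt_forms_iff]
    constructor
    · intro h y hy S
      exact (h S).contDiffAt (target_mem_nhds hy)
    · intro h S y hy
      exact (h y hy S).contDiffWithinAt
  constructor
  · intro h x
    exact (key x).mp (h x) _ (mem_extChartAt_target x)
  · intro h x
    refine (key x).mpr fun y hy => (contDiffAt_chartForm_iff' hy).mpr (h _)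

/-- At each point the exterior derivative is computed in the preferred chart of that very point.
Naturality of the coordinate derivative under chart changes shows that one fixed chart gives the
same result. -/
theorem chartForm_extD {α : RawForm n M} {x : M} {y : Model n} (hy : y ∈ (𝓔 x).target)
    (hα : ContDiffAt ℝ 1 (chartForm x α) y) :
    chartForm x (extD α) y = coordExtDeriv (chartForm x α) y := by
  obtain ⟨p, hp⟩ : ∃ p, p = (𝓔 x).symm y := ⟨_, rfl⟩
  have hp' : (𝓔 x).symm y ∈ (𝓔 p).source := hp ▸ mem_extChartAt_source p
  have e : chartForm x α =ᶠ[𝓝 y] fun z =>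
      pullbackForm (fderiv ℝ (fun z => 𝓔 p ((𝓔 x).symm z)) z).toLinearMap
        (chartForm p α (𝓔 p ((𝓔 x).symm z))) := by
    filter_upwards [target_mem_nhds hy, eventually_symm_mem_source hy hp'] with z h1 h2
    exact chartForm_coord_change α h1 h2
  have h1 := contDiffAt_coord_change hy hp'
  have h2 : ContDiffAt ℝ 1 (chartForm p α) (𝓔 p ((𝓔 x).symm y)) :=
    contDiffAt_chartForm_change (m := 1) (x' := x) ((𝓔 p).map_source hp')
      (by rw [(𝓔 p).left_inv hp']; exact (𝓔 x).map_target hy)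
      (by rw [(𝓔 p).left_inv hp', (𝓔 x).right_inv hy]; exact hα)
  rw [coordExtDeriv_congr e, coordExtDeriv_pullback (ψ := fun z => 𝓔 p ((𝓔 x).symm z))
    (h1.of_le (mod_cast le_top : ((2 : ℕ∞) : WithTop ℕ∞) ≤ ∞)) h2, mfderiv_coord_change hy hp']
  subst hp
  exact (pullbackForm_comp (U := Model n) (V := TangentSpace (𝓡 (2 * n)) ((𝓔 x).symm y))
    (W := Model n) _ _ _).symm

theorem mfderiv_chart_comp_symm {x : M} {y : Model n} (hy : y ∈ (𝓔 x).target) :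
    (mfderiv (𝓡 (2 * n)) 𝓘(ℝ, Model n) (𝓔 x) ((𝓔 x).symm y)).comp
      (mfderiv 𝓘(ℝ, Model n) (𝓡 (2 * n)) (𝓔 x).symm y) = ContinuousLinearMap.id ℝ (Model n) := by
  have := isManifold_one (n := n) (M := M)
  have h := mfderiv_extChartAt_comp_mfderivWithin_extChartAt_symm (I := 𝓡 (2 * n)) hy
  rw [ModelWithCorners.Boundaryless.range_eq_univ, mfderivWithin_univ] at h
  exact h

theorem mfderiv_symm_comp_chart {x : M} {y : Model n} (hy : y ∈ (𝓔 x).target) :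
    (mfderiv 𝓘(ℝ, Model n) (𝓡 (2 * n)) (𝓔 x).symm y).comp
      (mfderiv (𝓡 (2 * n)) 𝓘(ℝ, Model n) (𝓔 x) ((𝓔 x).symm y)) =
        ContinuousLinearMap.id ℝ (TangentSpace (𝓡 (2 * n)) ((𝓔 x).symm y)) := by
  have := isManifold_one (n := n) (M := M)
  have h := mfderivWithin_extChartAt_symm_comp_mfderiv_extChartAt (I := 𝓡 (2 * n)) hy
  rw [ModelWithCorners.Boundaryless.range_eq_univ, mfderivWithin_univ] at h
  exact h

/-- The differential of a chart as a linear equivalence. -/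
def chartEquiv (x : M) {y : Model n} (hy : y ∈ (𝓔 x).target) :
    Model n ≃ₗ[ℝ] TangentSpace (𝓡 (2 * n)) ((𝓔 x).symm y) :=
  LinearEquiv.ofLinearMap
    (mfderiv 𝓘(ℝ, Model n) (𝓡 (2 * n)) (𝓔 x).symm y : _ →L[ℝ] _).toLinearMap
    (mfderiv (𝓡 (2 * n)) 𝓘(ℝ, Model n) (𝓔 x) ((𝓔 x).symm y) : _ →L[ℝ] _).toLinearMap
    (by
      have := mfderiv_symm_comp_chart hy
      exact LinearMap.ext fun v => DFunLike.congr_fun this v)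
    (by
      have := mfderiv_chart_comp_symm hy
      exact LinearMap.ext fun v => DFunLike.congr_fun this v)

theorem chartForm_eq_chartEquiv (α : RawForm n M) {x : M} {y : Model n} (hy : y ∈ (𝓔 x).target) :
    chartForm x α y = pullbackForm (chartEquiv x hy).toLinearMap (α ((𝓔 x).symm y)) := rfl

theorem pullbackForm_symm_apply {V W : Type*} [AddCommGroup V] [Module ℝ V] [AddCommGroup W]
    [Module ℝ W] (g : V ≃ₗ[ℝ] W) (α : ExtForms W) :
    pullbackForm g.symm.toLinearMap (pullbackForm g.toLinearMap α) = α := by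
  rw [← pullbackForm_comp]
  convert pullbackForm_id α
  ext v; simp

theorem pullbackForm_injective {V W : Type*} [AddCommGroup V] [Module ℝ V] [AddCommGroup W]
    [Module ℝ W] (g : V ≃ₗ[ℝ] W) : Function.Injective (pullbackForm g.toLinearMap) :=
  Function.LeftInverse.injective (pullbackForm_symm_apply g)

theorem rawForm_ext_chart {α β : RawForm n M}
    (h : ∀ x, chartForm x α (𝓔 x x) = chartForm x β (𝓔 x x)) : α = β := by
  funext x
  have hx := h x
  have e : ∀ γ : RawForm n M, chartForm x γ (𝓔 x x) = pullbackForm (V := Model n)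
      (W := Model n) (mfderiv 𝓘(ℝ, Model n) (𝓡 (2 * n)) (𝓔 x).symm (𝓔 x x) :
        Model n →L[ℝ] Model n).toLinearMap (γ x) := fun γ => by
    rw [chartForm]; exact pullbackForm_point_congr (extChartAt_to_inv x) _ γ
  rw [e, e] at hx
  exact pullbackForm_injective (V := Model n) (W := Model n)
    (chartEquiv x (mem_extChartAt_target (I := 𝓡 (2 * n)) x)) hx

theorem isSmoothFormAt_extD {α : RawForm n M} {x : M} (hα : IsSmoothFormAt α x) :
    IsSmoothFormAt (extD α) x := by
  have e : chartForm x (extD α) =ᶠ[𝓝 (𝓔 x x)] coordExtDeriv (chartForm x α) := by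
    filter_upwards [target_mem_nhds (mem_extChartAt_target x),
      (hα.of_le (m := 1) (by exact_mod_cast le_top)).eventually (by simp)] with z h1 h2
    exact chartForm_extD h1 h2
  exact (contDiffAt_coordExtDeriv hα).congr_of_eventuallyEq e

end Charts

/-! ### Compatibility of linear algebra operations with pull-backs -/

section Naturality

open ExteriorAlgebra

variable {V W : Type*} [AddCommGroup V] [Module ℝ V] [AddCommGroup W] [Module ℝ W]

theorem pullbackForm_apply_ι (f : V →ₗ[ℝ] W) (a : Module.Dual ℝ W) :
    pullbackForm f (ι ℝ a) = ι ℝ (a ∘ₗ f) := by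
  rw [pullbackForm, map_apply_ι]; rfl

theorem pullbackForm_interior (g : V →ₗ[ℝ] W) (v : V) (β : ExtForms W) :
    pullbackForm g (interior (g v) β) = interior v (pullbackForm g β) := by
  induction β using extForms_induction with
  | h0 r => simp [interior_algebraMap, AlgHom.commutes]
  | hadd α β hα hβ => simp only [map_add, hα, hβ]
  | hι a β hβ =>
    rw [interior_ι_mul, map_sub, map_smul, map_mul, map_mul, pullbackForm_apply_ι, interior_ι_mul,
      hβ]
    rfl

theorem algebraMapInv_pullbackForm (g : V →ₗ[ℝ] W) (β : ExtForms W) :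
    algebraMapInv (pullbackForm g β) = algebraMapInv β := by
  refine homogeneous_induction (P := fun β => algebraMapInv (pullbackForm g β) = algebraMapInv β)
    (fun α β hα hβ => by simp only [map_add, hα, hβ]) (fun k β hβ => ?_) β
  rcases Nat.eq_zero_or_pos k with rfl | hk
  · obtain ⟨r, rfl⟩ := mem_exteriorPower_zero.mp hβ
    rw [AlgHom.commutes, algebraMapInv_algebraMap, algebraMapInv_algebraMap]
  · rw [algebraMapInv_eq_zero hk.ne' hβ, algebraMapInv_eq_zero hk.ne' (pullbackForm_mem g hβ)]

theorem toBilin_pullbackForm (g : V →ₗ[ℝ] W) (η : ExtForms W) (u v : V) :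
    toBilin (pullbackForm g η) u v = toBilin η (g u) (g v) := by
  change algebraMapInv (interior v (interior u (pullbackForm g η))) =
    algebraMapInv (interior (g v) (interior (g u) η))
  rw [← pullbackForm_interior, ← pullbackForm_interior, algebraMapInv_pullbackForm]

theorem pullbackForm_adjMul (g : V →ₗ[ℝ] W) {s : Module.Dual ℝ W →ₗ[ℝ] W}
    {s' : Module.Dual ℝ V →ₗ[ℝ] V} (hs : ∀ a, g (s' (a ∘ₗ g)) = s a) (η β : ExtForms W) :
    pullbackForm g (adjMul s η β) = adjMul s' (pullbackForm g η) (pullbackForm g β) := by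
  induction η using extForms_induction generalizing β with
  | h0 r => rw [AlgHom.commutes, adjMul_algebraMap, adjMul_algebraMap]; simp
  | hadd α γ hα hγ => simp only [map_add, LinearMap.add_apply, hα, hγ]
  | hι a α hα =>
    rw [map_mul (pullbackForm g), pullbackForm_apply_ι, adjMul_ι_mul, adjMul_ι_mul,
      Module.End.mul_apply, Module.End.mul_apply, hα, ← hs, pullbackForm_interior]

theorem pullbackForm_dualDerivation [FiniteDimensional ℝ V] [FiniteDimensional ℝ W]
    (g : V →ₗ[ℝ] W) {P : Module.End ℝ W} {P' : Module.End ℝ V} (hP : ∀ v, g (P' v) = P (g v))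
    (β : ExtForms W) : pullbackForm g (dualDerivation P β) =
      dualDerivation P' (pullbackForm g β) := by
  induction β using extForms_induction with
  | h0 r =>
    rw [AlgHom.commutes, Algebra.algebraMap_eq_smul_one, map_smul, map_smul, dualDerivation_one,
      Algebra.algebraMap_eq_smul_one, map_smul, dualDerivation_one, map_zero]
  | hadd α γ hα hγ => simp only [map_add, hα, hγ]
  | hι a α hα =>
    rw [map_mul (pullbackForm g), dualDerivation_ι_mul, map_add, map_mul, map_mul,
      pullbackForm_apply_ι, pullbackForm_apply_ι, dualDerivation_ι_mul, hα]
    congr 3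
    ext v
    exact congrArg a (hP v).symm

end Naturality

/-! ### Fibrewise operators preserving smoothness -/

section Forms

open ExteriorAlgebra Topology

variable {n : ℕ} {M : Type*} [TopologicalSpace M] [ChartedSpace (Model n) M]
  [IsManifold (𝓡 (2 * n)) ∞ M]

local notation "𝓔" => extChartAt (𝓡 (2 * n))

theorem mem_form_iff {α : RawForm n M} : α ∈ Form n M ↔ ∀ x, IsSmoothFormAt α x := isSmoothForm_iff

theorem chartForm_mul (x : M) (α β : RawForm n M) (y : Model n) :
    chartForm x (α * β) y = chartForm x α y * chartForm x β y := map_mul (chartFormHom x y) α β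

theorem chartForm_add (x : M) (α β : RawForm n M) (y : Model n) :
    chartForm x (α + β) y = chartForm x α y + chartForm x β y := map_add (chartFormHom x y) α β

theorem chartForm_smul (x : M) (c : ℝ) (α : RawForm n M) (y : Model n) :
    chartForm x (c • α) y = c • chartForm x α y := map_smul (chartFormHom x y) c α

theorem chartForm_function_smul (x : M) (f : M → ℝ) (α : RawForm n M) (y : Model n) :
    chartForm x (fun p => f p • α p) y = f ((𝓔 x).symm y) • chartForm x α y :=
  map_smul (pullbackForm (V := Model n) (W := TangentSpace (𝓡 (2 * n)) ((𝓔 x).symm y)) _) _ _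

/-- An operator acting fibrewise which preserves smoothness. -/
def IsSmoothOp (T : ∀ x : M, Module.End ℝ (ExtForms (TangentSpace (𝓡 (2 * n)) x))) : Prop :=
  ∀ α : RawForm n M, α ∈ Form n M → (fun x => T x (α x)) ∈ Form n M

theorem isSmoothOp_of_chart
    {T : ∀ x : M, Module.End ℝ (ExtForms (TangentSpace (𝓡 (2 * n)) x))}
    (h : ∀ p : M, ∃ T' : Model n → Module.End ℝ (ExtForms (Model n)),
      (∀ β, ContDiffAt ℝ ∞ (fun z => T' z β) (𝓔 p p)) ∧
      ∀ᶠ z in 𝓝 (𝓔 p p), ∀ (hz : z ∈ (𝓔 p).target) (β : ExtForms _),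
        pullbackForm (chartEquiv p hz).toLinearMap (T ((𝓔 p).symm z) β) =
          T' z (pullbackForm (chartEquiv p hz).toLinearMap β)) : IsSmoothOp T := by
  intro α hα
  rw [mem_form_iff] at hα ⊢
  intro p
  obtain ⟨T', h1, h2⟩ := h p
  have e : chartForm p (fun x => T x (α x)) =ᶠ[𝓝 (𝓔 p p)] fun z => T' z (chartForm p α z) := by
    filter_upwards [h2, target_mem_nhds (mem_extChartAt_target p)] with z hz hz'
    exact hz hz' _
  exact (contDiffAt_apply h1 (hα p)).congr_of_eventuallyEq e

theorem isSmoothOp_gradedScale (c : ℕ → ℝ) :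
    IsSmoothOp fun x : M => gradedScale (V := TangentSpace (𝓡 (2 * n)) x) c :=
  isSmoothOp_of_chart fun _ => ⟨fun _ => gradedScale c, fun _ => contDiffAt_const,
    Filter.Eventually.of_forall fun _ _ _ => pullbackForm_gradedScale _ _ _⟩

theorem contDiffAt_interior {X : Type*} [NormedAddCommGroup X] [NormedSpace ℝ X] {x : X}
    {v : X → Model n} {f : X → ExtForms (Model n)} (hv : ContDiffAt ℝ ∞ v x)
    (hf : ContDiffAt ℝ ∞ f x) : ContDiffAt ℝ ∞ (fun z => interior (v z) (f z)) x :=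
  contDiffAt_bilinear (interiorₗ (V := Model n)) hv hf

theorem contDiffAt_adjMul {X : Type*} [NormedAddCommGroup X] [NormedSpace ℝ X] {x : X}
    {s : X → Module.Dual ℝ (Model n) →ₗ[ℝ] Model n} {η f : X → ExtForms (Model n)}
    (hs : ∀ a, ContDiffAt ℝ ∞ (fun z => s z a) x) (hη : ContDiffAt ℝ ∞ η x)
    (hf : ContDiffAt ℝ ∞ f x) : ContDiffAt ℝ ∞ (fun z => adjMul (s z) (η z) (f z)) x := by
  refine contDiffAt_apply (T := fun z => (adjMul (s z)).flip (f z)) (fun β => ?_) hη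
  simp only [LinearMap.flip_apply]
  induction β using extForms_induction generalizing f with
  | h0 r =>
    simp only [adjMul_algebraMap]
    exact hf.const_smul r
  | hadd α β hα hβ => simp only [map_add, LinearMap.add_apply]; exact (hα hf).add (hβ hf)
  | hι a β hβ =>
    simp only [adjMul_ι_mul, Module.End.mul_apply]
    exact hβ (contDiffAt_interior (hs a) hf)

variable (n) in
/-- The bilinear form of a `2`-form as a continuous linear map. -/
def toBilinL : ExtForms (Model n) →ₗ[ℝ] Model n →L[ℝ] Model n →L[ℝ] ℝ where
  toFun η := (toBilin η).toContinuousBilinearMap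
  map_add' η ζ := by
    ext u v; exact LinearMap.congr_fun₂ (toBilin_add η ζ) u v
  map_smul' c η := by
    ext u v
    change algebraMapInv (interior v (interior u (c • η))) =
      c * algebraMapInv (interior v (interior u η))
    simp

theorem toBilinL_apply (η : ExtForms (Model n)) (u v : Model n) :
    toBilinL n η u v = toBilin η u v := rfl

namespace AlmostSymplecticForm

variable (Ω : AlmostSymplecticForm n M)

/-- The musical isomorphism at a point. -/
def sharpAt (x : M) :
    Module.Dual ℝ (TangentSpace (𝓡 (2 * n)) x) →ₗ[ℝ] TangentSpace (𝓡 (2 * n)) x :=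
  sharp (toBilin (Ω.toForm x)) (Ω.nondegenerate x)

theorem isSharp (x : M) : IsSharp (Ω.toForm x) (Ω.sharpAt x) :=
  isSharp_sharp (Ω.degree_two x) (Ω.nondegenerate x)

/-- Transporting `♯` through the differential of the chart gives an explicit two-sided inverse.
Smoothness of `♯` then follows from smoothness of inversion of continuous linear maps. -/
theorem isInvertible_toBilinL (p : M) {z : Model n} (hz : z ∈ (𝓔 p).target) :
    (toBilinL n (chartForm p Ω.toForm z)).IsInvertible ∧
    ∀ a : Module.Dual ℝ (TangentSpace (𝓡 (2 * n)) ((𝓔 p).symm z)),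
      chartEquiv p hz ((toBilinL n (chartForm p Ω.toForm z)).inverse
        (LinearMap.toContinuousLinearMap (a ∘ₗ (chartEquiv p hz).toLinearMap))) =
      Ω.sharpAt ((𝓔 p).symm z) a := by
  set g := chartEquiv p hz
  set s := Ω.sharpAt ((𝓔 p).symm z)
  have hs := Ω.isSharp ((𝓔 p).symm z)
  have key : ∀ u v, toBilinL n (chartForm p Ω.toForm z) u v =
      toBilin (Ω.toForm ((𝓔 p).symm z)) (g u) (g v) := fun u v => by
    rw [toBilinL_apply, chartForm_eq_chartEquiv _ hz, toBilin_pullbackForm]; rfl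
  let R : (Model n →L[ℝ] ℝ) →ₗ[ℝ] Model n :=
    g.symm.toLinearMap ∘ₗ s ∘ₗ (g.symm.toLinearMap.dualMap) ∘ₗ
      (LinearMap.toContinuousLinearMap (E := Model n) (F' := ℝ)).symm.toLinearMap
  have hR : ∀ b : Model n →L[ℝ] ℝ, R b = g.symm (s (b.toLinearMap ∘ₗ g.symm.toLinearMap)) :=
    fun b => rfl
  have h1 : ∀ b, toBilinL n (chartForm p Ω.toForm z) (R b) = b := fun b => by
    ext v
    rw [key, hR, LinearEquiv.apply_symm_apply, hs.toBilin_sharp]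
    exact congrArg b (g.symm_apply_apply v)
  have h2 : ∀ u, R (toBilinL n (chartForm p Ω.toForm z) u) = u := fun u => by
    rw [hR]
    have : (toBilinL n (chartForm p Ω.toForm z) u).toLinearMap ∘ₗ g.symm.toLinearMap =
        toBilin (Ω.toForm ((𝓔 p).symm z)) (g u) := by
      ext v
      refine (key u (g.symm v)).trans ?_
      rw [LinearEquiv.apply_symm_apply]
    rw [this, hs.sharp_toBilin, LinearEquiv.symm_apply_apply]
  have hinv : (toBilinL n (chartForm p Ω.toForm z)).IsInvertible :=
    ContinuousLinearMap.IsInvertible.of_inverse (g := LinearMap.toContinuousLinearMap R)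
      (by ext1 b; exact h1 b) (by ext1 u; exact h2 u)
  refine ⟨hinv, fun a => ?_⟩
  have h3 : (toBilinL n (chartForm p Ω.toForm z)).inverse
      (LinearMap.toContinuousLinearMap (a ∘ₗ g.toLinearMap)) =
      R (LinearMap.toContinuousLinearMap (a ∘ₗ g.toLinearMap)) := by
    rw [hinv.inverse_apply_eq, h1]
  rw [h3, hR, LinearEquiv.apply_symm_apply]
  congr 1
  ext v
  exact congrArg a (g.apply_symm_apply v)

theorem isSmoothOp_adjMul {η : RawForm n M} (hη : η ∈ Form n M) :
    IsSmoothOp fun x => adjMul (Ω.sharpAt x) (η x) := by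
  refine isSmoothOp_of_chart fun p => ?_
  let s : Model n → Module.Dual ℝ (Model n) →ₗ[ℝ] Model n := fun z =>
    (toBilinL n (chartForm p Ω.toForm z)).inverse.toLinearMap ∘ₗ
      (LinearMap.toContinuousLinearMap (E := Model n) (F' := ℝ)).toLinearMap
  refine ⟨fun z => adjMul (s z) (chartForm p η z), fun β => ?_, ?_⟩
  · refine contDiffAt_adjMul (fun a => ?_) (mem_form_iff.mp hη p) contDiffAt_const
    have h1 : ContDiffAt ℝ ∞ (fun z => toBilinL n (chartForm p Ω.toForm z)) (𝓔 p p) :=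
      contDiffAt_linear _ (mem_form_iff.mp Ω.smooth p)
    obtain ⟨e, he⟩ := (Ω.isInvertible_toBilinL p (mem_extChartAt_target p)).1
    have h2 : ContDiffAt ℝ ∞ ContinuousLinearMap.inverse
        (toBilinL n (chartForm p Ω.toForm (𝓔 p p))) := by
      rw [← he]; exact contDiffAt_map_inverse e
    exact (ContDiffAt.comp (f := fun z => toBilinL n (chartForm p Ω.toForm z)) _ h2 h1).clm_apply
      contDiffAt_const
  · refine Filter.Eventually.of_forall fun z hz β => ?_
    rw [pullbackForm_adjMul _ (s' := s z)]
    · rfl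
    · exact (Ω.isInvertible_toBilinL p hz).2

end AlmostSymplecticForm

end Forms

/-! ### Vector fields in charts and smoothness of the projections -/

section Fields

open ExteriorAlgebra Topology Bundle

variable {n : ℕ} {M : Type*} [TopologicalSpace M] [ChartedSpace (Model n) M]
  [IsManifold (𝓡 (2 * n)) ∞ M]

local notation "𝓔" => extChartAt (𝓡 (2 * n))

/-- The expression of a vector field in the preferred chart at `p`. -/
def chartField (p : M) (X : ∀ x : M, TangentSpace (𝓡 (2 * n)) x) (z : Model n) : Model n :=
  mfderiv (𝓡 (2 * n)) 𝓘(ℝ, Model n) (𝓔 p) ((𝓔 p).symm z) (X ((𝓔 p).symm z))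

theorem chartEquiv_chartField (X : ∀ x : M, TangentSpace (𝓡 (2 * n)) x) {p : M} {z : Model n}
    (hz : z ∈ (𝓔 p).target) : chartEquiv p hz (chartField p X z) = X ((𝓔 p).symm z) :=
  (chartEquiv p hz).apply_symm_apply (X ((𝓔 p).symm z))

/-- Over the chart domain the preferred trivialization of the tangent bundle at `p` is the
differential of the chart at `p`. -/
theorem contMDiffAt_field_iff {X : ∀ x : M, TangentSpace (𝓡 (2 * n)) x} {p : M} :
    ContMDiffAt (𝓡 (2 * n)) (𝓡 (2 * n)).tangent ∞
      (fun x => (⟨x, X x⟩ : TangentBundle (𝓡 (2 * n)) M)) p ↔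
    ContDiffAt ℝ ∞ (chartField p X) (𝓔 p p) := by
  have := isManifold_one (n := n) (M := M)
  have h1 : ContMDiffAt (𝓡 (2 * n)) (𝓡 (2 * n)).tangent ∞
      (fun x => (⟨x, X x⟩ : TangentBundle (𝓡 (2 * n)) M)) p ↔
      ContMDiffAt (𝓡 (2 * n)) 𝓘(ℝ, Model n) ∞ (fun x => (trivializationAt (Model n)
        (TangentSpace (𝓡 (2 * n)) : M → Type _) p ⟨x, X x⟩).2) p := contMDiffAt_section p
  rw [h1]
  have h2 : ∀ x ∈ (𝓔 p).source, (trivializationAt (Model n)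
      (TangentSpace (𝓡 (2 * n)) : M → Type _) p ⟨x, X x⟩).2 =
      mfderiv (𝓡 (2 * n)) 𝓘(ℝ, Model n) (𝓔 p) x (X x) := by
    intro x hx
    rw [extChartAt_source] at hx
    refine Eq.trans ?_ (DFunLike.congr_fun
      (TangentBundle.continuousLinearMapAt_trivializationAt (I := 𝓡 (2 * n)) hx) (X x))
    rw [Trivialization.continuousLinearMapAt_apply, Trivialization.coe_linearMapAt_of_mem]
    simpa using hx
  have h3 : (fun x => (trivializationAt (Model n)
      (TangentSpace (𝓡 (2 * n)) : M → Type _) p ⟨x, X x⟩).2) =ᶠ[𝓝 p]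
      fun x => chartField p X (𝓔 p x) := by
    filter_upwards [extChartAt_source_mem_nhds (I := 𝓡 (2 * n)) p] with x hx
    rw [h2 x hx, chartField, (𝓔 p).left_inv hx]
  rw [h3.contMDiffAt_iff]
  constructor
  · intro h
    have h4 : ContMDiffAt 𝓘(ℝ, Model n) (𝓡 (2 * n)) ∞ (𝓔 p).symm (𝓔 p p) :=
      (contMDiffOn_extChartAt_symm p).contMDiffAt (target_mem_nhds (mem_extChartAt_target p))
    rw [← extChartAt_to_inv (I := 𝓡 (2 * n)) p] at h
    have h5 := (ContMDiffAt.comp (𝓔 p p) (by simpa using h) h4).contDiffAt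
    refine h5.congr_of_eventuallyEq ?_
    filter_upwards [target_mem_nhds (mem_extChartAt_target p)] with z hz
    exact congrArg (chartField p X) ((𝓔 p).right_inv hz).symm
  · intro h
    exact ContMDiffAt.comp p h.contMDiffAt contMDiffAt_extChartAt

theorem isSmoothOp_dualDerivation {P : ∀ x : M, Module.End ℝ (TangentSpace (𝓡 (2 * n)) x)}
    (h : ∀ p : M, ∃ P' : Model n → Model n →L[ℝ] Model n, ContDiffAt ℝ ∞ P' (𝓔 p p) ∧
      ∀ᶠ z in 𝓝 (𝓔 p p), ∀ (hz : z ∈ (𝓔 p).target) (v : Model n),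
        chartEquiv p hz (P' z v) = P ((𝓔 p).symm z) (chartEquiv p hz v)) :
    IsSmoothOp fun x => dualDerivation (P x) := by
  refine isSmoothOp_of_chart fun p => ?_
  obtain ⟨P', h1, h2⟩ := h p
  refine ⟨fun z => dualDerivation (P' z).toLinearMap, fun β => ?_, ?_⟩
  · induction β using extForms_induction with
    | h0 r =>
      simp only [Algebra.algebraMap_eq_smul_one, map_smul, dualDerivation_one]
      exact contDiffAt_const
    | hadd α β hα hβ => simp only [map_add]; exact hα.add hβ
    | hι a β hβ =>
      simp only [dualDerivation_ι_mul]
      refine ContDiffAt.add (contDiffAt_mul ?_ contDiffAt_const) (contDiffAt_mul contDiffAt_const hβ)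
      have := contDiffAt_pullbackForm h1 (contDiffAt_const (c := ι ℝ a))
      simpa only [pullbackForm_apply_ι] using this
  · filter_upwards [h2] with z hz hz' β
    exact pullbackForm_dualDerivation _ (hz hz') β

theorem contDiffAt_chartField_of_contMDiffOn {X : ∀ x : M, TangentSpace (𝓡 (2 * n)) x} {p : M}
    {U : Set M} (hU : U ∈ 𝓝 p) (hX : ContMDiffOn (𝓡 (2 * n)) (𝓡 (2 * n)).tangent ∞
        (fun x => (⟨x, X x⟩ : TangentBundle (𝓡 (2 * n)) M)) U) :
    ContDiffAt ℝ ∞ (chartField p X) (𝓔 p p) :=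
  contMDiffAt_field_iff.mp (hX.contMDiffAt hU)

/-- Local frames of the two subbundles form a joint frame. If `F` denotes the frame in a chart, the
projection is `F Q F⁻¹` with a constant coordinate projection `Q`, hence smooth. -/
theorem isSmoothOp_projection {L L' : TangentSubspaces n M} (hL : IsSmoothSubbundle n L)
    (hL' : IsSmoothSubbundle n L') (h : ∀ x, IsCompl (L x) (L' x)) :
    IsSmoothOp fun x => dualDerivation ((L x).projection (L' x) (h x)) := by
  refine isSmoothOp_dualDerivation fun p => ?_
  obtain ⟨U, hU, hpU, s, hs, hs'⟩ := hL p
  obtain ⟨U', hU', hpU', t, ht, ht'⟩ := hL' p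
  let b : Fin n ⊕ Fin n → ∀ x : M, TangentSpace (𝓡 (2 * n)) x := Sum.elim s t
  have hb : ∀ k, ContDiffAt ℝ ∞ (chartField p (b k)) (𝓔 p p) := by
    rintro (i | j)
    · exact contDiffAt_chartField_of_contMDiffOn (hU.mem_nhds hpU) (hs i)
    · exact contDiffAt_chartField_of_contMDiffOn (hU'.mem_nhds hpU') (ht j)
  let F : Model n → (Fin n ⊕ Fin n → ℝ) →L[ℝ] Model n := fun z =>
    ∑ k, (ContinuousLinearMap.proj k : (Fin n ⊕ Fin n → ℝ) →L[ℝ] ℝ).smulRight (chartField p (b k) z)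
  let Q : (Fin n ⊕ Fin n → ℝ) →L[ℝ] (Fin n ⊕ Fin n → ℝ) :=
    LinearMap.toContinuousLinearMap (LinearMap.pi (Sum.elim (fun i => LinearMap.proj (Sum.inl i))
      fun _ => 0))
  have hF : ContDiffAt ℝ ∞ F (𝓔 p p) := by
    refine ContDiffAt.sum fun k _ => ?_
    exact (ContinuousLinearMap.smulRightL ℝ (Fin n ⊕ Fin n → ℝ) (Model n)
      (ContinuousLinearMap.proj k)).contDiff.contDiffAt.comp (𝓔 p p) (hb k)
  have key : ∀ z, (𝓔 p).symm z ∈ U → (𝓔 p).symm z ∈ U' → ∀ hz : z ∈ (𝓔 p).target,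
      ∃ e : (Fin n ⊕ Fin n → ℝ) ≃L[ℝ] Model n, (e : (Fin n ⊕ Fin n → ℝ) →L[ℝ] Model n) = F z ∧
        ∀ v, chartEquiv p hz (e (Q (e.symm v))) =
          (L ((𝓔 p).symm z)).projection (L' ((𝓔 p).symm z)) (h _) (chartEquiv p hz v) := by
    intro z hzU hzU' hz
    set x := (𝓔 p).symm z
    have hli : LinearIndependent ℝ (fun k => b k x) := by
      have := LinearIndependent.sum_type (hs' x hzU).1 (ht' x hzU').1 (by
        rw [(hs' x hzU).2, (ht' x hzU').2]; exact (h x).disjoint)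
      have e : (fun k => b k x) = Sum.elim (fun i => s i x) fun i => t i x := by
        ext1 k; rcases k with k | k <;> rfl
      rw [e]; exact this
    have hsp : ⊤ ≤ Submodule.span ℝ (Set.range fun k => b k x) := by
      have : (Set.range fun k => b k x) = (Set.range fun i => s i x) ∪ Set.range fun i => t i x := by
        rw [← Set.Sum.elim_range]
        congr 1
        ext1 k; rcases k with k | k <;> rfl
      rw [this, Submodule.span_union, (hs' x hzU).2, (ht' x hzU').2, (h x).sup_eq_top]
    let B := Module.Basis.mk hli hsp
    have hB : ∀ k, B k = b k x := fun k => Module.Basis.mk_apply hli hsp k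
    have hB' : ∀ k, B.equivFun (B k) = Pi.single k 1 := fun k => by
      ext j; rw [Module.Basis.equivFun_self, Pi.single_apply]; simp [eq_comm]
    let e' : (Fin n ⊕ Fin n → ℝ) ≃ₗ[ℝ] Model n := B.equivFun.symm ≪≫ₗ (chartEquiv p hz).symm
    refine ⟨e'.toContinuousLinearEquiv, ?_, fun v => ?_⟩
    · ext1 c
      change (chartEquiv p hz).symm (B.equivFun.symm c) = F z c
      rw [Module.Basis.equivFun_symm_apply, map_sum]
      simp only [F, sum_apply]
      refine Finset.sum_congr rfl fun k _ => ?_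
      rw [map_smul, hB]
      rfl
    · obtain ⟨w, rfl⟩ := (chartEquiv p hz).symm.surjective v
      change chartEquiv p hz ((chartEquiv p hz).symm (B.equivFun.symm (Q (B.equivFun
        (chartEquiv p hz ((chartEquiv p hz).symm w)))))) = _
      rw [LinearEquiv.apply_symm_apply, LinearEquiv.apply_symm_apply]
      have : B.equivFun.symm.toLinearMap ∘ₗ Q.toLinearMap ∘ₗ B.equivFun.toLinearMap =
          (L x).projection (L' x) (h x) := by
        refine B.ext fun k => ?_
        change B.equivFun.symm (Q (B.equivFun (B k))) = _
        rw [hB', hB]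
        rcases k with i | j
        · have h1 : Q (Pi.single (Sum.inl i) 1) = Pi.single (Sum.inl i) 1 := by
            ext k; rcases k with k | k
            · rfl
            · simp [Q]
          have h2 : b (Sum.inl i) x ∈ L x := by
            rw [← (hs' x hzU).2]; exact Submodule.subset_span ⟨i, rfl⟩
          rw [h1, (Submodule.projection_eq_self_iff _ _).mpr h2, ← hB, ← hB',
            LinearEquiv.symm_apply_apply]
        · have h1 : Q (Pi.single (Sum.inr j) 1) = 0 := by
            ext k; rcases k with k | k
            · simp [Q]
            · rfl
          have h2 : b (Sum.inr j) x ∈ L' x := by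
            rw [← (ht' x hzU').2]; exact Submodule.subset_span ⟨j, rfl⟩
          rw [h1, (Submodule.projection_apply_eq_zero_iff _).mpr h2, map_zero]
      exact LinearMap.congr_fun this w
  refine ⟨fun z => (F z).comp (Q.comp (F z).inverse), ?_, ?_⟩
  · obtain ⟨e, he, -⟩ := key (𝓔 p p) (by rwa [extChartAt_to_inv]) (by rwa [extChartAt_to_inv])
      (mem_extChartAt_target p)
    have h2 : ContDiffAt ℝ ∞ ContinuousLinearMap.inverse (F (𝓔 p p)) := by
      rw [← he]; exact contDiffAt_map_inverse e
    exact hF.clm_comp (contDiffAt_const.clm_comp (h2.comp _ hF))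
  · have hc := continuousAt_extChartAt_symm (I := 𝓡 (2 * n)) p
    filter_upwards [hc.eventually (by rw [extChartAt_to_inv]; exact hU.mem_nhds hpU),
      hc.eventually (by rw [extChartAt_to_inv]; exact hU'.mem_nhds hpU')] with z h1 h2 hz v
    obtain ⟨e, he, he'⟩ := key z h1 h2 hz
    rw [← he' v, ← he]
    simp [ContinuousLinearMap.inverse_equiv]

end Fields

/-! ### Cutting off local forms and vector fields -/

section Bump

open ExteriorAlgebra Topology Bundle

variable {n : ℕ} {M : Type*} [TopologicalSpace M] [ChartedSpace (Model n) M]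
  [IsManifold (𝓡 (2 * n)) ∞ M]

local notation "𝓔" => extChartAt (𝓡 (2 * n))

theorem contDiffAt_comp_chart_symm {f : M → ℝ} (hf : ContMDiff (𝓡 (2 * n)) 𝓘(ℝ, ℝ) ∞ f) (p : M) :
    ContDiffAt ℝ ∞ (fun z => f ((𝓔 p).symm z)) (𝓔 p p) := by
  have h4 : ContMDiffAt 𝓘(ℝ, Model n) (𝓡 (2 * n)) ∞ (𝓔 p).symm (𝓔 p p) :=
    (contMDiffOn_extChartAt_symm p).contMDiffAt (target_mem_nhds (mem_extChartAt_target p))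
  exact (ContMDiffAt.comp (𝓔 p p) hf.contMDiffAt h4).contDiffAt

variable [T2Space M]

theorem exists_bump {p : M} {U : Set M} (hU : U ∈ 𝓝 p) : ∃ f : M → ℝ,
    ContMDiff (𝓡 (2 * n)) 𝓘(ℝ, ℝ) ∞ f ∧ f =ᶠ[𝓝 p] 1 ∧ ∀ x ∉ U, ∀ᶠ y in 𝓝 x, f y = 0 := by
  obtain ⟨f, -, hf⟩ := (SmoothBumpFunction.nhds_basis_tsupport (I := 𝓡 (2 * n)) p).mem_iff.mp hU
  refine ⟨f, f.contMDiff, f.eventuallyEq_one, fun x hx => ?_⟩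
  have : x ∉ tsupport f := fun h => hx (hf h)
  exact notMem_tsupport_iff_eventuallyEq.mp this

theorem exists_smul_mem_form {p : M} {α : RawForm n M} (hα : ∀ᶠ x in 𝓝 p, IsSmoothFormAt α x) :
    ∃ f : M → ℝ, f =ᶠ[𝓝 p] 1 ∧ (fun x => f x • α x) ∈ Form n M := by
  obtain ⟨f, hf, hf1, hf0⟩ := exists_bump (n := n) hα
  refine ⟨f, hf1, mem_form_iff.mpr fun x => ?_⟩
  -- The bump function is supported in the set where `α` is smooth, so at the other points the
  -- product is zero nearby.
  by_cases hx : IsSmoothFormAt α x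
  · have : chartForm x (fun p => f p • α p) = fun z => f ((𝓔 x).symm z) • chartForm x α z :=
      funext fun z => chartForm_function_smul x f α z
    rw [IsSmoothFormAt, this]
    exact (contDiffAt_comp_chart_symm hf x).smul hx
  · have h1 := (continuousAt_extChartAt_symm (I := 𝓡 (2 * n)) x).eventually
      (by rw [extChartAt_to_inv]; exact hf0 x hx)
    refine (contDiffAt_const (c := 0)).congr_of_eventuallyEq ?_
    filter_upwards [h1] with z hz
    rw [chartForm_function_smul, hz, zero_smul]

theorem exists_smul_contMDiff {p : M} {X : ∀ x : M, TangentSpace (𝓡 (2 * n)) x}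
    (hX : ∀ᶠ x in 𝓝 p, ContDiffAt ℝ ∞ (chartField x X) (𝓔 x x)) :
    ∃ f : M → ℝ, f =ᶠ[𝓝 p] 1 ∧ ContMDiff (𝓡 (2 * n)) (𝓡 (2 * n)).tangent ∞
      (fun x => (⟨x, f x • X x⟩ : TangentBundle (𝓡 (2 * n)) M)) := by
  obtain ⟨f, hf, hf1, hf0⟩ := exists_bump (n := n) hX
  refine ⟨f, hf1, fun x => contMDiffAt_field_iff.mpr ?_⟩
  have e : chartField x (fun p => f p • X p) = fun z => f ((𝓔 x).symm z) • chartField x X z :=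
    funext fun z => map_smul (mfderiv (𝓡 (2 * n)) 𝓘(ℝ, Model n) (𝓔 x) ((𝓔 x).symm z) :
      TangentSpace (𝓡 (2 * n)) ((𝓔 x).symm z) →L[ℝ] Model n) _ _
  by_cases hx : ContDiffAt ℝ ∞ (chartField x X) (𝓔 x x)
  · rw [e]
    exact (contDiffAt_comp_chart_symm hf x).smul hx
  · have h1 := (continuousAt_extChartAt_symm (I := 𝓡 (2 * n)) x).eventually
      (by rw [extChartAt_to_inv]; exact hf0 x hx)
    refine (contDiffAt_const (c := 0)).congr_of_eventuallyEq ?_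
    filter_upwards [h1] with z hz
    rw [e]
    exact (congrArg (· • chartField x X z) hz).trans (zero_smul ℝ _)

end Bump

/-! ### The integer grading on the forms of one vector space -/

section FiberDegree

open ExteriorAlgebra

variable {V : Type*} [AddCommGroup V] [Module ℝ V] [FiniteDimensional ℝ V]

variable (V) in
/-- The grading of the exterior forms on a vector space by integers. -/
def fiberDegree (i : ℤ) : Submodule ℝ (ExtForms V) :=
  Module.End.eigenspace (gradedScale fun k => (k : ℝ)) (i : ℝ)

theorem mem_fiberDegree {i : ℤ} {β : ExtForms V} :
    β ∈ fiberDegree V i ↔ gradedScale (fun k => (k : ℝ)) β = (i : ℝ) • β :=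
  Module.End.mem_eigenspace_iff

theorem mem_fiberDegree_natCast {k : ℕ} {β : ExtForms V} :
    β ∈ fiberDegree V k ↔ β ∈ ⋀[ℝ]^k (Module.Dual ℝ V) := by
  rw [mem_fiberDegree]
  refine ⟨fun h => mem_exteriorPower_of_gradedScale (by simpa using h), fun h => ?_⟩
  rw [gradedScale_of_mem _ h]; simp

/-- The degree operator plus `m + 1` is invertible, as `k + m + 1` never vanishes. -/
theorem eq_zero_of_mem_fiberDegree_negSucc {m : ℕ} {β : ExtForms V}
    (h : β ∈ fiberDegree V (Int.negSucc m)) : β = 0 := by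
  rw [mem_fiberDegree] at h
  have h1 : gradedScale (fun k => ((k : ℝ) + m + 1)⁻¹) (gradedScale (fun k => (k : ℝ) + m + 1) β) =
      β := by
    rw [← Module.End.mul_apply, gradedScale_mul_gradedScale]
    convert gradedScale_one β using 3
    ext k
    simp only [Pi.mul_apply]
    exact inv_mul_cancel₀ (by positivity)
  have h2 : gradedScale (fun k => (k : ℝ) + m + 1) β = 0 := by
    have e : (fun k : ℕ => (k : ℝ) + m + 1) = (fun k : ℕ => (k : ℝ)) + fun _ => (m : ℝ) + 1 := by
      ext k; simp [add_assoc]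
    have e2 : gradedScale (fun _ => (m : ℝ) + 1) β = ((m : ℝ) + 1) • β :=
      homogeneous_induction (P := fun β => gradedScale (fun _ => (m : ℝ) + 1) β =
        ((m : ℝ) + 1) • β) (fun α γ hα hγ => by rw [map_add, hα, hγ, smul_add])
        (fun k γ hγ => gradedScale_of_mem _ hγ) β
    rw [e, gradedScale_add, LinearMap.add_apply, h, e2]
    push_cast
    module
  rw [← h1, h2, map_zero]

theorem fiberDegree_mul_mem (i j : ℤ) (a : ExtForms V) (ha : a ∈ fiberDegree V i)
    (b : ExtForms V) (hb : b ∈ fiberDegree V j) : a * b ∈ fiberDegree V (i + j) := by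
  rw [mem_fiberDegree] at *
  rw [← dualDerivation_id] at *
  rw [dualDerivation_mul, ha, hb]
  push_cast
  rw [smul_mul_assoc, mul_smul_comm, add_smul]

theorem fiberDegree_mul_comm (i j : ℤ) (a : ExtForms V) (ha : a ∈ fiberDegree V i)
    (b : ExtForms V) (hb : b ∈ fiberDegree V j) : a * b = ((-1 : ℝ) ^ (i * j)) • (b * a) := by
  rcases i with i | i
  · rcases j with j | j
    · simp only [Int.ofNat_eq_natCast] at *
      rw [mem_fiberDegree_natCast] at ha hb
      rw [mul_comm_of_mem ha hb, ← Nat.cast_mul, zpow_natCast]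
    · rw [eq_zero_of_mem_fiberDegree_negSucc hb]; simp
  · rw [eq_zero_of_mem_fiberDegree_negSucc ha]; simp

theorem gradingInvolution_of_mem_fiberDegree {i : ℤ} {a : ExtForms V} (ha : a ∈ fiberDegree V i) :
    gradingInvolution V a = ((-1 : ℝ) ^ i) • a := by
  rcases i with i | i
  · simp only [Int.ofNat_eq_natCast] at *
    rw [mem_fiberDegree_natCast] at ha
    rw [gradingInvolution_of_mem ha, zpow_natCast]
  · rw [eq_zero_of_mem_fiberDegree_negSucc ha]; simp

theorem hasOrderLE_interior (v : V) : HasOrderLE (fiberDegree V) 1 (-1) (interior v) := by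
  refine HasOrderLE.of_antiderivation (by decide) (fun i a ha => ?_) fun i a ha b => ?_
  · rw [mem_fiberDegree] at *
    have h1 := dualDerivation_mul_interior LinearMap.id v a
    rw [dualDerivation_id, ha, map_smul, LinearMap.id_apply, sub_eq_iff_eq_add] at h1
    rw [h1]; push_cast; module
  · rw [interior_mul, gradingInvolution_of_mem_fiberDegree ha, smul_mul_assoc]

/-- Contraction with a decomposable two-form is a product of two odd derivations, each of order one.
-/
theorem hasOrderLE_adjMul {s : Module.Dual ℝ V →ₗ[ℝ] V} {η : ExtForms V}
    (hη : η ∈ ⋀[ℝ]^2 (Module.Dual ℝ V)) : HasOrderLE (fiberDegree V) 2 (-2) (adjMul s η) := by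
  refine two_form_induction (P := fun η => HasOrderLE (fiberDegree V) 2 (-2) (adjMul s η))
    (fun α β hα hβ => by rw [map_add]; exact hα.add hβ) (fun a b => ?_) hη
  rw [adjMul_ι_mul, adjMul_ι]
  exact HasOrderLE.mul fiberDegree_mul_mem fiberDegree_mul_comm (hasOrderLE_interior (s b))
    (hasOrderLE_interior (s a))

end FiberDegree

/-! ### Homogeneity in terms of the degree operator -/

section Eigen

variable {A : Type*} [AddCommGroup A] [Module ℝ A] {H T : Module.End ℝ A} {k : ℝ}

theorem apply_eigen_of_bracket (h : H * T - T * H = k • T) {i : ℝ} {a : A} (ha : H a = i • a) :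
    H (T a) = (i + k) • T a := by
  have h1 := LinearMap.congr_fun h a
  simp only [LinearMap.sub_apply, Module.End.mul_apply, LinearMap.smul_apply] at h1
  rw [ha, map_smul, sub_eq_iff_eq_add] at h1
  rw [h1]; module

theorem bracket_of_apply_eigen {κ : Type*} {S : κ → Submodule ℝ A} {c : κ → ℝ}
    (hS : ⨆ i, S i = ⊤) (h1 : ∀ i, ∀ a ∈ S i, H a = c i • a)
    (h2 : ∀ i, ∀ a ∈ S i, H (T a) = (c i + k) • T a) : H * T - T * H = k • T := by
  refine LinearMap.ext fun α => ?_
  have hα : α ∈ ⨆ i, S i := by rw [hS]; trivial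
  refine Submodule.iSup_induction S (motive := fun α => (H * T - T * H) α = (k • T) α) hα
    (fun i a ha => ?_) (by simp) fun a b ha hb => by rw [map_add, map_add, ha, hb]
  simp only [LinearMap.sub_apply, Module.End.mul_apply, LinearMap.smul_apply]
  rw [h1 i a ha, h2 i a ha, map_smul]; module

theorem IsHomogeneousOp.bracket {A : Type*} [Ring A] [Algebra ℝ A] {𝒜 : ℤ → Submodule ℝ A}
    (h𝒜 : DirectSum.IsInternal 𝒜) {H T : Module.End ℝ A}
    (hH : ∀ (i : ℤ), ∀ a ∈ 𝒜 i, H a = (i : ℝ) • a) {k : ℤ} (h : IsHomogeneousOp 𝒜 k T) :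
    H * T - T * H = (k : ℝ) • T :=
  bracket_of_apply_eigen (c := fun i : ℤ => (i : ℝ)) h𝒜.submodule_iSup_eq_top hH fun i a ha => by
    rw [hH _ _ (h i a ha), Int.cast_add]

theorem IsHomogeneousOp.of_bracket {A : Type*} [Ring A] [Algebra ℝ A] {𝒜 : ℤ → Submodule ℝ A}
    {H T : Module.End ℝ A} (hH : ∀ (i : ℤ) (a : A), a ∈ 𝒜 i ↔ H a = (i : ℝ) • a) {k : ℤ}
    (h : H * T - T * H = (k : ℝ) • T) : IsHomogeneousOp 𝒜 k T := fun i a ha => by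
  rw [hH, apply_eigen_of_bracket h ((hH i a).mp ha), Int.cast_add]

end Eigen

/-! ### The graded algebra of smooth forms and its differential -/

section FormAlgebra

open ExteriorAlgebra Topology

variable {n : ℕ} {M : Type*} [TopologicalSpace M] [ChartedSpace (Model n) M]
  [IsManifold (𝓡 (2 * n)) ∞ M]

local notation "𝓔" => extChartAt (𝓡 (2 * n))

variable (n M) in
/-- The algebra of smooth forms as a type. -/
def SmoothForm : Type _ := Form n M

instance : Ring (SmoothForm n M) := inferInstanceAs (Ring (Form n M))

instance : Algebra ℝ (SmoothForm n M) := inferInstanceAs (Algebra ℝ (Form n M))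

/-- The underlying form. -/
def SmoothForm.raw (α : SmoothForm n M) : RawForm n M := Subtype.val α

theorem SmoothForm.smooth (α : SmoothForm n M) : α.raw ∈ Form n M := Subtype.prop α

/-- A smooth form from its underlying form. -/
def SmoothForm.mk (α : RawForm n M) (h : α ∈ Form n M) : SmoothForm n M := ⟨α, h⟩

theorem raw_mk (α : RawForm n M) (h : α ∈ Form n M) : (SmoothForm.mk α h).raw = α := rfl

theorem raw_ext {α β : SmoothForm n M} (h : α.raw = β.raw) : α = β := Subtype.ext h

theorem form_ext {α β : SmoothForm n M} (h : ∀ x, α.raw x = β.raw x) : α = β :=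
  raw_ext (funext h)

variable (n M) in
/-- The underlying form, as a homomorphism of algebras. -/
def rawHom : SmoothForm n M →ₐ[ℝ] RawForm n M where
  toFun := SmoothForm.raw
  map_one' := rfl
  map_mul' _ _ := rfl
  map_zero' := rfl
  map_add' _ _ := rfl
  commutes' _ := rfl

theorem raw_sub (α β : SmoothForm n M) : (α - β).raw = α.raw - β.raw := rfl

theorem raw_smul (c : ℝ) (α : SmoothForm n M) : (c • α).raw = c • α.raw := rfl

theorem raw_sum {κ : Type*} (s : Finset κ) (α : κ → SmoothForm n M) :
    (∑ i ∈ s, α i).raw = ∑ i ∈ s, (α i).raw := map_sum (rawHom n M) α s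

theorem raw_sum_apply {κ : Type*} (s : Finset κ) (α : κ → SmoothForm n M) (x : M) :
    (∑ i ∈ s, α i).raw x = ∑ i ∈ s, (α i).raw x := by rw [raw_sum, Finset.sum_apply]

/-- A smooth operator of order zero on smooth forms. -/
def fiberEnd (T : ∀ x : M, Module.End ℝ (ExtForms (TangentSpace (𝓡 (2 * n)) x)))
    (hT : IsSmoothOp T) : Module.End ℝ (SmoothForm n M) where
  toFun α := SmoothForm.mk (fun x => T x (α.raw x)) (hT α.raw α.smooth)
  map_add' α β := form_ext fun x => map_add (T x) (α.raw x) (β.raw x)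
  map_smul' c α := form_ext fun x => map_smul (T x) c (α.raw x)

theorem fiberEnd_raw {T : ∀ x : M, Module.End ℝ (ExtForms (TangentSpace (𝓡 (2 * n)) x))}
    (hT : IsSmoothOp T) (α : SmoothForm n M) (x : M) : (fiberEnd T hT α).raw x = T x (α.raw x) :=
  rfl

variable (n M) in
/-- The grading by degree. -/
def smoothDegree (i : ℤ) : Submodule ℝ (SmoothForm n M) := formDegree n M i

theorem finrank_tangentSpace (x : M) : Module.finrank ℝ (TangentSpace (𝓡 (2 * n)) x) = 2 * n :=
  finrank_euclideanSpace_fin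

theorem mem_formDegree {i : ℤ} {α : SmoothForm n M} :
    α ∈ smoothDegree n M i ↔ ∀ x, α.raw x ∈ fiberDegree (TangentSpace (𝓡 (2 * n)) x) i := by
  rcases i with i | i
  · exact forall_congr' fun x => mem_fiberDegree_natCast.symm
  · refine ⟨fun h x => ?_, fun h => ?_⟩
    · have h' : α = 0 := (Submodule.mem_bot ℝ (M := Form n M)).mp h
      rw [h']; exact zero_mem _
    · exact (Submodule.mem_bot ℝ (M := Form n M)).mpr (form_ext fun x => eq_zero_of_mem_fiberDegree_negSucc (h x))

variable (n M) in
/-- The operator multiplying forms of degree `k` by `c k`. -/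
def scaleOp (c : ℕ → ℝ) : Module.End ℝ (SmoothForm n M) := fiberEnd _ (isSmoothOp_gradedScale c)

theorem scaleOp_apply (c : ℕ → ℝ) (α : SmoothForm n M) (x : M) :
    (scaleOp n M c α).raw x = gradedScale c (α.raw x) := rfl

theorem mem_formDegree_iff_scaleOp {i : ℤ} {α : SmoothForm n M} :
    α ∈ smoothDegree n M i ↔ scaleOp n M (fun k => (k : ℝ)) α = (i : ℝ) • α := by
  rw [mem_formDegree]
  refine ⟨fun h => form_ext fun x => mem_fiberDegree.mp (h x), fun h x => mem_fiberDegree.mpr ?_⟩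
  rw [← scaleOp_apply, h]; rfl

theorem isHomogeneousOp_of_bracket {k : ℤ} {T : Module.End ℝ (SmoothForm n M)}
    (h : scaleOp n M (fun k => (k : ℝ)) * T - T * scaleOp n M (fun k => (k : ℝ)) = (k : ℝ) • T) :
    IsHomogeneousOp (smoothDegree n M) k T :=
  IsHomogeneousOp.of_bracket (fun _ _ => mem_formDegree_iff_scaleOp) h

theorem formDegree_mul_mem (i j : ℤ) (a : SmoothForm n M) (ha : a ∈ smoothDegree n M i)
    (b : SmoothForm n M) (hb : b ∈ smoothDegree n M j) : a * b ∈ smoothDegree n M (i + j) := by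
  rw [mem_formDegree] at *
  exact fun x => fiberDegree_mul_mem i j _ (ha x) _ (hb x)

theorem formDegree_mul_comm (i j : ℤ) (a : SmoothForm n M) (ha : a ∈ smoothDegree n M i)
    (b : SmoothForm n M) (hb : b ∈ smoothDegree n M j) : a * b = ((-1 : ℝ) ^ (i * j)) • (b * a) := by
  rw [mem_formDegree] at *
  exact form_ext fun x => fiberDegree_mul_comm i j _ (ha x) _ (hb x)

theorem one_mem_formDegree : (1 : SmoothForm n M) ∈ smoothDegree n M 0 :=
  mem_formDegree.mpr fun _ => mem_fiberDegree_natCast.mpr one_mem_exteriorPower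

theorem sum_scaleOp_single (α : SmoothForm n M) :
    ∑ k ∈ Finset.range (2 * n + 1), scaleOp n M (Pi.single k 1) α = α := by
  refine form_ext fun x => ?_
  have e : (∑ k ∈ Finset.range (2 * n + 1), scaleOp n M (Pi.single k 1) α).raw x =
      ∑ k ∈ Finset.range (2 * n + 1), gradedScale (Pi.single k 1) (α.raw x) := by
    rw [raw_sum_apply]; rfl
  rw [e]
  refine homogeneous_induction (P := fun β => ∑ k ∈ Finset.range (2 * n + 1),
    gradedScale (Pi.single k 1) β = β) (fun β γ hβ hγ => ?_) (fun k β hβ => ?_) (α.raw x)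
  · simp only [map_add, Finset.sum_add_distrib, hβ, hγ]
  · simp only [gradedScale_of_mem _ hβ]
    by_cases hk : k < 2 * n + 1
    · rw [Finset.sum_eq_single_of_mem k (Finset.mem_range.mpr hk) fun l _ hl => by
        rw [Pi.single_eq_of_ne hl.symm, zero_smul]]
      simp
    · rw [exteriorPower_eq_bot (by rw [finrank_tangentSpace]; omega)] at hβ
      rw [(Submodule.mem_bot ℝ).mp hβ]; simp

/-- The graded pieces are eigenspaces of the degree operator, hence independent; they span because
the degree is bounded by the dimension. -/
theorem formDegree_isInternal : DirectSum.IsInternal (smoothDegree n M) := by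
  rw [DirectSum.isInternal_submodule_iff_iSupIndep_and_iSup_eq_top]
  constructor
  · have h := (Module.End.eigenspaces_iSupIndep (scaleOp n M fun k => (k : ℝ))).comp
      (f := fun i : ℤ => (i : ℝ)) Int.cast_injective
    refine h.mono fun i α hα => ?_
    exact Module.End.mem_eigenspace_iff.mpr (mem_formDegree_iff_scaleOp.mp hα)
  · refine eq_top_iff.mpr fun α _ => ?_
    rw [← sum_scaleOp_single α]
    refine sum_mem fun k _ => Submodule.mem_iSup_of_mem (k : ℤ) ?_
    refine mem_formDegree.mpr fun x => mem_fiberDegree_natCast.mpr ?_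
    rw [scaleOp_apply, ← degPart_eq_gradedScale]
    exact degPart_mem k _

/-- The bracket of a fibrewise operator with a multiplication is again fibrewise, so the induction
runs in each fibre. In order zero the multipliers of the fibres assemble to the smooth form `D 1`.
-/
theorem hasOrderLE_of_fiber {r : ℕ} {k : ℤ} {D : Module.End ℝ (SmoothForm n M)}
    {T : ∀ x : M, Module.End ℝ (ExtForms (TangentSpace (𝓡 (2 * n)) x))}
    (hD : ∀ α x, (D α).raw x = T x (α.raw x))
    (hT : ∀ x, HasOrderLE (fiberDegree (TangentSpace (𝓡 (2 * n)) x)) r k (T x)) :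
    HasOrderLE (smoothDegree n M) r k D := by
  induction r generalizing k D T with
  | zero =>
    have h1 : ∀ x β, T x β = T x 1 * β := fun x β => by
      obtain ⟨c, -, hc⟩ := hT x; rw [hc]; simp
    refine ⟨D 1, mem_formDegree.mpr fun x => ?_, LinearMap.ext fun α => form_ext fun x => ?_⟩
    · obtain ⟨c, hc, hc'⟩ := hT x
      have : (D 1).raw x = c := by
        rw [hD, hc']; exact mul_one c
      rw [this]; exact hc
    · refine (hD α x).trans ((h1 x _).trans ?_)
      rw [← show (D 1).raw x = T x 1 from hD 1 x]
      rfl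
  | succ r ih =>
    refine ⟨fun i a ha => mem_formDegree.mpr fun x => ?_, fun j a ha => ?_⟩
    · rw [hD]; exact (hT x).1 i _ (mem_formDegree.mp ha x)
    · refine ih (T := fun x => gradedCommutator j k (LinearMap.mulLeft ℝ (a.raw x)) (T x))
        (fun α x => ?_) fun x => (hT x).2 j _ (mem_formDegree.mp ha x)
      have e1 : (gradedCommutator j k (LinearMap.mulLeft ℝ a) D α).raw x =
        a.raw x * (D α).raw x - ((-1 : ℝ) ^ (j * k)) • (D (a * α)).raw x := rfl
      have e2 : (D (a * α)).raw x = T x (a.raw x * α.raw x) := hD (a * α) x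
      rw [e1, hD α x, e2]; rfl

theorem contDiffAt_chartForm (α : SmoothForm n M) {x : M} {y : Model n} (hy : y ∈ (𝓔 x).target) :
    ContDiffAt ℝ ∞ (chartForm x α.raw) y :=
  (contDiffAt_chartForm_iff' hy).mpr (mem_form_iff.mp α.2 _)

theorem contDiffAt_chartForm_self (α : SmoothForm n M) (x : M) :
    ContDiffAt ℝ ∞ (chartForm x α.raw) (𝓔 x x) := mem_form_iff.mp α.2 x

theorem one_le_infty : (1 : WithTop ℕ∞) ≤ ∞ := by exact_mod_cast le_top

theorem two_le_infty : (2 : WithTop ℕ∞) ≤ ∞ := (mod_cast le_top : ((2 : ℕ∞) : WithTop ℕ∞) ≤ ∞)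

theorem differentiableAt_chartForm_self (α : SmoothForm n M) (x : M) :
    DifferentiableAt ℝ (chartForm x α.raw) (𝓔 x x) :=
  (contDiffAt_chartForm_self α x).differentiableAt (by simp)

theorem chartForm_extD_self (α : SmoothForm n M) (x : M) :
    chartForm x (extD α.raw) (𝓔 x x) = coordExtDeriv (chartForm x α.raw) (𝓔 x x) :=
  chartForm_extD (mem_extChartAt_target x) ((contDiffAt_chartForm_self α x).of_le one_le_infty)

theorem extD_add (α β : SmoothForm n M) : extD (α.raw + β.raw) = extD α.raw + extD β.raw := by
  refine rawForm_ext_chart fun x => ?_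
  have e : chartForm x (α.raw + β.raw) = fun y => chartForm x α.raw y + chartForm x β.raw y :=
    funext fun y => chartForm_add x α.raw β.raw y
  have h : chartForm x (extD (α.raw + β.raw)) (𝓔 x x) = coordExtDeriv (chartForm x (α.raw + β.raw)) (𝓔 x x) :=
    chartForm_extD_self (α + β) x
  rw [chartForm_add, chartForm_extD_self α x, chartForm_extD_self β x, h, e,
    ← coordExtDeriv_add (differentiableAt_chartForm_self α x) (differentiableAt_chartForm_self β x)]

theorem extD_smul (c : ℝ) (α : SmoothForm n M) : extD (c • α.raw) = c • extD α.raw := by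
  refine rawForm_ext_chart fun x => ?_
  have e : chartForm x (c • α.raw) = fun y => algebraMap ℝ (ExtForms (Model n)) c *
      chartForm x α.raw y := funext fun y =>
    (chartForm_smul x c α.raw y).trans (Algebra.smul_def c (chartForm x α.raw y))
  have h : chartForm x (extD (c • α.raw)) (𝓔 x x) = coordExtDeriv (chartForm x (c • α.raw)) (𝓔 x x) :=
    chartForm_extD_self (c • α) x
  rw [h, e, coordExtDeriv_mul (differentiableAt_const _) (differentiableAt_chartForm_self α x),
    coordExtDeriv_const, zero_mul, zero_add, gradingInvolution_of_mem (algebraMap_mem c),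
    pow_zero, one_smul, ← chartForm_extD_self α x, chartForm_smul]
  exact (Algebra.smul_def c _).symm

variable (n M) in
/-- The exterior derivative on smooth forms. -/
def formD : Module.End ℝ (SmoothForm n M) where
  toFun α := ⟨extD α.raw, mem_form_iff.mpr fun x => isSmoothFormAt_extD (mem_form_iff.mp α.2 x)⟩
  map_add' α β := Subtype.ext (extD_add α β)
  map_smul' c α := Subtype.ext (extD_smul c α)

theorem formD_coe (α : SmoothForm n M) : (formD n M α).raw = extD α.raw := rfl

theorem formD_mul (α β : SmoothForm n M) : formD n M (α * β) =
    formD n M α * β + scaleOp n M (fun k => (-1) ^ k) α * formD n M β := by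
  refine Subtype.ext (rawForm_ext_chart fun x => ?_)
  change chartForm x (extD (α * β).raw) _ = chartForm x (extD α.raw * β.raw +
    (scaleOp n M (fun k => (-1) ^ k) α).raw * extD β.raw) _
  have e1 : chartForm x (α * β).raw = fun y => chartForm x α.raw y * chartForm x β.raw y :=
    funext fun y => chartForm_mul x α.raw β.raw y
  have e2 : chartForm x (scaleOp n M (fun k => (-1) ^ k) α).raw (𝓔 x x) =
      gradingInvolution (Model n) (chartForm x α.raw (𝓔 x x)) :=
    pullbackForm_gradedScale _ _ _
  rw [chartForm_add, chartForm_mul, chartForm_mul, chartForm_extD_self α x,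
    chartForm_extD_self β x, chartForm_extD_self (α * β) x, e1, e2,
    coordExtDeriv_mul (differentiableAt_chartForm_self α x) (differentiableAt_chartForm_self β x)]

theorem formD_formD : formD n M * formD n M = 0 := by
  refine LinearMap.ext fun α => Subtype.ext (rawForm_ext_chart fun x => ?_)
  change chartForm x (extD (formD n M α).raw) _ = chartForm x 0 _
  have e : chartForm x (formD n M α).raw =ᶠ[𝓝 (𝓔 x x)] coordExtDeriv (chartForm x α.raw) := by
    filter_upwards [target_mem_nhds (mem_extChartAt_target x)] with y hy
    exact chartForm_extD hy ((contDiffAt_chartForm α hy).of_le one_le_infty)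
  rw [chartForm_extD_self, coordExtDeriv_congr e,
    coordExtDeriv_coordExtDeriv ((contDiffAt_chartForm_self α x).of_le two_le_infty)]
  exact (map_zero (chartFormHom x _)).symm

theorem coordExtDeriv_mem {k : ℕ} {f : Model n → ExtForms (Model n)} {y : Model n}
    (hf : DifferentiableAt ℝ f y) (h : ∀ z, f z ∈ ⋀[ℝ]^k (Module.Dual ℝ (Model n))) :
    coordExtDeriv f y ∈ ⋀[ℝ]^(k + 1) (Module.Dual ℝ (Model n)) := by
  rw [coordExtDeriv_eq hf]
  refine sum_mem fun i _ => ι_mul_mem _ ?_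
  have e : f = fun z => gradedScale (Pi.single k 1) (f z) := by
    ext1 z; rw [gradedScale_of_mem _ (h z)]; simp
  rw [e, fderiv_linear _ hf, ← degPart_eq_gradedScale]
  exact degPart_mem k _

theorem formD_isHomogeneousOp : IsHomogeneousOp (smoothDegree n M) 1 (formD n M) := by
  intro i α hα
  rw [mem_formDegree] at hα ⊢
  rcases i with i | i
  · intro x
    have h1 : ∀ x, α.raw x ∈ ⋀[ℝ]^i (Module.Dual ℝ (TangentSpace (𝓡 (2 * n)) x)) := fun x =>
      mem_fiberDegree_natCast.mp (hα x)
    have : (Int.ofNat i + 1 : ℤ) = ((i + 1 : ℕ) : ℤ) := rfl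
    rw [this, mem_fiberDegree_natCast]
    exact pullbackForm_mem _ (coordExtDeriv_mem (differentiableAt_chartForm_self α x)
      fun z => pullbackForm_mem _ (h1 _))
  · have : α = 0 := form_ext fun x => eq_zero_of_mem_fiberDegree_negSucc (hα x)
    intro x
    rw [this, map_zero]; exact zero_mem _

theorem isHomogeneousOp_bracket {k : ℤ} {T : Module.End ℝ (SmoothForm n M)}
    (h : IsHomogeneousOp (smoothDegree n M) k T) :
    scaleOp n M (fun k => (k : ℝ)) * T - T * scaleOp n M (fun k => (k : ℝ)) = (k : ℝ) • T :=
  h.bracket formDegree_isInternal fun _ _ ha => mem_formDegree_iff_scaleOp.mp ha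

end FormAlgebra

/-! ### Polynomials in intertwined operators -/

section Intertwine

open Polynomial

theorem map_aeval_of_intertwines {A B : Type*} [AddCommGroup A] [Module ℝ A] [AddCommGroup B]
    [Module ℝ B] {S : Module.End ℝ A} {T : Module.End ℝ B} (f : A →ₗ[ℝ] B)
    (hf : ∀ a, f (S a) = T (f a)) (p : ℝ[X]) (a : A) : f (aeval S p a) = aeval T p (f a) := by
  induction p using Polynomial.induction_on' with
  | add p q hp hq => rw [map_add, map_add, LinearMap.add_apply, LinearMap.add_apply, map_add, hp, hq]
  | monomial k c =>
    rw [aeval_monomial, aeval_monomial, ← Algebra.smul_def, ← Algebra.smul_def,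
      LinearMap.smul_apply, LinearMap.smul_apply, map_smul]
    congr 1
    induction k with
    | zero => rfl
    | succ k ih => rw [pow_succ', pow_succ', Module.End.mul_apply, Module.End.mul_apply, hf, ih]

end Intertwine

/-! ### The `sl₂`-triple and the bigrading on smooth forms -/

section Operators

open ExteriorAlgebra Polynomial

variable {n : ℕ} {M : Type*} [TopologicalSpace M] [ChartedSpace (Model n) M]
  [IsManifold (𝓡 (2 * n)) ∞ M]

variable (n) in
/-- The value of a form at a point. -/
def fiberEval (x : M) : SmoothForm n M →ₗ[ℝ] ExtForms (TangentSpace (𝓡 (2 * n)) x) where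
  toFun α := α.raw x
  map_add' _ _ := rfl
  map_smul' _ _ := rfl

variable (n M) in
/-- The operator multiplying forms of degree `k` by `k`. -/
def degOp : Module.End ℝ (SmoothForm n M) := scaleOp n M fun k => (k : ℝ)

theorem degOp_bracket {k : ℤ} {T : Module.End ℝ (SmoothForm n M)}
    (h : IsHomogeneousOp (smoothDegree n M) k T) :
    degOp n M * T - T * degOp n M = (k : ℝ) • T := isHomogeneousOp_bracket h

theorem scaleOp_sub_const (c : ℝ) :
    scaleOp n M (fun k => (k : ℝ) - c) = degOp n M - c • 1 := by
  refine LinearMap.ext fun α => form_ext fun x => ?_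
  change gradedScale (fun k => (k : ℝ) - c) (α.raw x) =
    gradedScale (fun k => (k : ℝ)) (α.raw x) - c • α.raw x
  refine homogeneous_induction (P := fun β => gradedScale (fun k => (k : ℝ) - c) β =
    gradedScale (fun k => (k : ℝ)) β - c • β) (fun β γ hβ hγ => ?_) (fun k β hβ => ?_) (α.raw x)
  · rw [map_add, map_add, hβ, hγ]; module
  · rw [gradedScale_of_mem _ hβ, gradedScale_of_mem _ hβ]; module

theorem scaleOp_neg_one_pow {i : ℤ} {α : SmoothForm n M} (hα : α ∈ smoothDegree n M i) :
    scaleOp n M (fun k => (-1) ^ k) α = ((-1 : ℝ) ^ i) • α :=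
  form_ext fun x => gradingInvolution_of_mem_fiberDegree (mem_formDegree.mp hα x)

theorem formD_leibniz (i : ℤ) (α : SmoothForm n M) (hα : α ∈ smoothDegree n M i)
    (β : SmoothForm n M) :
    formD n M (α * β) = formD n M α * β + ((-1 : ℝ) ^ i) • (α * formD n M β) := by
  rw [formD_mul, scaleOp_neg_one_pow hα, smul_mul_assoc]

namespace AlmostSymplecticForm

variable (Ω : AlmostSymplecticForm n M)

/-- The almost symplectic form as an element of the algebra of smooth forms. -/
def form : SmoothForm n M := SmoothForm.mk Ω.toForm Ω.smooth

/-- The fibrewise adjoint of the multiplication by a form. -/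
def adjOp (η : SmoothForm n M) : Module.End ℝ (SmoothForm n M) :=
  fiberEnd _ (Ω.isSmoothOp_adjMul η.smooth)

/-- The multiplication by the almost symplectic form. -/
def raise : Module.End ℝ (SmoothForm n M) := LinearMap.mulLeft ℝ Ω.form

/-- The adjoint of the multiplication by the almost symplectic form. -/
def lower : Module.End ℝ (SmoothForm n M) := Ω.adjOp Ω.form

theorem form_mem : Ω.form ∈ smoothDegree n M 2 :=
  mem_formDegree.mpr fun x => mem_fiberDegree_natCast.mpr (Ω.degree_two x)

theorem formD_form_mem : formD n M Ω.form ∈ smoothDegree n M 3 :=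
  formD_isHomogeneousOp 2 _ Ω.form_mem

theorem adjOp_mul (η ζ : SmoothForm n M) : Ω.adjOp (η * ζ) = Ω.adjOp ζ * Ω.adjOp η :=
  LinearMap.ext fun α => form_ext fun x =>
    LinearMap.congr_fun (adjMul_mul (Ω.sharpAt x) (η.raw x) (ζ.raw x)) (α.raw x)

theorem hasOrderLE_lower : HasOrderLE (smoothDegree n M) 2 (-2) Ω.lower :=
  hasOrderLE_of_fiber (T := fun x => adjMul (Ω.sharpAt x) (Ω.toForm x)) (fun _ _ => rfl)
    fun x => hasOrderLE_adjMul (Ω.degree_two x)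

theorem isHomogeneousOp_raise : IsHomogeneousOp (smoothDegree n M) 2 Ω.raise :=
  isHomogeneousOp_mulLeft formDegree_mul_mem Ω.form_mem

theorem raise_lower : Ω.raise * Ω.lower - Ω.lower * Ω.raise =
    scaleOp n M fun k => (k : ℝ) - n :=
  LinearMap.ext fun α => form_ext fun x =>
    LinearMap.congr_fun ((Ω.isSharp x).bracket_omega_lambda (finrank_tangentSpace x)) (α.raw x)

theorem raise_pow : Ω.raise ^ (n + 1) = 0 := by
  rw [raise, LinearMap.pow_mulLeft]
  have : Ω.form ^ (n + 1) = 0 := by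
    have e : ∀ (k : ℕ) (x : M), (Ω.form ^ k).raw x = Ω.toForm x ^ k := fun k x => by
      rw [show (Ω.form ^ k).raw = Ω.toForm ^ k from map_pow (rawHom n M) Ω.form k, Pi.pow_apply]
    exact form_ext fun x => (e _ x).trans
      ((Ω.isSharp x).mulLeft_pow_eq_zero (finrank_tangentSpace x))
  rw [this]; simp

theorem adjOp_zero : Ω.adjOp 0 = 0 :=
  LinearMap.ext fun α => form_ext fun x =>
    LinearMap.congr_fun (map_zero (adjMul (Ω.sharpAt x))) (α.raw x)

theorem adjOp_one : Ω.adjOp 1 = 1 :=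
  LinearMap.ext fun α => form_ext fun x =>
    LinearMap.congr_fun (adjMul_one (Ω.sharpAt x)) (α.raw x)

theorem adjOp_pow (η : SmoothForm n M) (k : ℕ) : Ω.adjOp (η ^ k) = Ω.adjOp η ^ k := by
  induction k with
  | zero => rw [pow_zero, pow_zero, adjOp_one]
  | succ k ih => rw [pow_succ, adjOp_mul, ih, ← pow_succ']

theorem lower_pow : Ω.lower ^ (n + 1) = 0 := by
  have := Ω.raise_pow
  rw [raise, LinearMap.pow_mulLeft] at this
  have h1 : Ω.form ^ (n + 1) = 0 := by simpa using LinearMap.congr_fun this 1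
  rw [lower, ← adjOp_pow, h1, adjOp_zero]

theorem formD_raise : formD n M * Ω.raise - Ω.raise * formD n M =
    LinearMap.mulLeft ℝ (formD n M Ω.form) := by
  refine LinearMap.ext fun α => ?_
  simp only [LinearMap.sub_apply, Module.End.mul_apply, raise, LinearMap.mulLeft_apply]
  rw [formD_leibniz 2 _ Ω.form_mem]
  simp

theorem lower_triple : (fun Y => Ω.lower * Y - Y * Ω.lower)^[3]
    (LinearMap.mulLeft ℝ (formD n M Ω.form)) = (6 : ℝ) • Ω.adjOp (formD n M Ω.form) := by
  refine LinearMap.ext fun α => form_ext fun x => ?_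
  exact LinearMap.congr_fun ((Ω.isSharp x).triple_bracket_mulLeft
    (mem_fiberDegree_natCast.mp (mem_formDegree.mp Ω.formD_form_mem x))) (α.raw x)

theorem form_comm : Ω.form * formD n M Ω.form = formD n M Ω.form * Ω.form := by
  rw [formDegree_mul_comm 2 3 _ Ω.form_mem _ Ω.formD_form_mem]
  norm_num

/-- Brackets with the weight operator measure the degree, because constants are central. The last
two properties both come from `ω ∧ dω = dω ∧ ω`: once for the multiplications, once for their
adjoints. -/
theorem slTwoWeightOne :
    SlTwoWeightOne Ω.raise Ω.lower (scaleOp n M fun k => (k : ℝ) - n) (formD n M) := by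
  have hH : ∀ {k : ℤ} {T : Module.End ℝ (SmoothForm n M)},
      IsHomogeneousOp (smoothDegree n M) k T → ⁅scaleOp n M fun k => (k : ℝ) - n, T⁆ =
        (k : ℝ) • T := fun {k T} hT => by
    rw [scaleOp_sub_const, Ring.lie_def, ← degOp_bracket hT, sub_mul, mul_sub, smul_mul_assoc,
      mul_smul_comm, one_mul, mul_one]
    abel
  refine ⟨Ω.raise_lower, ?_, ?_, ?_, ?_, ?_⟩
  · exact (hH (Ω.hasOrderLE_lower.isHomogeneousOp formDegree_mul_mem)).trans (by push_cast; rfl)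
  · rw [hH Ω.isHomogeneousOp_raise]; norm_num
  · rw [hH formD_isHomogeneousOp]; norm_num
  · rw [Ring.lie_def (formD n M), formD_raise, Ring.lie_def, sub_eq_zero]
    refine LinearMap.ext fun α => ?_
    change Ω.form * (formD n M Ω.form * α) = formD n M Ω.form * (Ω.form * α)
    rw [← mul_assoc, form_comm, mul_assoc]
  · rw [Ring.lie_def (formD n M), formD_raise]
    have h3 : ⁅Ω.lower, ⁅Ω.lower, ⁅Ω.lower, LinearMap.mulLeft ℝ (formD n M Ω.form)⁆⁆⁆ =
        (6 : ℝ) • Ω.adjOp (formD n M Ω.form) := Ω.lower_triple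
    rw [h3, Ring.lie_def, mul_smul_comm, smul_mul_assoc, lower, ← adjOp_mul, ← adjOp_mul, form_comm,
      sub_self]

end AlmostSymplecticForm

section Bigrading

variable {L L' : TangentSubspaces n M}

theorem finrank_dualAnnihilator (hL : IsSmoothSubbundle n L) (x : M) :
    Module.finrank ℝ (L x).dualAnnihilator = n := by
  obtain ⟨U, -, hx, s, -, hs⟩ := hL x
  have h1 : Module.finrank ℝ (L x) = n := by
    rw [← (hs x hx).2, finrank_span_eq_card (hs x hx).1, Fintype.card_fin]
  have h2 := Subspace.finrank_add_finrank_dualAnnihilator_eq (L x)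
  rw [finrank_tangentSpace] at h2
  omega

/-- The operator multiplying forms of bidegree `(p, q)` by `q`. -/
def weightOp (hL : IsSmoothSubbundle n L) (hL' : IsSmoothSubbundle n L')
    (h : ∀ x, IsCompl (L x) (L' x)) : Module.End ℝ (SmoothForm n M) :=
  fiberEnd _ (isSmoothOp_projection hL hL' h)

/-- The projection of the smooth forms to those of bidegree `r`. -/
def bidegEnd (hL : IsSmoothSubbundle n L) (hL' : IsSmoothSubbundle n L')
    (h : ∀ x, IsCompl (L x) (L' x)) (r : ℕ × ℕ) : Module.End ℝ (SmoothForm n M) :=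
  scaleOp n M (Pi.single (r.1 + r.2) 1) * aeval (weightOp hL hL' h)
    (Lagrange.basis (Finset.range (r.1 + r.2 + 1)) (fun j : ℕ => (j : ℝ)) r.2)

variable (hL : IsSmoothSubbundle n L) (hL' : IsSmoothSubbundle n L')
  (h : ∀ x, IsCompl (L x) (L' x))

theorem aeval_weightOp_raw (p : ℝ[X]) (α : SmoothForm n M) (x : M) :
    (aeval (weightOp hL hL' h) p α).raw x =
      aeval (dualDerivation ((L x).projection (L' x) (h x))) p (α.raw x) :=
  map_aeval_of_intertwines (fiberEval n x) (fun _ => rfl) p α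

theorem bidegEnd_raw (r : ℕ × ℕ) (α : SmoothForm n M) (x : M) :
    (bidegEnd hL hL' h r α).raw x = bidegOp ((L x).projection (L' x) (h x)) r (α.raw x) := by
  rw [bidegEnd, Module.End.mul_apply, scaleOp_apply, aeval_weightOp_raw]; rfl

theorem isBigrading_bidegEnd :
    IsBigrading n (degOp n M) (weightOp hL hL' h) (bidegEnd hL hL' h) := by
  have H : ∀ x, _ := fun x => isBigrading_bidegOp (h x) (finrank_dualAnnihilator hL x)
    (finrank_dualAnnihilator hL' x)
  refine ⟨fun r => ?_, fun r => ?_, fun r => ?_, fun r => ?_, ?_⟩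
  · refine LinearMap.ext fun α => form_ext fun x => ?_
    refine Eq.trans ?_ ((LinearMap.congr_fun ((H x).degree_mul r) (α.raw x)).trans ?_)
    · exact congrArg (gradedScale fun k => (k : ℝ)) (bidegEnd_raw hL hL' h r α x)
    · exact congrArg (fun β => ((r.1 : ℝ) + r.2) • β) (bidegEnd_raw hL hL' h r α x).symm
  · refine LinearMap.ext fun α => form_ext fun x => ?_
    refine Eq.trans ?_ ((LinearMap.congr_fun ((H x).weight_mul r) (α.raw x)).trans ?_)
    · exact congrArg (dualDerivation _) (bidegEnd_raw hL hL' h r α x)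
    · exact congrArg (fun β => (r.2 : ℝ) • β) (bidegEnd_raw hL hL' h r α x).symm
  · refine LinearMap.ext fun α => form_ext fun x => ?_
    refine Eq.trans ?_ ((LinearMap.congr_fun ((H x).commute_degree r) (α.raw x)).trans ?_)
    · exact congrArg (gradedScale fun k => (k : ℝ)) (bidegEnd_raw hL hL' h r α x)
    · exact (bidegEnd_raw hL hL' h r (degOp n M α) x).symm
  · refine LinearMap.ext fun α => form_ext fun x => ?_
    refine Eq.trans ?_ ((LinearMap.congr_fun ((H x).commute_weight r) (α.raw x)).trans ?_)
    · exact congrArg (dualDerivation _) (bidegEnd_raw hL hL' h r α x)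
    · exact (bidegEnd_raw hL hL' h r (weightOp hL hL' h α) x).symm
  · refine LinearMap.ext fun α => form_ext fun x => ?_
    rw [LinearMap.sum_apply, raw_sum_apply]
    simp only [bidegEnd_raw]
    rw [← LinearMap.sum_apply, (H x).sum_eq]; rfl

theorem bidegProj_raw (r : ℕ × ℕ) (α : SmoothForm n M) (x : M) :
    bidegProj (L x) (L' x) r.1 r.2 (α.raw x) = (bidegEnd hL hL' h r α).raw x :=
  (bidegProj_eq (h x) r (α.raw x)).trans (bidegEnd_raw hL hL' h r α x).symm

/-- The components of an operator which is a sum of homogeneous operators. -/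
theorem bidegComponent_eq {T : RawForm n M → RawForm n M} {D : Module.End ℝ (SmoothForm n M)}
    (hT : ∀ α : SmoothForm n M, T α.raw = (D α).raw) {S : Finset ℤ}
    {C : ℤ → Module.End ℝ (SmoothForm n M)} (hD : D = ∑ c ∈ S, C c) {k : ℤ}
    (hk : ∀ c ∈ S, degOp n M * C c - C c * degOp n M = (k : ℝ) • C c)
    (hc : ∀ c ∈ S, weightOp hL hL' h * C c - C c * weightOp hL hL' h = (c : ℝ) • C c) {a b : ℤ}
    (hb : b ∈ S) (hab : a + b = k) (α : SmoothForm n M) :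
    bidegComponent L L' a b T α.raw = (C b α).raw := by
  rw [← (isBigrading_bidegEnd hL hL' h).component hk hc hb α, raw_sum]
  obtain rfl : a = k - b := by omega
  refine Finset.sum_congr rfl fun r _ => ?_
  rw [raw_sum]
  refine Finset.sum_congr rfl fun s _ => ?_
  split_ifs
  · have e : (fun z => bidegProj (L z) (L' z) r.1 r.2 (α.raw z)) = (bidegEnd hL hL' h r α).raw :=
      funext fun z => bidegProj_raw hL hL' h r α z
    rw [e, hT]
    funext x
    rw [bidegProj_raw hL hL' h, hD, LinearMap.sum_apply]
  · rfl

theorem weightOp_lower (Ω : AlmostSymplecticForm n M)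
    (hΩ : ∀ x, ∀ u ∈ L x, ∀ v ∈ L x, toBilin (Ω.toForm x) u v = 0)
    (hΩ' : ∀ x, ∀ u ∈ L' x, ∀ v ∈ L' x, toBilin (Ω.toForm x) u v = 0) :
    weightOp hL hL' h * Ω.lower - Ω.lower * weightOp hL hL' h = -Ω.lower :=
  LinearMap.ext fun α => form_ext fun x =>
    LinearMap.congr_fun ((Ω.isSharp x).weight_lambda (h x) (hΩ x) (hΩ' x)) (α.raw x)

theorem weightOp_mul (α β : SmoothForm n M) : weightOp hL hL' h (α * β) =
    weightOp hL hL' h α * β + α * weightOp hL hL' h β :=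
  form_ext fun x => dualDerivation_mul _ (α.raw x) (β.raw x)

end Bigrading

end Operators

/-! ### Global smooth forms with prescribed local behaviour -/

section LocalForms

open ExteriorAlgebra Topology

variable {n : ℕ} {M : Type*} [TopologicalSpace M] [ChartedSpace (Model n) M]
  [IsManifold (𝓡 (2 * n)) ∞ M]

local notation "𝓔" => extChartAt (𝓡 (2 * n))

/-- The form with given coefficients in the chart at `p`. -/
def formOfChart (p : M) (f : Model n → ExtForms (Model n)) : RawForm n M := fun x =>
  pullbackForm (W := Model n) (mfderiv (𝓡 (2 * n)) 𝓘(ℝ, Model n) (𝓔 p) x).toLinearMap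
    (f (𝓔 p x))

theorem chartForm_formOfChart (p : M) (f : Model n → ExtForms (Model n)) {z : Model n}
    (hz : z ∈ (𝓔 p).target) : chartForm p (formOfChart p f) z = f z := by
  refine (pullbackForm_of_eq_comp (A := ContinuousLinearMap.id ℝ (Model n))
    (mfderiv_chart_comp_symm hz).symm (f (𝓔 p ((𝓔 p).symm z)))).symm.trans ?_
  rw [(𝓔 p).right_inv hz]
  exact pullbackForm_id _

theorem isSmoothFormAt_formOfChart {p x : M} {f : Model n → ExtForms (Model n)}
    (hx : x ∈ (𝓔 p).source) (hf : ContDiffAt ℝ ∞ f (𝓔 p x)) :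
    IsSmoothFormAt (formOfChart p f) x := by
  rw [← contDiffAt_chartForm_iff hx]
  refine hf.congr_of_eventuallyEq ?_
  filter_upwards [target_mem_nhds ((𝓔 p).map_source hx)] with z hz
  exact chartForm_formOfChart p f hz

variable [T2Space M]

theorem exists_smoothForm_chart (p : M) {f : Model n → ExtForms (Model n)}
    (hf : ∀ᶠ z in 𝓝 (𝓔 p p), ContDiffAt ℝ ∞ f z) :
    ∃ α : SmoothForm n M, ∃ g : M → ℝ, α.raw = (fun x => g x • formOfChart p f x) ∧
      chartForm p α.raw =ᶠ[𝓝 (𝓔 p p)] f := by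
  have h1 : ∀ᶠ x in 𝓝 p, IsSmoothFormAt (formOfChart p f) x := by
    filter_upwards [(continuousAt_extChartAt (I := 𝓡 (2 * n)) p).eventually hf,
      source_mem_nhds (mem_extChartAt_source (I := 𝓡 (2 * n)) p)] with x hx hx'
    exact isSmoothFormAt_formOfChart hx' hx
  obtain ⟨g, hg, hg'⟩ := exists_smul_mem_form h1
  refine ⟨SmoothForm.mk _ hg', g, rfl, ?_⟩
  have h2 := (continuousAt_extChartAt_symm (I := 𝓡 (2 * n)) p).eventually
    (show ∀ᶠ x in 𝓝 ((𝓔 p).symm (𝓔 p p)), g x = 1 by rw [extChartAt_to_inv]; exact hg)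
  filter_upwards [h2, target_mem_nhds (mem_extChartAt_target p)] with z hz hz'
  rw [raw_mk, chartForm_function_smul, hz, one_smul, chartForm_formOfChart p f hz']

/-- Extend with constant coefficients in a chart and cut off. This allows pointwise conclusions from
identities tested on smooth forms. -/
theorem exists_smoothForm_apply (x : M) (β : ExtForms (TangentSpace (𝓡 (2 * n)) x)) :
    ∃ α : SmoothForm n M, α.raw x = β := by
  classical
  obtain ⟨α, -, -, hα⟩ := exists_smoothForm_chart x (f := fun _ => pullbackForm (V := Model n)
    (mfderiv 𝓘(ℝ, Model n) (𝓡 (2 * n)) (𝓔 x).symm (𝓔 x x)).toLinearMap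
      ((Pi.single x β : RawForm n M) ((𝓔 x).symm (𝓔 x x))))
    (Filter.Eventually.of_forall fun z => contDiffAt_const)
  refine ⟨α, ?_⟩
  have h1 : chartForm x α.raw (𝓔 x x) = chartForm x (Pi.single x β) (𝓔 x x) := hα.self_of_nhds
  have h2 := pullbackForm_injective (chartEquiv x (mem_extChartAt_target x)) h1
  rw [extChartAt_to_inv] at h2
  rw [h2, Pi.single_eq_same]

end LocalForms

/-! ### Symplectic adjoints of operators of order zero -/

section Adjoints

open ExteriorAlgebra Topology

variable {n : ℕ} {M : Type*} [TopologicalSpace M] [ChartedSpace (Model n) M]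
  [IsManifold (𝓡 (2 * n)) ∞ M]

theorem map_nilExp_of_intertwines {A B : Type*} [AddCommGroup A] [Module ℝ A] [AddCommGroup B]
    [Module ℝ B] {S : Module.End ℝ A} {T : Module.End ℝ B} (f : A →ₗ[ℝ] B)
    (hf : ∀ a, f (S a) = T (f a)) (N : ℕ) (a : A) : f (nilExp N S a) = nilExp N T (f a) := by
  rw [nilExp, nilExp, LinearMap.sum_apply, LinearMap.sum_apply, map_sum]
  refine Finset.sum_congr rfl fun k _ => ?_
  rw [LinearMap.smul_apply, LinearMap.smul_apply, map_smul]
  congr 1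
  clear * - hf
  induction k with
  | zero => rfl
  | succ k ih => rw [pow_succ', pow_succ', Module.End.mul_apply, Module.End.mul_apply, hf, ih]

namespace AlmostSymplecticForm

variable (Ω : AlmostSymplecticForm n M)

theorem pairing_eq (α β : RawForm n M) (x : M) :
    Ω.pairing α β x = algebraMapInv (adjMul (Ω.sharpAt x) (α x) (β x)) := formPairing_eq _ _ _ _

/-- `B` is the adjoint of `A`. -/
def IsAdjointPair (A B : Module.End ℝ (SmoothForm n M)) : Prop :=
  ∀ α β : SmoothForm n M, Ω.pairing (A α).raw β.raw = Ω.pairing α.raw (B β).raw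

variable {Ω} in
theorem IsAdjointPair.mul {A A' B B' : Module.End ℝ (SmoothForm n M)} (h : Ω.IsAdjointPair A B)
    (h' : Ω.IsAdjointPair A' B') : Ω.IsAdjointPair (A * A') (B' * B) := fun α β =>
  (h (A' α) β).trans (h' α (B β))

theorem pairing_sub_left (α α' β : RawForm n M) :
    Ω.pairing (α - α') β = Ω.pairing α β - Ω.pairing α' β := funext fun x => by
  rw [Pi.sub_apply, pairing_eq, pairing_eq, pairing_eq, Pi.sub_apply, map_sub, LinearMap.sub_apply,
    map_sub]

theorem pairing_sub_right (α β β' : RawForm n M) :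
    Ω.pairing α (β - β') = Ω.pairing α β - Ω.pairing α β' := funext fun x => by
  rw [Pi.sub_apply, pairing_eq, pairing_eq, pairing_eq, Pi.sub_apply, map_sub, map_sub]

variable {Ω} in
theorem IsAdjointPair.sub {A A' B B' : Module.End ℝ (SmoothForm n M)} (h : Ω.IsAdjointPair A B)
    (h' : Ω.IsAdjointPair A' B') : Ω.IsAdjointPair (A - A') (B - B') := fun α β => by
  rw [LinearMap.sub_apply, LinearMap.sub_apply, raw_sub, raw_sub, pairing_sub_left,
    pairing_sub_right, h, h']

theorem isAdjointPair_mulLeft (η : SmoothForm n M) :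
    Ω.IsAdjointPair (LinearMap.mulLeft ℝ η) (Ω.adjOp η) := fun α β => funext fun x => by
  rw [pairing_eq, pairing_eq]
  exact congrArg algebraMapInv (LinearMap.congr_fun (adjMul_mul (Ω.sharpAt x) (η.raw x) (α.raw x))
    (β.raw x))

theorem isAdjointPair_lower : Ω.IsAdjointPair Ω.lower Ω.raise := fun α β => funext fun x => by
  rw [pairing_eq, pairing_eq]
  exact (Ω.isSharp x).scalar_adjMul_lambda (α.raw x) (β.raw x)

variable {Ω} in
-- The chosen adjoint is determined: smooth forms take all values at a point, and the pairing there
-- is nondegenerate.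
theorem IsAdjointPair.adjoint_eq [T2Space M] {A B : Module.End ℝ (SmoothForm n M)}
    (h : Ω.IsAdjointPair A B) {T : RawForm n M → RawForm n M}
    (hT : ∀ α : SmoothForm n M, T α.raw = (A α).raw) (β : SmoothForm n M) :
    Ω.adjoint T β.raw = (B β).raw := by
  have hex : ∃ γ : RawForm n M, ∀ α : RawForm n M, IsSmoothForm α →
      Ω.pairing (T α) β.raw = Ω.pairing α γ := ⟨(B β).raw, fun α hα => by
    have := h (SmoothForm.mk α hα) β
    rwa [← hT] at this⟩
  have hγ := Classical.epsilon_spec hex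
  change ∀ α, IsSmoothForm α → Ω.pairing (T α) β.raw = Ω.pairing α (Ω.adjoint T β.raw) at hγ
  funext x
  rw [← sub_eq_zero]
  refine eq_zero_of_adjMul (Ω.isSharp x).surjective fun δ => ?_
  obtain ⟨α, rfl⟩ := exists_smoothForm_apply x δ
  have h1 := congrFun ((hγ α.raw α.smooth).symm.trans ((congrArg (Ω.pairing · β.raw) (hT α)).trans
    (h α β))) x
  rw [pairing_eq, pairing_eq] at h1
  rw [map_sub, map_sub, h1, sub_self]

/-! ### The operators of the statement on smooth forms -/

theorem lefschetz_raw (α : SmoothForm n M) : Ω.lefschetz α.raw = (Ω.raise α).raw := rfl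

theorem dL_raw (α : SmoothForm n M) :
    Ω.dL α.raw = (LinearMap.mulLeft ℝ (formD n M Ω.form) α).raw := by
  rw [← formD_raise]
  have e : Ω.dL α.raw = extD (Ω.lefschetz α.raw) - ((-1 : ℝ) ^ ((1 : ℤ) * 2)) •
      Ω.lefschetz (extD α.raw) := rfl
  have e1 : ((-1 : ℝ) ^ ((1 : ℤ) * 2)) = 1 := by norm_num
  rw [e, e1, one_smul]; rfl

variable [T2Space M]

theorem dualLefschetz_raw (α : SmoothForm n M) : Ω.dualLefschetz α.raw = (Ω.lower α).raw :=
  (Ω.isAdjointPair_mulLeft Ω.form).adjoint_eq Ω.lefschetz_raw α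

theorem adjoint_dL_raw (α : SmoothForm n M) :
    Ω.adjoint Ω.dL α.raw = (Ω.adjOp (formD n M Ω.form) α).raw :=
  (Ω.isAdjointPair_mulLeft _).adjoint_eq Ω.dL_raw α

theorem lambdaDL_raw (α : SmoothForm n M) : Ω.lambdaDL α.raw =
    ((Ω.lower * LinearMap.mulLeft ℝ (formD n M Ω.form) -
      LinearMap.mulLeft ℝ (formD n M Ω.form) * Ω.lower) α).raw := by
  have e : Ω.lambdaDL α.raw = Ω.dualLefschetz (Ω.dL α.raw) - ((-1 : ℝ) ^ ((-2 : ℤ) * 3)) •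
      Ω.dL (Ω.dualLefschetz α.raw) := rfl
  have e1 : ((-1 : ℝ) ^ ((-2 : ℤ) * 3)) = 1 := by norm_num
  rw [e, e1, one_smul, dL_raw, dualLefschetz_raw, dualLefschetz_raw, dL_raw]; rfl

/-- Adjunction reverses products and exchanges `L` with `Λ`, so with `D = [d, L]` the bracket `[Λ,
D]` becomes `[D^ω, L]`. -/
theorem adjoint_lambdaDL_raw (α : SmoothForm n M) : Ω.adjoint Ω.lambdaDL α.raw =
    ((Ω.adjOp (formD n M Ω.form) * Ω.raise - Ω.raise * Ω.adjOp (formD n M Ω.form)) α).raw :=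
  ((Ω.isAdjointPair_lower.mul (Ω.isAdjointPair_mulLeft _)).sub
    ((Ω.isAdjointPair_mulLeft _).mul Ω.isAdjointPair_lower)).adjoint_eq Ω.lambdaDL_raw α

end AlmostSymplecticForm

end Adjoints

/-! ### The symplectic adjoint of the exterior derivative -/

section Star

open ExteriorAlgebra

variable {n : ℕ} {M : Type*} [TopologicalSpace M] [ChartedSpace (Model n) M]
  [IsManifold (𝓡 (2 * n)) ∞ M]

theorem scaleOp_of_mem (c : ℕ → ℝ) {k : ℕ} {α : SmoothForm n M} (hα : α ∈ smoothDegree n M k) :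
    scaleOp n M c α = c k • α :=
  form_ext fun x => gradedScale_of_mem c (mem_fiberDegree_natCast.mp (mem_formDegree.mp hα x))

namespace AlmostSymplecticForm

variable (Ω : AlmostSymplecticForm n M)

/-- The Weyl operator on smooth forms. -/
def weyl : Module.End ℝ (SmoothForm n M) := weylOp (n + 1) Ω.raise Ω.lower

theorem weyl_raw (α : SmoothForm n M) (x : M) : (Ω.weyl α).raw x =
    weylOp (n + 1) (LinearMap.mulLeft ℝ (Ω.toForm x)) (adjMul (Ω.sharpAt x) (Ω.toForm x))
      (α.raw x) := by
  have h1 : ∀ β, fiberEval n x (nilExp (n + 1) Ω.raise β) =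
      nilExp (n + 1) (LinearMap.mulLeft ℝ (Ω.toForm x)) (fiberEval n x β) :=
    map_nilExp_of_intertwines (fiberEval n x) (fun _ => rfl) (n + 1)
  have h2 : ∀ β, fiberEval n x (nilExp (n + 1) (-Ω.lower) β) =
      nilExp (n + 1) (-adjMul (Ω.sharpAt x) (Ω.toForm x)) (fiberEval n x β) :=
    map_nilExp_of_intertwines (fiberEval n x) (fun _ => rfl) (n + 1)
  exact (h1 _).trans ((congrArg _ (h2 _)).trans (congrArg _ (congrArg _ (h1 α))))

theorem star_raw (α : SmoothForm n M) :
    Ω.star α.raw = (Ω.weyl (scaleOp n M starSign α)).raw := by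
  funext x
  rw [weyl_raw]
  exact linearStar_eq (finrank_tangentSpace x) (Ω.degree_two x) (Ω.nondegenerate x) (α.raw x)

theorem weyl_weyl (α : SmoothForm n M) :
    Ω.weyl (Ω.weyl α) = ((-1 : ℝ) ^ n) • scaleOp n M (fun k => (-1) ^ k) α := by
  refine form_ext fun x => ?_
  rw [weyl_raw, weyl_raw]
  exact LinearMap.congr_fun ((Ω.isSharp x).weyl_weyl (finrank_tangentSpace x)) (α.raw x)

theorem weyl_mem {k : ℕ} (hk : k ≤ 2 * n) {α : SmoothForm n M} (hα : α ∈ smoothDegree n M k) :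
    Ω.weyl α ∈ smoothDegree n M (2 * n - k : ℕ) := by
  refine mem_formDegree.mpr fun x => mem_fiberDegree_natCast.mpr ?_
  rw [weyl_raw]
  exact (Ω.isSharp x).weyl_mem (finrank_tangentSpace x) (Nat.add_sub_cancel' hk)
    (mem_fiberDegree_natCast.mp (mem_formDegree.mp hα x))

/-- The operator `[Λ, d] + ½ [Λ, [Λ, [d, L]]]`. -/
def dAdj : Module.End ℝ (SmoothForm n M) :=
  ⁅Ω.lower, formD n M⁆ + (1 / 2 : ℝ) • ⁅Ω.lower, ⁅Ω.lower, ⁅formD n M, Ω.raise⁆⁆⁆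

theorem weyl_formD (α : SmoothForm n M) : Ω.weyl (formD n M α) = -Ω.dAdj (Ω.weyl α) :=
  LinearMap.congr_fun (Ω.slTwoWeightOne.weyl_mul Ω.raise_pow Ω.lower_pow) α

/-- The star is the Weyl operator with signs, and moving `d` past the Weyl operator gives minus the
stated operator. The signs `(-1)^k`, `(-1)^{n+1}` from the two stars, `(-1)^{n+k}` from the squared
Weyl operator and this minus multiply to one. -/
theorem star_extD_star {k : ℕ} (hk : k ≤ 2 * n) {α : SmoothForm n M}
    (hα : α ∈ smoothDegree n M k) :
    ((-1 : ℝ) ^ k) • Ω.star (extD (Ω.star α.raw)) = (Ω.dAdj α).raw := by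
  have hd : formD n M (Ω.weyl α) ∈ smoothDegree n M (2 * n + 1 - k : ℕ) := by
    have e : ((2 * n + 1 - k : ℕ) : ℤ) = ((2 * n - k : ℕ) : ℤ) + 1 := by omega
    rw [e]
    exact formD_isHomogeneousOp _ _ (Ω.weyl_mem hk hα)
  have e : Ω.star (extD (Ω.star α.raw)) = (Ω.weyl (scaleOp n M starSign
      (formD n M (Ω.weyl (scaleOp n M starSign α))))).raw := by
    rw [Ω.star_raw α, ← formD_coe, star_raw]
  rw [e, ← raw_smul]
  congr 1
  rw [scaleOp_of_mem _ hα, map_smul, map_smul, map_smul, scaleOp_of_mem _ hd, smul_smul, map_smul,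
    smul_smul, starSign_mul n k (by omega), weyl_formD, weyl_weyl, scaleOp_of_mem _ hα, map_smul,
    map_smul, smul_neg, smul_smul, smul_smul, ← neg_smul]
  have h1 : ((-1 : ℝ) ^ k) * (-1) ^ k = 1 := by rw [← mul_pow]; norm_num
  have h2 : ((-1 : ℝ) ^ n) * (-1) ^ n = 1 := by rw [← mul_pow]; norm_num
  have : -((-1 : ℝ) ^ k * (-1) ^ (n + 1) * (-1) ^ n * (-1) ^ k) = 1 := by
    rw [pow_succ]
    linear_combination (-1 : ℝ) ^ n * (-1) ^ n * h1 + h2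
  rw [this, one_smul]

theorem dAdjoint_raw (α : SmoothForm n M) : Ω.dAdjoint α.raw = (Ω.dAdj α).raw := by
  have e0 : (Ω.dAdj α).raw = ∑ k ∈ Finset.range (2 * n + 1),
      (Ω.dAdj (scaleOp n M (Pi.single k 1) α)).raw := by
    rw [← raw_sum, ← map_sum, sum_scaleOp_single]
  rw [e0]
  refine Finset.sum_congr rfl fun k hk => ?_
  have hmem : scaleOp n M (Pi.single k 1) α ∈ smoothDegree n M k := by
    refine mem_formDegree.mpr fun x => mem_fiberDegree_natCast.mpr ?_
    rw [scaleOp_apply, ← degPart_eq_gradedScale]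
    exact degPart_mem k _
  rw [← Ω.star_extD_star (Nat.lt_succ_iff.mp (Finset.mem_range.mp hk)) hmem]
  have e : (fun x => degPart k (α.raw x)) = (scaleOp n M (Pi.single k 1) α).raw :=
    funext fun x => degPart_eq_gradedScale k _
  rw [e]

end AlmostSymplecticForm

end Star

/-! ### Cartan's formula and Frobenius integrability for one-forms -/

section Cartan

open ExteriorAlgebra Topology

/-- The pairing of the degree one part of a form with a vector. -/
def contract {V : Type*} [AddCommGroup V] [Module ℝ V] : V →ₗ[ℝ] ExtForms V →ₗ[ℝ] ℝ :=
  (interiorₗ V).compr₂ algebraMapInv.toLinearMap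

theorem contract_apply {V : Type*} [AddCommGroup V] [Module ℝ V] (v : V) (β : ExtForms V) :
    contract v β = algebraMapInv (interior v β) := rfl

theorem toBilin_ι_mul {V : Type*} [AddCommGroup V] [Module ℝ V] (a : Module.Dual ℝ V)
    (β : ExtForms V) (u v : V) :
    toBilin (ι ℝ a * β) u v = a u * contract v β - a v * contract u β := by
  change algebraMapInv (interior v (interior u (ι ℝ a * β))) = _
  rw [interior_ι_mul, map_sub, map_smul, interior_ι_mul, map_sub, map_sub, map_smul, map_smul,
    map_mul]
  simp [contract_apply, algebraMapInv]

theorem toBilin_sum {V : Type*} [AddCommGroup V] [Module ℝ V] {κ : Type*} (s : Finset κ)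
    (η : κ → ExtForms V) (u v : V) : toBilin (∑ i ∈ s, η i) u v = ∑ i ∈ s, toBilin (η i) u v := by
  change algebraMapInv (interior v (interior u (∑ i ∈ s, η i))) = _
  simp only [map_sum]; rfl

variable {n : ℕ}

theorem toBilin_coordExtDeriv {f : Model n → ExtForms (Model n)} {y : Model n}
    (hf : DifferentiableAt ℝ f y) (u v : Model n) : toBilin (coordExtDeriv f y) u v =
      contract v (fderiv ℝ f y u) - contract u (fderiv ℝ f y v) := by
  have key : ∀ u v, contract v (fderiv ℝ f y u) =
      ∑ i, dualStdBasis n i u * contract v (fderiv ℝ f y (stdBasis n i)) := fun u v => by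
    conv_lhs => rw [← (stdBasis n).sum_repr u]
    simp only [map_sum, map_smul, smul_eq_mul]
    refine Finset.sum_congr rfl fun i _ => ?_
    rw [dualStdBasis, Module.Basis.coe_dualBasis, Module.Basis.coord_apply]
  rw [coordExtDeriv_eq hf, toBilin_sum, key, key, ← Finset.sum_sub_distrib]
  exact Finset.sum_congr rfl fun i _ => toBilin_ι_mul _ _ _ _

/-- Differentiate the identity `f(X) = 0`, valid near `y`. -/
theorem contract_fderiv {f : Model n → ExtForms (Model n)} {X : Model n → Model n} {y : Model n}
    (hf : DifferentiableAt ℝ f y) (hX : DifferentiableAt ℝ X y)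
    (h : (fun z => contract (X z) (f z)) =ᶠ[𝓝 y] 0) (w : Model n) :
    contract (X y) (fderiv ℝ f y w) = -contract (fderiv ℝ X y w) (f y) := by
  have h1 := ((contract (V := Model n)).toContinuousBilinearMap.hasFDerivAt_of_bilinear
    hX.hasFDerivAt hf.hasFDerivAt).fderiv
  have h2 : fderiv ℝ (fun z => (contract (V := Model n)).toContinuousBilinearMap (X z) (f z)) y =
      0 := (Filter.EventuallyEq.fderiv_eq (𝕜 := ℝ) h).trans (fderiv_const_apply (0 : ℝ))
  have h3 := DFunLike.congr_fun (h1.symm.trans h2) w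
  exact eq_neg_of_add_eq_zero_left h3

/-- Cartan's formula for forms vanishing on two vector fields. -/
theorem toBilin_coordExtDeriv_of_contract {f : Model n → ExtForms (Model n)}
    {X Y : Model n → Model n} {y : Model n} (hf : DifferentiableAt ℝ f y)
    (hX : DifferentiableAt ℝ X y) (hY : DifferentiableAt ℝ Y y)
    (hfX : (fun z => contract (X z) (f z)) =ᶠ[𝓝 y] 0)
    (hfY : (fun z => contract (Y z) (f z)) =ᶠ[𝓝 y] 0) :
    toBilin (coordExtDeriv f y) (X y) (Y y) =
      -contract (VectorField.lieBracket ℝ X Y y) (f y) := by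
  rw [toBilin_coordExtDeriv hf, contract_fderiv hf hX hfX, contract_fderiv hf hY hfY,
    VectorField.lieBracket, map_sub, LinearMap.sub_apply]
  ring

variable {M : Type*} [TopologicalSpace M] [ChartedSpace (Model n) M]
  [IsManifold (𝓡 (2 * n)) ∞ M]

local notation "𝓔" => extChartAt (𝓡 (2 * n))

theorem contract_chartForm (ξ : RawForm n M) (X : ∀ x : M, TangentSpace (𝓡 (2 * n)) x) {p : M}
    {z : Model n} (hz : z ∈ (𝓔 p).target) : contract (chartField p X z) (chartForm p ξ z) =
      contract (X ((𝓔 p).symm z)) (ξ ((𝓔 p).symm z)) := by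
  rw [contract_apply, contract_apply, chartForm_eq_chartEquiv ξ hz, ← pullbackForm_interior,
    algebraMapInv_pullbackForm]
  exact congrArg (fun v => algebraMapInv (interior v (ξ ((𝓔 p).symm z))))
    (chartEquiv_chartField X hz)

theorem toBilin_chartForm (η : RawForm n M) (X Y : ∀ x : M, TangentSpace (𝓡 (2 * n)) x) {p : M}
    {z : Model n} (hz : z ∈ (𝓔 p).target) :
    toBilin (chartForm p η z) (chartField p X z) (chartField p Y z) =
      toBilin (η ((𝓔 p).symm z)) (X ((𝓔 p).symm z)) (Y ((𝓔 p).symm z)) := by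
  rw [chartForm_eq_chartEquiv η hz, toBilin_pullbackForm]
  exact congrArg₂ (fun u v => toBilin (η ((𝓔 p).symm z)) u v) (chartEquiv_chartField X hz)
    (chartEquiv_chartField Y hz)

theorem mpullbackWithin_chart (X : ∀ x : M, TangentSpace (𝓡 (2 * n)) x) {p : M} {z : Model n}
    (hz : z ∈ (𝓔 p).target) : VectorField.mpullbackWithin 𝓘(ℝ, Model n) (𝓡 (2 * n)) (𝓔 p).symm X
      (Set.range (𝓡 (2 * n))) z = chartField p X z := by
  rw [VectorField.mpullbackWithin_apply, ModelWithCorners.Boundaryless.range_eq_univ,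
    mfderivWithin_univ]
  have hi : (mfderiv 𝓘(ℝ, Model n) (𝓡 (2 * n)) (𝓔 p).symm z).IsInvertible :=
    ContinuousLinearMap.IsInvertible.of_inverse (mfderiv_symm_comp_chart hz)
      (mfderiv_chart_comp_symm hz)
  exact hi.inverse_apply_eq.mpr (chartEquiv_chartField X hz).symm

theorem lieBracketWithin_eq_lieBracket {s : Set (Model n)} (hs : s = Set.univ)
    {X X' Y Y' : Model n → Model n} {y : Model n} (hX : X =ᶠ[𝓝 y] X') (hY : Y =ᶠ[𝓝 y] Y') :
    VectorField.lieBracketWithin ℝ X Y s y = VectorField.lieBracket ℝ X' Y' y := by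
  rw [hs, VectorField.lieBracketWithin_univ]
  exact hX.lieBracket_vectorField_eq hY

/-- The manifold bracket is defined by pulling back to the preferred chart at the point, where the
pulled-back fields agree with the chart expressions. -/
theorem chartField_mlieBracket (X Y : ∀ x : M, TangentSpace (𝓡 (2 * n)) x) (p : M) :
    chartField p (VectorField.mlieBracket (𝓡 (2 * n)) X Y) (𝓔 p p) =
      VectorField.lieBracket ℝ (chartField p X) (chartField p Y) (𝓔 p p) := by
  have key : ∀ q : M, q = p → mfderiv (𝓡 (2 * n)) 𝓘(ℝ, Model n) (𝓔 p) q
      (VectorField.mlieBracket (𝓡 (2 * n)) X Y q) =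
      VectorField.lieBracket ℝ (chartField p X) (chartField p Y) (𝓔 p p) := by
    rintro q rfl
    have hz := mem_extChartAt_target (I := 𝓡 (2 * n)) q
    have hi : (mfderiv (𝓡 (2 * n)) 𝓘(ℝ, Model n) (𝓔 q) q).IsInvertible := by
      have h1 := mfderiv_symm_comp_chart hz
      have h2 := mfderiv_chart_comp_symm hz
      rw [extChartAt_to_inv] at h1 h2
      exact ContinuousLinearMap.IsInvertible.of_inverse h2 h1
    rw [← VectorField.mlieBracketWithin_univ, VectorField.mlieBracketWithin_apply]
    refine (hi.inverse_apply_eq.mp rfl).symm.trans ?_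
    refine lieBracketWithin_eq_lieBracket (by
      rw [Set.preimage_univ, Set.univ_inter, ModelWithCorners.Boundaryless.range_eq_univ]) ?_ ?_
    · filter_upwards [target_mem_nhds hz] with z hz' using mpullbackWithin_chart X hz'
    · filter_upwards [target_mem_nhds hz] with z hz' using mpullbackWithin_chart Y hz'
  exact key _ (extChartAt_to_inv p)

/-- Integrability speaks of global vector fields, so a vector of `L` must be extended: take a
constant combination of a local frame and cut it off. -/
theorem exists_field [T2Space M] {r : ℕ} {L : TangentSubspaces n M} (hL : IsSmoothSubbundle r L)
    {p : M} {u : TangentSpace (𝓡 (2 * n)) p} (hu : u ∈ L p) :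
    ∃ X : ∀ x : M, TangentSpace (𝓡 (2 * n)) x,
      ContMDiff (𝓡 (2 * n)) (𝓡 (2 * n)).tangent ∞
        (fun x => (⟨x, X x⟩ : TangentBundle (𝓡 (2 * n)) M)) ∧ (∀ x, X x ∈ L x) ∧ X p = u := by
  classical
  obtain ⟨U, hU, hpU, s, hs, hs'⟩ := hL p
  rw [← (hs' p hpU).2, Submodule.mem_span_range_iff_exists_fun] at hu
  obtain ⟨c, hc⟩ := hu
  -- The value zero off `U` keeps the field in `L` everywhere; the jump is removed by the bump
  -- function.
  let X₀ : ∀ x : M, TangentSpace (𝓡 (2 * n)) x := fun x => if x ∈ U then ∑ i, c i • s i x else 0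
  have hX₀ : ∀ x ∈ U, X₀ x = ∑ i, c i • s i x := fun x hx => if_pos hx
  have hmem : ∀ x, X₀ x ∈ L x := fun x => by
    by_cases hx : x ∈ U
    · rw [hX₀ x hx, ← (hs' x hx).2]
      exact sum_mem fun i _ => Submodule.smul_mem _ _ (Submodule.subset_span ⟨i, rfl⟩)
    · rw [show X₀ x = 0 from if_neg hx]; exact zero_mem _
  have hsm : ∀ᶠ x in 𝓝 p, ContDiffAt ℝ ∞ (chartField x X₀) (𝓔 x x) := by
    filter_upwards [hU.mem_nhds hpU] with x hx
    have h1 : ContDiffAt ℝ ∞ (fun z => ∑ i, c i • chartField x (s i) z) (𝓔 x x) :=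
      ContDiffAt.sum fun i _ =>
        (contDiffAt_chartField_of_contMDiffOn (hU.mem_nhds hx) (hs i)).const_smul (c i)
    refine h1.congr_of_eventuallyEq ?_
    have h2 := (continuousAt_extChartAt_symm (I := 𝓡 (2 * n)) x).eventually
      (show ∀ᶠ q in 𝓝 ((𝓔 x).symm (𝓔 x x)), q ∈ U by
        rw [extChartAt_to_inv]; exact hU.mem_nhds hx)
    filter_upwards [h2] with z hz
    refine (congrArg (mfderiv (𝓡 (2 * n)) 𝓘(ℝ, Model n) (𝓔 x) ((𝓔 x).symm z) :
      TangentSpace (𝓡 (2 * n)) ((𝓔 x).symm z) →L[ℝ] Model n) (hX₀ _ hz)).trans ?_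
    refine (map_sum (mfderiv (𝓡 (2 * n)) 𝓘(ℝ, Model n) (𝓔 x) ((𝓔 x).symm z) :
      TangentSpace (𝓡 (2 * n)) ((𝓔 x).symm z) →L[ℝ] Model n) _ _).trans ?_
    exact Finset.sum_congr rfl fun i _ =>
      map_smul (mfderiv (𝓡 (2 * n)) 𝓘(ℝ, Model n) (𝓔 x) ((𝓔 x).symm z) :
        TangentSpace (𝓡 (2 * n)) ((𝓔 x).symm z) →L[ℝ] Model n) _ _
  obtain ⟨f, hf, hf'⟩ := exists_smul_contMDiff hsm
  refine ⟨fun x => f x • X₀ x, hf', fun x => Submodule.smul_mem _ _ (hmem x), ?_⟩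
  change f p • X₀ p = u
  rw [hf.self_of_nhds, hX₀ p hpU, hc]
  exact one_smul ℝ u

/-- For `X`, `Y` in `L` and `ξ` vanishing on `L`, Cartan's formula leaves `dξ(X, Y) = -ξ([X, Y])`,
which is zero by integrability. -/
theorem toBilin_formD_of_integrable [T2Space M] {r : ℕ} {L : TangentSubspaces n M}
    (hL : IsSmoothSubbundle r L) (hint : IsIntegrable L) {ξ : SmoothForm n M}
    (hξ : ∀ x, ∀ u ∈ L x, contract u (ξ.raw x) = 0) {p : M} {u v : TangentSpace (𝓡 (2 * n)) p}
    (hu : u ∈ L p) (hv : v ∈ L p) : toBilin ((formD n M ξ).raw p) u v = 0 := by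
  obtain ⟨X, hX, hXL, rfl⟩ := exists_field hL hu
  obtain ⟨Y, hY, hYL, rfl⟩ := exists_field hL hv
  have hz := mem_extChartAt_target (I := 𝓡 (2 * n)) p
  have hc : ∀ Z : ∀ x : M, TangentSpace (𝓡 (2 * n)) x, (∀ x, Z x ∈ L x) →
      ∀ z ∈ (𝓔 p).target, contract (chartField p Z z) (chartForm p ξ.raw z) = 0 :=
    fun Z hZ z hz => by rw [contract_chartForm ξ.raw Z hz]; exact hξ _ _ (hZ _)
  have hev : ∀ Z : ∀ x : M, TangentSpace (𝓡 (2 * n)) x, (∀ x, Z x ∈ L x) →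
      (fun z => contract (chartField p Z z) (chartForm p ξ.raw z)) =ᶠ[𝓝 (𝓔 p p)] 0 :=
    fun Z hZ => by
      filter_upwards [target_mem_nhds hz] with z hz' using hc Z hZ z hz'
  have h1 := toBilin_coordExtDeriv_of_contract (differentiableAt_chartForm_self ξ p)
    ((contMDiffAt_field_iff.mp (hX p)).differentiableAt (by simp))
    ((contMDiffAt_field_iff.mp (hY p)).differentiableAt (by simp)) (hev X hXL) (hev Y hYL)
  rw [← chartField_mlieBracket, hc _ (hint X Y hX hY hXL hYL) _ hz, neg_zero,
    ← chartForm_extD_self, toBilin_chartForm _ _ _ hz] at h1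
  have h2 : ∀ q : M, q = p → toBilin (extD ξ.raw q) (X q) (Y q) = 0 →
      toBilin (extD ξ.raw p) (X p) (Y p) = 0 := by rintro q rfl h; exact h
  exact h2 _ (extChartAt_to_inv p) h1

end Cartan

/-! ### Weights of one-forms and two-forms -/

section Fiber

open ExteriorAlgebra

variable {V : Type*} [AddCommGroup V] [Module ℝ V]

theorem mem_exteriorPower_one {β : ExtForms V} :
    β ∈ ⋀[ℝ]^1 (Module.Dual ℝ V) ↔ ∃ a, ι ℝ a = β := by
  rw [exteriorPower, pow_one]; rfl

variable [FiniteDimensional ℝ V]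

theorem dualDerivation_of_mem_zero (f : Module.End ℝ V) {β : ExtForms V}
    (hβ : β ∈ ⋀[ℝ]^0 (Module.Dual ℝ V)) : dualDerivation f β = 0 := by
  obtain ⟨r, rfl⟩ := mem_exteriorPower_zero.mp hβ
  rw [Algebra.algebraMap_eq_smul_one, map_smul, dualDerivation_one, smul_zero]

theorem contract_dualDerivation (f : Module.End ℝ V) (u : V) {β : ExtForms V}
    (hβ : β ∈ ⋀[ℝ]^1 (Module.Dual ℝ V)) : contract u (dualDerivation f β) = contract (f u) β := by
  obtain ⟨a, rfl⟩ := mem_exteriorPower_one.mp hβ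
  rw [dualDerivation_ι, contract_apply, contract_apply, interior_ι, interior_ι]; rfl

variable {f : Module.End ℝ V} (hf : f * f = f)

include hf

theorem dualDerivation_dualDerivation_of_mem_one {β : ExtForms V}
    (hβ : β ∈ ⋀[ℝ]^1 (Module.Dual ℝ V)) :
    dualDerivation f (dualDerivation f β) = dualDerivation f β := by
  obtain ⟨a, rfl⟩ := mem_exteriorPower_one.mp hβ
  rw [dualDerivation_ι, dualDerivation_ι]
  congr 1
  exact LinearMap.ext fun v => congrArg a (LinearMap.congr_fun hf v)

/-- The weights of a two-form are `0, 1, 2`: `N (N - 1)` leaves twice the restriction to the image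
of `f`, on which `N` acts by two. -/
theorem dualDerivation_of_mem_two {η : ExtForms V} (hη : η ∈ ⋀[ℝ]^2 (Module.Dual ℝ V)) :
    dualDerivation f (dualDerivation f (dualDerivation f η - η)) =
      (2 : ℝ) • dualDerivation f (dualDerivation f η - η) := by
  have hm := dualDerivation_mem f (sub_mem (dualDerivation_mem f hη) hη)
  rw [← sub_eq_zero]
  refine eq_zero_of_toBilin_eq_zero (sub_mem (dualDerivation_mem f hm)
    (Submodule.smul_mem _ _ hm)) fun u v => ?_
  have h1 : ∀ c : ℝ, ∀ ζ : ExtForms V, toBilin (c • ζ) u v = c * toBilin ζ u v := fun c ζ => by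
    change algebraMapInv (interior v (interior u (c • ζ))) = _
    simp only [map_smul]; rfl
  have h2 : ∀ w, f (f w) = f w := fun w => LinearMap.congr_fun hf w
  rw [toBilin_sub, LinearMap.sub_apply, LinearMap.sub_apply, h1, toBilin_dualDerivation f hm,
    toBilin_dualDerivation_sq hf hη, toBilin_dualDerivation_sq hf hη,
    toBilin_dualDerivation_sq hf hη, h2, h2]
  ring

/-- The part of weight two is the restriction to the image of `f`; without it only the weights `0`
and `1` occur. -/
theorem dualDerivation_of_mem_two_of_toBilin {η : ExtForms V}
    (hη : η ∈ ⋀[ℝ]^2 (Module.Dual ℝ V)) (h : ∀ u v, toBilin η (f u) (f v) = 0) :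
    dualDerivation f (dualDerivation f η) = dualDerivation f η := by
  rw [← sub_eq_zero, ← map_sub]
  refine eq_zero_of_toBilin_eq_zero
    (dualDerivation_mem f (sub_mem (dualDerivation_mem f hη) hη)) fun u v => ?_
  rw [toBilin_dualDerivation_sq hf hη, h, mul_zero]

end Fiber

/-! ### Local odd derivations -/

section Antiderivations

open ExteriorAlgebra Topology

variable {n : ℕ} {M : Type*} [TopologicalSpace M] [ChartedSpace (Model n) M]
  [IsManifold (𝓡 (2 * n)) ∞ M]

local notation "𝓔" => extChartAt (𝓡 (2 * n))

/-- Odd derivations of the algebra of smooth forms. -/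
def IsAntiderivation (T : Module.End ℝ (SmoothForm n M)) : Prop :=
  ∀ α β, T (α * β) = T α * β + scaleOp n M (fun k => (-1) ^ k) α * T β

/-- Operators which do not increase the support. -/
def IsLocalOp (T : Module.End ℝ (SmoothForm n M)) : Prop :=
  ∀ (α : SmoothForm n M) (p : M), chartForm p α.raw =ᶠ[𝓝 (𝓔 p p)] 0 →
    chartForm p (T α).raw =ᶠ[𝓝 (𝓔 p p)] 0

namespace IsAntiderivation

variable {S T : Module.End ℝ (SmoothForm n M)}

theorem add (hS : IsAntiderivation S) (hT : IsAntiderivation T) : IsAntiderivation (S + T) :=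
  fun α β => by
    simp only [LinearMap.add_apply]
    rw [hS, hT, add_mul, mul_add]; abel

theorem smul (c : ℝ) (hT : IsAntiderivation T) : IsAntiderivation (c • T) := fun α β => by
  simp only [LinearMap.smul_apply]
  rw [hT, smul_add, smul_mul_assoc, mul_smul_comm]

theorem bracket {N : Module.End ℝ (SmoothForm n M)} (hT : IsAntiderivation T)
    (hN : ∀ α β, N (α * β) = N α * β + α * N β)
    (hNs : ∀ α, N (scaleOp n M (fun k => (-1) ^ k) α) = scaleOp n M (fun k => (-1) ^ k) (N α)) :
    IsAntiderivation ⁅N, T⁆ := fun α β => by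
  simp only [Ring.lie_def, LinearMap.sub_apply, Module.End.mul_apply]
  rw [hT, hN, map_add, map_add, hN, hN, hT, hT, hNs]
  simp only [sub_mul, mul_sub]
  abel

theorem map_one (hT : IsAntiderivation T) : T 1 = 0 := by
  have h := hT 1 1
  have h1 : scaleOp n M (fun k => (-1) ^ k) 1 = 1 := by
    rw [scaleOp_of_mem (k := 0) _ one_mem_formDegree]; simp
  rw [mul_one, mul_one, h1, one_mul] at h
  exact left_eq_add.mp h

/-- The forms annihilated by an odd derivation. -/
def kernel (hT : IsAntiderivation T) : Subalgebra ℝ (SmoothForm n M) where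
  carrier := {α | T α = 0}
  mul_mem' {α β} hα hβ := by
    change T (α * β) = 0
    rw [hT, show T α = 0 from hα, show T β = 0 from hβ, zero_mul, mul_zero, add_zero]
  add_mem' {α β} hα hβ := by
    change T (α + β) = 0
    rw [map_add, show T α = 0 from hα, show T β = 0 from hβ, add_zero]
  algebraMap_mem' c := by
    change T (algebraMap ℝ _ c) = 0
    rw [Algebra.algebraMap_eq_smul_one, map_smul, hT.map_one, smul_zero]

end IsAntiderivation

theorem formD_isAntiderivation : IsAntiderivation (formD n M) := formD_mul

theorem raw_mem_of_chart {k : ℕ} {p : M} {f : Model n → ExtForms (Model n)} {g : M → ℝ}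
    {α : SmoothForm n M} (hα : α.raw = fun x => g x • formOfChart p f x)
    (hf : ∀ z, f z ∈ ⋀[ℝ]^k (Module.Dual ℝ (Model n))) : α ∈ smoothDegree n M k := by
  refine mem_formDegree.mpr fun x => mem_fiberDegree_natCast.mpr ?_
  rw [hα]
  exact Submodule.smul_mem _ _ (pullbackForm_mem _ (hf _))

theorem chartForm_raw_add (p : M) (α β : SmoothForm n M) (z : Model n) :
    chartForm p (α + β).raw z = chartForm p α.raw z + chartForm p β.raw z :=
  chartForm_add p α.raw β.raw z

theorem chartForm_raw_mul (p : M) (α β : SmoothForm n M) (z : Model n) :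
    chartForm p (α * β).raw z = chartForm p α.raw z * chartForm p β.raw z :=
  chartForm_mul p α.raw β.raw z

theorem chartForm_raw_sub (p : M) (α β : SmoothForm n M) (z : Model n) :
    chartForm p (α - β).raw z = chartForm p α.raw z - chartForm p β.raw z :=
  map_sub (chartFormHom p z) α.raw β.raw

theorem chartForm_raw_sum {κ : Type*} (s : Finset κ) (p : M) (α : κ → SmoothForm n M)
    (z : Model n) : chartForm p (∑ i ∈ s, α i).raw z = ∑ i ∈ s, chartForm p (α i).raw z := by
  rw [raw_sum]; exact map_sum (chartFormHom p z) _ s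

/-- A local odd derivation which vanishes on functions and one-forms is zero. -/
theorem IsAntiderivation.eq_zero [T2Space M] {T : Module.End ℝ (SmoothForm n M)}
    (hT : IsAntiderivation T) (hloc : IsLocalOp T) (h0 : ∀ α ∈ smoothDegree n M 0, T α = 0)
    (h1 : ∀ α ∈ smoothDegree n M 1, T α = 0) : T = 0 := by
  -- The annihilated forms are a subalgebra containing all functions and one-forms, hence realize
  -- every constant-coefficient form near `p`.
  have hconst : ∀ (p : M) (b : ExtForms (Model n)), ∃ β ∈ hT.kernel,
      chartForm p β.raw =ᶠ[𝓝 (𝓔 p p)] fun _ => b := by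
    intro p b
    induction b using extForms_induction with
    | h0 r => exact ⟨algebraMap ℝ _ r, Subalgebra.algebraMap_mem _ r,
        Filter.Eventually.of_forall fun z => (chartFormHom p z).commutes r⟩
    | hadd b c hb hc =>
      obtain ⟨β, hβ, hb⟩ := hb
      obtain ⟨γ, hγ, hc⟩ := hc
      refine ⟨β + γ, add_mem hβ hγ, ?_⟩
      filter_upwards [hb, hc] with z hz hz'
      rw [chartForm_raw_add, hz, hz']
    | hι a b hb =>
      obtain ⟨β, hβ, hb⟩ := hb
      obtain ⟨ξ, g, hξ, hξ'⟩ := exists_smoothForm_chart p (f := fun _ => ι ℝ a)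
        (Filter.Eventually.of_forall fun z => contDiffAt_const)
      refine ⟨ξ * β, mul_mem (h1 ξ (raw_mem_of_chart hξ fun _ =>
        mem_exteriorPower_one.mpr ⟨a, rfl⟩)) hβ, ?_⟩
      filter_upwards [hξ', hb] with z hz hz'
      rw [chartForm_raw_mul, hz, hz']
  -- Near `p` any form is a combination of these with function coefficients, so it agrees there with
  -- an annihilated form; locality then gives the vanishing at `p`.
  have hloc' : ∀ (α : SmoothForm n M) (p : M), ∃ β ∈ hT.kernel,
      chartForm p β.raw =ᶠ[𝓝 (𝓔 p p)] chartForm p α.raw := by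
    intro α p
    choose B hB hB' using fun S => hconst p (formBasis n S)
    have hF : ∀ S : Finset (Fin (2 * n)), ∃ F ∈ hT.kernel, chartForm p F.raw =ᶠ[𝓝 (𝓔 p p)]
        fun z => algebraMap ℝ _ ((formBasis n).repr (chartForm p α.raw z) S) := by
      intro S
      obtain ⟨F, g, hF, hF'⟩ := exists_smoothForm_chart p
        (f := fun z => algebraMap ℝ _ ((formBasis n).repr (chartForm p α.raw z) S)) (by
          filter_upwards [target_mem_nhds (mem_extChartAt_target p)] with z hz
          exact contDiffAt_linear (Algebra.linearMap ℝ (ExtForms (Model n)) ∘ₗ (formBasis n).coord S)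
            (contDiffAt_chartForm α hz))
      exact ⟨F, h0 F (raw_mem_of_chart hF fun z => algebraMap_mem _), hF'⟩
    choose F hF hF' using hF
    refine ⟨∑ S, F S * B S, sum_mem fun S _ => mul_mem (hF S) (hB S), ?_⟩
    filter_upwards [Filter.eventually_all.mpr hF', Filter.eventually_all.mpr hB'] with z hz hz'
    rw [chartForm_raw_sum]
    refine (Finset.sum_congr rfl fun S _ => ?_).trans ((formBasis n).sum_repr (chartForm p α.raw z))
    rw [chartForm_raw_mul, hz, hz', ← Algebra.smul_def]
  refine LinearMap.ext fun α => raw_ext (rawForm_ext_chart fun p => ?_)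
  obtain ⟨β, hβ, hαβ⟩ := hloc' α p
  have h2 := hloc (α - β) p (by
    filter_upwards [hαβ] with z hz
    rw [chartForm_raw_sub, hz, sub_self]; rfl)
  rw [map_sub, show T β = 0 from hβ, sub_zero] at h2
  exact h2.self_of_nhds.trans (map_zero (chartFormHom p _)).symm

namespace IsLocalOp

variable {S T : Module.End ℝ (SmoothForm n M)}

theorem mul (hS : IsLocalOp S) (hT : IsLocalOp T) : IsLocalOp (S * T) :=
  fun α p h => hS (T α) p (hT α p h)

theorem sub (hS : IsLocalOp S) (hT : IsLocalOp T) : IsLocalOp (S - T) := fun α p h => by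
  filter_upwards [hS α p h, hT α p h] with z hz hz'
  rw [LinearMap.sub_apply, chartForm_raw_sub, hz, hz', sub_self]; rfl

theorem lie (hS : IsLocalOp S) (hT : IsLocalOp T) : IsLocalOp ⁅S, T⁆ :=
  (hS.mul hT).sub (hT.mul hS)

theorem fiberEnd {T : ∀ x : M, Module.End ℝ (ExtForms (TangentSpace (𝓡 (2 * n)) x))}
    (hT : IsSmoothOp T) : IsLocalOp (fiberEnd T hT) := fun α p h => by
  filter_upwards [h, target_mem_nhds (mem_extChartAt_target p)] with z hz hz'
  have h1 : pullbackForm (chartEquiv p hz').toLinearMap (α.raw ((𝓔 p).symm z)) = 0 := hz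
  have h2 : α.raw ((𝓔 p).symm z) = 0 :=
    pullbackForm_injective (chartEquiv p hz') (h1.trans (map_zero _).symm)
  have h3 : (SymplecticPolarization.fiberEnd T hT α).raw ((𝓔 p).symm z) = 0 := by
    rw [fiberEnd_raw, h2, map_zero]
  exact (congrArg (pullbackForm (chartEquiv p hz').toLinearMap) h3).trans (map_zero _)

theorem formD : IsLocalOp (formD n M) := fun α p h => by
  filter_upwards [h.eventuallyEq_nhds, target_mem_nhds (mem_extChartAt_target p)] with z hz hz'
  refine (chartForm_extD hz' ((contDiffAt_chartForm α hz').of_le one_le_infty)).trans ?_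
  rw [coordExtDeriv_congr hz]
  exact coordExtDeriv_const 0 z

end IsLocalOp

end Antiderivations

/-! ### Eigenvectors of an inner derivation -/

section LieEigen

attribute [local instance] LieRing.ofAssociativeRing

variable {R : Type*} [Ring R] [Algebra ℝ R]

/-- Lagrange interpolation at the roots `-1, 0, 1` of `x³ = x`, with a single formula in `c` for the
three projections: `1 - x²` for `c = 0` and `(x² ± x) / 2` for `c = ±1`. -/
theorem lie_eigen_of_cube {N d : R} (h : ⁅N, ⁅N, ⁅N, d⁆⁆⁆ = ⁅N, d⁆) {c : ℝ} (hc : c ^ 3 = c) :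
    ⁅N, (1 - c ^ 2) • d + (c / 2) • ⁅N, d⁆ + (3 / 2 * c ^ 2 - 1) • ⁅N, ⁅N, d⁆⁆⁆ =
      c • ((1 - c ^ 2) • d + (c / 2) • ⁅N, d⁆ + (3 / 2 * c ^ 2 - 1) • ⁅N, ⁅N, d⁆⁆) := by
  rw [lie_add, lie_add, lie_smul, lie_smul, lie_smul, h, smul_add, smul_add, smul_smul, smul_smul,
    smul_smul]
  have a1 : c * (1 - c ^ 2) = 0 := by linear_combination -hc
  have a2 : c * (3 / 2 * c ^ 2 - 1) = c / 2 := by linear_combination 3 / 2 * hc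
  rw [a1, a2]
  module

theorem lie_eigen {N A B : R} {a b : ℝ} (hA : ⁅N, A⁆ = a • A) (hB : ⁅N, B⁆ = b • B) :
    ⁅N, ⁅A, B⁆⁆ = (a + b) • ⁅A, B⁆ := by
  rw [leibniz_lie, hA, hB, smul_lie, lie_smul, add_smul]

theorem lie_eigen_mul {N A B : R} {a b : ℝ} (hA : ⁅N, A⁆ = a • A) (hB : ⁅N, B⁆ = b • B) :
    ⁅N, A * B⁆ = (a + b) • (A * B) := by
  rw [Ring.lie_def] at *
  rw [add_smul, ← smul_mul_assoc, ← mul_smul_comm, ← hA, ← hB]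
  noncomm_ring

end LieEigen

/-! ### Integrability and the weights of the exterior derivative -/

section Integrable

open ExteriorAlgebra

variable {n : ℕ} {M : Type*} [TopologicalSpace M] [ChartedSpace (Model n) M]
  [IsManifold (𝓡 (2 * n)) ∞ M] {L L' : TangentSubspaces n M}
  (hL : IsSmoothSubbundle n L) (hL' : IsSmoothSubbundle n L') (h : ∀ x, IsCompl (L x) (L' x))

theorem weightOp_mem {i : ℕ} {α : SmoothForm n M} (hα : α ∈ smoothDegree n M i) :
    weightOp hL hL' h α ∈ smoothDegree n M i :=
  mem_formDegree.mpr fun x => mem_fiberDegree_natCast.mpr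
    (dualDerivation_mem _ (mem_fiberDegree_natCast.mp (mem_formDegree.mp hα x)))

theorem weightOp_scaleOp (c : ℕ → ℝ) (α : SmoothForm n M) :
    weightOp hL hL' h (scaleOp n M c α) = scaleOp n M c (weightOp hL hL' h α) := by
  refine form_ext fun x => ?_
  change dualDerivation ((L x).projection (L' x) (h x)) (gradedScale c (α.raw x)) =
    gradedScale c (dualDerivation ((L x).projection (L' x) (h x)) (α.raw x))
  refine homogeneous_induction (P := fun β =>
    dualDerivation ((L x).projection (L' x) (h x)) (gradedScale c β) =
    gradedScale c (dualDerivation ((L x).projection (L' x) (h x)) β))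
    (fun β γ hβ hγ => by simp only [map_add, hβ, hγ]) (fun k β hβ => ?_) (α.raw x)
  rw [gradedScale_of_mem _ hβ, gradedScale_of_mem _ (dualDerivation_mem _ hβ), map_smul]

theorem projection_sq (x : M) : (L x).projection (L' x) (h x) * (L x).projection (L' x) (h x) =
    (L x).projection (L' x) (h x) := Submodule.isIdempotentElem_projection (h x)

theorem mem_two {η : SmoothForm n M} (hη : η ∈ smoothDegree n M 2) (x : M) :
    η.raw x ∈ ⋀[ℝ]^2 (Module.Dual ℝ (TangentSpace (𝓡 (2 * n)) x)) :=
  mem_fiberDegree_natCast.mp (mem_formDegree.mp hη x)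

theorem mem_one {η : SmoothForm n M} (hη : η ∈ smoothDegree n M 1) (x : M) :
    η.raw x ∈ ⋀[ℝ]^1 (Module.Dual ℝ (TangentSpace (𝓡 (2 * n)) x)) :=
  mem_fiberDegree_natCast.mp (mem_formDegree.mp hη x)

/-- If `L` is integrable, `d` has no component of bidegree `(-1, 2)`. -/
theorem weightOp_bracket_cube [T2Space M] (hint : IsIntegrable L) :
    ⁅weightOp hL hL' h, ⁅weightOp hL hL' h, ⁅weightOp hL hL' h, formD n M⁆⁆⁆ =
      ⁅weightOp hL hL' h, formD n M⁆ := by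
  set N := weightOp hL hL' h with hN
  have hder : ∀ {T : Module.End ℝ (SmoothForm n M)}, IsAntiderivation T → IsAntiderivation ⁅N, T⁆ :=
    fun hT => hT.bracket (weightOp_mul hL hL' h) (weightOp_scaleOp hL hL' h _)
  have hlocN : IsLocalOp N := IsLocalOp.fiberEnd _
  -- The weights `-1, 0, 1` are the roots of `x³ = x`. The difference of the two sides is a local
  -- odd derivation, so it suffices to test it on functions and one-forms.
  have hR : IsAntiderivation (⁅N, ⁅N, ⁅N, formD n M⁆⁆⁆ - ⁅N, formD n M⁆) := by
    have := (hder (hder (hder formD_isAntiderivation))).add ((hder formD_isAntiderivation).smul (-1))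
    convert this using 1
    module
  have hloc : IsLocalOp (⁅N, ⁅N, ⁅N, formD n M⁆⁆⁆ - ⁅N, formD n M⁆) :=
    (hlocN.lie (hlocN.lie (hlocN.lie IsLocalOp.formD))).sub (hlocN.lie IsLocalOp.formD)
  rw [← sub_eq_zero]
  have e0 : ∀ {ξ : SmoothForm n M}, N ξ = 0 → ∀ T : Module.End ℝ (SmoothForm n M),
      ⁅N, T⁆ ξ = N (T ξ) := fun hξ T => by
    rw [Ring.lie_def, LinearMap.sub_apply, Module.End.mul_apply, Module.End.mul_apply, hξ, map_zero,
      sub_zero]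
  have e1 : ∀ {ξ : SmoothForm n M}, N ξ = ξ → ∀ T : Module.End ℝ (SmoothForm n M),
      ⁅N, T⁆ ξ = N (T ξ) - T ξ := fun hξ T => by
    rw [Ring.lie_def, LinearMap.sub_apply, Module.End.mul_apply, Module.End.mul_apply, hξ]
  have hsq : ∀ ξ ∈ smoothDegree n M 1, N (N ξ) = N ξ := fun ξ hξ => form_ext fun x =>
    dualDerivation_dualDerivation_of_mem_one (projection_sq h x) (mem_one hξ x)
  have hd2 : ∀ ξ ∈ smoothDegree n M 1, formD n M ξ ∈ smoothDegree n M 2 := fun ξ hξ =>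
    formD_isHomogeneousOp 1 ξ hξ
  -- A one-form of weight zero vanishes on `L`. By integrability `dξ` vanishes on pairs of vectors
  -- of `L`, so it has no part of weight two. Only here is integrability used.
  have hk0 : ∀ ξ ∈ smoothDegree n M 1, N ξ = 0 →
      (⁅N, ⁅N, ⁅N, formD n M⁆⁆⁆ - ⁅N, formD n M⁆) ξ = 0 := by
    intro ξ hξ hξ0
    have hc : ∀ x, ∀ u ∈ L x, contract u (ξ.raw x) = 0 := fun x u hu => by
      have h2 : (N ξ).raw x = 0 := by rw [hξ0]; rfl
      have h3 := contract_dualDerivation ((L x).projection (L' x) (h x)) u (mem_one hξ x)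
      rw [Submodule.projection_apply_of_mem_left (h x) hu] at h3
      rw [← h3]
      exact (congrArg (contract u) h2).trans (map_zero _)
    have h4 : N (N (formD n M ξ)) = N (formD n M ξ) := form_ext fun x =>
      dualDerivation_of_mem_two_of_toBilin (projection_sq h x) (mem_two (hd2 ξ hξ) x)
        fun u v => toBilin_formD_of_integrable hL hint hc (Submodule.projection_apply_mem (h x) u)
          (Submodule.projection_apply_mem (h x) v)
    rw [LinearMap.sub_apply, e0 hξ0, e0 hξ0, e0 hξ0, h4, h4, sub_self]
  -- Here `dξ` may have all the weights `0, 1, 2`, which relative to `ξ` are `-1, 0, 1`.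
  have hk1 : ∀ ξ ∈ smoothDegree n M 1, N ξ = ξ →
      (⁅N, ⁅N, ⁅N, formD n M⁆⁆⁆ - ⁅N, formD n M⁆) ξ = 0 := by
    intro ξ hξ hξ1
    have h4 : N (N (N (formD n M ξ) - formD n M ξ)) = (2 : ℝ) • N (N (formD n M ξ) - formD n M ξ) :=
      form_ext fun x => dualDerivation_of_mem_two (projection_sq h x) (mem_two (hd2 ξ hξ) x)
    rw [LinearMap.sub_apply, e1 hξ1, e1 hξ1, e1 hξ1, map_sub, h4]
    module
  refine hR.eq_zero hloc (fun f hf => ?_) fun ξ hξ => ?_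
  · have hf0 : N f = 0 := form_ext fun x => dualDerivation_of_mem_zero _
      (mem_fiberDegree_natCast.mp (mem_formDegree.mp hf x))
    rw [LinearMap.sub_apply, e0 hf0, e0 hf0, e0 hf0, hsq _ (formD_isHomogeneousOp 0 f hf),
      hsq _ (formD_isHomogeneousOp 0 f hf), sub_self]
  · have hNξ : N ξ ∈ smoothDegree n M 1 := weightOp_mem hL hL' h hξ
    -- A general one-form splits into its parts of weight one and zero.
    have e : ξ = N ξ + (ξ - N ξ) := by abel
    rw [e, map_add, hk1 _ hNξ (hsq ξ hξ), hk0 _ (sub_mem hξ hNξ) (by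
      rw [map_sub, hsq ξ hξ, sub_self]), add_zero]

/-- The component of `d` of weight `c`, provided that `d` has weights `-1`, `0`, `1`. -/
def dPart (c : ℤ) : Module.End ℝ (SmoothForm n M) :=
  (1 - (c : ℝ) ^ 2) • formD n M + ((c : ℝ) / 2) • ⁅weightOp hL hL' h, formD n M⁆ +
    (3 / 2 * (c : ℝ) ^ 2 - 1) • ⁅weightOp hL hL' h, ⁅weightOp hL hL' h, formD n M⁆⁆

theorem sum_dPart : formD n M = ∑ c ∈ {-1, 0, 1}, dPart hL hL' h c := by
  rw [Finset.sum_insert (by decide), Finset.sum_insert (by decide), Finset.sum_singleton]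
  simp only [dPart]
  push_cast
  module

theorem weightOp_bracket_dPart [T2Space M] (hint : IsIntegrable L) {c : ℤ}
    (hc : c ∈ ({-1, 0, 1} : Finset ℤ)) :
    ⁅weightOp hL hL' h, dPart hL hL' h c⁆ = (c : ℝ) • dPart hL hL' h c := by
  have hc3 : (c : ℝ) ^ 3 = c := by
    simp only [Finset.mem_insert, Finset.mem_singleton] at hc
    rcases hc with rfl | rfl | rfl <;> norm_num
  exact lie_eigen_of_cube (weightOp_bracket_cube hL hL' h hint) hc3

theorem isHomogeneousOp_weightOp : IsHomogeneousOp (smoothDegree n M) 0 (weightOp hL hL' h) := by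
  refine isHomogeneousOp_of_bracket ?_
  rw [Int.cast_zero, zero_smul, sub_eq_zero]
  exact LinearMap.ext fun α => (weightOp_scaleOp hL hL' h _ α).symm

theorem isHomogeneousOp_dPart (c : ℤ) :
    IsHomogeneousOp (smoothDegree n M) 1 (dPart hL hL' h c) := by
  have hb : ∀ {T : Module.End ℝ (SmoothForm n M)}, IsHomogeneousOp (smoothDegree n M) 1 T →
      IsHomogeneousOp (smoothDegree n M) 1 ⁅weightOp hL hL' h, T⁆ := fun {T} hT => by
    have h1 := (isHomogeneousOp_weightOp hL hL' h).mul hT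
    have h2 := (hT.mul (isHomogeneousOp_weightOp hL hL' h)).smul (-1)
    rw [zero_add] at h1
    rw [add_zero] at h2
    have := h1.add h2
    convert this using 1
    rw [Ring.lie_def]
    module
  exact ((formD_isHomogeneousOp.smul _).add ((hb formD_isHomogeneousOp).smul _)).add
    ((hb (hb formD_isHomogeneousOp)).smul _)

theorem isAntiderivation_dPart (c : ℤ) : IsAntiderivation (dPart hL hL' h c) := by
  have hder : ∀ {T : Module.End ℝ (SmoothForm n M)}, IsAntiderivation T →
      IsAntiderivation ⁅weightOp hL hL' h, T⁆ :=
    fun hT => hT.bracket (weightOp_mul hL hL' h) (weightOp_scaleOp hL hL' h _)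
  exact ((formD_isAntiderivation.smul _).add ((hder formD_isAntiderivation).smul _)).add
    ((hder (hder formD_isAntiderivation)).smul _)

end Integrable

/-! ### Separating weights and iterated brackets of a differential -/

section LieAlgebra

attribute [local instance] LieRing.ofAssociativeRing

variable {R : Type*} [Ring R] [Algebra ℝ R]

theorem SlTwoWeightOne.lie_raise_lower_cube_D {L Λ H d : R} (h : SlTwoWeightOne L Λ H d) :
    ⁅L, ⁅Λ, ⁅Λ, ⁅Λ, ⁅d, L⁆⁆⁆⁆⁆ = (3 : ℝ) • ⁅Λ, ⁅Λ, ⁅d, L⁆⁆⁆ := by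
  have hw : ⁅H, ⁅Λ, ⁅Λ, ⁅d, L⁆⁆⁆⁆ = (-1 : ℝ) • ⁅Λ, ⁅Λ, ⁅d, L⁆⁆⁆ := by
    rw [leibniz_lie, h.lie_weight_lower, h.lie_weight_lower_D, smul_lie]; module
  rw [leibniz_lie, h.lie_raise_lower, hw, h.lie_raise_lower_lower_D, lie_smul]
  module

/-- Eigenvectors for distinct eigenvalues are independent; the combination used is the Lagrange
polynomial which is one at `c` and zero at `c - 1`, `c - 2`. -/
theorem eq_zero_of_sum_three {N u v w : R} {c : ℝ} (hu : ⁅N, u⁆ = c • u)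
    (hv : ⁅N, v⁆ = (c - 1) • v) (hw : ⁅N, w⁆ = (c - 2) • w) (h : u + v + w = 0) : u = 0 := by
  have h1 : ⁅N, u + v + w⁆ = 0 := by rw [h, lie_zero]
  rw [lie_add, lie_add, hu, hv, hw] at h1
  have h2 : ⁅N, c • u + (c - 1) • v + (c - 2) • w⁆ = 0 := by rw [h1, lie_zero]
  rw [lie_add, lie_add, lie_smul, lie_smul, lie_smul, hu, hv, hw] at h2
  linear_combination (norm := module) (1 / 2 : ℝ) • h2 - ((2 * c - 3) / 2) • h1 +
    ((c - 1) * (c - 2) / 2) • h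

theorem eq_zero_of_sum_five {N a b c b' a' : R} (ha : ⁅N, a⁆ = (2 : ℝ) • a)
    (hb : ⁅N, b⁆ = b) (hc : ⁅N, c⁆ = 0) (hb' : ⁅N, b'⁆ = -b') (ha' : ⁅N, a'⁆ = (-2 : ℝ) • a')
    (h : a + b + c + b' + a' = 0) : a = 0 := by
  have h1 : ⁅N, a + b + c + b' + a'⁆ = 0 := by rw [h, lie_zero]
  simp only [lie_add, ha, hb, hc, hb', ha'] at h1
  have h2 := congrArg (⁅N, ·⁆) h1
  simp only [lie_add, lie_smul, lie_neg, lie_zero, ha, hb, hc, hb', ha'] at h2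
  have h3 := congrArg (⁅N, ·⁆) h2
  simp only [lie_add, lie_smul, lie_neg, lie_zero, ha, hb, hc, hb', ha'] at h3
  have h4 := congrArg (⁅N, ·⁆) h3
  simp only [lie_add, lie_smul, lie_neg, lie_zero, ha, hb, hc, hb', ha'] at h4
  -- The coefficients of `x (x - 1) (x + 1) (x + 2) / 24`, which is one at `2` and zero at the other
  -- four eigenvalues.
  linear_combination (norm := module) (1 / 24 : ℝ) • h4 + (1 / 12 : ℝ) • h3 - (1 / 24 : ℝ) • h2 -
    (1 / 12 : ℝ) • h1

/-- The square of the weight-one part is the whole weight-two part of the vanishing square. -/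
theorem sq_eq_zero_of_weights {N dm d₀ d₁ : R} (hm : ⁅N, dm⁆ = (-1 : ℝ) • dm)
    (h₀ : ⁅N, d₀⁆ = (0 : ℝ) • d₀) (h₁ : ⁅N, d₁⁆ = (1 : ℝ) • d₁)
    (h : (dm + (d₀ + d₁)) * (dm + (d₀ + d₁)) = 0) : d₁ * d₁ = 0 := by
  refine eq_zero_of_sum_five (N := N) (b := d₁ * d₀ + d₀ * d₁)
    (c := d₁ * dm + d₀ * d₀ + dm * d₁) (b' := d₀ * dm + dm * d₀) (a' := dm * dm) ?_ ?_ ?_ ?_ ?_ ?_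
  · rw [lie_eigen_mul h₁ h₁]; norm_num
  · rw [lie_add, lie_eigen_mul h₁ h₀, lie_eigen_mul h₀ h₁]; simp
  · rw [lie_add, lie_add, lie_eigen_mul h₁ hm, lie_eigen_mul h₀ h₀, lie_eigen_mul hm h₁]; simp
  · rw [lie_add, lie_eigen_mul h₀ hm, lie_eigen_mul hm h₀]; module
  · rw [lie_eigen_mul hm hm]; norm_num
  · rw [← h]; noncomm_ring

/-- The linear map `[T, ·]`. -/
def adL (T : R) : R →ₗ[ℝ] R := LinearMap.mulLeft ℝ T - LinearMap.mulRight ℝ T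

theorem adL_apply (T X : R) : adL T X = ⁅T, X⁆ := rfl

/-- `Φ` shifts the weights of `[K, ·]` by `x`. -/
def ShiftsWeight (K : R) (x : ℝ) (Φ : R →ₗ[ℝ] R) : Prop :=
  ∀ (X : R) (c : ℝ), ⁅K, X⁆ = c • X → ⁅K, Φ X⁆ = (c + x) • Φ X

namespace ShiftsWeight

variable {K T : R} {x y : ℝ} {Φ Ψ : R →ₗ[ℝ] R}

theorem adL (h : ⁅K, T⁆ = x • T) : ShiftsWeight K x (adL T) := fun X c hX => by
  rw [adL_apply, lie_eigen h hX, add_comm]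

theorem comp (hΦ : ShiftsWeight K x Φ) (hΨ : ShiftsWeight K y Ψ) :
    ShiftsWeight K (x + y) (Φ ∘ₗ Ψ) := fun X c hX => by
  rw [LinearMap.comp_apply, hΦ _ _ (hΨ X c hX), add_assoc, add_comm y]

theorem add (hΦ : ShiftsWeight K x Φ) (hΨ : ShiftsWeight K x Ψ) : ShiftsWeight K x (Φ + Ψ) :=
  fun X c hX => by rw [LinearMap.add_apply, lie_add, hΦ X c hX, hΨ X c hX, smul_add]

theorem smul (r : ℝ) (hΦ : ShiftsWeight K x Φ) : ShiftsWeight K x (r • Φ) :=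
  fun X c hX => by rw [LinearMap.smul_apply, lie_smul, hΦ X c hX, smul_comm]

end ShiftsWeight

/-- Apply the derivation `ad Λ` one to four times to `d² = 0`. As its cube kills `d`, what remains
are multiples of the coefficients of the square of `d + [Λ, d] ξ + (1/2) [Λ, [Λ, d]] ξ²`. -/
theorem bracket_relations {Λ d : R} (hd : d * d = 0) (h3 : ⁅Λ, ⁅Λ, ⁅Λ, d⁆⁆⁆ = 0) :
    d * ⁅Λ, d⁆ + ⁅Λ, d⁆ * d = 0 ∧
    d * ((1 / 2 : ℝ) • ⁅Λ, ⁅Λ, d⁆⁆) + ⁅Λ, d⁆ * ⁅Λ, d⁆ + ((1 / 2 : ℝ) • ⁅Λ, ⁅Λ, d⁆⁆) * d = 0 ∧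
    ⁅Λ, d⁆ * ((1 / 2 : ℝ) • ⁅Λ, ⁅Λ, d⁆⁆) + ((1 / 2 : ℝ) • ⁅Λ, ⁅Λ, d⁆⁆) * ⁅Λ, d⁆ = 0 ∧
    ((1 / 2 : ℝ) • ⁅Λ, ⁅Λ, d⁆⁆) * ((1 / 2 : ℝ) • ⁅Λ, ⁅Λ, d⁆⁆) = 0 := by
  have lm : ∀ X Y : R, ⁅Λ, X * Y⁆ = ⁅Λ, X⁆ * Y + X * ⁅Λ, Y⁆ := fun X Y => by
    simp only [Ring.lie_def]; noncomm_ring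
  set Y := ⁅Λ, d⁆ with hY
  set Z := ⁅Λ, Y⁆ with hZ
  have r1 : Y * d + d * Y = 0 := by rw [hY, ← lm, hd, lie_zero]
  have r2 : Z * d + Y * Y + (Y * Y + d * Z) = 0 := by
    have := congrArg (⁅Λ, ·⁆) r1
    simpa only [lie_add, lm, ← hY, ← hZ, lie_zero] using this
  have r3 : (0 : ℝ) • d + (3 : ℝ) • (Y * Z + Z * Y) = 0 := by
    have := congrArg (⁅Λ, ·⁆) r2
    simp only [lie_add, lm, ← hY, ← hZ, lie_zero, h3, zero_mul, mul_zero] at this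
    linear_combination (norm := module) this
  rw [zero_smul, zero_add] at r3
  have r3' : Y * Z + Z * Y = 0 := (smul_eq_zero.mp r3).resolve_left (by norm_num)
  have r4 : (2 : ℝ) • (Z * Z) = 0 := by
    have := congrArg (⁅Λ, ·⁆) r3'
    simp only [lie_add, lm, ← hY, ← hZ, lie_zero, h3, zero_mul, mul_zero] at this
    linear_combination (norm := module) this
  have r4' : Z * Z = 0 := (smul_eq_zero.mp r4).resolve_left (by norm_num)
  simp only [mul_smul_comm, smul_mul_assoc]
  refine ⟨by rw [add_comm]; exact r1, ?_, ?_, by rw [r4', smul_zero, smul_zero]⟩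
  · linear_combination (norm := module) (1 / 2 : ℝ) • r2
  · rw [← smul_add, r3', smul_zero]

end LieAlgebra

/-! ### Commutative `BV_∞`-structures from conjugation by an exponential -/

section BVInfty

variable {A : Type*} [Ring A] [Algebra ℝ A]

theorem opSeq_add_three (d Δ₁ Δ₂ : Module.End ℝ A) (r : ℕ) : opSeq d Δ₁ Δ₂ (r + 3) = 0 := rfl

/-- The commutative `BV_∞`-algebra given by `e^{Λξ} d e^{-Λξ}` if `ad(Λ)³ d = 0`. -/
theorem isCommBVInfty_of_bracket {𝒜 : ℤ → Submodule ℝ A} (h𝒜 : DirectSum.IsInternal 𝒜)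
    (hone : (1 : A) ∈ 𝒜 0) (hmul : ∀ i j : ℤ, ∀ a ∈ 𝒜 i, ∀ b ∈ 𝒜 j, a * b ∈ 𝒜 (i + j))
    (hcomm : ∀ i j : ℤ, ∀ a ∈ 𝒜 i, ∀ b ∈ 𝒜 j, a * b = ((-1 : ℝ) ^ (i * j)) • (b * a))
    {d Λ : Module.End ℝ A} (hdeg : IsHomogeneousOp 𝒜 1 d)
    (hd : ∀ i : ℤ, ∀ a ∈ 𝒜 i, ∀ b : A, d (a * b) = d a * b + ((-1 : ℝ) ^ i) • (a * d b))
    (hdd : d * d = 0) (hΛ : HasOrderLE 𝒜 2 (-2) Λ) (h3 : ⁅Λ, ⁅Λ, ⁅Λ, d⁆⁆⁆ = 0) :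
    IsCommBVInfty 𝒜 (opSeq d ⁅Λ, d⁆ ((1 / 2 : ℝ) • ⁅Λ, ⁅Λ, d⁆⁆)) := by
  -- `Λ` has even degree, so graded commutators with it are ordinary ones.
  have hgc : ∀ (l : ℤ) (f : Module.End ℝ A), gradedCommutator (-2) l Λ f = ⁅Λ, f⁆ := fun l f => by
    have e : (-1 : ℝ) ^ (-2 * l) = 1 := by rw [zpow_mul]; norm_num
    rw [gradedCommutator, e, one_smul, Ring.lie_def]
  -- Each bracket with the second-order operator `Λ` raises the order by one and lowers the degree
  -- by two.
  have o0 : HasOrderLE 𝒜 1 1 d := HasOrderLE.of_antiderivation (by decide) hdeg hd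
  have o1 : HasOrderLE 𝒜 2 (-1) ⁅Λ, d⁆ := by
    have := HasOrderLE.gradedCommutator hmul (s := 0) hΛ o0
    rwa [hgc] at this
  have o2 : HasOrderLE 𝒜 3 (-3) ⁅Λ, ⁅Λ, d⁆⁆ := by
    have := HasOrderLE.gradedCommutator hmul (s := 1) hΛ o1
    rwa [hgc] at this
  have order : ∀ r : ℕ, HasOrderLE 𝒜 (r + 1) (1 - 2 * r)
      (opSeq d ⁅Λ, d⁆ ((1 / 2 : ℝ) • ⁅Λ, ⁅Λ, d⁆⁆) r) := by
    rintro (_ | _ | _ | r)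
    · exact o0
    · exact o1
    · exact o2.smul _
    · exact HasOrderLE.zero _ _
  obtain ⟨r1, r2, r3, r4⟩ := bracket_relations hdd h3
  refine ⟨h𝒜, hone, hmul, hcomm, hd, fun r => (order r).isHomogeneousOp hmul, ?_, order⟩
  rintro (_ | _ | _ | _ | _ | r)
  · simpa [opSeq] using hdd
  · simpa [opSeq, Finset.sum_range_succ] using r1
  · simpa only [opSeq, Finset.sum_range_succ, Finset.sum_range_zero, zero_add] using r2
  · simpa [opSeq, Finset.sum_range_succ] using r3
  · simpa [opSeq, Finset.sum_range_succ] using r4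
  -- The indices add up to at least five, so one of them exceeds two.
  · refine Finset.sum_eq_zero fun i hi => ?_
    rcases Nat.lt_or_ge i 3 with h | h
    · obtain ⟨k, hk⟩ := Nat.exists_eq_add_of_le' (show 3 ≤ r + 5 - i by omega)
      rw [hk, opSeq_add_three, mul_zero]
    · obtain ⟨k, hk⟩ := Nat.exists_eq_add_of_le' h
      rw [hk, opSeq_add_three, zero_mul]

end BVInfty

/-! ### Extracting weight components -/

section Components

variable {n : ℕ} {M : Type*} [TopologicalSpace M] [ChartedSpace (Model n) M]
  [IsManifold (𝓡 (2 * n)) ∞ M] [T2Space M] {L L' : TangentSubspaces n M}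
  (hL : IsSmoothSubbundle n L) (hL' : IsSmoothSubbundle n L') (h : ∀ x, IsCompl (L x) (L' x))
  (hint : IsIntegrable L)

include hint

/-- The components of an operator depending linearly on `d`. -/
theorem bidegComponent_of_shift {T : RawForm n M → RawForm n M}
    {Φ : Module.End ℝ (SmoothForm n M) →ₗ[ℝ] Module.End ℝ (SmoothForm n M)}
    (hT : ∀ α : SmoothForm n M, T α.raw = (Φ (formD n M) α).raw) {e w : ℤ}
    (he : ShiftsWeight (degOp n M) (e : ℝ) Φ) (hw : ShiftsWeight (weightOp hL hL' h) (w : ℝ) Φ)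
    {a b : ℤ} (hb : b = 1 + w) (hab : a + b = 1 + e) (α : SmoothForm n M) :
    bidegComponent L L' a b T α.raw = (Φ (dPart hL hL' h 1) α).raw := by
  -- The part of weight `c` of `Φ d` is `Φ` applied to the part of `d` of weight `c - w`, so the
  -- weights are `-1, 0, 1` translated by `w`.
  have key := bidegComponent_eq hL hL' h hT
    (S := ({-1, 0, 1} : Finset ℤ).map (addRightEmbedding w))
    (C := fun c => Φ (dPart hL hL' h (c - w))) (k := 1 + e) (a := a) (b := b) ?_ ?_ ?_ ?_ hab α
  · rw [key, hb, add_sub_cancel_right]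
  · rw [Finset.sum_map]
    simp only [addRightEmbedding_apply, add_sub_cancel_right]
    rw [← map_sum, ← sum_dPart]
  · intro c _
    have h1 := he (dPart hL hL' h (c - w)) ((1 : ℤ) : ℝ)
      (degOp_bracket (isHomogeneousOp_dPart hL hL' h (c - w)))
    rw [← Int.cast_add] at h1
    exact h1
  · intro c hc
    obtain ⟨c, hc', rfl⟩ := Finset.mem_map.mp hc
    have h1 := hw (dPart hL hL' h c) (c : ℝ) (weightOp_bracket_dPart hL hL' h hint hc')
    rw [← Int.cast_add] at h1
    simp only [addRightEmbedding_apply, add_sub_cancel_right]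
    exact h1
  · rw [hb, Finset.mem_map]
    exact ⟨1, by decide, rfl⟩

theorem delbar_raw (α : SmoothForm n M) :
    delbar L L' α.raw = (dPart hL hL' h 1 α).raw := by
  refine bidegComponent_of_shift hL hL' h hint (Φ := LinearMap.id) (e := 0) (w := 0)
    (fun _ => rfl) ?_ ?_ (by norm_num) (by norm_num) α
  · intro X c hX; rw [Int.cast_zero, add_zero]; exact hX
  · intro X c hX; rw [Int.cast_zero, add_zero]; exact hX

theorem dPart_sq : dPart hL hL' h 1 * dPart hL hL' h 1 = 0 := by
  have h1 : ∀ c ∈ ({-1, 0, 1} : Finset ℤ), _ := fun c hc =>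
    weightOp_bracket_dPart hL hL' h hint hc
  have hm := h1 (-1) (by decide)
  have h₀ := h1 0 (by decide)
  have h₁ := h1 1 (by decide)
  push_cast at hm h₀ h₁
  refine sq_eq_zero_of_weights hm h₀ h₁ ?_
  have h2 := sum_dPart hL hL' h
  rw [Finset.sum_insert (by decide), Finset.sum_insert (by decide), Finset.sum_singleton] at h2
  rw [← h2]
  exact formD_formD

/-- The images of the three parts of `d` have distinct weights, so if they add up to zero each of
them vanishes. This is how relations for `d` pass to `∂̄`. -/
theorem shift_dPart_eq_zero {Φ : Module.End ℝ (SmoothForm n M) →ₗ[ℝ] Module.End ℝ (SmoothForm n M)}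
    {w : ℝ} (hw : ShiftsWeight (weightOp hL hL' h) w Φ) (hΦ : Φ (formD n M) = 0) :
    Φ (dPart hL hL' h 1) = 0 := by
  have h1 : ∀ c ∈ ({-1, 0, 1} : Finset ℤ), _ := fun c hc =>
    hw _ _ (weightOp_bracket_dPart hL hL' h hint hc)
  have hm := h1 (-1) (by decide)
  have h₀ := h1 0 (by decide)
  have h₁ := h1 1 (by decide)
  have h2 := sum_dPart hL hL' h
  rw [Finset.sum_insert (by decide), Finset.sum_insert (by decide), Finset.sum_singleton] at h2
  rw [h2, map_add, map_add] at hΦ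
  refine eq_zero_of_sum_three h₁ (v := Φ (dPart hL hL' h 0)) (w := Φ (dPart hL hL' h (-1)))
    ?_ ?_ ?_
  · rw [h₀]; push_cast; congr 1; ring
  · rw [hm]; push_cast; congr 1; ring
  · rw [← hΦ]; abel

end Components

/-! ### The adjoint operators of the statement in terms of `Λ` and `∂̄` -/

section LowerComponents

attribute [local instance] LieRing.ofAssociativeRing

variable {n : ℕ} {M : Type*} [TopologicalSpace M] [ChartedSpace (Model n) M]
  [IsManifold (𝓡 (2 * n)) ∞ M] [T2Space M] {L L' : TangentSubspaces n M}
  (hL : IsSmoothSubbundle n L) (hL' : IsSmoothSubbundle n L') (h : ∀ x, IsCompl (L x) (L' x))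
  (Ω : AlmostSymplecticForm n M)
  (hΩ : ∀ x, ∀ u ∈ L x, ∀ v ∈ L x, toBilin (Ω.toForm x) u v = 0)
  (hΩ' : ∀ x, ∀ u ∈ L' x, ∀ v ∈ L' x, toBilin (Ω.toForm x) u v = 0)
  (hint : IsIntegrable L)

namespace AlmostSymplecticForm

theorem degOp_shifts_raise : ShiftsWeight (degOp n M) 2 (adL Ω.raise) :=
  ShiftsWeight.adL ((degOp_bracket Ω.isHomogeneousOp_raise).trans (by norm_num))

theorem degOp_shifts_lower : ShiftsWeight (degOp n M) (-2) (adL Ω.lower) :=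
  ShiftsWeight.adL ((degOp_bracket
    (Ω.hasOrderLE_lower.isHomogeneousOp formDegree_mul_mem)).trans (by push_cast; rfl))

include hΩ hΩ' in
theorem weightOp_shifts_raise : ShiftsWeight (weightOp hL hL' h) 1 (adL Ω.raise) := by
  refine ShiftsWeight.adL ?_
  have hN : weightOp hL hL' h Ω.form = Ω.form := form_ext fun x =>
    dualDerivation_symplectic (h x) (Ω.degree_two x) (hΩ x) (hΩ' x)
  refine LinearMap.ext fun α => ?_
  have e := weightOp_mul hL hL' h Ω.form α
  rw [hN] at e
  rw [one_smul]
  change weightOp hL hL' h (Ω.form * α) - Ω.form * weightOp hL hL' h α = Ω.form * α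
  rw [e]; abel

include hΩ hΩ' in
theorem weightOp_shifts_lower : ShiftsWeight (weightOp hL hL' h) (-1) (adL Ω.lower) :=
  ShiftsWeight.adL ((weightOp_lower hL hL' h Ω hΩ hΩ').trans (by rw [neg_smul, one_smul]))

/-- `X ↦ [Λ, [Λ, [X, L]]]`. -/
def lowerLowerRaise :
    Module.End ℝ (SmoothForm n M) →ₗ[ℝ] Module.End ℝ (SmoothForm n M) :=
  (-1 : ℝ) • (adL Ω.lower ∘ₗ (adL Ω.lower ∘ₗ adL Ω.raise))

theorem lowerLowerRaise_apply (X : Module.End ℝ (SmoothForm n M)) :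
    Ω.lowerLowerRaise X = ⁅Ω.lower, ⁅Ω.lower, ⁅X, Ω.raise⁆⁆⁆ := by
  rw [← lie_skew X Ω.raise, lie_neg, lie_neg, ← neg_one_smul ℝ]
  rfl

theorem degOp_shifts_lowerLowerRaise : ShiftsWeight (degOp n M) (-2) Ω.lowerLowerRaise := by
  have := (Ω.degOp_shifts_lower.comp (Ω.degOp_shifts_lower.comp Ω.degOp_shifts_raise)).smul (-1)
  norm_num at this
  exact this

include hΩ hΩ' in
theorem weightOp_shifts_lowerLowerRaise :
    ShiftsWeight (weightOp hL hL' h) (-1) Ω.lowerLowerRaise := by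
  have hl := Ω.weightOp_shifts_lower hL hL' h hΩ hΩ'
  have := (hl.comp (hl.comp (Ω.weightOp_shifts_raise hL hL' h hΩ hΩ'))).smul (-1)
  norm_num at this
  exact this

theorem lower_cube_D : ⁅Ω.lower, ⁅Ω.lower, ⁅Ω.lower, ⁅formD n M, Ω.raise⁆⁆⁆⁆ =
    (6 : ℝ) • Ω.adjOp (formD n M Ω.form) := by
  rw [← Ω.lower_triple, ← formD_raise]
  rfl

/-- With `D = [d, L]`, combine `[Λ, [Λ, d]] = -(1/3) ad(Λ)³ D` with `ad(Λ)³ D = 6 D^ω`. -/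
theorem adjOp_formD_form : Ω.adjOp (formD n M Ω.form) =
    (-(1 / 2) : ℝ) • ⁅Ω.lower, ⁅Ω.lower, formD n M⁆⁆ := by
  rw [Ω.slTwoWeightOne.lower_lower Ω.lower_pow, Ω.lower_cube_D]
  module

/-- Bracketing `ad(Λ)³ D = 6 D^ω` with `L` gives `3 ad(Λ)² D` on the left, by the `sl₂`-relations
for `D = [d, L]`. -/
theorem adjOp_raise : Ω.adjOp (formD n M Ω.form) * Ω.raise - Ω.raise * Ω.adjOp (formD n M Ω.form) =
    (-(1 / 2) : ℝ) • Ω.lowerLowerRaise (formD n M) := by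
  have h1 := Ω.slTwoWeightOne.lie_raise_lower_cube_D
  have h3 : ⁅Ω.raise, (6 : ℝ) • Ω.adjOp (formD n M Ω.form)⁆ =
      (6 : ℝ) • ⁅Ω.raise, Ω.adjOp (formD n M Ω.form)⁆ := map_smul (adL Ω.raise) _ _
  rw [Ω.lower_cube_D, h3] at h1
  rw [lowerLowerRaise_apply, ← Ring.lie_def, ← lie_skew]
  have h2 : ⁅Ω.raise, Ω.adjOp (formD n M Ω.form)⁆ = (1 / 6 : ℝ) • ((6 : ℝ) •
      ⁅Ω.raise, Ω.adjOp (formD n M Ω.form)⁆) := by module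
  rw [h2, h1]
  module

include hint hΩ hΩ'

/-- The formula for `d^ω` is linear in `d` and shifts bidegrees by `(-1, -1)`, so its `(-1,
0)`-component comes from the `(0, 1)`-part of `d`. The next two operators are treated in the same
way. -/
theorem delAdjoint_raw (α : SmoothForm n M) : Ω.delAdjoint L L' α.raw =
    ((⁅Ω.lower, dPart hL hL' h 1⁆ +
      (1 / 2 : ℝ) • Ω.lowerLowerRaise (dPart hL hL' h 1)) α).raw := by
  refine bidegComponent_of_shift hL hL' h hint
    (Φ := adL Ω.lower + (1 / 2 : ℝ) • Ω.lowerLowerRaise) (e := -2) (w := -1)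
    (fun α => ?_) ?_ ?_ (by norm_num) (by norm_num) α
  · rw [Ω.dAdjoint_raw, LinearMap.add_apply, LinearMap.smul_apply, lowerLowerRaise_apply]
    rfl
  · push_cast
    exact Ω.degOp_shifts_lower.add (Ω.degOp_shifts_lowerLowerRaise.smul _)
  · push_cast
    exact (Ω.weightOp_shifts_lower hL hL' h hΩ hΩ').add
      ((Ω.weightOp_shifts_lowerLowerRaise hL hL' h hΩ hΩ').smul _)

theorem lambdaDelLAdjoint_raw (α : SmoothForm n M) : Ω.lambdaDelLAdjoint L L' α.raw =
    (((-(1 / 2) : ℝ) • Ω.lowerLowerRaise (dPart hL hL' h 1)) α).raw := by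
  refine bidegComponent_of_shift hL hL' h hint
    (Φ := (-(1 / 2) : ℝ) • Ω.lowerLowerRaise) (e := -2) (w := -1)
    (fun α => ?_) ?_ ?_ (by norm_num) (by norm_num) α
  · rw [Ω.adjoint_lambdaDL_raw, Ω.adjOp_raise]; rfl
  · push_cast
    exact Ω.degOp_shifts_lowerLowerRaise.smul _
  · push_cast
    exact (Ω.weightOp_shifts_lowerLowerRaise hL hL' h hΩ hΩ').smul _

theorem delLAdjoint_raw (α : SmoothForm n M) : Ω.delLAdjoint L L' α.raw =
    (((-(1 / 2) : ℝ) • ⁅Ω.lower, ⁅Ω.lower, dPart hL hL' h 1⁆⁆) α).raw := by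
  refine bidegComponent_of_shift hL hL' h hint
    (Φ := (-(1 / 2) : ℝ) • (adL Ω.lower ∘ₗ adL Ω.lower)) (e := -4) (w := -2)
    (fun α => ?_) ?_ ?_ (by norm_num) (by norm_num) α
  · rw [Ω.adjoint_dL_raw, Ω.adjOp_formD_form]
    rfl
  · have := (Ω.degOp_shifts_lower.comp Ω.degOp_shifts_lower).smul (-(1 / 2))
    norm_num at this ⊢
    exact this
  · have hl := Ω.weightOp_shifts_lower hL hL' h hΩ hΩ'
    have := (hl.comp hl).smul (-(1 / 2))
    norm_num at this ⊢
    exact this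

theorem lower_cube_dPart :
    ⁅Ω.lower, ⁅Ω.lower, ⁅Ω.lower, dPart hL hL' h 1⁆⁆⁆ = 0 := by
  have hl := Ω.weightOp_shifts_lower hL hL' h hΩ hΩ'
  exact shift_dPart_eq_zero hL hL' h hint (hl.comp (hl.comp hl))
    (Ω.slTwoWeightOne.lower_pow_three Ω.lower_pow)

/-- `[Λ, [Λ, d]]` is a multiple of `ad(Λ)³ [d, L]`, and `[d, L]` is multiplication by `dω = 0`. -/
theorem lower_sq_dPart (hd : formD n M Ω.form = 0) :
    ⁅Ω.lower, ⁅Ω.lower, dPart hL hL' h 1⁆⁆ = 0 := by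
  have hl := Ω.weightOp_shifts_lower hL hL' h hΩ hΩ'
  refine shift_dPart_eq_zero hL hL' h hint (hl.comp hl) ?_
  have e : ⁅formD n M, Ω.raise⁆ = 0 := by
    rw [Ring.lie_def, formD_raise, hd, LinearMap.mulLeft_zero_eq_zero]
  change ⁅Ω.lower, ⁅Ω.lower, formD n M⁆⁆ = 0
  rw [Ω.slTwoWeightOne.lower_lower Ω.lower_pow, e, lie_zero, lie_zero, lie_zero, smul_zero]

theorem lowerLowerRaise_dPart (hd : formD n M Ω.form = 0) :
    Ω.lowerLowerRaise (dPart hL hL' h 1) = 0 := by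
  refine shift_dPart_eq_zero hL hL' h hint (Ω.weightOp_shifts_lowerLowerRaise hL hL' h hΩ hΩ') ?_
  rw [lowerLowerRaise_apply, Ring.lie_def (formD n M), formD_raise, hd,
    LinearMap.mulLeft_zero_eq_zero, lie_zero, lie_zero]

theorem isCommBVInfty_dPart : IsCommBVInfty (smoothDegree n M)
    (opSeq (dPart hL hL' h 1) ⁅Ω.lower, dPart hL hL' h 1⁆
      ((1 / 2 : ℝ) • ⁅Ω.lower, ⁅Ω.lower, dPart hL hL' h 1⁆⁆)) :=
  isCommBVInfty_of_bracket formDegree_isInternal one_mem_formDegree formDegree_mul_mem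
    formDegree_mul_comm (isHomogeneousOp_dPart hL hL' h 1)
    (fun i a ha b => by
      rw [isAntiderivation_dPart hL hL' h 1 a b, scaleOp_neg_one_pow ha, smul_mul_assoc])
    (dPart_sq hL hL' h hint) Ω.hasOrderLE_lower (Ω.lower_cube_dPart hL hL' h hΩ hΩ' hint)

end AlmostSymplecticForm

end LowerComponents

/-! ### Return to the subalgebra of smooth forms -/

section Transfer

variable {n : ℕ} {M : Type*} [TopologicalSpace M] [ChartedSpace (Model n) M]

/-- A linear operator on smooth forms, as an operator on the subalgebra of smooth forms. -/
def toFormEnd (D : Module.End ℝ (SmoothForm n M)) : Module.End ℝ (Form n M) := D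

theorem isGivenBy_toFormEnd {D : Module.End ℝ (SmoothForm n M)} {T : RawForm n M → RawForm n M}
    (h : ∀ α : SmoothForm n M, T α.raw = (D α).raw) : IsGivenBy (toFormEnd D) T :=
  fun α => (h α).symm

theorem isCommBVInfty_toFormEnd {d Δ₁ Δ₂ : Module.End ℝ (SmoothForm n M)}
    (h : IsCommBVInfty (smoothDegree n M) (opSeq d Δ₁ Δ₂)) :
    IsCommBVInfty (formDegree n M) (opSeq (toFormEnd d) (toFormEnd Δ₁) (toFormEnd Δ₂)) := h

theorem expSeries_toFormEnd {d Δ Λ : Module.End ℝ (SmoothForm n M)}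
    (h : PowerSeries.C d + PowerSeries.C Δ * PowerSeries.X =
      expSeries Λ * PowerSeries.C d * expSeries (-Λ)) :
    PowerSeries.C (toFormEnd d) + PowerSeries.C (toFormEnd Δ) * PowerSeries.X =
      expSeries (toFormEnd Λ) * PowerSeries.C (toFormEnd d) * expSeries (-toFormEnd Λ) := h

theorem AlmostSymplecticForm.IsSymplectic.formD_form [IsManifold (𝓡 (2 * n)) ∞ M]
    {Ω : AlmostSymplecticForm n M} (h : Ω.IsSymplectic) : formD n M Ω.form = 0 := raw_ext h

end Transfer

/-! ### The two structures -/

section Final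

attribute [local instance] LieRing.ofAssociativeRing

variable {n : ℕ} {M : Type*} [TopologicalSpace M] [ChartedSpace (Model n) M]
  [IsManifold (𝓡 (2 * n)) ∞ M] [T2Space M] {L L' : TangentSubspaces n M}
  (hL : IsSmoothSubbundle n L) (hL' : IsSmoothSubbundle n L') (h : ∀ x, IsCompl (L x) (L' x))
  (Ω : AlmostSymplecticForm n M)
  (hΩ : ∀ x, ∀ u ∈ L x, ∀ v ∈ L x, toBilin (Ω.toForm x) u v = 0)
  (hΩ' : ∀ x, ∀ u ∈ L' x, ∀ v ∈ L' x, toBilin (Ω.toForm x) u v = 0)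
  (hint : IsIntegrable L)

namespace AlmostSymplecticForm

include hL hL' h hΩ hΩ' hint

theorem exists_isDGBV (hs : Ω.IsSymplectic) : ∃ dbar delAdj Lam : Module.End ℝ (Form n M),
    IsGivenBy dbar (delbar L L') ∧ IsGivenBy delAdj (Ω.delAdjoint L L') ∧
    IsGivenBy Lam Ω.dualLefschetz ∧ IsDGBV (formDegree n M) dbar delAdj ∧
    PowerSeries.C dbar + PowerSeries.C delAdj * PowerSeries.X =
      expSeries Lam * PowerSeries.C dbar * expSeries (-Lam) := by
  have h2 := Ω.lower_sq_dPart hL hL' h hΩ hΩ' hint hs.formD_form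
  refine ⟨toFormEnd (dPart hL hL' h 1), toFormEnd ⁅Ω.lower, dPart hL hL' h 1⁆,
    toFormEnd Ω.lower, isGivenBy_toFormEnd (delbar_raw hL hL' h hint),
    isGivenBy_toFormEnd fun α => ?_, isGivenBy_toFormEnd Ω.dualLefschetz_raw, ?_,
    expSeries_toFormEnd (expSeries_conj rfl h2)⟩
  -- For closed `ω` the correction `(1/2) [Λ, [Λ, [∂̄, L]]]` vanishes, so `∂^ω = [Λ, ∂̄]`.
  · rw [Ω.delAdjoint_raw hL hL' h hΩ hΩ' hint,
      Ω.lowerLowerRaise_dPart hL hL' h hΩ hΩ' hint hs.formD_form, smul_zero, add_zero]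
  · have h3 := Ω.isCommBVInfty_dPart hL hL' h hΩ hΩ' hint
    rw [h2, smul_zero] at h3
    exact isCommBVInfty_toFormEnd h3

theorem exists_isCommBVInfty : ∃ dbar delAdj lamDelLAdj delLAdj : Module.End ℝ (Form n M),
    IsGivenBy dbar (delbar L L') ∧ IsGivenBy delAdj (Ω.delAdjoint L L') ∧
    IsGivenBy lamDelLAdj (Ω.lambdaDelLAdjoint L L') ∧
    IsGivenBy delLAdj (Ω.delLAdjoint L L') ∧
    IsCommBVInfty (formDegree n M) (opSeq dbar (delAdj + lamDelLAdj) (-delLAdj)) := by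
  refine ⟨_, _, _, _, isGivenBy_toFormEnd (delbar_raw hL hL' h hint),
    isGivenBy_toFormEnd (Ω.delAdjoint_raw hL hL' h hΩ hΩ' hint),
    isGivenBy_toFormEnd (Ω.lambdaDelLAdjoint_raw hL hL' h hΩ hΩ' hint),
    isGivenBy_toFormEnd (Ω.delLAdjoint_raw hL hL' h hΩ hΩ' hint), ?_⟩
  have h3 := Ω.isCommBVInfty_dPart hL hL' h hΩ hΩ' hint
  -- The corrections in `∂^ω` and in `[Λ, [∂, L]]^ω` are opposite, so their sum is exactly `[Λ,
  -- ∂̄]`.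
  have e1 : ⁅Ω.lower, dPart hL hL' h 1⁆ = ⁅Ω.lower, dPart hL hL' h 1⁆ +
      (1 / 2 : ℝ) • Ω.lowerLowerRaise (dPart hL hL' h 1) +
      (-(1 / 2) : ℝ) • Ω.lowerLowerRaise (dPart hL hL' h 1) := by module
  have e2 : (1 / 2 : ℝ) • ⁅Ω.lower, ⁅Ω.lower, dPart hL hL' h 1⁆⁆ =
      -((-(1 / 2) : ℝ) • ⁅Ω.lower, ⁅Ω.lower, dPart hL hL' h 1⁆⁆) := by module
  rw [e2] at h3
  have h4 := congrArg (fun X => IsCommBVInfty (smoothDegree n M) (opSeq (dPart hL hL' h 1) X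
    (-((-(1 / 2) : ℝ) • ⁅Ω.lower, ⁅Ω.lower, dPart hL hL' h 1⁆⁆)))) e1
  exact isCommBVInfty_toFormEnd (h4.mp h3)

end AlmostSymplecticForm

end Final

end SymplecticPolarization

end

theorem mainTheorem7 (n : ℕ) (M : Type*) [TopologicalSpace M] [T2Space M]
    [SecondCountableTopology M] [ChartedSpace (SymplecticPolarization.Model n) M]
    [IsManifold (𝓡 (2 * n)) ∞ M]
    (Ω : SymplecticPolarization.AlmostSymplecticForm n M)
    (L L' : SymplecticPolarization.TangentSubspaces n M)
    (hpol : SymplecticPolarization.IsRealPolarization Ω L L')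
    (hint : SymplecticPolarization.IsIntegrable L) :
    (Ω.IsSymplectic →
      ∃ dbar delAdj Lam : Module.End ℝ (SymplecticPolarization.Form n M),
        SymplecticPolarization.IsGivenBy dbar (SymplecticPolarization.delbar L L') ∧
        SymplecticPolarization.IsGivenBy delAdj (Ω.delAdjoint L L') ∧
        SymplecticPolarization.IsGivenBy Lam Ω.dualLefschetz ∧
        SymplecticPolarization.IsDGBV (SymplecticPolarization.formDegree n M) dbar delAdj ∧
        PowerSeries.C dbar + PowerSeries.C delAdj * PowerSeries.X =
          SymplecticPolarization.expSeries Lam * PowerSeries.C dbar *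
            SymplecticPolarization.expSeries (-Lam)) ∧
    (∃ dbar delAdj lamDelLAdj delLAdj : Module.End ℝ (SymplecticPolarization.Form n M),
        SymplecticPolarization.IsGivenBy dbar (SymplecticPolarization.delbar L L') ∧
        SymplecticPolarization.IsGivenBy delAdj (Ω.delAdjoint L L') ∧
        SymplecticPolarization.IsGivenBy lamDelLAdj (Ω.lambdaDelLAdjoint L L') ∧
        SymplecticPolarization.IsGivenBy delLAdj (Ω.delLAdjoint L L') ∧
        SymplecticPolarization.IsCommBVInfty (SymplecticPolarization.formDegree n M)
          (SymplecticPolarization.opSeq dbar (delAdj + lamDelLAdj) (-delLAdj))) := by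
  exact ⟨Ω.exists_isDGBV hpol.lagrangian_left.1 hpol.lagrangian_right.1 hpol.isCompl
      hpol.lagrangian_left.2 hpol.lagrangian_right.2 hint,
    Ω.exists_isCommBVInfty hpol.lagrangian_left.1 hpol.lagrangian_right.1 hpol.isCompl
      hpol.lagrangian_left.2 hpol.lagrangian_right.2 hint⟩
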